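/- Fix real numbers $0<t<1$, $\gamma\ge 1$ and $a>a_0:=\dfrac{1-t^2}{t((\gamma+1)t+2\sqrt\gamma)}$, and set $$W(z)=-\gamma a\log(1+tz)-a\log(1+t/z)+\log z,\qquad W'(z)=-\frac{\gamma a}{z+t^{-1}}-\frac{a}{z+t}+\frac{a+1}{z}.$$ A simple open curve from $p$ to $q$ means a simple rectifiable oriented arc from $p$ to $q$ with its two endpoints removed, continuously differentiable with non-vanishing tangent; $\overline\Gamma$ is its closure. For a function $f$ defined off $\overline\Gamma$, $f_+$ and $f_-$ denote the limits of $f$ at points of $\Gamma$ from the left and from the right of $\Gamma$. The notation $f\,dz>0$ on $\Gamma$ (similarly $f\,dz<0$, $f\,(dz)^2>0$, $f\,(dz)^2<0$) means that $f(z(s))z'(s)$ (resp. $f(z(s))z'(s)^2$) is real with the indicated sign along an oriented regular parametrization $z(s)$ of $\Gamma$. Then there exist * a point $\xi$ with $\operatorname{Im}\xi>0$; * a simple open curve $\Gamma_1$ from $\overline\xi$ to $\xi$, symmetric under reflection in the real axis and not meeting $(-\infty,0]$; * a simple open curve $\Gamma_2$ from $\xi$ to $\overline\xi$, symmetric under reflection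 in the real axis, not meeting $(-\infty,-1/t]\cup[-t,\infty)$ and disjoint from $\overline{\Gamma_1}$; * a function $h$ analytic in $\mathbb C\setminus\overline{\Gamma_1}$ and continuous up to the boundary (the limits $h_\pm$ exist on $\Gamma_1$, and $h$ has limits at $\xi$ and $\overline\xi$) such that * (a) $h_+(z)+h_-(z)=W'(z)$ for $z\in\Gamma_1$; * (b) $h(z)=\frac1z+O(z^{-2})$ as $z\to\infty$; * (c) $i(h_+(z)-h_-(z))\,dz>0$ on $\Gamma_1$; * (d) $(2h(z)-W'(z))\,dz<0$ on $\Gamma_2\cap\mathbb C_+$ and $(2h(z)-W'(z))\,dz>0$ on $\Gamma_2\cap\mathbb C_-$, where $\mathbb C_\pm$ are the open upper and lower half-planes. Moreover, let $R(z)=\sqrt{(z-\xi)(z-\overline\xi)}$ be the branch that is analytic in $\mathbb C\setminus\overline{\Gamma_1}$ with $R(z)\sim z$ as $z\to\infty$. Then: * (i) for $z\in\mathbb C\setminus\overline{\Gamma_1}$, $$h(z)=\frac{R(z)}{2\pi i}\int_{\Gamma_1}\frac{W'(s)}{R_+(s)(s-z)}\,ds=\frac12W'(z)+\frac12R(z)\Bigl(\frac{\gamma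 a}{(z+t^{-1})R(-t^{-1})}+\frac{a}{(z+t)R(-t)}-\frac{a+1}{zR(0)}\Bigr),$$ the second equality for $z\ne 0,-t,-t^{-1}$; * (ii) $\displaystyle\int_{\Gamma_1}\frac{W'(s)}{R_+(s)}\,ds=0$ and $\displaystyle\frac1{2\pi i}\int_{\Gamma_1}\frac{sW'(s)}{R_+(s)}\,ds=-1$, and these integrals and those in (i) converge absolutely; * (iii) with $z_0=\dfrac{a+1}{-R(0)(1+\gamma a)}$, which is real, and $\Phi(z)=(1+\gamma a)\dfrac{R(z)(z+z_0)}{z(z+t)(z+t^{-1})}$, one has $2h(z)-W'(z)=\Phi(z)$ for $z\in\mathbb C\setminus\overline{\Gamma_1}$, $z\neq 0,-t,-t^{-1}$; in particular $h_+-h_-=\Phi_+$ on $\Gamma_1$ and $2h-W'=\Phi$ on $\Gamma_2$; * (iv) $\Gamma_2$ meets the real axis exactly at $-z_0$. Finally, with $$Q(z)=-(1+\gamma a)^2\frac{(z-\xi)(z-\overline\xi)(z+z_0)^2}{z^2(z+t)^2(z+t^{-1})^2},$$ $\Gamma_1$ is a trajectory of the quadratic differential $Q(z)(dz)^2$, that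 is $Q(z)(dz)^2>0$ on $\Gamma_1$, and $\Gamma_2$ is made of orthogonal trajectories, that is $Q(z)(dz)^2<0$ on $\Gamma_2\setminus\{-z_0\}$. -/

import Mathlib

open Set Filter Topology MeasureTheory
open scoped ComplexConjugate

noncomputable section

namespace HFunction

/-- `z` is a strictly positive real number. -/
def PosReal (z : ℂ) : Prop := 0 < z.re ∧ z.im = 0

/-- `z` is a strictly negative real number. -/
def NegReal (z : ℂ) : Prop := z.re < 0 ∧ z.im = 0

/-- The critical value `a₀`. -/
def a0 (t γ : ℝ) : ℝ := (1 - t ^ 2) / (t * ((γ + 1) * t + 2 * √γ))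

/-- `W(z) = -γ a log (1 + t z) - a log (1 + t / z) + log z`, with principal logarithms. -/
def W (t γ a : ℝ) (z : ℂ) : ℂ :=
  -(γ * a) * Complex.log (1 + t * z) - a * Complex.log (1 + t / z) + Complex.log z

/-- The rational function `W'`, which continues the derivative of `W` across the cuts of the
logarithms (see `hasDerivAt_W`). Its poles are `-1/t`, `-t` and `0`. -/
def W' (t γ a : ℝ) (z : ℂ) : ℂ :=
  -(γ * a) / (z + (t : ℂ)⁻¹) - a / (z + t) + (a + 1) / z

theorem hasDerivAt_W {t γ a : ℝ} (ht : 0 < t) {z : ℂ} (hz : z ∈ Complex.slitPlane)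
    (h1 : 1 + t * z ∈ Complex.slitPlane) (h2 : 1 + t / z ∈ Complex.slitPlane) :
    HasDerivAt (W t γ a) (W' t γ a z) z := by
  have hz0 : z ≠ 0 := Complex.slitPlane_ne_zero hz
  have ht0 : (t : ℂ) ≠ 0 := by exact_mod_cast ht.ne'
  have h10 : 1 + t * z ≠ 0 := Complex.slitPlane_ne_zero h1
  have h20 : 1 + t / z ≠ 0 := Complex.slitPlane_ne_zero h2
  have e1 : HasDerivAt (fun w : ℂ => 1 + t * w) t z := by
    simpa using ((hasDerivAt_id z).const_mul (t : ℂ)).const_add 1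
  have e2 : HasDerivAt (fun w : ℂ => 1 + t / w) (-t / z ^ 2) z := by
    have := ((hasDerivAt_inv hz0).const_mul (t : ℂ)).const_add 1
    have e3 : (-t / z ^ 2 : ℂ) = t * -(z ^ 2)⁻¹ := by ring
    rw [e3]
    simpa only [div_eq_mul_inv] using this
  have e := (((e1.clog h1).const_mul (-((γ : ℂ) * a))).sub
    ((e2.clog h2).const_mul (a : ℂ))).add (Complex.hasDerivAt_log hz)
  refine e.congr_deriv ?_
  have h3 : z + t ≠ 0 := by
    intro h
    apply h20
    have : (1 : ℂ) + t / z = (z + t) / z := by field_simp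
    rw [this, h, zero_div]
  have h4 : z + (t : ℂ)⁻¹ ≠ 0 := by
    intro h
    apply h10
    have : (1 : ℂ) + t * z = t * (z + (t : ℂ)⁻¹) := by field_simp; ring
    rw [this, h, mul_zero]
  have h5 : t * z + 1 ≠ 0 := by rwa [add_comm]
  rw [W']
  have i1 : (z + (t : ℂ)⁻¹) = (1 + t * z) / t := by field_simp; ring
  have i2 : 1 + t / z = (z + t) / z := by field_simp
  rw [i1, i2]
  field_simp
  ring

/-- `c`, restricted to `[0, 1]`, parametrizes a simple rectifiable oriented arc from `p` to `q`,
regular and continuously differentiable between its endpoints. -/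
structure IsSimpleArc (c : ℝ → ℂ) (p q : ℂ) : Prop where
  continuousOn : ContinuousOn c (Icc 0 1)
  injOn : InjOn c (Icc 0 1)
  contDiffOn : ContDiffOn ℝ 1 c (Ioo 0 1)
  deriv_ne_zero : ∀ s ∈ Ioo (0 : ℝ) 1, deriv c s ≠ 0
  rectifiable : IntervalIntegrable (deriv c) volume 0 1
  source : c 0 = p
  target : c 1 = q

/-- The open curve `Γ`, without its endpoints. -/
def openArc (c : ℝ → ℂ) : Set ℂ := c '' Ioo 0 1

/-- The curve with its endpoints, i.e. the closure of the open curve. -/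
def closedArc (c : ℝ → ℂ) : Set ℂ := c '' Icc 0 1

/-- The set `S` is symmetric under reflection in the real axis. -/
def ConjSymm (S : Set ℂ) : Prop := (fun z : ℂ => conj z) '' S = S

/-- `l` is the limit of `f(z)` as `z` tends to `c s` from the left (`+`) side of the oriented
arc `c`. Points on the left near `c s` are exactly the points `c s' + i ε c'(s')` with `s'` near
`s` and `ε > 0` small, because a point close to the curve and off it lies on the normal at the
point of the curve nearest to it. So the approach is unrestricted. -/
def HasLeftLimit (f : ℂ → ℂ) (c : ℝ → ℂ) (s : ℝ) (l : ℂ) : Prop :=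
  Tendsto (fun p : ℝ × ℝ => f (c p.1 + Complex.I * p.2 * deriv c p.1))
    (𝓝 s ×ˢ 𝓝[>] (0 : ℝ)) (𝓝 l)

/-- `l` is the limit of `f(z)` as `z` tends to `c s` from the right (`-`) side of `c`. -/
def HasRightLimit (f : ℂ → ℂ) (c : ℝ → ℂ) (s : ℝ) (l : ℂ) : Prop :=
  Tendsto (fun p : ℝ × ℝ => f (c p.1 - Complex.I * p.2 * deriv c p.1))
    (𝓝 s ×ˢ 𝓝[>] (0 : ℝ)) (𝓝 l)

/-- The integral along the arc `c` of the function with value `F s` at the point `c s` exists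
and is equal to `l`. -/
def HasArcIntegral (c : ℝ → ℂ) (F : ℝ → ℂ) (l : ℂ) : Prop :=
  IntervalIntegrable (fun s => F s * deriv c s) volume 0 1 ∧
    ∫ s in (0 : ℝ)..1, F s * deriv c s = l

/-- `R` is the branch of the square root of `(z - ξ)(z - conj ξ)` that is analytic off the
arc `c` and satisfies `R(z) ~ z` at infinity. -/
structure IsSqrtBranch (c : ℝ → ℂ) (ξ : ℂ) (R : ℂ → ℂ) : Prop where
  analytic : AnalyticOnNhd ℂ R (closedArc c)ᶜ
  sq : ∀ z ∉ closedArc c, R z ^ 2 = (z - ξ) * (z - conj ξ)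
  atInfinity : Tendsto (fun z => R z / z) (Bornology.cobounded ℂ) (𝓝 1)

/-- The function `Φ`. -/
def Φ (t γ a z₀ : ℝ) (R : ℂ → ℂ) (z : ℂ) : ℂ :=
  (1 + γ * a) * (R z * (z + z₀) / (z * (z + t) * (z + (t : ℂ)⁻¹)))

/-- The coefficient of the quadratic differential `Q(z) (dz)²`. -/
def Q (t γ a z₀ : ℝ) (ξ z : ℂ) : ℂ :=
  -(1 + γ * a) ^ 2 * ((z - ξ) * (z - conj ξ) * (z + z₀) ^ 2 /
    (z ^ 2 * (z + t) ^ 2 * (z + (t : ℂ)⁻¹) ^ 2))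

end HFunction

end

open HFunction

noncomputable section

namespace HFunction

/-! The function 2h − W' should equal R times a rational function, so it lives on the two-sheeted
surface of R, which has genus zero. That surface is uniformized by z = Z(w) = α(w − 1/w) + β, on
which R becomes X(w) = α(w + 1/w). The sheet exchange is w ↦ −1/w, and the branch points are w = ±i,
over ξ = β + 2αi and its conjugate. The differential Φ dz pulls back to f(w) dw, where f has seven
simple poles, all real with real residues, double zeros at ±i, and simple real zeros y₁, y₂ over
−z₀. Its primitive g with g(i) = 0 is a real combination of logarithms: analytic in the upper
half-plane, with piecewise constant imaginary part on the real axis, and odd under the sheet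
exchange (`Config.g_neg_inv`).

The constants must make the residues of R times the rational factor match those of W'. Given z₀, the
residue equations fix the moduli s₀, s₁, s₂ of R at the poles 0, −t, −1/t. These are values of one
quadratic exactly when a polynomial in z₀ vanishes, which happens somewhere in (t, 1/t) by a sign
change. The assumption a > a₀ then excludes real branch points (`disc_pos`, `exists_config`).

Near i the map g is a cube, so three curves over each of the rays iℝ₊ and ℝ₋ leave i into the upper
half-plane. They are continued as lifts through g (`IsLift.exists_maximal`) and their ends are
identified by counting. Over iℝ₊ the lifts must stop, because Im g is bounded. They stop on the
three real intervals where Im g > 0, each of which offers at most one end point, and distinct lifts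
cannot share an end; so all three intervals are reached, including the one that projects to the
positive axis (`Config.exists_lift_Γ₁`). Over ℝ₋ a lift that stops can do so only at y₁, and one
that never stops must run into one of two poles. Three distinct lifts cannot share two poles, so one
of them reaches y₁ (`Config.exists_lift_Γ₂`). Reflection in the real axis and projection by Z give
Γ₁ and Γ₂; simplicity and disjointness follow from the oddness of g and the values of g on the two
curves.

The branch R is not chosen but computed. Since dz/X = dw/w, the Cauchy integral of dz/R₊ over Γ₁ is
the integral of a logarithmic derivative, and its product with a square root of (z − ξ)(z − ξ̄) is
an odd multiple of πi (`Config.CritPath.exists_odd`). The multiple is locally constant and is ±1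
near infinity. It is ±1 everywhere because the arc does not separate the plane: a bounded
complementary component would, by the maximum principle for exp(±g), make Re g vanish on an open set
(`Config.CritPath.not_bounded`). So R can be defined as πi over the Cauchy integral. Its boundary
values are ±X on the lifted path (`Config.TrajPath.hasLeftLimit_R`).

Finally h is a combination of divided differences of R at the three poles, hence analytic there, and
expanding them gives W'/2 + Φ/2. The integral formulas reduce by partial fractions to Cauchy
integrals of dz/R₊, and every sign condition is read off from f(w) dw along the lifted paths
(`Config.CritPath.mul_arcDeriv`). -/

/-- The real constants that determine the branch point `ξ = β + 2 α i` and the zero `-z₀`. The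
`sᵢ` are the absolute values of the square root at the poles `0`, `-t`, `-1/t`. -/
structure Config (t γ a : ℝ) where
  α : ℝ
  β : ℝ
  z₀ : ℝ
  s₀ : ℝ
  s₁ : ℝ
  s₂ : ℝ
  t_pos : 0 < t
  t_lt : t < 1
  γ_pos : 0 < γ
  a_pos : 0 < a
  α_pos : 0 < α
  s₀_pos : 0 < s₀
  s₁_pos : 0 < s₁
  s₂_pos : 0 < s₂
  lt_z₀ : t < z₀
  z₀_lt : t * z₀ < 1
  s₀_sq : s₀ ^ 2 = β ^ 2 + 4 * α ^ 2
  s₁_sq : s₁ ^ 2 = (t + β) ^ 2 + 4 * α ^ 2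
  s₂_sq : s₂ ^ 2 = (t⁻¹ + β) ^ 2 + 4 * α ^ 2
  res₀ : (1 + γ * a) * s₀ * z₀ = a + 1
  res₁ : (1 + γ * a) * s₁ * (z₀ - t) = a * (1 - t ^ 2)
  res₂ : (1 + γ * a) * s₂ * t * (1 - t * z₀) = γ * a * (1 - t ^ 2)

/-! ### The real constants: residue equations and non-real branch points. -/

/-- The hyperbola x = √(X² − e²) has slope at least 1, so its increments dominate those of X. -/
theorem sub_le_sub_of_sq {e X Y x y : ℝ} (hy : 0 ≤ y)
    (hX : x ^ 2 = X ^ 2 - e ^ 2) (hY : y ^ 2 = Y ^ 2 - e ^ 2) (hx : 0 < x)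
    (hY0 : 0 ≤ Y) (hXY : Y ≤ X) : X - Y ≤ x - y := by
  have h1 : x ≤ X := by nlinarith [sq_nonneg e]
  have h2 : y ≤ Y := by nlinarith [sq_nonneg e]
  have h3 : (x - y) * (x + y) = (X - Y) * (X + Y) := by nlinarith
  by_contra h
  push Not at h
  nlinarith

theorem add_le_of_sq {e X Y x y : ℝ}
    (hX : x ^ 2 = X ^ 2 - e ^ 2) (hY : y ^ 2 = Y ^ 2 - e ^ 2)
    (hX0 : 0 ≤ X) (hY0 : 0 ≤ Y) : x + y ≤ X + Y := by
  have h1 : x ≤ X := by nlinarith [sq_nonneg e]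
  have h2 : y ≤ Y := by nlinarith [sq_nonneg e]
  linarith

/-- Excludes real branch points whose midpoint β lies to the left of all three poles. Multiplied by
the positive factors z, z − t, 1 − tz, the residue equations turn the two slope bounds into
incompatible polynomial inequalities. -/
theorem sqrt_slope_left_absurd {t γ a z s₀ s₁ s₂ : ℝ} (ht0 : 0 < t)
    (hγ : 0 < γ) (ha : 0 < a) (hz : t < z) (hz' : t * z < 1)
    (r₀ : (1 + γ * a) * s₀ * z = a + 1)
    (r₁ : (1 + γ * a) * s₁ * (z - t) = a * (1 - t ^ 2))
    (r₂ : (1 + γ * a) * s₂ * t * (1 - t * z) = γ * a * (1 - t ^ 2))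
    (h1 : 1 - t ^ 2 ≤ t * (s₁ - s₂)) (h2 : t ≤ s₀ - s₁) : False := by
  have hk : 0 < 1 + γ * a := by positivity
  have hx : 0 < z - t := by linarith
  have hy : 0 < 1 - t * z := by linarith
  have hD : 0 < 1 - t ^ 2 := by nlinarith
  have hz0 : 0 < z := by linarith
  have e1 := mul_le_mul_of_nonneg_left h1 (by positivity : 0 ≤ (1 + γ * a) * (z - t) * (1 - t * z))
  have e2 := mul_le_mul_of_nonneg_left h2 (by positivity : 0 ≤ (1 + γ * a) * (z - t) * z)
  have e1' : (1 + γ * a) * (z - t) * (1 - t * z) * (t * (s₁ - s₂))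
      = (1 - t ^ 2) * (t * a * (1 - t * z) - γ * a * (z - t)) := by
    linear_combination t * (1 - t * z) * r₁ - (z - t) * r₂
  have e2' : (1 + γ * a) * (z - t) * z * (s₀ - s₁) = (a + 1) * (z - t) - a * (1 - t ^ 2) * z := by
    linear_combination (z - t) * r₀ - z * r₁
  rw [e1'] at e1
  rw [e2'] at e2
  have e3 : (1 + γ * a) * (z - t) * (1 - t * z) ≤ t * a * (1 - t * z) - γ * a * (z - t) := by
    refine le_of_mul_le_mul_left ?_ hD
    linarith
  have h5 : 0 < γ * a * (z - t) := by positivity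
  nlinarith

/-- Mirror case: β to the right of all three poles, where the root decreases with slope at most −1.
-/
theorem sqrt_slope_right_absurd {t γ a z s₀ s₁ s₂ : ℝ} (ht0 : 0 < t)
    (hγ : 0 < γ) (ha : 0 < a) (hz : t < z) (hz' : t * z < 1)
    (r₀ : (1 + γ * a) * s₀ * z = a + 1)
    (r₁ : (1 + γ * a) * s₁ * (z - t) = a * (1 - t ^ 2))
    (r₂ : (1 + γ * a) * s₂ * t * (1 - t * z) = γ * a * (1 - t ^ 2))
    (h1 : 1 - t ^ 2 ≤ t * (s₂ - s₁)) (h2 : t ≤ s₁ - s₀) : False := by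
  have hk : 0 < 1 + γ * a := by positivity
  have hx : 0 < z - t := by linarith
  have hy : 0 < 1 - t * z := by linarith
  have hD : 0 < 1 - t ^ 2 := by nlinarith
  have hz0 : 0 < z := by linarith
  have e1 := mul_le_mul_of_nonneg_left h1 (by positivity : 0 ≤ (1 + γ * a) * (z - t) * (1 - t * z))
  have e2 := mul_le_mul_of_nonneg_left h2 (by positivity : 0 ≤ (1 + γ * a) * (z - t) * z)
  have e1' : (1 + γ * a) * (z - t) * (1 - t * z) * (t * (s₂ - s₁))
      = (1 - t ^ 2) * (γ * a * (z - t) - t * a * (1 - t * z)) := by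
    linear_combination -t * (1 - t * z) * r₁ + (z - t) * r₂
  have e2' : (1 + γ * a) * (z - t) * z * (s₁ - s₀) = a * (1 - t ^ 2) * z - (a + 1) * (z - t) := by
    linear_combination -(z - t) * r₀ + z * r₁
  rw [e1'] at e1
  rw [e2'] at e2
  have e3 : (1 + γ * a) * (z - t) * (1 - t * z) ≤ γ * a * (z - t) - t * a * (1 - t * z) := by
    refine le_of_mul_le_mul_left ?_ hD
    linarith
  nlinarith

/-- Case of β between −1/t and −t, where each root is at most the distance from its pole to β. This
is the only case that needs a > a₀, and the value of a₀ comes from it: minimizing over z produces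
exactly that threshold. -/
theorem sqrt_sum_outer_absurd {t γ a z s₁ s₂ : ℝ} (ht0 : 0 < t)
    (hγ : 0 < γ) (ha : 0 < a) (hz : t < z) (hz' : t * z < 1)
    (ha0 : 1 - t ^ 2 < a * (t * ((γ + 1) * t + 2 * √γ)))
    (r₁ : (1 + γ * a) * s₁ * (z - t) = a * (1 - t ^ 2))
    (r₂ : (1 + γ * a) * s₂ * t * (1 - t * z) = γ * a * (1 - t ^ 2))
    (h1 : t * (s₁ + s₂) ≤ 1 - t ^ 2) : False := by
  have hk : 0 < 1 + γ * a := by positivity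
  have hx : 0 < z - t := by linarith
  have hy : 0 < 1 - t * z := by linarith
  have hD : 0 < 1 - t ^ 2 := by nlinarith
  have e1 := mul_le_mul_of_nonneg_left h1 (by positivity : 0 ≤ (1 + γ * a) * (z - t) * (1 - t * z))
  have e1' : (1 + γ * a) * (z - t) * (1 - t * z) * (t * (s₁ + s₂))
      = (1 - t ^ 2) * (t * a * (1 - t * z) + γ * a * (z - t)) := by
    linear_combination t * (1 - t * z) * r₁ + (z - t) * r₂
  rw [e1'] at e1
  have e3 : t * a * (1 - t * z) + γ * a * (z - t) ≤ (1 + γ * a) * (z - t) * (1 - t * z) := by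
    refine le_of_mul_le_mul_left ?_ hD
    linarith
  obtain ⟨m, hm, rfl⟩ : ∃ m : ℝ, 0 < m ∧ γ = m ^ 2 :=
    ⟨√γ, Real.sqrt_pos.2 hγ, (Real.sq_sqrt hγ.le).symm⟩
  rw [Real.sqrt_sq hm.le] at ha0
  obtain ⟨x, hxe⟩ : ∃ x, x = z - t := ⟨_, rfl⟩
  obtain ⟨y, hye⟩ : ∃ y, y = 1 - t * z := ⟨_, rfl⟩
  have hDe : 1 - t ^ 2 = t * x + y := by rw [hxe, hye]; ring
  rw [← hxe, ← hye] at e3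
  rw [← hxe] at hx
  rw [← hye] at hy
  -- The difference of the two sides is t·a·(y − m·x)², with m = √γ; this is Cauchy–Schwarz, and the
  -- cross term 2tm becomes the 2√γ in a₀.
  have e4 : a * (x * y) * (t ^ 2 + m ^ 2 + 2 * t * m) ≤ (t * a * y + m ^ 2 * a * x) * (t * x + y) := by
    nlinarith [mul_nonneg (mul_nonneg ht0.le ha.le) (sq_nonneg (y - m * x))]
  have e5 := mul_le_mul_of_nonneg_right e3 (hDe ▸ hD.le : 0 ≤ t * x + y)
  have hxy : 0 < x * y := by positivity
  have e6 : a * (t ^ 2 + m ^ 2 + 2 * t * m) ≤ (1 + m ^ 2 * a) * (1 - t ^ 2) := by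
    refine le_of_mul_le_mul_left ?_ hxy
    rw [hDe]
    linarith
  nlinarith

/-- Case of β between −t and 0: here s₀ + s₁ and s₀ + s₂ are bounded by the distances between the
corresponding poles. -/
theorem sqrt_sum_inner_absurd {t γ a z s₀ s₁ s₂ : ℝ} (ht0 : 0 < t)
    (hγ : 0 < γ) (ha : 0 < a) (hz : t < z) (hz' : t * z < 1)
    (r₀ : (1 + γ * a) * s₀ * z = a + 1)
    (r₁ : (1 + γ * a) * s₁ * (z - t) = a * (1 - t ^ 2))
    (r₂ : (1 + γ * a) * s₂ * t * (1 - t * z) = γ * a * (1 - t ^ 2))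
    (h1 : s₀ + s₁ ≤ t) (h2 : t * (s₀ + s₂) ≤ 1) : False := by
  have hk : 0 < 1 + γ * a := by positivity
  have hx : 0 < z - t := by linarith
  have hy : 0 < 1 - t * z := by linarith
  have hD : 0 < 1 - t ^ 2 := by nlinarith
  have hz0 : 0 < z := by linarith
  have e1 := mul_le_mul_of_nonneg_left h1 (by positivity : 0 ≤ (1 + γ * a) * (z - t) * z)
  have e2 := mul_le_mul_of_nonneg_left h2 (by positivity : 0 ≤ (1 + γ * a) * (1 - t * z) * z)
  have e1' : (1 + γ * a) * (z - t) * z * (s₀ + s₁) = (a + 1) * (z - t) + a * (1 - t ^ 2) * z := by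
    linear_combination (z - t) * r₀ + z * r₁
  have e2' : (1 + γ * a) * (1 - t * z) * z * (t * (s₀ + s₂))
      = t * (a + 1) * (1 - t * z) + γ * a * (1 - t ^ 2) * z := by
    linear_combination t * (1 - t * z) * r₀ + z * r₂
  rw [e1'] at e1
  rw [e2'] at e2
  nlinarith [mul_pos ha hx, mul_pos ha hz0, mul_pos (mul_pos ha hz0) hD, mul_pos ht0 hx, mul_pos ht0 hz0]

/-- The polynomial is the compatibility condition for s₀, s₁, s₂ with the residue equations
substituted. At z = t only the contribution of s₁ survives, and it is negative; at z = 1/t only that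
of s₂ survives, and it is positive. -/
theorem exists_residue_root {t γ a : ℝ} (ht0 : 0 < t) (ht1 : t < 1) (hγ : 0 < γ) (ha : 0 < a) :
    ∃ z : ℝ, t < z ∧ t * z < 1 ∧
      (a + 1) ^ 2 * (z - t) ^ 2 * (1 - t * z) ^ 2
        - (1 + γ * a) ^ 2 * z ^ 2 * (z - t) ^ 2 * (1 - t * z) ^ 2
        - a ^ 2 * (1 - t ^ 2) * z ^ 2 * ((1 - t * z) ^ 2 - γ ^ 2 * (z - t) ^ 2) = 0 := by
  set P : ℝ → ℝ := fun z => (a + 1) ^ 2 * (z - t) ^ 2 * (1 - t * z) ^ 2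
        - (1 + γ * a) ^ 2 * z ^ 2 * (z - t) ^ 2 * (1 - t * z) ^ 2
        - a ^ 2 * (1 - t ^ 2) * z ^ 2 * ((1 - t * z) ^ 2 - γ ^ 2 * (z - t) ^ 2) with hP
  have hD : 0 < 1 - t ^ 2 := by nlinarith
  have htt : t < t⁻¹ := by
    rw [lt_inv_comm₀ ht0 ht0]
    exact lt_of_lt_of_le ht1 (by rw [one_le_inv₀ ht0]; exact ht1.le)
  have h1 : P t < 0 := by
    have : P t = -(a ^ 2 * (1 - t ^ 2) * t ^ 2 * (1 - t ^ 2) ^ 2) := by simp only [hP]; ring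
    rw [this]
    have : 0 < a ^ 2 * (1 - t ^ 2) * t ^ 2 * (1 - t ^ 2) ^ 2 := by positivity
    linarith
  have h2 : 0 < P t⁻¹ := by
    have : P t⁻¹ = a ^ 2 * (1 - t ^ 2) * t⁻¹ ^ 2 * γ ^ 2 * (t⁻¹ - t) ^ 2 := by
      simp only [hP]
      rw [mul_inv_cancel₀ ht0.ne']
      ring
    rw [this]
    have : 0 < t⁻¹ - t := by linarith
    positivity
  have hc : ContinuousOn P (Icc t t⁻¹) := by
    simp only [hP]
    fun_prop
  obtain ⟨z, hz, hPz⟩ := intermediate_value_Ioo htt.le hc ⟨h1, h2⟩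
  refine ⟨z, hz.1, ?_, hPz⟩
  have := mul_lt_mul_of_pos_left hz.2 ht0
  rwa [mul_inv_cancel₀ ht0.ne'] at this

/-- If this quantity were not positive, the quadratic (x − β)² + s₀² − β² would have the real roots
β ± e, and the sᵢ would be the values √((x − β)² − e²) at the poles. Each position of β relative to
the poles contradicts the residue equations. -/
theorem disc_pos {t γ a z s₀ s₁ s₂ β : ℝ} (ht0 : 0 < t) (ht1 : t < 1)
    (hγ0 : 0 < γ) (ha0 : 0 < a) (ha' : 1 - t ^ 2 < a * (t * ((γ + 1) * t + 2 * √γ)))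
    (hz : t < z) (hz' : t * z < 1) (p0 : 0 < s₀) (p1 : 0 < s₁) (p2 : 0 < s₂)
    (r0 : (1 + γ * a) * s₀ * z = a + 1)
    (r1 : (1 + γ * a) * s₁ * (z - t) = a * (1 - t ^ 2))
    (r2 : (1 + γ * a) * s₂ * t * (1 - t * z) = γ * a * (1 - t ^ 2))
    (hβ1 : s₁ ^ 2 = (t + β) ^ 2 + (s₀ ^ 2 - β ^ 2))
    (hβ2 : s₂ ^ 2 = (t⁻¹ + β) ^ 2 + (s₀ ^ 2 - β ^ 2)) : 0 < s₀ ^ 2 - β ^ 2 := by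
  by_contra hneg
  push Not at hneg
  obtain ⟨e, he0, he⟩ : ∃ e : ℝ, 0 ≤ e ∧ e ^ 2 = β ^ 2 - s₀ ^ 2 :=
    ⟨√(β ^ 2 - s₀ ^ 2), Real.sqrt_nonneg _, Real.sq_sqrt (by linarith)⟩
  have hti : t * t⁻¹ = 1 := mul_inv_cancel₀ ht0.ne'
  have hti0 : 0 < t⁻¹ := by positivity
  have hlt : t < t⁻¹ := by nlinarith
  have f0 : s₀ ^ 2 = β ^ 2 - e ^ 2 := by linarith
  have f1 : s₁ ^ 2 = (t + β) ^ 2 - e ^ 2 := by linarith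
  have f2 : s₂ ^ 2 = (t⁻¹ + β) ^ 2 - e ^ 2 := by linarith
  have f0' : s₀ ^ 2 = (-β) ^ 2 - e ^ 2 := by linarith
  have f1' : s₁ ^ 2 = (-(t + β)) ^ 2 - e ^ 2 := by linarith
  have f2' : s₂ ^ 2 = (-(t⁻¹ + β)) ^ 2 - e ^ 2 := by linarith
  -- The four cases are the positions of β relative to −1/t < −t < 0. On one side of β root
  -- increments dominate; for poles on opposite sides root sums are dominated.
  rcases le_total β 0 with c0 | c0
  · rcases le_total (t + β) 0 with c1 | c1
    · rcases le_total (t⁻¹ + β) 0 with c2 | c2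
      · have g1 := sub_le_sub_of_sq p1.le f0' f1' p0 (by linarith) (by linarith)
        have g2 := sub_le_sub_of_sq p2.le f1' f2' p1 (by linarith) (by linarith)
        refine sqrt_slope_left_absurd ht0 hγ0 ha0 hz hz' r0 r1 r2 ?_ (by linarith)
        linarith [mul_le_mul_of_nonneg_left g2 ht0.le]
      · have g2 := add_le_of_sq f1' f2 (by linarith) (by linarith)
        exact sqrt_sum_outer_absurd ht0 hγ0 ha0 hz hz' ha' r1 r2
          (by linarith [mul_le_mul_of_nonneg_left g2 ht0.le])
    · have g1 := add_le_of_sq f0' f1 (by linarith) (by linarith)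
      have g2 := add_le_of_sq f0' f2 (by linarith) (by linarith)
      exact sqrt_sum_inner_absurd ht0 hγ0 ha0 hz hz' r0 r1 r2 (by linarith)
        (by linarith [mul_le_mul_of_nonneg_left g2 ht0.le])
  · have g1 := sub_le_sub_of_sq p0.le f1 f0 p1 (by linarith) (by linarith)
    have g2 := sub_le_sub_of_sq p1.le f2 f1 p2 (by linarith) (by linarith)
    refine sqrt_slope_right_absurd ht0 hγ0 ha0 hz hz' r0 r1 r2 ?_ (by linarith)
    linarith [mul_le_mul_of_nonneg_left g2 ht0.le]

theorem exists_config {t γ a : ℝ} (ht0 : 0 < t) (ht1 : t < 1) (hγ : 1 ≤ γ) (ha : a0 t γ < a) :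
    Nonempty (Config t γ a) := by
  have hγ0 : 0 < γ := by linarith
  have hD : 0 < 1 - t ^ 2 := by nlinarith
  have hden : 0 < t * ((γ + 1) * t + 2 * √γ) := by positivity
  have ha' : 1 - t ^ 2 < a * (t * ((γ + 1) * t + 2 * √γ)) := (div_lt_iff₀ hden).1 ha
  have ha0 : 0 < a := lt_trans (div_pos hD hden) ha
  obtain ⟨z, hz, hz', hP⟩ := exists_residue_root ht0 ht1 hγ0 ha0
  have hk : 0 < 1 + γ * a := by positivity
  have hx : 0 < z - t := by linarith
  have hy : 0 < 1 - t * z := by linarith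
  have hz0 : 0 < z := by linarith
  obtain ⟨s₀, e0⟩ : ∃ s, s = (a + 1) / ((1 + γ * a) * z) := ⟨_, rfl⟩
  obtain ⟨s₁, e1⟩ : ∃ s, s = a * (1 - t ^ 2) / ((1 + γ * a) * (z - t)) := ⟨_, rfl⟩
  obtain ⟨s₂, e2⟩ : ∃ s, s = γ * a * (1 - t ^ 2) / ((1 + γ * a) * t * (1 - t * z)) := ⟨_, rfl⟩
  have p0 : 0 < s₀ := by rw [e0]; positivity
  have p1 : 0 < s₁ := by rw [e1]; positivity
  have p2 : 0 < s₂ := by rw [e2]; positivity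
  have r0 : (1 + γ * a) * s₀ * z = a + 1 := by rw [e0]; field_simp
  have r1 : (1 + γ * a) * s₁ * (z - t) = a * (1 - t ^ 2) := by rw [e1]; field_simp
  have r2 : (1 + γ * a) * s₂ * t * (1 - t * z) = γ * a * (1 - t ^ 2) := by rw [e2]; field_simp
  -- This is what remains of the three equations for sᵢ² once α and β are eliminated; it lets the
  -- value of β computed from s₀ and s₁ also serve s₂.
  have hrel : s₁ ^ 2 - t ^ 2 * s₂ ^ 2 = (1 - t ^ 2) * (s₀ ^ 2 - 1) := by
    have hm : ((1 + γ * a) ^ 2 * z ^ 2 * (z - t) ^ 2 * (1 - t * z) ^ 2) ≠ 0 := by positivity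
    refine mul_left_cancel₀ hm ?_
    have q0 : (1 + γ * a) ^ 2 * s₀ ^ 2 * z ^ 2 = (a + 1) ^ 2 := by rw [← r0]; ring
    have q1 : (1 + γ * a) ^ 2 * s₁ ^ 2 * (z - t) ^ 2 = (a * (1 - t ^ 2)) ^ 2 := by rw [← r1]; ring
    have q2 : (1 + γ * a) ^ 2 * s₂ ^ 2 * t ^ 2 * (1 - t * z) ^ 2 = (γ * a * (1 - t ^ 2)) ^ 2 := by
      rw [← r2]; ring
    linear_combination z ^ 2 * (1 - t * z) ^ 2 * q1 - z ^ 2 * (z - t) ^ 2 * q2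
      - (1 - t ^ 2) * (z - t) ^ 2 * (1 - t * z) ^ 2 * q0 - (1 - t ^ 2) * hP
  obtain ⟨β, hβ⟩ : ∃ β, β = (s₁ ^ 2 - t ^ 2 - s₀ ^ 2) / (2 * t) := ⟨_, rfl⟩
  have hβ1 : s₁ ^ 2 = (t + β) ^ 2 + (s₀ ^ 2 - β ^ 2) := by rw [hβ]; field_simp; ring
  have hβ2 : s₂ ^ 2 = (t⁻¹ + β) ^ 2 + (s₀ ^ 2 - β ^ 2) := by
    have : t ^ 2 * s₂ ^ 2 = t ^ 2 * ((t⁻¹ + β) ^ 2 + (s₀ ^ 2 - β ^ 2)) := by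
      have : t ^ 2 * ((t⁻¹ + β) ^ 2 + (s₀ ^ 2 - β ^ 2)) = 1 + 2 * β * t + t ^ 2 * s₀ ^ 2 := by
        field_simp
        ring
      rw [this]
      linarith
    exact mul_left_cancel₀ (by positivity) this
  have hdisc : 0 < s₀ ^ 2 - β ^ 2 := disc_pos ht0 ht1 hγ0 ha0 ha' hz hz' p0 p1 p2 r0 r1 r2 hβ1 hβ2
  have hα : (√(s₀ ^ 2 - β ^ 2) / 2) ^ 2 * 4 = s₀ ^ 2 - β ^ 2 := by
    rw [div_pow, Real.sq_sqrt hdisc.le]; ring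
  exact ⟨{ α := √(s₀ ^ 2 - β ^ 2) / 2, β := β, z₀ := z, s₀ := s₀, s₁ := s₁, s₂ := s₂
           t_pos := ht0, t_lt := ht1, γ_pos := hγ0, a_pos := ha0
           α_pos := half_pos (Real.sqrt_pos.2 hdisc)
           s₀_pos := p0, s₁_pos := p1, s₂_pos := p2, lt_z₀ := hz, z₀_lt := hz'
           s₀_sq := by linarith, s₁_sq := by linarith, s₂_sq := by linarith
           res₀ := r0, res₁ := r1, res₂ := r2 }⟩

/-! ### Lifting rays through a holomorphic map. -/

theorem exists_injOn_of_hasStrictDerivAt {g : ℂ → ℂ} {g' a : ℂ} (h : HasStrictDerivAt g g' a)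
    (h0 : g' ≠ 0) : ∃ N ∈ 𝓝 a, InjOn g N := by
  refine ⟨_, h.eventually_left_inverse h0, fun x hx y hy hxy => ?_⟩
  rw [← show _ = x from hx, ← show _ = y from hy, hxy]

/-- Uniqueness of lifts: both agreement near a point and disagreement near a point are open
conditions, local injectivity of g makes them exhaust J, and J is connected. -/
theorem eqOn_of_comp_eq {g : ℂ → ℂ} {J : Set ℝ} {w w' : ℝ → ℂ} (hJo : IsOpen J)
    (hJ : IsPreconnected J) (hw : ContinuousOn w J) (hw' : ContinuousOn w' J)
    (hinj : ∀ τ ∈ J, ∃ N ∈ 𝓝 (w τ), InjOn g N) (hg : ∀ τ ∈ J, g (w τ) = g (w' τ))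
    {τ₀ : ℝ} (hτ₀ : τ₀ ∈ J) (h0 : w τ₀ = w' τ₀) : EqOn w w' J := by
  have key : J ⊆ {τ | ∀ᶠ σ in 𝓝 τ, w σ = w' σ} := by
    refine hJ.subset_left_of_subset_union (v := {τ | ∀ᶠ σ in 𝓝 τ, w σ ≠ w' σ})
      isOpen_setOfPred_eventually_nhds isOpen_setOfPred_eventually_nhds ?_ ?_ ?_
    · rw [Set.disjoint_left]
      intro τ h1 h2
      have h1' : ∀ᶠ σ in 𝓝 τ, w σ = w' σ := h1
      have h2' : ∀ᶠ σ in 𝓝 τ, w σ ≠ w' σ := h2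
      exact (h1'.and h2').exists.elim fun σ hσ => hσ.2 hσ.1
    · intro τ hτ
      have c1 := (hw.continuousAt (hJo.mem_nhds hτ))
      have c2 := (hw'.continuousAt (hJo.mem_nhds hτ))
      by_cases h : w τ = w' τ
      · left
        obtain ⟨N, hN, hi⟩ := hinj τ hτ
        filter_upwards [c1 hN, c2 (h ▸ hN), hJo.mem_nhds hτ] with σ h1 h2 h3
        exact hi h1 h2 (hg σ h3)
      · right
        obtain ⟨A, B, hA, hB, hxA, hxB, hAB⟩ := t2_separation h
        filter_upwards [c1 (hA.mem_nhds hxA), c2 (hB.mem_nhds hxB)] with σ h1 h2 h3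
        have h1' : w σ ∈ A := h1
        exact Set.disjoint_left.1 hAB h1' (h3 ▸ h2)
    · refine ⟨τ₀, hτ₀, ?_⟩
      obtain ⟨N, hN, hi⟩ := hinj τ₀ hτ₀
      have c1 := (hw.continuousAt (hJo.mem_nhds hτ₀))
      have c2 := (hw'.continuousAt (hJo.mem_nhds hτ₀))
      filter_upwards [c1 hN, c2 (h0 ▸ hN), hJo.mem_nhds hτ₀] with σ h1 h2 h3
      exact hi h1 h2 (hg σ h3)
  exact fun τ hτ => (key hτ).self_of_nhds

/-- `w` is continuous on `J`, with values in the upper half-plane, and lifts the ray `τ ↦ δ τ`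
through `g`. -/
structure IsLift (g : ℂ → ℂ) (δ : ℂ) (J : Set ℝ) (w : ℝ → ℂ) : Prop where
  continuousOn : ContinuousOn w J
  im_pos : ∀ τ ∈ J, 0 < (w τ).im
  eq : ∀ τ ∈ J, g (w τ) = δ * τ

theorem IsLift.mono {g : ℂ → ℂ} {δ : ℂ} {J J' : Set ℝ} {w : ℝ → ℂ} (h : IsLift g δ J w)
    (hJ : J' ⊆ J) : IsLift g δ J' w :=
  ⟨h.continuousOn.mono hJ, fun τ hτ => h.im_pos τ (hJ hτ), fun τ hτ => h.eq τ (hJ hτ)⟩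

/-- `g` is locally biholomorphic in the upper half-plane away from its zeros. -/
structure LocBihol (g : ℂ → ℂ) : Prop where
  cont : ∀ w : ℂ, 0 < w.im → ContinuousAt g w
  deriv : ∀ w : ℂ, 0 < w.im → g w ≠ 0 → ∃ g' : ℂ, g' ≠ 0 ∧ HasStrictDerivAt g g' w

theorem _root_.MapClusterPt.eq_of_tendsto {X Y : Type*} [TopologicalSpace Y] [T2Space Y]
    {l : Filter X} {u : X → Y} {x y : Y} (h : MapClusterPt x l u) (h' : Tendsto u l (𝓝 y)) :
    x = y := by
  have : (𝓝 x ⊓ 𝓝 y).NeBot := Filter.NeBot.mono h (inf_le_inf_left _ h')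
  exact eq_of_nhds_neBot this

theorem tendsto_mul_ofReal (δ : ℂ) (T : ℝ) : Tendsto (fun τ : ℝ => δ * (τ : ℂ)) (𝓝 T) (𝓝 (δ * T)) :=
  (continuous_const.mul Complex.continuous_ofReal).tendsto T

/-- At positive times the value δτ is nonzero, so a lift avoids the zeros of g, where local
injectivity may fail. -/
theorem IsLift.eqOn {g : ℂ → ℂ} {δ : ℂ} {J : Set ℝ} {w w' : ℝ → ℂ} (hg : LocBihol g)
    (hδ : δ ≠ 0) (h : IsLift g δ J w) (h' : IsLift g δ J w') (hJo : IsOpen J)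
    (hJ : IsPreconnected J) (hpos : J ⊆ Ioi 0) {τ₀ : ℝ} (hτ₀ : τ₀ ∈ J) (h0 : w τ₀ = w' τ₀) :
    EqOn w w' J := by
  refine eqOn_of_comp_eq (g := g) hJo hJ h.continuousOn h'.continuousOn (fun τ hτ => ?_)
    (fun τ hτ => by rw [h.eq τ hτ, h'.eq τ hτ]) hτ₀ h0
  have hne : g (w τ) ≠ 0 := by
    rw [h.eq τ hτ]
    exact mul_ne_zero hδ (by exact_mod_cast (hpos hτ).ne')
  obtain ⟨g', h1, h2⟩ := hg.deriv _ (h.im_pos τ hτ) hne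
  exact exists_injOn_of_hasStrictDerivAt h2 h1

/-- A lift on a bounded interval that accumulates inside the half-plane can be continued. -/
theorem IsLift.extend {g : ℂ → ℂ} {δ : ℂ} {T : ℝ} {w : ℝ → ℂ} (hg : LocBihol g)
    (hδ : δ ≠ 0) (hT : 0 < T) (h : IsLift g δ (Ioo 0 T) w) {q : ℂ} (hq : 0 < q.im)
    (hc : MapClusterPt q (𝓝[<] T) w) :
    ∃ T' > T, ∃ W, IsLift g δ (Ioo 0 T') W ∧ EqOn W w (Ioo 0 T) := by
  have hJ : Ioo 0 T ∈ 𝓝[<] T := Ioo_mem_nhdsLT hT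
  have hgq : g q = δ * T := by
    have hc' : MapClusterPt (g q) (𝓝[<] T) (g ∘ w) := hc.continuousAt_comp (hg.cont q hq)
    refine hc'.eq_of_tendsto (((tendsto_mul_ofReal δ T).mono_left nhdsWithin_le_nhds).congr' ?_)
    filter_upwards [hJ] with τ hτ
    exact (h.eq τ hτ).symm
  have hgq0 : g q ≠ 0 := by
    rw [hgq]
    exact mul_ne_zero hδ (by exact_mod_cast hT.ne')
  obtain ⟨g', hg0, hg'⟩ := hg.deriv q hq hgq0
  obtain ⟨N, hN, hinj⟩ := exists_injOn_of_hasStrictDerivAt hg' hg0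
  -- The continuation beyond T is τ ↦ u(δτ), with u the local inverse of g at the accumulation
  -- point.
  set u := hg'.localInverse g g' q hg0 with hu
  have hu' : HasStrictDerivAt u g'⁻¹ (g q) := hg'.to_localInverse hg0
  have huq : u (g q) = q := (hg'.eventually_left_inverse hg0).self_of_nhds
  obtain ⟨K, S, hS, hlip⟩ := hu'.hasStrictFDerivAt.exists_lipschitzOnWith
  have hcq : Tendsto u (𝓝 (g q)) (𝓝 q) := by
    have := hu'.hasDerivAt.continuousAt
    rwa [ContinuousAt, huq] at this
  have hev : ∀ᶠ v in 𝓝 (g q), u v ∈ N ∧ 0 < (u v).im ∧ g (u v) = v ∧ S ∈ 𝓝 v := by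
    filter_upwards [hcq hN, hcq ((isOpen_lt continuous_const Complex.continuous_im).mem_nhds hq),
      hg'.eventually_right_inverse hg0, eventually_mem_nhds_iff.2 hS] with v h1 h2 h3 h4
    exact ⟨h1, h2, h3, h4⟩
  rw [hgq] at hev
  obtain ⟨η, hη, hev⟩ := Metric.eventually_nhds_iff.1 ((tendsto_mul_ofReal δ T).eventually hev)
  have hev' : ∀ τ ∈ Ioo (T - η) (T + η), u (δ * τ) ∈ N ∧ 0 < (u (δ * τ)).im ∧
      g (u (δ * τ)) = δ * τ ∧ S ∈ 𝓝 (δ * (τ : ℂ)) := fun τ hτ =>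
    hev (by rw [Real.dist_eq, abs_lt]; constructor <;> linarith [hτ.1, hτ.2])
  have hucont : ∀ τ ∈ Ioo (T - η) (T + η), ContinuousAt (fun τ : ℝ => u (δ * τ)) τ := by
    intro τ hτ
    exact ContinuousAt.comp (f := fun τ : ℝ => δ * (τ : ℂ))
      (hlip.continuousOn.continuousAt (hev' τ hτ).2.2.2)
      (tendsto_mul_ofReal δ τ)
  set m := max 0 (T - η) with hm
  have hmT : m < T := max_lt hT (by linarith)
  have hlift : IsLift g δ (Ioo m T) (fun τ => u (δ * τ)) := by
    have hsub : ∀ τ ∈ Ioo m T, τ ∈ Ioo (T - η) (T + η) := fun τ hτ =>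
      ⟨lt_of_le_of_lt (le_max_right _ _) hτ.1, by linarith [hτ.2]⟩
    exact ⟨fun τ hτ => (hucont τ (hsub τ hτ)).continuousWithinAt,
      fun τ hτ => (hev' τ (hsub τ hτ)).2.1, fun τ hτ => (hev' τ (hsub τ hτ)).2.2.1⟩
  have hlift' : IsLift g δ (Ioo m T) w := h.mono (Ioo_subset_Ioo_left (le_max_left _ _))
  -- Accumulation at q supplies one time at which w lies where g is injective. There w agrees with
  -- the new branch, hence it does so on all of (m, T).
  obtain ⟨τ₀, hwN, hτ₀⟩ : ∃ τ₀, w τ₀ ∈ N ∧ τ₀ ∈ Ioo m T :=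
    ((mapClusterPt_iff_frequently.1 hc N hN).and_eventually (Ioo_mem_nhdsLT hmT)).exists
  have heq : EqOn w (fun τ => u (δ * τ)) (Ioo m T) := by
    refine hlift'.eqOn hg hδ hlift isOpen_Ioo isPreconnected_Ioo
      (fun τ hτ => lt_of_le_of_lt (le_max_left _ _) hτ.1) hτ₀ ?_
    refine hinj hwN (hev' τ₀ ⟨lt_of_le_of_lt (le_max_right _ _) hτ₀.1, by linarith [hτ₀.2]⟩).1 ?_
    rw [hlift'.eq τ₀ hτ₀]
    exact (hlift.eq τ₀ hτ₀).symm
  refine ⟨T + η, by linarith, fun τ => if τ < T then w τ else u (δ * τ), ?_,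
    fun τ hτ => if_pos hτ.2⟩
  have hR : ∀ τ ∈ Ioo m (T + η), (if τ < T then w τ else u (δ * τ)) = u (δ * τ) := by
    intro τ hτ
    by_cases hc : τ < T
    · rw [if_pos hc, heq ⟨hτ.1, hc⟩]
    · rw [if_neg hc]
  have hcases : ∀ τ ∈ Ioo 0 (T + η), τ ∈ Ioo 0 T ∨
      (τ ∈ Ioo m (T + η) ∧ τ ∈ Ioo (T - η) (T + η)) := by
    intro τ hτ
    rcases lt_or_ge τ T with hc | hc
    · exact Or.inl ⟨hτ.1, hc⟩
    · exact Or.inr ⟨⟨by linarith, hτ.2⟩, by linarith, hτ.2⟩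
  refine ⟨fun τ hτ => ContinuousAt.continuousWithinAt ?_, fun τ hτ => ?_, fun τ hτ => ?_⟩
  · rcases hcases τ hτ with h1 | ⟨h1, h2⟩
    · refine (h.continuousOn.continuousAt (isOpen_Ioo.mem_nhds h1)).congr ?_
      filter_upwards [isOpen_Ioo.mem_nhds h1] with σ hσ
      exact (if_pos hσ.2).symm
    · refine (hucont τ h2).congr ?_
      filter_upwards [isOpen_Ioo.mem_nhds h1] with σ hσ
      exact (hR σ hσ).symm
  · rcases hcases τ hτ with h1 | ⟨h1, h2⟩
    · simp only [if_pos h1.2]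
      exact h.im_pos τ h1
    · rw [hR τ h1]
      exact (hev' τ h2).2.1
  · rcases hcases τ hτ with h1 | ⟨h1, h2⟩
    · simp only [if_pos h1.2]
      exact h.eq τ h1
    · rw [hR τ h1]
      exact (hev' τ h2).2.2.1

/-- Lifts that extend a given one to longer and longer intervals fit together. -/
theorem IsLift.glue {g : ℂ → ℂ} {δ : ℂ} {ε : ℝ} {w : ℝ → ℂ} (hg : LocBihol g)
    (hδ : δ ≠ 0) (hε : 0 < ε) {J : Set ℝ} (hJpos : J ⊆ Ioi 0)
    (h : ∀ τ ∈ J, ∃ T > τ, ε ≤ T ∧ ∃ W, IsLift g δ (Ioo 0 T) W ∧ EqOn W w (Ioo 0 ε)) :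
    ∃ W, IsLift g δ J W ∧ ∀ τ ∈ J, τ < ε → W τ = w τ := by
  choose! T hT hεT V hV hVw using h
  have hsub : ∀ τ ∈ J, τ ∈ Ioo 0 (T τ) := fun τ hτ => ⟨hJpos hτ, hT τ hτ⟩
  have hcomm : ∀ τ ∈ J, ∀ σ ∈ J, ∀ ρ ∈ Ioo 0 (min (T τ) (T σ)), V τ ρ = V σ ρ := by
    intro τ hτ σ hσ
    refine ((hV τ hτ).mono (Ioo_subset_Ioo_right (min_le_left _ _))).eqOn hg hδ
      ((hV σ hσ).mono (Ioo_subset_Ioo_right (min_le_right _ _))) isOpen_Ioo isPreconnected_Ioo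
      (fun ρ hρ => hρ.1) (τ₀ := ε / 2)
      ⟨by linarith, lt_min (by linarith [hεT τ hτ]) (by linarith [hεT σ hσ])⟩ ?_
    rw [hVw τ hτ ⟨by linarith, by linarith⟩, hVw σ hσ ⟨by linarith, by linarith⟩]
  refine ⟨fun τ => V τ τ, ⟨fun τ hτ => ?_, fun τ hτ => (hV τ hτ).im_pos τ (hsub τ hτ),
    fun τ hτ => (hV τ hτ).eq τ (hsub τ hτ)⟩,
    fun τ hτ hτε => hVw τ hτ ⟨hJpos hτ, hτε⟩⟩
  have hc := ((hV τ hτ).continuousOn.continuousAt (isOpen_Ioo.mem_nhds (hsub τ hτ)))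
  refine hc.continuousWithinAt.congr_of_eventuallyEq ?_ rfl
  filter_upwards [self_mem_nhdsWithin,
    mem_nhdsWithin_of_mem_nhds (isOpen_Ioo.mem_nhds (hsub τ hτ))] with σ hσ hσ'
  exact hcomm σ hσ τ hτ σ ⟨hσ'.1, lt_min (hT σ hσ) hσ'.2⟩

/-- Every short lift extends to all times, or to a maximal bounded interval at the end of which
it does not accumulate inside the half-plane. -/
theorem IsLift.exists_maximal {g : ℂ → ℂ} {δ : ℂ} {ε : ℝ} {w : ℝ → ℂ} (hg : LocBihol g)
    (hδ : δ ≠ 0) (hε : 0 < ε) (hw : IsLift g δ (Ioo 0 ε) w) :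
    (∃ W, IsLift g δ (Ioi 0) W ∧ EqOn W w (Ioo 0 ε)) ∨
    ∃ T, ε ≤ T ∧ ∃ W, IsLift g δ (Ioo 0 T) W ∧ EqOn W w (Ioo 0 ε) ∧
      ∀ q : ℂ, 0 < q.im → ¬ MapClusterPt q (𝓝[<] T) W := by
  -- All end times of extensions of w. If they are bounded, the lift glued up to the supremum cannot
  -- accumulate in the half-plane, since it could then be extended past the supremum.
  set 𝒯 : Set ℝ := {T | ε ≤ T ∧ ∃ W, IsLift g δ (Ioo 0 T) W ∧ EqOn W w (Ioo 0 ε)} with h𝒯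
  have hε𝒯 : ε ∈ 𝒯 := ⟨le_rfl, w, hw, fun _ _ => rfl⟩
  by_cases hb : BddAbove 𝒯
  · right
    have hle : ε ≤ sSup 𝒯 := le_csSup hb hε𝒯
    obtain ⟨W, hW, hWw⟩ := IsLift.glue (J := Ioo 0 (sSup 𝒯)) (w := w) hg hδ hε (fun τ hτ => hτ.1)
      (by
        intro τ hτ
        obtain ⟨T, hT, hτT⟩ := exists_lt_of_lt_csSup ⟨ε, hε𝒯⟩ hτ.2
        exact ⟨T, hτT, hT.1, hT.2⟩)
    have hWε : EqOn W w (Ioo 0 ε) := fun τ hτ => hWw τ ⟨hτ.1, hτ.2.trans_le hle⟩ hτ.2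
    refine ⟨sSup 𝒯, hle, W, hW, hWε, ?_⟩
    intro q hq hc
    obtain ⟨T', hT', W', hW', he⟩ := hW.extend hg hδ (hε.trans_le hle) hq hc
    have : T' ∈ 𝒯 := ⟨by linarith, W', hW', fun τ hτ => by
      rw [he ⟨hτ.1, hτ.2.trans_le hle⟩, hWε hτ]⟩
    linarith [le_csSup hb this]
  · left
    obtain ⟨W, hW, hWw⟩ := IsLift.glue (J := Ioi 0) (w := w) hg hδ hε (fun τ hτ => hτ)
      (by
        intro τ hτ
        obtain ⟨T, hT, hτT⟩ := not_bddAbove_iff.1 hb τ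
        exact ⟨T, hτT, hT.1, hT.2⟩)
    exact ⟨W, hW, fun τ hτ => hWw τ hτ.1 hτ.2⟩

/-- A continuous function on small connected sets of the filter `l`, all of whose accumulation
points lie in a finite set, converges. -/
theorem exists_tendsto_of_finite_clusterPt {l : Filter ℝ} [l.NeBot] {w : ℝ → ℂ}
    (hl : ∀ S ∈ l, ∃ S' ∈ l, S' ⊆ S ∧ IsPreconnected (w '' S')) {K : Set ℂ} (hK : IsCompact K)
    (hwK : ∀ᶠ τ in l, w τ ∈ K) {F : Set ℂ} (hF : F.Finite)
    (hcl : ∀ q, MapClusterPt q l w → q ∈ F) : ∃ q ∈ F, Tendsto w l (𝓝 q) := by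
  obtain ⟨q, -, hq⟩ := hK.exists_mapClusterPt (Filter.tendsto_principal.2 hwK)
  refine ⟨q, hcl q hq, ?_⟩
  have hsep : ∃ r > 0, ∀ p ∈ F, p ≠ q → r ≤ dist p q := by
    have hfin : (F \ {q}).Finite := hF.subset sdiff_subset
    have : (F \ {q})ᶜ ∈ 𝓝 q := hfin.isClosed.isOpen_compl.mem_nhds (by simp)
    obtain ⟨r, hr, hball⟩ := Metric.mem_nhds_iff.1 this
    refine ⟨r, hr, fun p hp hpq => ?_⟩
    by_contra hlt
    exact hball (Metric.mem_ball.2 (not_le.1 hlt)) ⟨hp, hpq⟩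
  obtain ⟨r, hr, hsep⟩ := hsep
  rw [Metric.tendsto_nhds]
  intro e he
  set e' := min e (r / 2) with he'
  have he'0 : 0 < e' := lt_min he (by linarith)
  -- The closed annulus between radii e' and r/2 about q contains no point of F, so by compactness
  -- the path eventually avoids it; being connected and returning near q, the path stays in the
  -- inner ball.
  have hann : ∀ᶠ τ in l, w τ ∉ K \ (Metric.ball q e' ∪ (Metric.closedBall q (r / 2))ᶜ) := by
    have hcomp : IsCompact (K \ (Metric.ball q e' ∪ (Metric.closedBall q (r / 2))ᶜ)) :=
      hK.diff (Metric.isOpen_ball.union Metric.isClosed_closedBall.isOpen_compl)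
    by_contra hcon
    have hfr : ∃ᶠ τ in l, w τ ∈ K \ (Metric.ball q e' ∪ (Metric.closedBall q (r / 2))ᶜ) := by
      exact (Filter.not_eventually.1 hcon).mono fun _ h => not_not.1 h
    obtain ⟨p, hp, hpc⟩ := hcomp.exists_mapClusterPt_of_frequently hfr
    have hpF := hcl p hpc
    have h1 : ¬ (p ∈ Metric.ball q e') := fun h => hp.2 (Or.inl h)
    have h2 : p ∈ Metric.closedBall q (r / 2) := by
      by_contra h
      exact hp.2 (Or.inr h)
    have hpq : p ≠ q := by
      rintro rfl
      exact h1 (Metric.mem_ball_self he'0)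
    have := hsep p hpF hpq
    rw [Metric.mem_closedBall] at h2
    linarith
  obtain ⟨S', hS', hsub, hconn⟩ := hl _ (hann.and hwK)
  have hsub2 : w '' S' ⊆ Metric.ball q e' ∪ (Metric.closedBall q (r / 2))ᶜ := by
    rintro _ ⟨τ, hτ, rfl⟩
    by_contra hcon
    exact (hsub hτ).1 ⟨(hsub hτ).2, hcon⟩
  have hfreq : ∃ᶠ τ in l, w τ ∈ Metric.ball q e' :=
    mapClusterPt_iff_frequently.1 hq _ (Metric.ball_mem_nhds _ he'0)
  obtain ⟨τ₀, hτ₀, hτ₀S⟩ := (hfreq.and_eventually hS').exists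
  have hin := hconn.subset_left_of_subset_union Metric.isOpen_ball
    Metric.isClosed_closedBall.isOpen_compl (by
      rw [Set.disjoint_left]
      intro x hx hx'
      apply hx'
      rw [Metric.mem_ball] at hx
      rw [Metric.mem_closedBall]
      linarith [min_le_right e (r / 2)]) hsub2 ⟨w τ₀, ⟨τ₀, hτ₀S, rfl⟩, hτ₀⟩
  filter_upwards [hS'] with τ hτ
  have := hin ⟨τ, hτ, rfl⟩
  rw [Metric.mem_ball] at this
  exact lt_of_lt_of_le this (min_le_left _ _)

/-! ### Local normal forms at zeros and critical points. -/

theorem exists_local_inverse {g : ℂ → ℂ} {g' a : ℂ} (h : HasStrictDerivAt g g' a)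
    (h0 : g' ≠ 0) : ∃ u : ℂ → ℂ, u (g a) = a ∧ (∀ᶠ w in 𝓝 a, u (g w) = w) ∧
      HasStrictDerivAt u g'⁻¹ (g a) ∧ ∀ᶠ v in 𝓝 (g a), ContinuousAt u v ∧ g (u v) = v := by
  have hu' := h.to_localInverse h0
  obtain ⟨K, S, hS, hlip⟩ := hu'.hasStrictFDerivAt.exists_lipschitzOnWith
  refine ⟨_, (h.eventually_left_inverse h0).self_of_nhds, h.eventually_left_inverse h0, hu', ?_⟩
  filter_upwards [h.eventually_right_inverse h0, eventually_mem_nhds_iff.2 hS] with v h3 h4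
  exact ⟨hlip.continuousOn.continuousAt h4, h3⟩

/-- The order of vanishing of g − g(q) exceeds that of its derivative by one. Differentiating the
factorization and letting w → q relates the two leading coefficients. -/
theorem exists_factor_of_deriv {g S : ℂ → ℂ} {q : ℂ} {n : ℕ} (hg : AnalyticAt ℂ g q)
    (hS : AnalyticAt ℂ S q) (hS0 : S q ≠ 0) (hd : ∀ᶠ w in 𝓝 q, deriv g w = (w - q) ^ n * S w) :
    ∃ k : ℂ → ℂ, AnalyticAt ℂ k q ∧ (n + 1) * k q = S q ∧
      ∀ᶠ w in 𝓝 q, g w = g q + (w - q) ^ (n + 1) * k w := by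
  have h1 : analyticOrderAt (deriv g) q = n :=
    hg.deriv.analyticOrderAt_eq_natCast.2 ⟨S, hS, hS0, by simpa using hd⟩
  have h2 : analyticOrderAt (g · - g q) q = (n + 1 : ℕ) := by
    rw [← hg.analyticOrderAt_deriv_add_one, h1]
    push_cast
    rfl
  have hga : AnalyticAt ℂ (g · - g q) q := hg.sub analyticAt_const
  obtain ⟨k, hk, -, hkw⟩ := hga.analyticOrderAt_eq_natCast.1 h2
  have hkw' : ∀ᶠ w in 𝓝 q, g w = g q + (w - q) ^ (n + 1) * k w := by
    filter_upwards [hkw] with w hw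
    rw [smul_eq_mul] at hw
    rw [← hw]
    ring
  refine ⟨k, hk, ?_, hkw'⟩
  have hder : ∀ᶠ w in 𝓝[≠] q, (n + 1) * k w + (w - q) * deriv k w = S w := by
    filter_upwards [hkw'.eventually_nhds.filter_mono nhdsWithin_le_nhds,
      hd.filter_mono nhdsWithin_le_nhds, self_mem_nhdsWithin,
      hk.eventually_analyticAt.filter_mono nhdsWithin_le_nhds] with w hw hdw hne hka
    have hne' : w - q ≠ 0 := sub_ne_zero.2 hne
    have e1 : deriv g w = (n + 1) * (w - q) ^ n * k w + (w - q) ^ (n + 1) * deriv k w := by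
      rw [Filter.EventuallyEq.deriv_eq (show g =ᶠ[𝓝 w] _ from hw)]
      have := (((((hasDerivAt_id w).sub_const q).pow (n + 1)).mul
        hka.differentiableAt.hasDerivAt).const_add (g q)).deriv
      simpa using this
    rw [e1] at hdw
    refine mul_left_cancel₀ (pow_ne_zero n hne') ?_
    rw [← hdw]
    ring
  have hc : Tendsto (fun w => (n + 1 : ℂ) * k w + (w - q) * deriv k w) (𝓝[≠] q)
      (𝓝 ((n + 1) * k q + (q - q) * deriv k q)) := by
    have h3 := hk.continuousAt
    have h4 := hk.deriv.continuousAt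
    have : ContinuousAt (fun w => (n + 1 : ℂ) * k w + (w - q) * deriv k w) q := by fun_prop
    exact this.tendsto.mono_left nhdsWithin_le_nhds
  have hc' : Tendsto S (𝓝[≠] q) (𝓝 (S q)) := hS.continuousAt.tendsto.mono_left nhdsWithin_le_nhds
  have := tendsto_nhds_unique (hc.congr' hder) hc'
  simpa using this

/-- The three local lifts of a ray that start at a triple zero. -/
theorem exists_three_lifts {g S : ℂ → ℂ} {q δ : ℂ} (hq : 0 < q.im) (hg : AnalyticAt ℂ g q)
    (hgq : g q = 0) (hS : AnalyticAt ℂ S q) (hS0 : S q ≠ 0)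
    (hd : ∀ᶠ w in 𝓝 q, deriv g w = (w - q) ^ 2 * S w) (hδ : δ ≠ 0) :
    ∃ ε > 0, ∃ w : Fin 3 → ℝ → ℂ, (∀ j, IsLift g δ (Ioo 0 ε) (w j)) ∧
      (∀ j, Tendsto (w j) (𝓝[>] 0) (𝓝 q)) ∧
      ∀ j k, j ≠ k → ∀ τ ∈ Ioo 0 ε, w j τ ≠ w k τ := by
  obtain ⟨k, hk, hkq, hkw⟩ := exists_factor_of_deriv hg hS hS0 hd
  have hk0 : k q ≠ 0 := by
    rintro h
    rw [h, mul_zero] at hkq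
    exact hS0 hkq.symm
  obtain ⟨κ, hκ⟩ := IsAlgClosed.exists_pow_nat_eq (k q) (n := 3) (by norm_num)
  obtain ⟨d, hd3⟩ := IsAlgClosed.exists_pow_nat_eq δ (n := 3) (by norm_num)
  have hκ0 : κ ≠ 0 := by
    rintro rfl
    exact hk0 (by rw [← hκ]; norm_num)
  have hd0 : d ≠ 0 := by
    rintro rfl
    exact hδ (by rw [← hd3]; norm_num)
  -- A cube root of g. The division by k(q) places the argument of the logarithm at 1, away from its
  -- cut.
  set φ : ℂ → ℂ := fun w => (w - q) * (κ * Complex.exp (Complex.log (k w / k q) / 3)) with hφ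
  have hslit : k q / k q ∈ Complex.slitPlane := by
    rw [div_self hk0]
    exact Complex.one_mem_slitPlane
  have hlog : AnalyticAt ℂ (fun w => κ * Complex.exp (Complex.log (k w / k q) / 3)) q :=
    analyticAt_const.mul ((((hk.div analyticAt_const hk0).clog hslit).div analyticAt_const
      (by norm_num)).cexp')
  have hφq : φ q = 0 := by simp [hφ]
  have hφd : HasStrictDerivAt φ κ q := by
    have := HasStrictDerivAt.mul ((hasStrictDerivAt_id q).sub_const q) hlog.hasStrictDerivAt
    refine this.congr_deriv ?_
    simp [hk0]
  have hφ3 : ∀ᶠ w in 𝓝 q, g w = φ w ^ 3 := by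
    filter_upwards [hkw, hk.continuousAt.eventually_ne hk0] with w hw hkw0
    rw [hw, hgq, hφ]
    have : (κ * Complex.exp (Complex.log (k w / k q) / 3)) ^ 3 = k w := by
      rw [mul_pow, hκ, ← Complex.exp_nat_mul]
      have : ((3 : ℕ) : ℂ) * (Complex.log (k w / k q) / 3) = Complex.log (k w / k q) := by
        push_cast; ring
      rw [this, Complex.exp_log (div_ne_zero hkw0 hk0)]
      field_simp
    simp only [mul_pow] at this ⊢
    rw [this]
    ring
  obtain ⟨u, hu0, -, -, huv⟩ := exists_local_inverse hφd hκ0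
  rw [hφq] at hu0 huv
  have hutend : Tendsto u (𝓝 0) (𝓝 q) := by
    have := huv.self_of_nhds.1
    rwa [ContinuousAt, hu0] at this
  have hev : ∀ᶠ v in 𝓝 (0 : ℂ), ContinuousAt u v ∧ φ (u v) = v ∧ g (u v) = v ^ 3 ∧
      0 < (u v).im := by
    filter_upwards [huv, hutend.eventually hφ3,
      hutend ((isOpen_lt continuous_const Complex.continuous_im).mem_nhds hq)] with v h1 h2 h3
    exact ⟨h1.1, h1.2, by rw [h2, h1.2], h3⟩
  have hω : IsPrimitiveRoot (Complex.exp (2 * Real.pi * Complex.I / (3 : ℕ))) 3 :=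
    Complex.isPrimitiveRoot_exp 3 (by norm_num)
  set ω := Complex.exp (2 * Real.pi * Complex.I / (3 : ℕ)) with hω'
  -- The three cube roots of δτ; their images under the local inverse of φ are the three lifts.
  set v : Fin 3 → ℝ → ℂ := fun j τ => d * ω ^ (j : ℕ) * ((τ ^ (1 / 3 : ℝ) : ℝ) : ℂ) with hv
  have hvc : ∀ j, Continuous (v j) := fun j => by
    have : Continuous fun τ : ℝ => τ ^ (1 / 3 : ℝ) :=
      Real.continuous_rpow_const (by norm_num)
    exact continuous_const.mul (Complex.continuous_ofReal.comp this)
  have hv0 : ∀ j, v j 0 = 0 := fun j => by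
    simp only [hv]
    rw [Real.zero_rpow (by norm_num)]
    simp
  have hv3 : ∀ j, ∀ τ : ℝ, 0 < τ → v j τ ^ 3 = δ * τ := by
    intro j τ hτ
    simp only [hv]
    have h1 : (ω ^ (j : ℕ)) ^ 3 = 1 := by
      rw [← pow_mul, mul_comm, pow_mul, hω.pow_eq_one, one_pow]
    have h2 : (((τ ^ (1 / 3 : ℝ) : ℝ) : ℂ)) ^ 3 = τ := by
      rw [← Complex.ofReal_pow, ← Real.rpow_natCast, ← Real.rpow_mul hτ.le]
      norm_num
    rw [mul_pow, mul_pow, h1, h2, hd3, mul_one]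
  have hall : ∀ᶠ τ in 𝓝 (0 : ℝ), ∀ j, ContinuousAt u (v j τ) ∧ φ (u (v j τ)) = v j τ ∧
      g (u (v j τ)) = v j τ ^ 3 ∧ 0 < (u (v j τ)).im := by
    rw [Filter.eventually_all]
    intro j
    have : Tendsto (v j) (𝓝 0) (𝓝 0) := by
      have := (hvc j).tendsto 0
      rwa [hv0] at this
    exact this.eventually hev
  obtain ⟨ε, hε, hball⟩ := Metric.eventually_nhds_iff.1 hall
  have hball' : ∀ τ ∈ Ioo 0 ε, ∀ j, ContinuousAt u (v j τ) ∧ φ (u (v j τ)) = v j τ ∧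
      g (u (v j τ)) = v j τ ^ 3 ∧ 0 < (u (v j τ)).im := fun τ hτ =>
    hball (by rw [Real.dist_eq, abs_lt]; constructor <;> linarith [hτ.1, hτ.2])
  refine ⟨ε, hε, fun j τ => u (v j τ), fun j => ⟨fun τ hτ => ?_, fun τ hτ => (hball' τ hτ j).2.2.2,
    fun τ hτ => ?_⟩, fun j => ?_, fun j l hjl τ hτ heq => hjl ?_⟩
  · exact (ContinuousAt.comp (f := v j) (hball' τ hτ j).1
      (hvc j).continuousAt).continuousWithinAt
  · rw [(hball' τ hτ j).2.2.1, hv3 j τ hτ.1]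
  · refine (hutend.comp ?_).mono_left nhdsWithin_le_nhds
    have := (hvc j).tendsto 0
    rwa [hv0] at this
  · have h1 : v j τ = v l τ := by
      rw [← (hball' τ hτ j).2.1, ← (hball' τ hτ l).2.1]
      exact congrArg φ heq
    have hτ3 : ((τ ^ (1 / 3 : ℝ) : ℝ) : ℂ) ≠ 0 := by
      exact_mod_cast (Real.rpow_pos_of_pos hτ.1 _).ne'
    have h2 : ω ^ (j : ℕ) = ω ^ (l : ℕ) := by
      have := mul_right_cancel₀ hτ3 h1
      exact mul_left_cancel₀ hd0 this
    exact Fin.ext (hω.pow_inj j.2 l.2 h2)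

/-- A real-analytic coordinate preserves the upper half-plane. -/
theorem eventually_im_pos {φ : ℂ → ℂ} {φ' : ℂ} {q : ℝ} (h : HasStrictDerivAt φ φ' (q : ℂ))
    (hpos : 0 < φ'.re) (hreal : ∀ᶠ u : ℝ in 𝓝 q, (φ u).im = 0) :
    ∀ᶠ w in 𝓝 (q : ℂ), 0 < w.im → 0 < (φ w).im := by
  -- The point w is compared with its real part, at which φ is real: up to an error of half its
  -- size, the increment of φ is φ' · i · Im w.
  have h1 := (hasStrictDerivAt_iff_hasStrictFDerivAt.1 h).isLittleO.def (c := φ'.re / 2) (by linarith)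
  have hre : Tendsto (fun w : ℂ => w.re) (𝓝 (q : ℂ)) (𝓝 q) := by
    simpa using Complex.continuous_re.tendsto (q : ℂ)
  have hpair : Tendsto (fun w : ℂ => (w, ((w.re : ℝ) : ℂ))) (𝓝 (q : ℂ)) (𝓝 ((q : ℂ), (q : ℂ))) :=
    tendsto_id.prodMk_nhds ((Complex.continuous_ofReal.tendsto q).comp hre)
  filter_upwards [hpair.eventually h1, hre.eventually hreal] with w hw hr him
  have e : w - (w.re : ℂ) = w.im * Complex.I := by
    apply Complex.ext <;> simp
  simp only [e, ContinuousLinearMap.toSpanSingleton_apply, smul_eq_mul] at hw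
  have h2 := (Complex.abs_im_le_norm _).trans hw
  simp only [Complex.sub_im, hr, Complex.mul_im, Complex.mul_re, Complex.ofReal_re,
    Complex.ofReal_im, Complex.I_re, Complex.I_im] at h2
  rw [norm_mul, Complex.norm_I, Complex.norm_real, Real.norm_eq_abs, abs_of_pos him] at h2
  have h3 := (abs_le.1 h2).1
  nlinarith

/-- The square root coordinate at a simple critical point on the real axis. -/
theorem exists_sqrt_coordinate {g S : ℂ → ℂ} {q : ℝ} {σ : ℝ} (hσ : σ = 1 ∨ σ = -1)
    (hg : AnalyticAt ℂ g q) (hS : AnalyticAt ℂ S q) (hSre : 0 < σ * (S q).re)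
    (hSim : (S q).im = 0) (hd : ∀ᶠ w in 𝓝 (q : ℂ), deriv g w = (w - q) * S w)
    (hreal : ∀ᶠ u : ℝ in 𝓝 q, (g u).im = (g q).im) :
    ∃ φ φ' : ℂ → ℂ, (∀ᶠ w in 𝓝 (q : ℂ), HasStrictDerivAt φ (φ' w) w) ∧ ContinuousAt φ' q ∧
      0 < (φ' q).re ∧ (φ' q).im = 0 ∧ φ q = 0 ∧
      (∀ᶠ w in 𝓝 (q : ℂ), g w = g q + σ * φ w ^ 2) ∧
      (∀ᶠ u : ℝ in 𝓝 q, (φ u).im = 0) ∧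
      ∀ᶠ w in 𝓝 (q : ℂ), 0 < w.im → 0 < (φ w).im := by
  have hS0 : S q ≠ 0 := by
    intro h
    rw [h] at hSre
    simp at hSre
  have hσ2 : (σ : ℂ) * σ = 1 := by
    rcases hσ with rfl | rfl <;> norm_num
  obtain ⟨k, hk, hkq, hkw⟩ := exists_factor_of_deriv (n := 1) hg hS hS0 (by simpa using hd)
  have hkq' : (σ : ℂ) * k q = ((σ * (S q).re / 2 : ℝ) : ℂ) := by
    have h2 : S q = ((S q).re : ℂ) := Complex.ext (by simp) (by simp [hSim])
    push_cast at hkq ⊢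
    rw [← h2, ← hkq]
    ring
  have hslit : (σ : ℂ) * k q ∈ Complex.slitPlane := by
    rw [hkq']
    exact Complex.ofReal_mem_slitPlane.2 (by linarith)
  have hlog : AnalyticAt ℂ (fun w => Complex.exp (Complex.log (σ * k w) / 2)) q :=
    ((((analyticAt_const.mul hk).clog hslit).div analyticAt_const (by norm_num)).cexp')
  set φ : ℂ → ℂ := fun w => (w - q) * Complex.exp (Complex.log (σ * k w) / 2) with hφ
  have hφa : AnalyticAt ℂ φ q := (analyticAt_id.sub analyticAt_const).mul hlog
  have hφd : HasStrictDerivAt φ (Complex.exp (Complex.log (σ * k q) / 2)) q := by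
    have := HasStrictDerivAt.mul ((hasStrictDerivAt_id (q : ℂ)).sub_const (q : ℂ)) hlog.hasStrictDerivAt
    refine this.congr_deriv ?_
    simp
  have hval : Complex.exp (Complex.log (σ * k q) / 2)
      = ((Real.exp (Real.log (σ * (S q).re / 2) / 2) : ℝ) : ℂ) := by
    rw [hkq', ← Complex.ofReal_log (by linarith)]
    push_cast
    rfl
  have hφ'q : deriv φ q = ((Real.exp (Real.log (σ * (S q).re / 2) / 2) : ℝ) : ℂ) := by
    rw [hφd.hasDerivAt.deriv, hval]
  have hofr : Tendsto (fun u : ℝ => (u : ℂ)) (𝓝 q) (𝓝 (q : ℂ)) :=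
    Complex.continuous_ofReal.tendsto q
  have hφreal : ∀ᶠ u : ℝ in 𝓝 q, (φ u).im = 0 := by
    have hcont : ContinuousAt (fun w => ((σ : ℂ) * k w).re) q :=
      Complex.continuous_re.continuousAt.comp (continuousAt_const.mul hk.continuousAt)
    have hpos : ∀ᶠ w in 𝓝 (q : ℂ), 0 < ((σ : ℂ) * k w).re := by
      refine hcont.eventually (lt_mem_nhds ?_)
      have e := congrArg Complex.re hkq'
      rw [Complex.ofReal_re] at e
      show 0 < ((σ : ℂ) * k q).re
      rw [e]
      linarith
    filter_upwards [hofr.eventually hpos, hofr.eventually hkw, hreal] with u h1 h2 h3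
    rcases eq_or_ne u q with rfl | hne
    · simp [hφ]
    have hne' : u - q ≠ 0 := sub_ne_zero.2 hne
    -- On the real axis Im g is constant, so the cofactor is real there and the square root
    -- coordinate maps reals to reals.
    have h4 : (k u).im = 0 := by
      have h5 := congrArg Complex.im h2
      have e : ((u : ℂ) - q) ^ (1 + 1) = (((u - q) ^ 2 : ℝ) : ℂ) := by push_cast; ring
      rw [e, Complex.add_im, Complex.im_ofReal_mul, h3] at h5
      have : (u - q) ^ 2 * (k u).im = 0 := by linarith
      exact (mul_eq_zero.1 this).resolve_left (pow_ne_zero 2 hne')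
    have h6 : (σ : ℂ) * k u = ((σ * (k u).re : ℝ) : ℂ) := by
      apply Complex.ext <;> simp [h4]
    rw [h6, Complex.ofReal_re] at h1
    have h7 : φ u = (((u - q) * Real.exp (Real.log (σ * (k u).re) / 2) : ℝ) : ℂ) := by
      simp only [hφ]
      rw [h6, ← Complex.ofReal_log h1.le]
      push_cast
      rfl
    rw [h7, Complex.ofReal_im]
  have hpos' : 0 < (deriv φ q).re := by
    rw [hφ'q, Complex.ofReal_re]
    exact Real.exp_pos _
  refine ⟨φ, deriv φ, ?_, hφa.deriv.continuousAt, hpos', ?_, by simp [hφ], ?_, hφreal,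
    eventually_im_pos hφa.hasStrictDerivAt hpos' hφreal⟩
  · filter_upwards [hφa.eventually_analyticAt] with w hw
    exact hw.hasStrictDerivAt
  · rw [hφ'q, Complex.ofReal_im]
  · filter_upwards [hkw, (continuousAt_const.mul hk.continuousAt).eventually_ne
      (Complex.slitPlane_ne_zero hslit)] with w hw hkw0'
    have hkw0 : (σ : ℂ) * k w ≠ 0 := hkw0'
    rw [hw]
    have : (Complex.exp (Complex.log (σ * k w) / 2)) ^ 2 = σ * k w := by
      rw [← Complex.exp_nat_mul]
      have : ((2 : ℕ) : ℂ) * (Complex.log (σ * k w) / 2) = Complex.log (σ * k w) := by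
        push_cast; ring
      rw [this, Complex.exp_log hkw0]
    simp only [hφ, mul_pow]
    rw [this]
    linear_combination (-(w - q) ^ 2 * k w) * hσ2

/-! ### Real combinations of logarithms with real branch points. -/

/-- The logarithm with its cut along the negative imaginary axis. -/
def lg (w : ℂ) : ℂ := Complex.log (-Complex.I * w) + Real.pi / 2 * Complex.I

theorem neg_I_mul_mem_slitPlane {w : ℂ} (h : 0 ≤ w.im) (h0 : w ≠ 0) :
    -Complex.I * w ∈ Complex.slitPlane := by
  rw [Complex.mem_slitPlane_iff]
  have e1 : (-Complex.I * w).re = w.im := by simp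
  have e2 : (-Complex.I * w).im = -w.re := by simp
  rw [e1, e2]
  rcases h.lt_or_eq with h | h
  · exact Or.inl h
  · right
    intro hre
    exact h0 (Complex.ext (by simpa using hre) (by simpa using h.symm))

/-- With the cut pointing downwards the logarithm is analytic in a neighbourhood of every nonzero
real point, so values on the real axis need no limiting process. -/
theorem analyticAt_lg {w : ℂ} (h : 0 ≤ w.im) (h0 : w ≠ 0) : AnalyticAt ℂ lg w :=
  ((analyticAt_const.mul analyticAt_id).clog (neg_I_mul_mem_slitPlane h h0)).add analyticAt_const

theorem hasDerivAt_lg {w : ℂ} (h : 0 ≤ w.im) (h0 : w ≠ 0) : HasDerivAt lg w⁻¹ w := by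
  have := (((hasDerivAt_id w).const_mul (-Complex.I)).clog
    (neg_I_mul_mem_slitPlane h h0)).add_const (Real.pi / 2 * Complex.I)
  refine this.congr_deriv ?_
  have : Complex.I ≠ 0 := Complex.I_ne_zero
  simp only [id]
  field_simp

theorem exp_lg {w : ℂ} (h0 : w ≠ 0) : Complex.exp (lg w) = w := by
  have : Complex.exp (Real.pi / 2 * Complex.I) = Complex.I := by
    rw [Complex.exp_mul_I]
    have e : ((Real.pi : ℂ) / 2) = ((Real.pi / 2 : ℝ) : ℂ) := by push_cast; rfl
    rw [e, ← Complex.ofReal_cos, ← Complex.ofReal_sin, Real.cos_pi_div_two, Real.sin_pi_div_two]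
    simp
  rw [lg, Complex.exp_add, Complex.exp_log (mul_ne_zero (neg_ne_zero.2 Complex.I_ne_zero) h0), this]
  linear_combination -w * Complex.I_mul_I

theorem lg_re (w : ℂ) : (lg w).re = Real.log ‖w‖ := by
  have : ((Real.pi : ℂ) / 2 * Complex.I).re = 0 := by
    have e : ((Real.pi : ℂ) / 2) = ((Real.pi / 2 : ℝ) : ℂ) := by push_cast; rfl
    rw [e, Complex.re_ofReal_mul]; simp
  rw [lg, Complex.add_re, this, Complex.log_re]
  simp

theorem lg_im (w : ℂ) : (lg w).im = (-Complex.I * w).arg + Real.pi / 2 := by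
  have : ((Real.pi : ℂ) / 2 * Complex.I).im = Real.pi / 2 := by
    have e : ((Real.pi : ℂ) / 2) = ((Real.pi / 2 : ℝ) : ℂ) := by push_cast; rfl
    rw [e, Complex.im_ofReal_mul]; simp
  rw [lg, Complex.add_im, this, Complex.log_im]

theorem lg_ofReal_im_of_pos {u : ℝ} (h : 0 < u) : (lg u).im = 0 := by
  rw [lg_im]
  have : -Complex.I * (u : ℂ) = (u : ℝ) * (-Complex.I) := by ring
  rw [this, Complex.arg_real_mul _ h, Complex.arg_neg_I]
  ring

theorem lg_ofReal_im_of_neg {u : ℝ} (h : u < 0) : (lg u).im = Real.pi := by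
  rw [lg_im]
  have : -Complex.I * (u : ℂ) = ((-u : ℝ) : ℂ) * Complex.I := by push_cast; ring
  rw [this, Complex.arg_real_mul _ (by linarith), Complex.arg_I]
  ring

/-- The indicator of `u < x`. -/
def step (u x : ℝ) : ℝ := if u < x then 1 else 0

theorem step_of_lt {u x : ℝ} (h : u < x) : step u x = 1 := if_pos h

theorem step_of_le {u x : ℝ} (h : x ≤ u) : step u x = 0 := if_neg h.not_gt

section LogSum

variable {ι : Type*} [Fintype ι]

/-- A real linear combination of logarithms with real branch points, normalized to vanish
at `i`. -/
def logSum (x c : ι → ℝ) (w : ℂ) : ℂ :=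
  ∑ j, (c j : ℂ) * lg (w - x j) - ∑ j, (c j : ℂ) * lg (Complex.I - x j)

/-- The derivative of `logSum`. -/
def poleSum (x c : ι → ℝ) (w : ℂ) : ℂ := ∑ j, (c j : ℂ) / (w - x j)

theorem logSum_I (x c : ι → ℝ) : logSum x c Complex.I = 0 := sub_self _

theorem analyticAt_lg_sub {w : ℂ} {x : ℝ} (h : 0 ≤ w.im) (h0 : w ≠ x) :
    AnalyticAt ℂ (fun w => lg (w - x)) w :=
  AnalyticAt.comp (g := lg) (f := fun w => w - (x : ℂ))
    (analyticAt_lg (w := w - x) (by simpa using h) (sub_ne_zero.2 h0))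
    (analyticAt_id.sub analyticAt_const)

theorem analyticAt_logSum {x c : ι → ℝ} {w : ℂ} (h : 0 ≤ w.im) (h0 : ∀ j, w ≠ x j) :
    AnalyticAt ℂ (logSum x c) w := by
  refine AnalyticAt.sub ?_ analyticAt_const
  exact Finset.analyticAt_fun_sum _ fun j _ => analyticAt_const.mul (analyticAt_lg_sub h (h0 j))

theorem hasDerivAt_logSum {x c : ι → ℝ} {w : ℂ} (h : 0 ≤ w.im) (h0 : ∀ j, w ≠ x j) :
    HasDerivAt (logSum x c) (poleSum x c w) w := by
  refine HasDerivAt.sub_const _ (HasDerivAt.fun_sum fun j _ => ?_)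
  have := ((hasDerivAt_lg (w := w - x j) (by simpa using h) (sub_ne_zero.2 (h0 j))).comp w
    ((hasDerivAt_id w).sub_const (x j : ℂ))).const_mul (c j : ℂ)
  refine this.congr_deriv ?_
  rw [mul_one, div_eq_mul_inv]

theorem ne_ofReal_of_im_pos {w : ℂ} (h : 0 < w.im) (x : ℝ) : w ≠ x := by
  rintro rfl
  simp at h

theorem logSum_re (x c : ι → ℝ) (w : ℂ) : (logSum x c w).re =
    ∑ j, c j * Real.log ‖w - x j‖ - ∑ j, c j * Real.log ‖Complex.I - x j‖ := by
  simp [logSum, lg_re]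

theorem logSum_im (x c : ι → ℝ) (w : ℂ) : (logSum x c w).im =
    ∑ j, c j * (lg (w - x j)).im - ∑ j, c j * (lg (Complex.I - x j)).im := by
  simp [logSum]

/-- On the real axis the argument of w − xⱼ is π to the left of xⱼ and 0 to the right. -/
theorem logSum_ofReal_im {x c : ι → ℝ} {u : ℝ} (h0 : ∀ j, u ≠ x j) : (logSum x c u).im =
    Real.pi * ∑ j, c j * step u (x j) - ∑ j, c j * (lg (Complex.I - x j)).im := by
  rw [logSum_im, Finset.mul_sum]
  congr 1
  refine Finset.sum_congr rfl fun j _ => ?_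
  rw [← Complex.ofReal_sub]
  rcases (h0 j).lt_or_gt with h | h
  · rw [lg_ofReal_im_of_neg (by linarith), step_of_lt h]
    ring
  · rw [lg_ofReal_im_of_pos (by linarith), step_of_le h.le]
    ring

/-- On an interval of the real axis without branch points, the imaginary part is constant. -/
theorem logSum_im_eq_of_Icc {x c : ι → ℝ} {u v : ℝ} (huv : u ≤ v) (h : ∀ j, x j ∉ Icc u v) :
    (logSum x c u).im = (logSum x c v).im := by
  rw [logSum_ofReal_im fun j hj => h j (by rw [← hj]; exact left_mem_Icc.2 huv),
    logSum_ofReal_im fun j hj => h j (by rw [← hj]; exact right_mem_Icc.2 huv)]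
  congr 2
  refine Finset.sum_congr rfl fun j _ => ?_
  congr 1
  rcases lt_or_ge v (x j) with h1 | h1
  · rw [step_of_lt h1, step_of_lt (huv.trans_lt h1)]
  · rw [step_of_le h1, step_of_le (not_lt.1 fun h2 => h j ⟨h2.le, h1⟩)]

theorem eventually_logSum_im_eq {x c : ι → ℝ} {q : ℝ} (h0 : ∀ j, q ≠ x j) :
    ∀ᶠ u : ℝ in 𝓝 q, (logSum x c u).im = (logSum x c q).im := by
  have hfin : (range x)ᶜ ∈ 𝓝 q :=
    (finite_range x).isClosed.isOpen_compl.mem_nhds (by rintro ⟨j, hj⟩; exact h0 j hj.symm)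
  obtain ⟨r, hr, hball⟩ := Metric.mem_nhds_iff.1 hfin
  filter_upwards [Metric.ball_mem_nhds q hr] with u hu
  rw [Metric.mem_ball, Real.dist_eq, abs_lt] at hu
  rcases le_total u q with h | h
  · refine logSum_im_eq_of_Icc h fun j hj => hball (a := x j) ?_ ⟨j, rfl⟩
    rw [Metric.mem_ball, Real.dist_eq, abs_lt]
    constructor <;> linarith [hj.1, hj.2]
  · refine (logSum_im_eq_of_Icc h fun j hj => hball (a := x j) ?_ ⟨j, rfl⟩).symm
    rw [Metric.mem_ball, Real.dist_eq, abs_lt]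
    constructor <;> linarith [hj.1, hj.2]

theorem hasDerivAt_logSum_re {x c : ι → ℝ} {u : ℝ} (h0 : ∀ j, u ≠ x j) :
    HasDerivAt (fun u : ℝ => (logSum x c u).re) (poleSum x c u).re u := by
  exact (hasDerivAt_logSum (w := (u : ℂ)) (by simp)
    (fun j h => h0 j (by exact_mod_cast h))).real_of_complex

theorem poleSum_ofReal_im (x c : ι → ℝ) (u : ℝ) : (poleSum x c u).im = 0 := by
  rw [poleSum, Complex.im_sum]
  refine Finset.sum_eq_zero fun j _ => ?_
  have : (c j : ℂ) / ((u : ℂ) - x j) = ((c j / (u - x j) : ℝ) : ℂ) := by push_cast; rfl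
  rw [this, Complex.ofReal_im]

/-- Rolle: the real part takes a value at most once between critical points. -/
theorem exists_critical_of_re_eq {x c : ι → ℝ} {u v : ℝ} (huv : u < v) (h : ∀ j, x j ∉ Icc u v)
    (he : (logSum x c u).re = (logSum x c v).re) : ∃ y ∈ Ioo u v, poleSum x c y = 0 := by
  have hne : ∀ y ∈ Icc u v, ∀ j, y ≠ x j := fun y hy j hj => h j (hj ▸ hy)
  obtain ⟨y, hy, hy0⟩ := exists_hasDerivAt_eq_zero huv
    (fun y hy => (hasDerivAt_logSum_re (c := c) (hne y hy)).continuousAt.continuousWithinAt) he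
    (fun y hy => hasDerivAt_logSum_re (hne y (Ioo_subset_Icc_self hy)))
  exact ⟨y, hy, Complex.ext hy0 (poleSum_ofReal_im x c y)⟩

/-- Each log|w − xⱼ| differs from log|w| by o(1), so the total residue decides. It is what keeps the
curves with Re g ≤ 0 in a bounded region. -/
theorem tendsto_logSum_re_cobounded {x c : ι → ℝ} (hc : 0 < ∑ j, c j) :
    Tendsto (fun w => (logSum x c w).re) (Bornology.cobounded ℂ) atTop := by
  have h1 : ∀ j, Tendsto (fun w : ℂ => Real.log ‖w - x j‖ - Real.log ‖w‖) (Bornology.cobounded ℂ)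
      (𝓝 0) := by
    intro j
    have h2 : Tendsto (fun w : ℂ => 1 - (x j : ℂ) * w⁻¹) (Bornology.cobounded ℂ) (𝓝 1) := by
      have := (tendsto_inv₀_cobounded (α := ℂ)).const_mul (x j : ℂ)
      simpa using this.const_sub 1
    have h3 := ((Real.continuousAt_log (x := 1) one_ne_zero).tendsto.comp
      (by simpa using h2.norm : Tendsto (fun w : ℂ => ‖1 - (x j : ℂ) * w⁻¹‖) _ (𝓝 1)))
    rw [Real.log_one] at h3
    have h4 : ∀ᶠ w : ℂ in Bornology.cobounded ℂ, 1 - (x j : ℂ) * w⁻¹ ≠ 0 :=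
      h2.eventually_ne one_ne_zero
    refine h3.congr' ?_
    filter_upwards [h4, Bornology.eventually_ne_cobounded (0 : ℂ)] with w hw hw0
    have e : w - x j = (1 - (x j : ℂ) * w⁻¹) * w := by field_simp
    simp only [Function.comp]
    rw [e, norm_mul, Real.log_mul (norm_ne_zero_iff.2 hw) (norm_ne_zero_iff.2 hw0)]
    ring
  have h5 : Tendsto (fun w : ℂ => ∑ j, c j * (Real.log ‖w - x j‖ - Real.log ‖w‖)
      - ∑ j, c j * Real.log ‖Complex.I - x j‖) (Bornology.cobounded ℂ)
      (𝓝 (∑ j, c j * 0 - ∑ j, c j * Real.log ‖Complex.I - x j‖)) :=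
    (tendsto_finsetSum _ fun j _ => (h1 j).const_mul (c j)).sub_const _
  have h6 : Tendsto (fun w : ℂ => (∑ j, c j) * Real.log ‖w‖) (Bornology.cobounded ℂ) atTop :=
    (Real.tendsto_log_atTop.comp tendsto_norm_cobounded_atTop).const_mul_atTop hc
  refine (h6.atTop_add h5).congr fun w => ?_
  rw [logSum_re, Finset.sum_mul]
  have : ∑ j, c j * (Real.log ‖w - x j‖ - Real.log ‖w‖)
      = ∑ j, c j * Real.log ‖w - x j‖ - ∑ j, c j * Real.log ‖w‖ := by
    rw [← Finset.sum_sub_distrib]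
    exact Finset.sum_congr rfl fun j _ => by ring
  rw [this]
  ring

variable [DecidableEq ι]

/-- The regular part of `logSum` at a branch point. -/
def logSumRest (x c : ι → ℝ) (j : ι) (w : ℂ) : ℂ :=
  ∑ i ∈ Finset.univ.erase j, (c i : ℂ) * lg (w - x i) - ∑ j, (c j : ℂ) * lg (Complex.I - x j)

theorem logSum_eq_add_rest (x c : ι → ℝ) (j : ι) (w : ℂ) :
    logSum x c w = c j * lg (w - x j) + logSumRest x c j w := by
  rw [logSum, logSumRest, ← Finset.add_sum_erase _ _ (Finset.mem_univ j)]
  ring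

theorem analyticAt_logSumRest {x c : ι → ℝ} (hx : Function.Injective x) (j : ι) :
    AnalyticAt ℂ (logSumRest x c j) (x j) := by
  refine AnalyticAt.sub ?_ analyticAt_const
  refine Finset.analyticAt_fun_sum _ fun i hi => analyticAt_const.mul (analyticAt_lg_sub (by simp) ?_)
  intro h
  exact (Finset.mem_erase.1 hi).1 (hx (by exact_mod_cast h.symm))

/-- Near a branch point `logSum` is injective in the closed upper half-plane. -/
theorem exists_injOn_logSum_branch {x c : ι → ℝ} (hx : Function.Injective x) {j : ι}
    (hc : c j ≠ 0) : ∃ N ∈ 𝓝 (x j : ℂ), InjOn (logSum x c) (N ∩ {w | w ≠ x j}) := by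
  have hc' : (c j : ℂ) ≠ 0 := by exact_mod_cast hc
  have hG := analyticAt_logSumRest (c := c) hx j
  -- The function exp(logSum/cⱼ) continues analytically across xⱼ with a simple zero there, hence is
  -- injective nearby; injectivity of the sum follows.
  have hE : HasStrictDerivAt
      (fun w : ℂ => (w - x j) * Complex.exp (logSumRest x c j w / c j))
      (Complex.exp (logSumRest x c j (x j) / c j)) (x j) := by
    have h1 : AnalyticAt ℂ (fun w => Complex.exp (logSumRest x c j w / c j)) (x j) :=
      (hG.div analyticAt_const hc').cexp'
    have := HasStrictDerivAt.mul ((hasStrictDerivAt_id (x j : ℂ)).sub_const (x j : ℂ))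
      h1.hasStrictDerivAt
    refine this.congr_deriv ?_
    simp
  obtain ⟨N, hN, hinj⟩ := exists_injOn_of_hasStrictDerivAt hE (Complex.exp_ne_zero _)
  refine ⟨N, hN, fun w hw w' hw' he => hinj hw.1 hw'.1 ?_⟩
  have key : ∀ w : ℂ, w ≠ x j → Complex.exp (logSum x c w / c j)
      = (w - x j) * Complex.exp (logSumRest x c j w / c j) := by
    intro w hw
    rw [logSum_eq_add_rest x c j, add_div, Complex.exp_add, mul_div_cancel_left₀ _ hc',
      exp_lg (sub_ne_zero.2 hw)]
  show _ * _ = _ * _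
  rw [← key w hw.2, ← key w' hw'.2, he]

theorem tendsto_log_norm_sub (x : ℝ) :
    Tendsto (fun w : ℂ => Real.log ‖w - x‖) (𝓝[≠] (x : ℂ)) atBot := by
  refine Real.tendsto_log_nhdsGT_zero.comp ?_
  refine tendsto_nhdsWithin_iff.2 ⟨?_, ?_⟩
  · have : Tendsto (fun w : ℂ => ‖w - x‖) (𝓝 (x : ℂ)) (𝓝 ‖(x : ℂ) - x‖) :=
      ((continuous_id.sub continuous_const).norm).tendsto _
    rw [sub_self, norm_zero] at this
    exact this.mono_left nhdsWithin_le_nhds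
  · filter_upwards [self_mem_nhdsWithin] with w hw
    exact norm_pos_iff.2 (sub_ne_zero.2 hw)

theorem tendsto_rest_re {x c : ι → ℝ} (hx : Function.Injective x) (j : ι) :
    Tendsto (fun w => (logSumRest x c j w).re) (𝓝[≠] (x j : ℂ))
      (𝓝 (logSumRest x c j (x j)).re) :=
  ((Complex.continuous_re.tendsto _).comp
    (analyticAt_logSumRest hx j).continuousAt.tendsto).mono_left nhdsWithin_le_nhds

theorem logSum_re_eq_add (x c : ι → ℝ) (j : ι) (w : ℂ) :
    (logSum x c w).re = c j * Real.log ‖w - x j‖ + (logSumRest x c j w).re := by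
  rw [logSum_eq_add_rest x c j, Complex.add_re, Complex.re_ofReal_mul, lg_re]

theorem tendsto_logSum_re_atBot {x c : ι → ℝ} (hx : Function.Injective x) {j : ι} (hc : 0 < c j) :
    Tendsto (fun w => (logSum x c w).re) (𝓝[≠] (x j : ℂ)) atBot := by
  simp_rw [logSum_re_eq_add x c j]
  exact ((tendsto_log_norm_sub (x j)).const_mul_atBot hc).atBot_add (tendsto_rest_re hx j)

theorem tendsto_logSum_re_atTop {x c : ι → ℝ} (hx : Function.Injective x) {j : ι} (hc : c j < 0) :
    Tendsto (fun w => (logSum x c w).re) (𝓝[≠] (x j : ℂ)) atTop := by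
  simp_rw [logSum_re_eq_add x c j]
  exact ((tendsto_log_norm_sub (x j)).const_mul_atBot_of_neg hc).atTop_add (tendsto_rest_re hx j)

end LogSum

/-! ### The uniformization: positions of the poles and factorization of f. -/

/-- Since |x| < √(x² + d), both x + √(x² + d) and x − √(x² + d) increase with x. Thus on either
sheet the preimages of real points keep their order. -/
theorem add_sqrt_lt_add_sqrt {X Y s r d : ℝ} (hd : 0 < d) (hs : 0 < s) (hr : 0 < r)
    (hsX : s ^ 2 = X ^ 2 + d) (hrY : r ^ 2 = Y ^ 2 + d) (h : X < Y) :
    X + s < Y + r ∧ X - s < Y - r := by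
  have h1 : |X| < s := abs_lt_of_sq_lt_sq (by linarith) hs.le
  have h2 : |Y| < r := abs_lt_of_sq_lt_sq (by linarith) hr.le
  rw [abs_lt] at h1 h2
  have h3 : (s - r) * (s + r) = (X - Y) * (X + Y) := by linarith
  constructor
  · by_contra hc
    push Not at hc
    nlinarith
  · by_contra hc
    push Not at hc
    nlinarith

namespace Config

variable {t γ a : ℝ} (C : Config t γ a)

/-- The rational parametrization of the Riemann surface of the square root. -/
def Z (w : ℂ) : ℂ := C.α * (w - w⁻¹) + C.β

/-- The absolute value of the square root at `-z₀`. -/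
def s₃ : ℝ := √((-C.z₀ - C.β) ^ 2 + 4 * C.α ^ 2)

/-- The preimage of `x` on the first sheet, if `s` is the absolute value of the root at `x`. -/
def lo (x s : ℝ) : ℝ := (x - C.β - s) / (2 * C.α)

/-- The preimage of `x` on the second sheet. -/
def hi (x s : ℝ) : ℝ := (x - C.β + s) / (2 * C.α)

/-- `s` is the absolute value of the square root at `x`. -/
def IsRoot (x s : ℝ) : Prop := 0 < s ∧ s ^ 2 = (x - C.β) ^ 2 + 4 * C.α ^ 2

theorem isRoot₀ : C.IsRoot 0 C.s₀ := ⟨C.s₀_pos, by rw [C.s₀_sq]; ring⟩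
theorem isRoot₁ : C.IsRoot (-t) C.s₁ := ⟨C.s₁_pos, by rw [C.s₁_sq]; ring⟩
theorem isRoot₂ : C.IsRoot (-t⁻¹) C.s₂ := ⟨C.s₂_pos, by rw [C.s₂_sq]; ring⟩
theorem isRoot₃ : C.IsRoot (-C.z₀) C.s₃ := by
  have := C.α_pos
  exact ⟨Real.sqrt_pos.2 (by positivity), Real.sq_sqrt (by positivity)⟩

theorem k_pos (C : Config t γ a) : 0 < 1 + γ * a := by
  have := C.γ_pos
  have := C.a_pos
  positivity

variable {C}

namespace IsRoot

variable {x s x' s' : ℝ}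

theorem abs_lt (h : C.IsRoot x s) : |x - C.β| < s := by
  have := C.α_pos
  refine abs_lt_of_sq_lt_sq ?_ h.1.le
  rw [h.2]
  have : 0 < C.α ^ 2 := by positivity
  linarith

theorem lo_neg (h : C.IsRoot x s) : C.lo x s < 0 := by
  have := C.α_pos
  have h1 := (_root_.abs_lt.1 h.abs_lt).2
  exact div_neg_of_neg_of_pos (by linarith) (by linarith)

theorem hi_pos (h : C.IsRoot x s) : 0 < C.hi x s := by
  have := C.α_pos
  have h1 := (_root_.abs_lt.1 h.abs_lt).1
  exact div_pos (by linarith) (by linarith)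

theorem lt (h : C.IsRoot x s) (h' : C.IsRoot x' s') (hx : x < x') :
    C.hi x s < C.hi x' s' ∧ C.lo x s < C.lo x' s' := by
  have := C.α_pos
  obtain ⟨h1, h2⟩ := add_sqrt_lt_add_sqrt (d := 4 * C.α ^ 2) (by positivity) h.1 h'.1 h.2 h'.2
    (by linarith : x - C.β < x' - C.β)
  exact ⟨div_lt_div_of_pos_right h1 (by linarith), div_lt_div_of_pos_right h2 (by linarith)⟩

theorem lo_mul_hi (h : C.IsRoot x s) : C.lo x s * C.hi x s = -1 := by
  have := C.α_pos
  rw [lo, hi]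
  field_simp
  linear_combination -h.2

/-- The preimages of x have product −1 and sum (x − β)/α, which gives the quadratic numerator. -/
theorem Z_sub (h : C.IsRoot x s) {w : ℂ} (hw : w ≠ 0) :
    C.Z w - x = C.α * ((w - C.lo x s) * (w - C.hi x s)) / w := by
  have h1 : ((C.lo x s * C.hi x s : ℝ) : ℂ) = -1 := by rw [h.lo_mul_hi]; simp
  have hα : (C.α : ℂ) ≠ 0 := by exact_mod_cast C.α_pos.ne'
  have h2 : (C.α : ℂ) * (C.lo x s + C.hi x s) = x - C.β := by
    rw [lo, hi]; push_cast; field_simp; ring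
  push_cast at h1
  rw [Z]
  field_simp
  linear_combination w * h2 - C.α * h1

theorem lo_ne (h : C.IsRoot x s) : C.lo x s ≠ 0 := h.lo_neg.ne
theorem Z_lo (h : C.IsRoot x s) : C.Z (C.lo x s) = x := by
  have := h.Z_sub (w := C.lo x s) (by exact_mod_cast h.lo_ne)
  rw [sub_self, zero_mul, mul_zero, zero_div] at this
  exact sub_eq_zero.1 this

theorem Z_eq_iff (h : C.IsRoot x s) {w : ℂ} (hw : w ≠ 0) :
    C.Z w = x ↔ w = C.lo x s ∨ w = C.hi x s := by
  have hα : (C.α : ℂ) ≠ 0 := by exact_mod_cast C.α_pos.ne'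
  rw [← sub_eq_zero, h.Z_sub hw]
  simp [hα, hw, sub_eq_zero]

/-- The two simple poles over a simple pole. -/
theorem pole_pair (h : C.IsRoot x s) (r : ℝ) {w : ℂ} (hw : w ≠ 0) (hlo : w ≠ C.lo x s)
    (hhi : w ≠ C.hi x s) :
    w * ((r : ℂ) / (w - C.lo x s) - r / (w - C.hi x s)) = -(r * s) / (C.Z w - x) := by
  have hα : (C.α : ℂ) ≠ 0 := by exact_mod_cast C.α_pos.ne'
  have h1 : w - C.lo x s ≠ 0 := sub_ne_zero.2 hlo
  have h2 : w - C.hi x s ≠ 0 := sub_ne_zero.2 hhi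
  have h3 : (C.α : ℂ) * (C.lo x s - C.hi x s) = -s := by
    rw [lo, hi]; push_cast; field_simp; ring
  rw [h.Z_sub hw]
  field_simp
  linear_combination r * h3

end IsRoot

variable (C)

/-- The branch points, in increasing order. -/
def pts : Fin 7 → ℝ :=
  ![C.lo (-t⁻¹) C.s₂, C.lo (-t) C.s₁, C.lo 0 C.s₀, 0, C.hi (-t⁻¹) C.s₂, C.hi (-t) C.s₁, C.hi 0 C.s₀]

/-- The residues at the branch points. -/
def res (_ : Config t γ a) : Fin 7 → ℝ :=
  ![γ * a, a, -(a + 1), 1 + γ * a, -(γ * a), -a, a + 1]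

/-- The primitive of `Φ(z) dz` in the uniformizing variable. -/
def g : ℂ → ℂ := logSum C.pts C.res

/-- The derivative of `g`. -/
def f : ℂ → ℂ := poleSum C.pts C.res

/-- The zero of `f` over `-z₀` on the first sheet. -/
def y₁ : ℝ := C.lo (-C.z₀) C.s₃

/-- The zero of `f` over `-z₀` on the second sheet. -/
def y₂ : ℝ := C.hi (-C.z₀) C.s₃

theorem z₀_lt_inv : C.z₀ < t⁻¹ := by
  have h0 := C.t_pos
  have := C.z₀_lt
  rw [lt_inv_comm₀ (by linarith [C.lt_z₀]) h0, lt_inv_comm₀ h0 (by linarith [C.lt_z₀])]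
  have h2 : t * t⁻¹ = 1 := mul_inv_cancel₀ h0.ne'
  by_contra hc
  push Not at hc
  have := mul_le_mul_of_nonneg_left hc h0.le
  linarith

theorem order : C.lo (-t⁻¹) C.s₂ < C.y₁ ∧ C.y₁ < C.lo (-t) C.s₁ ∧ C.lo (-t) C.s₁ < C.lo 0 C.s₀ ∧
    C.lo 0 C.s₀ < 0 ∧ 0 < C.hi (-t⁻¹) C.s₂ ∧ C.hi (-t⁻¹) C.s₂ < C.y₂ ∧ C.y₂ < C.hi (-t) C.s₁ ∧
    C.hi (-t) C.s₁ < C.hi 0 C.s₀ := by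
  have h0 := C.t_pos
  have h1 := C.z₀_lt_inv
  have h2 := C.lt_z₀
  have a1 := C.isRoot₂.lt C.isRoot₃ (by linarith)
  have a2 := C.isRoot₃.lt C.isRoot₁ (by linarith)
  have a3 := C.isRoot₁.lt C.isRoot₀ (by linarith)
  exact ⟨a1.2, a2.2, a3.2, C.isRoot₀.lo_neg, C.isRoot₂.hi_pos, a1.1, a2.1, a3.1⟩

theorem pts_strictMono : StrictMono C.pts := by
  obtain ⟨h1, h2, h3, h4, h5, h6, h7, h8⟩ := C.order
  rw [Fin.strictMono_iff_lt_succ]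
  intro i
  fin_cases i <;> simp [pts] <;> linarith

theorem forall_pts {P : ℝ → Prop} : (∀ j, P (C.pts j)) ↔ P (C.lo (-t⁻¹) C.s₂) ∧ P (C.lo (-t) C.s₁) ∧
    P (C.lo 0 C.s₀) ∧ P 0 ∧ P (C.hi (-t⁻¹) C.s₂) ∧ P (C.hi (-t) C.s₁) ∧ P (C.hi 0 C.s₀) := by
  constructor
  · intro h
    exact ⟨h 0, h 1, h 2, h 3, h 4, h 5, h 6⟩
  · rintro ⟨h0, h1, h2, h3, h4, h5, h6⟩ j
    fin_cases j <;> assumption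

/-- The partial fraction decomposition of `Φ R`. -/
theorem partialFractions {z : ℂ} (hz0 : z ≠ 0) (hz1 : z + t ≠ 0) (hz2 : z + (t : ℂ)⁻¹ ≠ 0) :
    (1 + γ * a) + (a + 1) * C.s₀ / z - a * C.s₁ / (z + t) - γ * a * C.s₂ / (z + (t : ℂ)⁻¹) =
    (1 + γ * a) * (((z - C.β) ^ 2 + 4 * C.α ^ 2) * (z + C.z₀) / (z * (z + t) * (z + (t : ℂ)⁻¹))) := by
  have ht : (t : ℂ) ≠ 0 := by exact_mod_cast C.t_pos.ne'
  have hD : (1 - (t : ℂ) ^ 2) ≠ 0 := by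
    have h0 := C.t_pos
    have h1 := C.t_lt
    have : (1 - t ^ 2 : ℝ) ≠ 0 := by nlinarith
    exact_mod_cast this
  have e0 : (1 + (γ : ℂ) * a) * C.s₀ * C.z₀ = a + 1 := by exact_mod_cast C.res₀
  have e1 : (a : ℂ) = (1 + (γ : ℂ) * a) * C.s₁ * (C.z₀ - t) / (1 - t ^ 2) := by
    rw [eq_div_iff hD]; exact_mod_cast C.res₁.symm
  have e2 : (γ : ℂ) * a = (1 + (γ : ℂ) * a) * C.s₂ * t * (1 - t * C.z₀) / (1 - t ^ 2) := by
    rw [eq_div_iff hD]; exact_mod_cast C.res₂.symm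
  have q0 : (C.s₀ : ℂ) ^ 2 = C.β ^ 2 + 4 * C.α ^ 2 := by exact_mod_cast C.s₀_sq
  have q1 : (C.s₁ : ℂ) ^ 2 = (t + C.β) ^ 2 + 4 * C.α ^ 2 := by exact_mod_cast C.s₁_sq
  have q2 : (C.s₂ : ℂ) ^ 2 = ((t : ℂ)⁻¹ + C.β) ^ 2 + 4 * C.α ^ 2 := by exact_mod_cast C.s₂_sq
  have f0 : ((a : ℂ) + 1) * C.s₀ = (1 + γ * a) * ((C.β ^ 2 + 4 * C.α ^ 2) * C.z₀) := by
    rw [← e0, ← q0]; ring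
  have f1 : (a : ℂ) * C.s₁ = (1 + γ * a) * (((t + C.β) ^ 2 + 4 * C.α ^ 2) * (C.z₀ - t) / (1 - t ^ 2)) := by
    rw [← q1]
    nth_rewrite 1 [e1]
    ring
  have f2 : (γ : ℂ) * a * C.s₂ = (1 + γ * a) *
      ((((t : ℂ)⁻¹ + C.β) ^ 2 + 4 * C.α ^ 2) * t * (1 - t * C.z₀) / (1 - t ^ 2)) := by
    rw [← q2]
    nth_rewrite 1 [e2]
    ring
  rw [f0, f1, f2]
  have hz2' : z * t + 1 ≠ 0 := by
    intro h
    apply hz2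
    field_simp
    rw [h, mul_zero]
  have i2 : z + (t : ℂ)⁻¹ = (z * t + 1) / t := by field_simp
  rw [i2]
  have key : 1 + (C.β ^ 2 + 4 * C.α ^ 2) * C.z₀ / z
      - ((t + C.β) ^ 2 + 4 * C.α ^ 2) * (C.z₀ - t) / (1 - t ^ 2) / (z + t)
      - (((t : ℂ)⁻¹ + C.β) ^ 2 + 4 * C.α ^ 2) * t * (1 - t * C.z₀) / (1 - t ^ 2) / ((z * t + 1) / t)
      = ((z - C.β) ^ 2 + 4 * C.α ^ 2) * (z + C.z₀) / (z * (z + t) * ((z * t + 1) / t)) := by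
    field_simp
    ring
  linear_combination (1 + (γ : ℂ) * a) * key

theorem poleSum_pts (w : ℂ) : C.f w = (γ * a : ℝ) / (w - C.lo (-t⁻¹) C.s₂) + a / (w - C.lo (-t) C.s₁)
    + (-(a + 1) : ℝ) / (w - C.lo 0 C.s₀) + (1 + γ * a : ℝ) / w + (-(γ * a) : ℝ) / (w - C.hi (-t⁻¹) C.s₂)
    + (-a : ℝ) / (w - C.hi (-t) C.s₁) + (a + 1 : ℝ) / (w - C.hi 0 C.s₀) := by
  simp only [f, poleSum, Fin.sum_univ_succ, pts, res]
  simp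
  ring

theorem Z_ne {w : ℂ} (hw : ∀ j, w ≠ C.pts j) :
    w ≠ 0 ∧ C.Z w ≠ 0 ∧ C.Z w + t ≠ 0 ∧ C.Z w + (t : ℂ)⁻¹ ≠ 0 := by
  obtain ⟨h0, h1, h2, h3, h4, h5, h6⟩ := (C.forall_pts (P := fun x => w ≠ (x : ℂ))).1 hw
  have hw0 : w ≠ 0 := by simpa using h3
  refine ⟨hw0, ?_, ?_, ?_⟩
  · have := (C.isRoot₀.Z_eq_iff hw0).not.2 (by tauto)
    simpa using this
  · have := (C.isRoot₁.Z_eq_iff hw0).not.2 (by tauto)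
    intro h
    exact this (by push_cast; linear_combination h)
  · have := (C.isRoot₂.Z_eq_iff hw0).not.2 (by tauto)
    intro h
    exact this (by push_cast; linear_combination h)

/-- Because dz = X dw/w, the pullback of Φ dz is f dw precisely when w·f equals X² times the
rational factor of Φ. The two points over each finite pole carry opposite residues, and w = 0, over
infinity, carries 1 + γa. -/
theorem mul_f_eq {w : ℂ} (hw : ∀ j, w ≠ C.pts j) :
    w * C.f w = (1 + γ * a) * (((C.Z w - C.β) ^ 2 + 4 * C.α ^ 2) * (C.Z w + C.z₀) /
      (C.Z w * (C.Z w + t) * (C.Z w + (t : ℂ)⁻¹))) := by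
  obtain ⟨hw0, z0, z1, z2⟩ := C.Z_ne hw
  obtain ⟨h0, h1, h2, h3, h4, h5, h6⟩ := (C.forall_pts (P := fun x => w ≠ (x : ℂ))).1 hw
  rw [← C.partialFractions z0 z1 z2, C.poleSum_pts]
  have p0 := C.isRoot₀.pole_pair (-(a + 1)) hw0 h2 h6
  have p1 := C.isRoot₁.pole_pair a hw0 h1 h5
  have p2 := C.isRoot₂.pole_pair (γ * a) hw0 h0 h4
  push_cast at p0 p1 p2 ⊢
  rw [sub_zero] at p0
  rw [sub_neg_eq_add] at p1 p2
  have p3 : w * ((1 + (γ : ℂ) * a) / w) = 1 + γ * a := by field_simp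
  linear_combination p0 + p1 + p2 + p3

theorem Z_sq (w : ℂ) (hw : w ≠ 0) :
    (C.Z w - C.β) ^ 2 + 4 * C.α ^ 2 = (C.α * (w + w⁻¹)) ^ 2 := by
  rw [Z]
  field_simp
  ring

/-- The factor of `f` that does not vanish at `i`. -/
def den (w : ℂ) : ℂ :=
  w * ((w - C.lo 0 C.s₀) * (w - C.hi 0 C.s₀) * ((w - C.lo (-t) C.s₁) * (w - C.hi (-t) C.s₁)) *
    ((w - C.lo (-t⁻¹) C.s₂) * (w - C.hi (-t⁻¹) C.s₂)))

theorem den_ne {w : ℂ} (hw : ∀ j, w ≠ C.pts j) : C.den w ≠ 0 := by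
  obtain ⟨h0, h1, h2, h3, h4, h5, h6⟩ := (C.forall_pts (P := fun x => w ≠ (x : ℂ))).1 hw
  rw [den]
  simp only [ne_eq, mul_eq_zero, sub_eq_zero]
  have : w ≠ 0 := by simpa using h3
  tauto

/-- The factor (w² + 1)² comes from X²: one factor w² + 1 from R itself, one from dz. This double
zero at i is what makes g a cube there. -/
theorem f_eq {w : ℂ} (hw : ∀ j, w ≠ C.pts j) :
    C.f w = (1 + γ * a) * ((w ^ 2 + 1) ^ 2 * ((w - C.y₁) * (w - C.y₂))) / C.den w := by
  obtain ⟨hw0, z0, z1, z2⟩ := C.Z_ne hw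
  obtain ⟨h0, h1, h2, h3, h4, h5, h6⟩ := (C.forall_pts (P := fun x => w ≠ (x : ℂ))).1 hw
  have hα : (C.α : ℂ) ≠ 0 := by exact_mod_cast C.α_pos.ne'
  have e0 := C.isRoot₀.Z_sub hw0
  have e1 := C.isRoot₁.Z_sub hw0
  have e2 := C.isRoot₂.Z_sub hw0
  have e3 := C.isRoot₃.Z_sub hw0
  push_cast at e0 e1 e2 e3
  rw [sub_zero] at e0
  rw [sub_neg_eq_add] at e1 e2 e3
  have := C.mul_f_eq hw
  rw [C.Z_sq w hw0, e1, e2, e3, e0] at this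
  refine mul_left_cancel₀ hw0 ?_
  rw [this, den, y₁, y₂]
  have := sub_ne_zero.2 h0
  have := sub_ne_zero.2 h1
  have := sub_ne_zero.2 h2
  have := sub_ne_zero.2 h4
  have := sub_ne_zero.2 h5
  have := sub_ne_zero.2 h6
  field_simp

end Config

/-! ### The primitive g: derivative, boundary values, sheet symmetry. -/

namespace Config

variable {t γ a : ℝ} (C : Config t γ a)

theorem ne_pts_of_im_pos {w : ℂ} (hw : 0 < w.im) (j : Fin 7) : w ≠ C.pts j :=
  ne_ofReal_of_im_pos hw _

theorem analyticAt_g {w : ℂ} (h : 0 ≤ w.im) (h0 : ∀ j, w ≠ C.pts j) : AnalyticAt ℂ C.g w :=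
  analyticAt_logSum h h0

theorem hasDerivAt_g {w : ℂ} (h : 0 ≤ w.im) (h0 : ∀ j, w ≠ C.pts j) :
    HasDerivAt C.g (C.f w) w := hasDerivAt_logSum h h0

theorem hasStrictDerivAt_g {w : ℂ} (h : 0 ≤ w.im) (h0 : ∀ j, w ≠ C.pts j) :
    HasStrictDerivAt C.g (C.f w) w := by
  rw [← (C.hasDerivAt_g h h0).deriv]
  exact (C.analyticAt_g h h0).hasStrictDerivAt

theorem eventually_ne_pts {w : ℂ} (h0 : ∀ j, w ≠ C.pts j) : ∀ᶠ v : ℂ in 𝓝 w, ∀ j, v ≠ C.pts j :=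
  Filter.eventually_all.2 fun j => isOpen_ne.mem_nhds (h0 j)

theorem continuousAt_f {w : ℂ} (h0 : ∀ j, w ≠ C.pts j) : ContinuousAt C.f w := by
  have : ContinuousAt (fun v : ℂ => ∑ j, (C.res j : ℂ) / (v - C.pts j)) w :=
    tendsto_finsetSum _ fun j _ => ContinuousAt.div continuousAt_const
      (continuousAt_id.sub continuousAt_const) (sub_ne_zero.2 (h0 j))
  exact this

/-- `g` extends analytically across the real axis with derivative `f`. -/
theorem eventually_deriv_g {w : ℂ} (h : 0 ≤ w.im) (h0 : ∀ j, w ≠ C.pts j) :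
    ∀ᶠ v in 𝓝 w, HasDerivAt C.g (C.f v) v := by
  have hslit : ∀ j, ∀ᶠ v in 𝓝 w, -Complex.I * (v - C.pts j) ∈ Complex.slitPlane := by
    intro j
    have hc : ContinuousAt (fun v : ℂ => -Complex.I * (v - C.pts j)) w := by fun_prop
    exact hc.eventually (Complex.isOpen_slitPlane.mem_nhds
      (neg_I_mul_mem_slitPlane (by simpa using h) (sub_ne_zero.2 (h0 j))))
  filter_upwards [Filter.eventually_all.2 hslit, C.eventually_ne_pts h0] with v hv hv0
  refine HasDerivAt.sub_const _ (HasDerivAt.fun_sum fun j _ => ?_)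
  have := (((((hasDerivAt_id v).sub_const (C.pts j : ℂ)).const_mul (-Complex.I)).clog
    (hv j)).add_const (Real.pi / 2 * Complex.I)).const_mul (C.res j : ℂ)
  refine this.congr_deriv ?_
  have := Complex.I_ne_zero
  have := sub_ne_zero.2 (hv0 j)
  simp only [id]
  field_simp

theorem sq_add_one_ne {w : ℂ} (h : 0 ≤ w.im) (hI : w ≠ Complex.I) : w ^ 2 + 1 ≠ 0 := by
  have : w ^ 2 + 1 = (w - Complex.I) * (w + Complex.I) := by
    linear_combination Complex.I_mul_I
  rw [this]
  refine mul_ne_zero (sub_ne_zero.2 hI) fun h1 => ?_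
  have := congrArg Complex.im h1
  simp at this
  linarith

theorem f_ne_zero {w : ℂ} (h : 0 ≤ w.im) (h0 : ∀ j, w ≠ C.pts j) (hI : w ≠ Complex.I)
    (h1 : w ≠ C.y₁) (h2 : w ≠ C.y₂) : C.f w ≠ 0 := by
  rw [C.f_eq h0]
  have hk : (1 + (γ : ℂ) * a) ≠ 0 := by exact_mod_cast C.k_pos.ne'
  exact div_ne_zero (mul_ne_zero hk (mul_ne_zero (pow_ne_zero _ (sq_add_one_ne h hI))
    (mul_ne_zero (sub_ne_zero.2 h1) (sub_ne_zero.2 h2)))) (C.den_ne h0)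

theorem g_I : C.g Complex.I = 0 := logSum_I _ _

/-- In the open half-plane the only zero of f is i, and g vanishes there; away from the zeros of g
nothing obstructs local inversion. -/
theorem locBihol_g : LocBihol C.g where
  cont w hw := (C.analyticAt_g hw.le (C.ne_pts_of_im_pos hw)).continuousAt
  deriv w hw h0 := by
    refine ⟨C.f w, C.f_ne_zero hw.le (C.ne_pts_of_im_pos hw) ?_ (ne_ofReal_of_im_pos hw _)
      (ne_ofReal_of_im_pos hw _), C.hasStrictDerivAt_g hw.le (C.ne_pts_of_im_pos hw)⟩
    rintro rfl
    exact h0 C.g_I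

/-- The cofactor of the double zero of `f` at `i`. -/
def cofI (w : ℂ) : ℂ :=
  (1 + γ * a) * ((w + Complex.I) ^ 2 * ((w - C.y₁) * (w - C.y₂))) / C.den w

theorem analyticAt_den (w : ℂ) : AnalyticAt ℂ C.den w := by
  unfold den
  fun_prop

theorem analyticAt_cofI : AnalyticAt ℂ C.cofI Complex.I := by
  refine AnalyticAt.div ?_ (C.analyticAt_den _) (C.den_ne (C.ne_pts_of_im_pos (by simp)))
  fun_prop

theorem cofI_ne : C.cofI Complex.I ≠ 0 := by
  have hk : (1 + (γ : ℂ) * a) ≠ 0 := by exact_mod_cast C.k_pos.ne'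
  have hi : 0 < Complex.I.im := by simp
  refine div_ne_zero (mul_ne_zero hk (mul_ne_zero (pow_ne_zero _ ?_)
    (mul_ne_zero (sub_ne_zero.2 (ne_ofReal_of_im_pos hi _))
      (sub_ne_zero.2 (ne_ofReal_of_im_pos hi _))))) (C.den_ne (C.ne_pts_of_im_pos hi))
  intro h
  have := congrArg Complex.im h
  simp at this

theorem deriv_g_near_I :
    ∀ᶠ w in 𝓝 Complex.I, deriv C.g w = (w - Complex.I) ^ 2 * C.cofI w := by
  have hi : (0:ℝ) < Complex.I.im := by simp
  filter_upwards [(isOpen_lt continuous_const Complex.continuous_im).mem_nhds hi] with w hw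
  have hw' : 0 < w.im := hw
  rw [(C.hasDerivAt_g hw'.le (C.ne_pts_of_im_pos hw')).deriv, C.f_eq (C.ne_pts_of_im_pos hw'), cofI]
  have : w ^ 2 + 1 = (w - Complex.I) * (w + Complex.I) := by
    linear_combination Complex.I_mul_I
  rw [this]
  ring

theorem lg_im_one_add (u : ℝ) : (lg (Complex.I - u)).im = Real.arctan u + Real.pi / 2 := by
  rw [lg_im]
  congr 1
  have e : -Complex.I * (Complex.I - u) = 1 + u * Complex.I := by
    linear_combination -Complex.I_mul_I
  rw [e]
  have hre : (1 + (u : ℂ) * Complex.I).re = 1 := by simp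
  have him : (1 + (u : ℂ) * Complex.I).im = u := by simp
  rw [Complex.arg_of_re_nonneg (by rw [hre]; norm_num), him, Real.arctan_eq_arcsin]
  congr 2
  rw [Complex.norm_def, Complex.normSq_apply, hre, him]
  congr 1
  ring

/-- The product of the two preimages is −1, so their arctangents differ by π/2. -/
theorem lg_im_hi {x s : ℝ} (h : C.IsRoot x s) :
    (lg (Complex.I - C.hi x s)).im = (lg (Complex.I - C.lo x s)).im + Real.pi / 2 := by
  rw [lg_im_one_add, lg_im_one_add]
  have h1 : C.hi x s = (-C.lo x s)⁻¹ := by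
    refine eq_inv_of_mul_eq_one_left ?_
    linarith [h.lo_mul_hi]
  rw [h1, Real.arctan_inv_of_pos (by linarith [h.lo_neg]), Real.arctan_neg]
  ring

/-- Paired poles have opposite residues, so the unknown arctangents cancel and only multiples of π/2
remain. This is the normalization g(i) = 0 expressed through the boundary values of Im g. -/
theorem logSum_const_im : ∑ j, C.res j * (lg (Complex.I - C.pts j)).im = Real.pi := by
  have h0 := C.lg_im_hi C.isRoot₀
  have h1 := C.lg_im_hi C.isRoot₁
  have h2 := C.lg_im_hi C.isRoot₂
  have h3 : (lg (Complex.I - ((0 : ℝ) : ℂ))).im = Real.pi / 2 := by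
    rw [lg_im_one_add, Real.arctan_zero, zero_add]
  simp only [Fin.sum_univ_succ, pts, res]
  simp only [Matrix.cons_val_zero, Matrix.cons_val_succ, Fin.succ_zero_eq_one, Matrix.cons_val_one,
    Finset.univ_eq_empty, Finset.sum_empty]
  rw [h0, h1, h2, h3]
  ring

theorem g_ofReal_im {u : ℝ} (hu : ∀ j, u ≠ C.pts j) : (C.g u).im = Real.pi *
    (γ * a * step u (C.lo (-t⁻¹) C.s₂) + a * step u (C.lo (-t) C.s₁) + -(a + 1) * step u (C.lo 0 C.s₀)
    + (1 + γ * a) * step u 0 + -(γ * a) * step u (C.hi (-t⁻¹) C.s₂) + -a * step u (C.hi (-t) C.s₁)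
    + (a + 1) * step u (C.hi 0 C.s₀) - 1) := by
  rw [g, logSum_ofReal_im hu, C.logSum_const_im]
  simp only [Fin.sum_univ_succ, pts, res]
  simp only [Matrix.cons_val_zero, Matrix.cons_val_succ, Fin.succ_zero_eq_one, Matrix.cons_val_one,
    Finset.univ_eq_empty, Finset.sum_empty]
  ring

/-- From left to right, on the eight intervals cut out by the branch points, Im g/π equals γa, 0,
−a, 1, −γa, 0, a, −1. -/
theorem mem_of_im_pos {u : ℝ} (hu : ∀ j, u ≠ C.pts j) (h : 0 < (C.g u).im) :
    u < C.lo (-t⁻¹) C.s₂ ∨ u ∈ Ioo (C.lo 0 C.s₀) 0 ∨ u ∈ Ioo (C.hi (-t) C.s₁) (C.hi 0 C.s₀) := by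
  obtain ⟨n0, n1, n2, n3, n4, n5, n6⟩ := C.forall_pts.1 hu
  obtain ⟨h1, h2, h3, h4, h5, h6, h7, h8⟩ := C.order
  have hγ := C.γ_pos
  have ha := C.a_pos
  have hga : 0 < γ * a := by positivity
  rw [C.g_ofReal_im hu] at h
  have h := (mul_pos_iff_of_pos_left Real.pi_pos).1 h
  simp only [mem_Ioo]
  rcases n0.lt_or_gt with c0 | c0
  · exact Or.inl c0
  rcases n3.lt_or_gt with c3 | c3
  · rcases n2.lt_or_gt with c2 | c2
    · exfalso
      rcases n1.lt_or_gt with c1 | c1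
      · rw [step_of_le (x := C.lo (-t⁻¹) C.s₂) (by linarith),
          step_of_lt (x := C.lo (-t) C.s₁) (by linarith),
          step_of_lt (x := C.lo 0 C.s₀) (by linarith),
          step_of_lt (x := 0) (by linarith),
          step_of_lt (x := C.hi (-t⁻¹) C.s₂) (by linarith),
          step_of_lt (x := C.hi (-t) C.s₁) (by linarith),
          step_of_lt (x := C.hi 0 C.s₀) (by linarith)] at h
        linarith
      · rw [step_of_le (x := C.lo (-t⁻¹) C.s₂) (by linarith),
          step_of_le (x := C.lo (-t) C.s₁) (by linarith),
          step_of_lt (x := C.lo 0 C.s₀) (by linarith),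
          step_of_lt (x := 0) (by linarith),
          step_of_lt (x := C.hi (-t⁻¹) C.s₂) (by linarith),
          step_of_lt (x := C.hi (-t) C.s₁) (by linarith),
          step_of_lt (x := C.hi 0 C.s₀) (by linarith)] at h
        linarith
    · exact Or.inr (Or.inl ⟨c2, c3⟩)
  rcases n5.lt_or_gt with c5 | c5
  · exfalso
    rcases n4.lt_or_gt with c4 | c4
    · rw [step_of_le (x := C.lo (-t⁻¹) C.s₂) (by linarith),
        step_of_le (x := C.lo (-t) C.s₁) (by linarith),
        step_of_le (x := C.lo 0 C.s₀) (by linarith),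
        step_of_le (x := 0) (by linarith),
        step_of_lt (x := C.hi (-t⁻¹) C.s₂) (by linarith),
        step_of_lt (x := C.hi (-t) C.s₁) (by linarith),
        step_of_lt (x := C.hi 0 C.s₀) (by linarith)] at h
      linarith
    · rw [step_of_le (x := C.lo (-t⁻¹) C.s₂) (by linarith),
        step_of_le (x := C.lo (-t) C.s₁) (by linarith),
        step_of_le (x := C.lo 0 C.s₀) (by linarith),
        step_of_le (x := 0) (by linarith),
        step_of_le (x := C.hi (-t⁻¹) C.s₂) (by linarith),
        step_of_lt (x := C.hi (-t) C.s₁) (by linarith),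
        step_of_lt (x := C.hi 0 C.s₀) (by linarith)] at h
      linarith
  rcases n6.lt_or_gt with c6 | c6
  · exact Or.inr (Or.inr ⟨c5, c6⟩)
  exfalso
  rw [step_of_le (x := C.lo (-t⁻¹) C.s₂) (by linarith),
      step_of_le (x := C.lo (-t) C.s₁) (by linarith),
      step_of_le (x := C.lo 0 C.s₀) (by linarith),
      step_of_le (x := 0) (by linarith),
      step_of_le (x := C.hi (-t⁻¹) C.s₂) (by linarith),
      step_of_le (x := C.hi (-t) C.s₁) (by linarith),
      step_of_le (x := C.hi 0 C.s₀) (by linarith)] at h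
  linarith

theorem g_im_eq_zero_of_mem {u : ℝ} (h : u ∈ Ioo (C.lo (-t⁻¹) C.s₂) (C.lo (-t) C.s₁)) :
    (C.g u).im = 0 := by
  obtain ⟨h1, h2, h3, h4, h5, h6, h7, h8⟩ := C.order
  obtain ⟨c0, c1⟩ := h
  rw [C.g_ofReal_im (C.forall_pts.2 ⟨by linarith, by linarith, by linarith, by linarith,
    by linarith, by linarith, by linarith⟩)]
  rw [step_of_le (x := C.lo (-t⁻¹) C.s₂) (by linarith),
      step_of_lt (x := C.lo (-t) C.s₁) (by linarith),
      step_of_lt (x := C.lo 0 C.s₀) (by linarith),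
      step_of_lt (x := 0) (by linarith),
      step_of_lt (x := C.hi (-t⁻¹) C.s₂) (by linarith),
      step_of_lt (x := C.hi (-t) C.s₁) (by linarith),
      step_of_lt (x := C.hi 0 C.s₀) (by linarith)]
  ring

theorem neg_inv_im_pos {w : ℂ} (hw : 0 < w.im) : 0 < (-w⁻¹).im := by
  have h0 : w ≠ 0 := by rintro rfl; simp at hw
  rw [Complex.neg_im, Complex.inv_im, neg_div, neg_neg]
  exact div_pos hw (Complex.normSq_pos.2 h0)

theorem Z_neg_inv (w : ℂ) : C.Z (-w⁻¹) = C.Z w := by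
  rw [Z, Z, inv_neg, inv_inv]
  ring

/-- The sheet exchange reverses the sign of `g`. -/
theorem g_neg_inv {w : ℂ} (hw : 0 < w.im) : C.g (-w⁻¹) = -C.g w := by
  have hopen : IsOpen {w : ℂ | 0 < w.im} := isOpen_lt continuous_const Complex.continuous_im
  have hpre : IsPreconnected {w : ℂ | 0 < w.im} := (convex_halfSpace_im_gt 0).isPreconnected
  have hd : ∀ v ∈ {w : ℂ | 0 < w.im}, HasDerivAt (fun w => C.g (-w⁻¹) + C.g w) 0 v := by
    intro v hv
    have hv' : 0 < v.im := hv
    have hn := neg_inv_im_pos hv'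
    have h0 : v ≠ 0 := by rintro rfl; simp at hv'
    have h1 := (C.hasDerivAt_g hn.le (C.ne_pts_of_im_pos hn)).comp v (hasDerivAt_inv h0).neg
    have h2 := h1.add (C.hasDerivAt_g hv'.le (C.ne_pts_of_im_pos hv'))
    refine h2.congr_deriv ?_
    -- The product w·f(w) depends on Z(w) only, and Z is invariant under w ↦ −1/w; therefore g(−1/w)
    -- + g(w) has zero derivative. Its constant value is 0, since i is a fixed point and g(i) = 0.
    have e1 := C.mul_f_eq (C.ne_pts_of_im_pos hn)
    have e2 := C.mul_f_eq (C.ne_pts_of_im_pos hv')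
    rw [C.Z_neg_inv, ← e2] at e1
    field_simp at e1 ⊢
    linear_combination -e1
  have hc := hopen.is_const_of_deriv_eq_zero hpre
    (fun v hv => (hd v hv).differentiableAt.differentiableWithinAt)
    (fun v hv => (hd v hv).deriv) (x := w) (y := Complex.I) hw (by simp)
  simp only [Complex.inv_I, neg_neg, C.g_I, add_zero] at hc
  linear_combination hc

end Config

/-! ### The critical trajectory from i over the positive imaginary ray. -/

/-- Two lifts that end at a point near which `g` is injective in the half-plane coincide. -/
theorem IsLift.eqOn_of_tendsto {g : ℂ → ℂ} {δ q : ℂ} {J : Set ℝ} {W W' : ℝ → ℂ} {l : Filter ℝ}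
    [l.NeBot] (hg : LocBihol g) (hδ : δ ≠ 0) (h : IsLift g δ J W) (h' : IsLift g δ J W')
    (hJo : IsOpen J) (hJ : IsPreconnected J) (hpos : J ⊆ Ioi 0) (hJl : J ∈ l) {N : Set ℂ}
    (hN : N ∈ 𝓝 q) (hinj : InjOn g (N ∩ {w | 0 < w.im})) (ht : Tendsto W l (𝓝 q))
    (ht' : Tendsto W' l (𝓝 q)) : EqOn W W' J := by
  have e1 : ∀ᶠ τ in l, W τ ∈ N := ht hN
  have e2 : ∀ᶠ τ in l, W' τ ∈ N := ht' hN
  have e3 : ∀ᶠ τ in l, τ ∈ J := hJl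
  obtain ⟨τ, h1, h2, h3⟩ := (e1.and (e2.and e3)).exists
  refine h.eqOn hg hδ h' hJo hJ hpos h3 (hinj ⟨h1, h.im_pos τ h3⟩ ⟨h2, h'.im_pos τ h3⟩ ?_)
  rw [h.eq τ h3, h'.eq τ h3]

theorem im_nonneg_of_mapClusterPt {l : Filter ℝ} {W : ℝ → ℂ} {q : ℂ}
    (h : MapClusterPt q l W) (hW : ∀ᶠ τ in l, 0 < (W τ).im) : 0 ≤ q.im := by
  by_contra hneg
  push Not at hneg
  have := ((mapClusterPt_iff_frequently.1 h) _
    ((isOpen_lt Complex.continuous_im continuous_const).mem_nhds hneg)).and_eventually hW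
  obtain ⟨τ, h1, h2⟩ := this.exists
  exact lt_asymm h1 h2

theorem tendsto_small_preconnected_left {T : ℝ} (hT : 0 < T) {W : ℝ → ℂ}
    (hW : ContinuousOn W (Ioo 0 T)) :
    ∀ S ∈ 𝓝[<] T, ∃ S' ∈ 𝓝[<] T, S' ⊆ S ∧ IsPreconnected (W '' S') := by
  intro S hS
  obtain ⟨l, hl, hlS⟩ := (mem_nhdsLT_iff_exists_Ioo_subset' hT).1 hS
  have hl' : l < T := hl
  refine ⟨Ioo (max 0 l) T, Ioo_mem_nhdsLT (max_lt hT hl'),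
    (Ioo_subset_Ioo_left (le_max_right _ _)).trans hlS, ?_⟩
  exact isPreconnected_Ioo.image _ (hW.mono (Ioo_subset_Ioo_left (le_max_left _ _)))

theorem tendsto_small_preconnected_atTop {W : ℝ → ℂ} (hW : ContinuousOn W (Ioi 0)) :
    ∀ S ∈ (atTop : Filter ℝ), ∃ S' ∈ (atTop : Filter ℝ), S' ⊆ S ∧ IsPreconnected (W '' S') := by
  intro S hS
  obtain ⟨b, hb⟩ := mem_atTop_sets.1 hS
  refine ⟨Ioi (max 0 b), Ioi_mem_atTop _, fun x hx => hb x (le_of_lt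
    (lt_of_le_of_lt (le_max_right _ _) hx)), ?_⟩
  exact isPreconnected_Ioi.image _ (hW.mono (Ioi_subset_Ioi (le_max_left _ _)))

/-- Arguments are bounded. Hence a lift of the positive imaginary ray cannot exist for all times. -/
theorem exists_bound_logSum_im {ι : Type*} [Fintype ι] (x c : ι → ℝ) :
    ∃ B, ∀ w, (logSum x c w).im ≤ B := by
  refine ⟨∑ j, |c j| * (2 * Real.pi) - ∑ j, c j * (lg (Complex.I - x j)).im, fun w => ?_⟩
  rw [logSum_im]
  refine sub_le_sub_right (Finset.sum_le_sum fun j _ => ?_) _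
  refine (le_abs_self _).trans ?_
  rw [abs_mul]
  refine mul_le_mul_of_nonneg_left ?_ (abs_nonneg _)
  rw [lg_im]
  refine (abs_add_le _ _).trans ?_
  rw [abs_of_pos Real.pi_div_two_pos]
  linarith [Complex.abs_arg_le_pi (-Complex.I * (w - x j)), Real.pi_pos]

namespace Config

variable {t γ a : ℝ} (C : Config t γ a)

theorem res_sum : ∑ j, C.res j = 1 + γ * a := by
  simp only [Fin.sum_univ_succ, res]
  simp
  ring

theorem res_ne (j : Fin 7) : C.res j ≠ 0 := by
  have h1 := C.a_pos
  have h2 := C.γ_pos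
  have h3 : 0 < γ * a := by positivity
  fin_cases j <;> simp [res] <;> first | positivity | (constructor <;> positivity) | linarith

theorem eventually_lt_abs_re (B : ℝ) (j : Fin 7) :
    ∀ᶠ w in 𝓝[≠] (C.pts j : ℂ), B < |(C.g w).re| := by
  rcases (C.res_ne j).lt_or_gt with h | h
  · filter_upwards [(tendsto_logSum_re_atTop C.pts_strictMono.injective h).eventually_gt_atTop B]
      with w hw using hw.trans_le (le_abs_self _)
  · filter_upwards [(tendsto_logSum_re_atBot C.pts_strictMono.injective h).eventually_lt_atBot (-B)]
      with w hw
    have hw' : (C.g w).re < -B := hw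
    linarith [neg_le_abs (C.g w).re]

theorem exists_radius : ∃ r : ℝ, ∀ w : ℂ, (C.g w).re ≤ 0 → w ∈ Metric.closedBall (0 : ℂ) r := by
  have h := (tendsto_logSum_re_cobounded (x := C.pts) (c := C.res)
    (by rw [C.res_sum]; exact C.k_pos)).eventually_gt_atTop 0
  obtain ⟨r, hr⟩ := (Metric.hasBasis_cobounded_compl_closedBall (0 : ℂ)).eventually_iff.1 h
  refine ⟨r, fun w hw => ?_⟩
  by_contra hc
  have : 0 < (C.g w).re := hr.2 hc
  linarith

/-- A lift over a bounded real range accumulates only at real regular points. -/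
theorem exists_real_of_mapClusterPt {δ : ℂ} {T : ℝ} {W : ℝ → ℂ} {q : ℂ} (hT : 0 < T)
    (hW : IsLift C.g δ (Ioo 0 T) W) (hmax : ∀ q : ℂ, 0 < q.im → ¬ MapClusterPt q (𝓝[<] T) W)
    (hq : MapClusterPt q (𝓝[<] T) W) :
    ∃ u : ℝ, q = u ∧ (∀ j, u ≠ C.pts j) ∧ C.g u = δ * T := by
  have hJ : Ioo 0 T ∈ 𝓝[<] T := Ioo_mem_nhdsLT hT
  have him := im_nonneg_of_mapClusterPt hq (by filter_upwards [hJ] with τ hτ using hW.im_pos τ hτ)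
  have him0 : q.im = 0 := le_antisymm (not_lt.1 fun h => hmax q h hq) him
  obtain ⟨u, rfl⟩ : ∃ u : ℝ, q = u := ⟨q.re, Complex.ext (by simp) (by simpa using him0)⟩
  have hlim : Tendsto (C.g ∘ W) (𝓝[<] T) (𝓝 (δ * T)) := by
    refine ((tendsto_mul_ofReal δ T).mono_left nhdsWithin_le_nhds).congr' ?_
    filter_upwards [hJ] with τ hτ
    exact (hW.eq τ hτ).symm
  -- At a pole |Re g| tends to infinity, while along the lift g converges to the finite value δT.
  have hne : ∀ j, u ≠ C.pts j := by
    rintro j rfl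
    have h1 := eventually_nhdsWithin_iff.1 (C.eventually_lt_abs_re (|(δ * T).re| + 1) j)
    have h2 : ∀ᶠ τ in 𝓝[<] T, |((C.g ∘ W) τ).re| < |(δ * T).re| + 1 :=
      ((continuous_abs.comp Complex.continuous_re).tendsto _ |>.comp hlim).eventually
        (gt_mem_nhds (by simp))
    have h2' : ∀ᶠ τ in 𝓝[<] T, τ ∈ Ioo 0 T := hJ
    obtain ⟨τ, h3, h4, h5⟩ := ((hq.frequently h1).and_eventually (h2.and h2')).exists
    exact lt_asymm h4 (h3 (ne_ofReal_of_im_pos (hW.im_pos τ h5) _))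
  refine ⟨u, rfl, hne, ?_⟩
  have hc : ContinuousAt C.g u :=
    (C.analyticAt_g (by simp) fun j h => hne j (by exact_mod_cast h)).continuousAt
  exact (hq.continuousAt_comp hc).eq_of_tendsto hlim

/-- Two zeros of Re g without a pole in between force a real zero of f by Rolle, and the only real
zeros of f are y₁ and y₂. -/
theorem not_lt_of_re_eq_zero {u v : ℝ} (huv : u < v) (h : ∀ j, C.pts j ∉ Icc u v)
    (h1 : C.y₁ ∉ Icc u v) (h2 : C.y₂ ∉ Icc u v) (hu : (C.g u).re = 0) (hv : (C.g v).re = 0) :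
    False := by
  obtain ⟨y, hy, hy0⟩ := exists_critical_of_re_eq (c := C.res) huv h (hu.trans hv.symm)
  have hy' := Ioo_subset_Icc_self hy
  refine C.f_ne_zero (w := y) (by simp) (fun j hj => h j ?_) (fun hI => ?_) (fun hj => h1 ?_)
    (fun hj => h2 ?_) hy0
  · rwa [← (by exact_mod_cast hj : y = C.pts j)]
  · have := congrArg Complex.im hI
    simp at this
  · rwa [← (by exact_mod_cast hj : y = C.y₁)]
  · rwa [← (by exact_mod_cast hj : y = C.y₂)]

/-- The three intervals of the real axis on which the imaginary part of `g` is positive. -/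
def posInt : Fin 3 → Set ℝ :=
  ![Iio (C.lo (-t⁻¹) C.s₂), Ioo (C.lo 0 C.s₀) 0, Ioo (C.hi (-t) C.s₁) (C.hi 0 C.s₀)]

theorem posInt_not_mem {u v : ℝ} {i : Fin 3} (hu : u ∈ C.posInt i) (hv : v ∈ C.posInt i) :
    (∀ j, C.pts j ∉ Icc u v) ∧ C.y₁ ∉ Icc u v ∧ C.y₂ ∉ Icc u v := by
  obtain ⟨h1, h2, h3, h4, h5, h6, h7, h8⟩ := C.order
  rw [C.forall_pts (P := fun x => x ∉ Icc u v)]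
  fin_cases i <;> simp [posInt] at hu hv <;> simp only [mem_Icc] <;>
  refine ⟨⟨?_, ?_, ?_, ?_, ?_, ?_, ?_⟩, ?_, ?_⟩ <;> rintro ⟨c1, c2⟩ <;> linarith

theorem posInt_unique {u v : ℝ} {i : Fin 3} (hu : u ∈ C.posInt i) (hv : v ∈ C.posInt i)
    (hu0 : (C.g u).re = 0) (hv0 : (C.g v).re = 0) : u = v := by
  rcases lt_trichotomy u v with h | h | h
  · obtain ⟨a1, a2, a3⟩ := C.posInt_not_mem hu hv
    exact (C.not_lt_of_re_eq_zero h a1 a2 a3 hu0 hv0).elim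
  · exact h
  · obtain ⟨a1, a2, a3⟩ := C.posInt_not_mem hv hu
    exact (C.not_lt_of_re_eq_zero h a1 a2 a3 hv0 hu0).elim

theorem exists_posInt {u : ℝ} (hu : ∀ j, u ≠ C.pts j) (h : 0 < (C.g u).im) :
    ∃ i, u ∈ C.posInt i := by
  rcases C.mem_of_im_pos hu h with h | h | h
  · exact ⟨0, h⟩
  · exact ⟨1, h⟩
  · exact ⟨2, h⟩

/-- The upper half of the lift of `Γ₁`, from `i` to a point of the negative axis. -/
theorem exists_lift_Γ₁ : ∃ T > 0, ∃ W : ℝ → ℂ, ∃ q : ℝ, IsLift C.g Complex.I (Ioo 0 T) W ∧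
    Tendsto W (𝓝[>] 0) (𝓝 Complex.I) ∧ Tendsto W (𝓝[<] T) (𝓝 (q : ℂ)) ∧
    q ∈ Ioo (C.lo 0 C.s₀) 0 ∧ C.g q = Complex.I * T := by
  have hI : Complex.I ≠ 0 := Complex.I_ne_zero
  obtain ⟨ε, hε, w, hw, hw0, hwd⟩ := exists_three_lifts (δ := Complex.I) (q := Complex.I) (by simp)
    (C.analyticAt_g (by simp) (C.ne_pts_of_im_pos (by simp))) C.g_I C.analyticAt_cofI C.cofI_ne
    C.deriv_g_near_I hI
  have key : ∀ j, ∃ T, ε ≤ T ∧ ∃ W, IsLift C.g Complex.I (Ioo 0 T) W ∧ EqOn W (w j) (Ioo 0 ε) ∧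
      ∃ q : ℝ, Tendsto W (𝓝[<] T) (𝓝 (q : ℂ)) ∧ (∀ j, q ≠ C.pts j) ∧ C.g q = Complex.I * T ∧
        ∃ i, q ∈ C.posInt i := by
    intro j
    rcases (hw j).exists_maximal C.locBihol_g hI hε with ⟨W, hW, -⟩ | ⟨T, hT, W, hW, he, hmax⟩
    · exfalso
      obtain ⟨B, hB⟩ := exists_bound_logSum_im C.pts C.res
      have h1 := hB (W (|B| + 1))
      have h2 := congrArg Complex.im (hW.eq (|B| + 1) (by positivity : (0 : ℝ) < |B| + 1))
      simp at h2
      have h3 : (logSum C.pts C.res (W (|B| + 1))).im = |B| + 1 := h2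
      linarith [le_abs_self B]
    · have hT0 : 0 < T := hε.trans_le hT
      obtain ⟨r, hr⟩ := C.exists_radius
      -- The possible end points: at most one in each interval with Im g > 0. Finiteness turns
      -- accumulation into convergence.
      set F : Set ℂ := ⋃ i, (fun u : ℝ => (u : ℂ)) '' {u | u ∈ C.posInt i ∧ (C.g u).re = 0} with hF
      have hFfin : F.Finite := by
        refine Set.finite_iUnion fun i => Set.Finite.image _ (Set.Subsingleton.finite ?_)
        intro u hu v hv
        exact C.posInt_unique hu.1 hv.1 hu.2 hv.2
      have hclF : ∀ q, MapClusterPt q (𝓝[<] T) W → (q ∈ F ∧ ∃ u : ℝ, q = u ∧ (∀ j, u ≠ C.pts j) ∧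
          C.g u = Complex.I * T ∧ ∃ i, u ∈ C.posInt i) := by
        intro q hq
        obtain ⟨u, rfl, hne, hgu⟩ := C.exists_real_of_mapClusterPt hT0 hW hmax hq
        have h1 : (C.g u).re = 0 := by rw [hgu]; simp
        have h2 : 0 < (C.g u).im := by rw [hgu]; simpa using hT0
        obtain ⟨i, hi⟩ := C.exists_posInt hne h2
        exact ⟨mem_iUnion.2 ⟨i, u, ⟨hi, h1⟩, rfl⟩, u, rfl, hne, hgu, i, hi⟩
      obtain ⟨q, -, hq⟩ := exists_tendsto_of_finite_clusterPt
        (tendsto_small_preconnected_left hT0 hW.continuousOn) (isCompact_closedBall (0 : ℂ) r)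
        (by
          filter_upwards [Ioo_mem_nhdsLT hT0] with τ hτ
          refine hr _ ?_
          rw [hW.eq τ hτ]
          simp) hFfin (fun q hq => (hclF q hq).1)
      obtain ⟨-, u, rfl, hne, hgu, hi⟩ := hclF q hq.mapClusterPt
      exact ⟨T, hT, W, hW, he, u, hq, hne, hgu, hi⟩
  choose T hT W hW he q hq hne hgq i hi using key
  -- Two lifts ending in the same interval would end at the same point and, by the value of g there,
  -- at the same time. As g is injective near that point they would coincide, although they are
  -- distinct near i.
  have hinj : ∀ j l, j ≠ l → i j ≠ i l := by
    intro j l hjl hil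
    have hre : ∀ j, (C.g (q j)).re = 0 := fun j => by rw [hgq]; simp
    have hqq : q j = q l := C.posInt_unique (hi j) (hil ▸ hi l) (hre j) (hre l)
    have hTT : T j = T l := by
      have := hgq j
      rw [hqq, hgq l] at this
      have := mul_left_cancel₀ hI this
      exact_mod_cast this.symm
    have hf : C.f (q j) ≠ 0 := by
      obtain ⟨-, a2, a3⟩ := C.posInt_not_mem (hi j) (hi j)
      refine C.f_ne_zero (by simp) (fun k h => hne j k (by exact_mod_cast h)) (fun h => ?_)
        (fun h => a2 ?_) (fun h => a3 ?_)
      · have := congrArg Complex.im h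
        simp at this
      · rw [← (by exact_mod_cast h : q j = C.y₁)]
        simp
      · rw [← (by exact_mod_cast h : q j = C.y₂)]
        simp
    obtain ⟨N, hN, hNinj⟩ := exists_injOn_of_hasStrictDerivAt
      (C.hasStrictDerivAt_g (w := (q j : ℂ)) (by simp) (fun k h => hne j k (by exact_mod_cast h))) hf
    have hT0 : 0 < T j := hε.trans_le (hT j)
    have hWl := hW l
    rw [← hTT] at hWl
    have hql := hq l
    rw [← hTT, ← hqq] at hql
    have heq := (hW j).eqOn_of_tendsto C.locBihol_g hI hWl isOpen_Ioo isPreconnected_Ioo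
      (fun τ hτ => hτ.1) (Ioo_mem_nhdsLT hT0) hN (hNinj.mono inter_subset_left) (hq j) hql
    have hmem : ε / 2 ∈ Ioo 0 ε := ⟨by linarith, by linarith⟩
    refine hwd j l hjl (ε / 2) hmem ?_
    rw [← he j hmem, ← he l hmem]
    exact heq ⟨by linarith, by linarith [hT j]⟩
  -- Three lifts with pairwise different intervals occupy all three; index 1 is the interval over
  -- the positive real axis.
  have hsurj : Function.Surjective i :=
    Finite.surjective_of_injective fun j l h => by_contra fun hjl => hinj j l hjl h
  obtain ⟨j, hj⟩ := hsurj 1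
  refine ⟨T j, hε.trans_le (hT j), W j, q j, hW j, ?_, hq j, ?_, hgq j⟩
  · refine (hw0 j).congr' ?_
    filter_upwards [Ioo_mem_nhdsGT hε] with τ hτ
    exact (he j hτ).symm
  · have := hi j
    rw [hj] at this
    exact this

end Config
-- The orthogonal trajectory from i over the negative ray.
namespace Config

variable {t γ a : ℝ} (C : Config t γ a)

/-- Near a regular real point with real value, no non-real point of the half-plane has a
real value. -/
theorem eventually_g_im_ne {u : ℝ} (hu : ∀ j, u ≠ C.pts j) (h0 : (C.g u).im = 0)
    (hf : C.f u ≠ 0) : ∀ᶠ w in 𝓝 (u : ℂ), 0 < w.im → (C.g w).im ≠ 0 := by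
  have hs := C.hasStrictDerivAt_g (w := (u : ℂ)) (by simp) (fun j h => hu j (by exact_mod_cast h))
  have him : (C.f u).im = 0 := poleSum_ofReal_im C.pts C.res u
  have hfr : C.f u = ((C.f u).re : ℂ) := Complex.ext (by simp) (by simpa using him)
  have hd : HasStrictDerivAt (fun w => C.g w / C.f u) 1 (u : ℂ) := by
    have := hs.div_const (C.f u)
    rwa [div_self hf] at this
  have himd : ∀ w, (C.g w / C.f u).im = (C.g w).im / (C.f u).re := by
    intro w
    rw [hfr, Complex.div_ofReal_im]
    simp
  have key := eventually_im_pos hd (by simp) (by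
    filter_upwards [eventually_logSum_im_eq (x := C.pts) (c := C.res) hu] with v hv
    rw [himd]
    have : (C.g v).im = (C.g u).im := hv
    rw [this, h0, zero_div])
  filter_upwards [key] with w hw hwi h
  have := hw hwi
  rw [himd, h, zero_div] at this
  exact lt_irrefl _ this

/-- The cofactor of `w - y` in `f` at a zero `y`, where `y'` is the other real zero. -/
def cofReal (y' : ℝ) (w : ℂ) : ℂ :=
  (1 + γ * a) * ((w ^ 2 + 1) ^ 2 * (w - y')) / C.den w

theorem y₁_ne (j : Fin 7) : C.y₁ ≠ C.pts j := by
  obtain ⟨h1, h2, h3, h4, h5, h6, h7, h8⟩ := C.order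
  revert j
  rw [C.forall_pts (P := fun x => C.y₁ ≠ x)]
  refine ⟨?_, ?_, ?_, ?_, ?_, ?_, ?_⟩ <;> intro h <;> linarith

theorem y₂_ne (j : Fin 7) : C.y₂ ≠ C.pts j := by
  obtain ⟨h1, h2, h3, h4, h5, h6, h7, h8⟩ := C.order
  revert j
  rw [C.forall_pts (P := fun x => C.y₂ ≠ x)]
  refine ⟨?_, ?_, ?_, ?_, ?_, ?_, ?_⟩ <;> intro h <;> linarith

theorem analyticAt_cofReal (y' : ℝ) {w : ℂ} (hw : ∀ j, w ≠ C.pts j) :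
    AnalyticAt ℂ (C.cofReal y') w := by
  refine AnalyticAt.div ?_ (C.analyticAt_den w) (C.den_ne hw)
  fun_prop

/-- The values of `den` on the real axis. -/
def denRe (u : ℝ) : ℝ :=
  u * ((u - C.lo 0 C.s₀) * (u - C.hi 0 C.s₀) * ((u - C.lo (-t) C.s₁) * (u - C.hi (-t) C.s₁)) *
    ((u - C.lo (-t⁻¹) C.s₂) * (u - C.hi (-t⁻¹) C.s₂)))

theorem den_ofReal (u : ℝ) : C.den u = C.denRe u := by
  unfold den denRe
  push_cast
  ring

theorem cofReal_ofReal (y' u : ℝ) :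
    C.cofReal y' u = (((1 + γ * a) * ((u ^ 2 + 1) ^ 2 * (u - y')) / C.denRe u : ℝ) : ℂ) := by
  rw [cofReal, den_ofReal]
  push_cast
  ring

theorem denRe_y₁_pos : 0 < C.denRe C.y₁ := by
  obtain ⟨h1, h2, h3, h4, h5, h6, h7, h8⟩ := C.order
  have e : C.denRe C.y₁ = (-C.y₁) * ((C.lo 0 C.s₀ - C.y₁) * (C.hi 0 C.s₀ - C.y₁) *
    ((C.lo (-t) C.s₁ - C.y₁) * (C.hi (-t) C.s₁ - C.y₁)) *
    ((C.y₁ - C.lo (-t⁻¹) C.s₂) * (C.hi (-t⁻¹) C.s₂ - C.y₁))) := by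
    rw [denRe]; ring
  rw [e]
  refine mul_pos (by linarith) (mul_pos (mul_pos (mul_pos ?_ ?_) (mul_pos ?_ ?_)) (mul_pos ?_ ?_))
    <;> linarith

theorem denRe_y₂_pos : 0 < C.denRe C.y₂ := by
  obtain ⟨h1, h2, h3, h4, h5, h6, h7, h8⟩ := C.order
  have e : C.denRe C.y₂ = C.y₂ * ((C.y₂ - C.lo 0 C.s₀) * (C.hi 0 C.s₀ - C.y₂) *
    ((C.y₂ - C.lo (-t) C.s₁) * (C.hi (-t) C.s₁ - C.y₂)) *
    ((C.y₂ - C.lo (-t⁻¹) C.s₂) * (C.y₂ - C.hi (-t⁻¹) C.s₂))) := by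
    rw [denRe]; ring
  rw [e]
  refine mul_pos (by linarith) (mul_pos (mul_pos (mul_pos ?_ ?_) (mul_pos ?_ ?_)) (mul_pos ?_ ?_))
    <;> linarith

theorem y₁_lt_y₂ : C.y₁ < C.y₂ := by
  obtain ⟨h1, h2, h3, h4, h5, h6, h7, h8⟩ := C.order
  linarith

theorem eventually_deriv_y₁ : ∀ᶠ w in 𝓝 (C.y₁ : ℂ), deriv C.g w = (w - C.y₁) * C.cofReal C.y₂ w := by
  have hn : ∀ j, (C.y₁ : ℂ) ≠ C.pts j := fun j h => C.y₁_ne j (by exact_mod_cast h)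
  filter_upwards [C.eventually_deriv_g (by simp) hn, C.eventually_ne_pts hn] with w hw hw'
  rw [hw.deriv, C.f_eq hw', cofReal]
  ring

theorem eventually_deriv_y₂ : ∀ᶠ w in 𝓝 (C.y₂ : ℂ), deriv C.g w = (w - C.y₂) * C.cofReal C.y₁ w := by
  have hn : ∀ j, (C.y₂ : ℂ) ≠ C.pts j := fun j h => C.y₂_ne j (by exact_mod_cast h)
  filter_upwards [C.eventually_deriv_g (by simp) hn, C.eventually_ne_pts hn] with w hw hw'
  rw [hw.deriv, C.f_eq hw', cofReal]
  ring

/-- The square root coordinate at the zero `y₁`. -/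
theorem exists_sqrt_y₁ : ∃ φ φ' : ℂ → ℂ, (∀ᶠ w in 𝓝 (C.y₁ : ℂ), HasStrictDerivAt φ (φ' w) w) ∧
    ContinuousAt φ' C.y₁ ∧ 0 < (φ' C.y₁).re ∧ (φ' C.y₁).im = 0 ∧ φ C.y₁ = 0 ∧
    (∀ᶠ w in 𝓝 (C.y₁ : ℂ), C.g w = C.g C.y₁ - φ w ^ 2) ∧
    (∀ᶠ u : ℝ in 𝓝 C.y₁, (φ u).im = 0) ∧
    ∀ᶠ w in 𝓝 (C.y₁ : ℂ), 0 < w.im → 0 < (φ w).im := by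
  have hn : ∀ j, (C.y₁ : ℂ) ≠ C.pts j := fun j h => C.y₁_ne j (by exact_mod_cast h)
  -- The sign is −1 because the cofactor is negative at y₁: it contains y₁ − y₂ and `den` is
  -- positive. On the curve that enters the half-plane orthogonally at y₁, g therefore increases.
  obtain ⟨φ, φ', h1, h2, h3, h4, h5, h6, h7, h8⟩ := exists_sqrt_coordinate (Or.inr rfl)
    (C.analyticAt_g (by simp) hn) (C.analyticAt_cofReal C.y₂ hn) (by
      rw [cofReal_ofReal, Complex.ofReal_re, neg_one_mul, ← neg_div]
      refine div_pos ?_ C.denRe_y₁_pos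
      have : (1 + γ * a) * ((C.y₁ ^ 2 + 1) ^ 2 * (C.y₁ - C.y₂)) =
        -((1 + γ * a) * ((C.y₁ ^ 2 + 1) ^ 2 * (C.y₂ - C.y₁))) := by ring
      rw [this, neg_neg]
      have := C.y₁_lt_y₂
      exact mul_pos C.k_pos (mul_pos (by positivity) (by linarith)))
    (by rw [cofReal_ofReal, Complex.ofReal_im]) C.eventually_deriv_y₁
    (eventually_logSum_im_eq C.y₁_ne)
  refine ⟨φ, φ', h1, h2, h3, h4, h5, ?_, h7, h8⟩
  filter_upwards [h6] with w hw
  rw [hw]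
  push_cast
  ring

/-- Here the cofactor is positive, opposite to y₁; this sign prevents the orthogonal trajectory from
ending at y₂. -/
theorem exists_sqrt_y₂ : ∃ φ : ℂ → ℂ, (∀ᶠ w in 𝓝 (C.y₂ : ℂ), C.g w = C.g C.y₂ + φ w ^ 2) ∧
    ∀ᶠ w in 𝓝 (C.y₂ : ℂ), 0 < w.im → 0 < (φ w).im := by
  have hn : ∀ j, (C.y₂ : ℂ) ≠ C.pts j := fun j h => C.y₂_ne j (by exact_mod_cast h)
  obtain ⟨φ, φ', h1, h2, h3, h4, h5, h6, h7, h8⟩ := exists_sqrt_coordinate (Or.inl rfl)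
    (C.analyticAt_g (by simp) hn) (C.analyticAt_cofReal C.y₁ hn) (by
      rw [cofReal_ofReal, Complex.ofReal_re, one_mul]
      refine div_pos ?_ C.denRe_y₂_pos
      have := C.y₁_lt_y₂
      exact mul_pos C.k_pos (mul_pos (by positivity) (by linarith)))
    (by rw [cofReal_ofReal, Complex.ofReal_im]) C.eventually_deriv_y₂
    (eventually_logSum_im_eq C.y₂_ne)
  refine ⟨φ, ?_, h8⟩
  filter_upwards [h6] with w hw
  rw [hw]
  push_cast
  ring

/-- At a real noncritical point where g is real, no nearby point of the half-plane has a real value.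
At y₂ real values in the half-plane lie below g(y₂), whereas a lift arriving there has values above
it. Only y₁ remains. -/
theorem eq_y₁_of_mapClusterPt {T : ℝ} {W : ℝ → ℂ} {q : ℂ} (hT : 0 < T)
    (hW : IsLift C.g (-1) (Ioo 0 T) W) (hmax : ∀ q : ℂ, 0 < q.im → ¬ MapClusterPt q (𝓝[<] T) W)
    (hq : MapClusterPt q (𝓝[<] T) W) : q = C.y₁ ∧ C.g C.y₁ = -T := by
  obtain ⟨u, rfl, hne, hgu⟩ := C.exists_real_of_mapClusterPt hT hW hmax hq
  have him : (C.g u).im = 0 := by rw [hgu]; simp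
  have hmem : ∀ᶠ τ in 𝓝[<] T, τ ∈ Ioo 0 T := Ioo_mem_nhdsLT hT
  have hpos : ∀ τ ∈ Ioo 0 T, 0 < (W τ).im := hW.im_pos
  by_cases h1 : u = C.y₁
  · subst h1
    exact ⟨rfl, by rw [hgu]; ring⟩
  exfalso
  by_cases h2 : u = C.y₂
  · subst h2
    obtain ⟨φ, h3, h4⟩ := C.exists_sqrt_y₂
    obtain ⟨τ, ⟨h5, h6⟩, hτ⟩ := ((hq.frequently (h3.and h4)).and_eventually hmem).exists
    have h7 := h6 (hpos τ hτ)
    rw [hW.eq τ hτ, hgu] at h5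
    -- A number in the open upper half-plane cannot have the positive square T − τ.
    have e : φ (W τ) ^ 2 = ((T - τ : ℝ) : ℂ) := by
      push_cast
      linear_combination -h5
    have e1 := congrArg Complex.re e
    have e2 := congrArg Complex.im e
    rw [sq, Complex.mul_re, Complex.ofReal_re] at e1
    rw [sq, Complex.mul_im, Complex.ofReal_im] at e2
    have e3 : (φ (W τ)).re = 0 := by
      have : (φ (W τ)).re * (φ (W τ)).im = 0 := by linarith
      rcases mul_eq_zero.1 this with h | h
      · exact h
      · exact absurd h h7.ne'
    rw [e3] at e1
    have := hτ.2
    nlinarith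
  · have hf : C.f u ≠ 0 := by
      refine C.f_ne_zero (by simp) (fun k h => hne k (by exact_mod_cast h)) (fun h => ?_)
        (fun h => h1 (by exact_mod_cast h)) (fun h => h2 (by exact_mod_cast h))
      have := congrArg Complex.im h
      simp at this
    obtain ⟨τ, h3, hτ⟩ := ((hq.frequently
      (C.eventually_g_im_ne hne him hf)).and_eventually hmem).exists
    refine h3 (hpos τ hτ) ?_
    rw [hW.eq τ hτ]
    simp

/-- A lift of the negative axis does not end at a pole that borders an interval on which `g` is
real and regular. -/
theorem not_tendsto_pole {W : ℝ → ℂ} (hW : IsLift C.g (-1) (Ioi 0) W) {j : Fin 7}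
    (hj : 0 < C.res j) (hS : ∀ N ∈ 𝓝 (C.pts j : ℂ), ∃ S : Set ℝ, IsPreconnected S ∧
      (𝓝[S] (C.pts j)).NeBot ∧ (∀ u ∈ S, (u : ℂ) ∈ N) ∧
      ∀ u ∈ S, (∀ i, u ≠ C.pts i) ∧ (C.g u).im = 0) :
    ¬ Tendsto W atTop (𝓝 (C.pts j : ℂ)) := by
  intro h
  obtain ⟨N, hN, hinj⟩ := exists_injOn_logSum_branch (c := C.res) C.pts_strictMono.injective hj.ne'
  obtain ⟨S, hS1, hS2, hS3, hS4⟩ := hS N hN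
  have hSmem : ∀ᶠ u in 𝓝[S] (C.pts j), u ∈ S := eventually_mem_nhdsWithin
  obtain ⟨u₀, hu₀⟩ := hSmem.exists
  have hWN : ∀ᶠ τ in atTop, W τ ∈ N := h hN
  obtain ⟨τ, ⟨hτN, hτ0⟩, hτ⟩ := ((hWN.and (eventually_gt_atTop (0:ℝ))).and
    (eventually_gt_atTop (-(C.g u₀).re))).exists
  have hlim : Tendsto (fun u : ℝ => (C.g u).re) (𝓝[S] (C.pts j)) atBot := by
    refine (tendsto_logSum_re_atBot C.pts_strictMono.injective hj).comp ?_
    refine tendsto_nhdsWithin_iff.2 ⟨Complex.continuous_ofReal.continuousAt.tendsto.mono_left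
      nhdsWithin_le_nhds, ?_⟩
    filter_upwards [hSmem] with u hu
    exact fun h => (hS4 u hu).1 j (Complex.ofReal_injective h)
  obtain ⟨u₁, hu₁, hu₁'⟩ := (hSmem.and (hlim.eventually_lt_atBot (-τ))).exists
  have hcont : ContinuousOn (fun u : ℝ => (C.g u).re) S := by
    intro u hu
    have : ContinuousAt C.g (u : ℂ) :=
      (C.analyticAt_g (by simp) fun i h => (hS4 u hu).1 i (by exact_mod_cast h)).continuousAt
    exact (Complex.continuous_re.continuousAt.comp
      (this.comp Complex.continuous_ofReal.continuousAt)).continuousWithinAt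
  -- On the adjacent real interval g already takes the value −τ at a point close to the pole.
  -- Injectivity near the pole would put W(τ) on the real axis.
  obtain ⟨u, hu, hgu⟩ := hS1.intermediate_value hu₁ hu₀ hcont
    ⟨hu₁'.le, by linarith⟩
  have hgu' : (C.g u).re = -τ := hgu
  have e : C.g u = C.g (W τ) := by
    rw [hW.eq τ hτ0]
    apply Complex.ext
    · rw [hgu']; simp
    · rw [(hS4 u hu).2]; simp
  have hWne : W τ ≠ C.pts j := ne_ofReal_of_im_pos (hW.im_pos τ hτ0) _
  have := hinj ⟨hS3 u hu, fun h => (hS4 u hu).1 j (by exact_mod_cast h)⟩ ⟨hτN, hWne⟩ e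
  have h2 := hW.im_pos τ hτ0
  rw [← this] at h2
  simp at h2

theorem ne_pts_of_mem {u : ℝ} (h : u ∈ Ioo (C.lo (-t⁻¹) C.s₂) (C.lo (-t) C.s₁)) (j : Fin 7) :
    u ≠ C.pts j := by
  obtain ⟨h1, h2, h3, h4, h5, h6, h7, h8⟩ := C.order
  obtain ⟨h9, h10⟩ := h
  revert j
  rw [C.forall_pts (P := fun x => u ≠ x)]
  refine ⟨?_, ?_, ?_, ?_, ?_, ?_, ?_⟩ <;> intro h <;> linarith

/-- The values −τ tend to −∞, so the lift can accumulate only at poles with positive residue. Of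
these, the first two border the interval on which g is real and are excluded, which leaves w = 0 and
the preimage of 0 on the second sheet. -/
theorem mem_of_tendsto_atTop {W : ℝ → ℂ} (hW : IsLift C.g (-1) (Ioi 0) W) :
    ∃ j : Fin 7, (j = 3 ∨ j = 6) ∧ Tendsto W atTop (𝓝 (C.pts j : ℂ)) := by
  obtain ⟨r, hr⟩ := C.exists_radius
  have hmem : ∀ᶠ τ : ℝ in atTop, τ ∈ Ioi 0 := Ioi_mem_atTop 0
  have hcl : ∀ q, MapClusterPt q atTop W → ∃ j, q = C.pts j ∧ 0 < C.res j := by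
    intro q hq
    have him := im_nonneg_of_mapClusterPt hq (hmem.mono hW.im_pos)
    have hpole : ∃ j, q = C.pts j := by
      by_contra! hne
      have hc := (C.analyticAt_g him hne).continuousAt
      have h1 : ∀ᶠ w in 𝓝 q, ‖C.g w‖ < ‖C.g q‖ + 1 :=
        hc.norm.eventually (gt_mem_nhds (by simp))
      obtain ⟨τ, h2, h3, h4⟩ := ((hq.frequently h1).and_eventually
        (hmem.and (eventually_gt_atTop (‖C.g q‖ + 1)))).exists
      rw [hW.eq τ h3] at h2
      simp only [neg_one_mul, norm_neg, Complex.norm_real, Real.norm_eq_abs] at h2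
      linarith [le_abs_self τ]
    obtain ⟨j, rfl⟩ := hpole
    refine ⟨j, rfl, ?_⟩
    by_contra hneg
    have hneg' := lt_of_le_of_ne (not_lt.1 hneg) (C.res_ne j)
    have h1 := eventually_nhdsWithin_iff.1
      ((tendsto_logSum_re_atTop C.pts_strictMono.injective hneg').eventually_gt_atTop 0)
    obtain ⟨τ, h2, h3⟩ := ((hq.frequently h1).and_eventually hmem).exists
    have h4 := h2 (ne_ofReal_of_im_pos (hW.im_pos τ h3) _)
    have h5 : (C.g (W τ)).re < 0 := by rw [hW.eq τ h3]; simpa using h3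
    exact lt_asymm h4 h5
  obtain ⟨q, ⟨j, -, rfl⟩, hq⟩ := exists_tendsto_of_finite_clusterPt
    (tendsto_small_preconnected_atTop hW.continuousOn) (isCompact_closedBall (0 : ℂ) r)
    (hmem.mono fun τ hτ => hr _ (by rw [hW.eq τ hτ]; simpa using le_of_lt hτ))
    (F := (fun j => (C.pts j : ℂ)) '' univ) (finite_univ.image _)
    (fun q hq => by
      obtain ⟨j, h, -⟩ := hcl q hq
      exact ⟨j, trivial, h.symm⟩)
  obtain ⟨j', hj', hpos⟩ := hcl _ hq.mapClusterPt
  obtain rfl : j = j' := C.pts_strictMono.injective (Complex.ofReal_injective hj')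
  have ho := C.order
  have hlt : C.lo (-t⁻¹) C.s₂ < C.lo (-t) C.s₁ := ho.1.trans ho.2.1
  refine ⟨j, ?_, hq⟩
  have ha := C.a_pos
  have hγ := C.γ_pos
  have hγa : 0 < γ * a := by positivity
  have hnot : j ≠ 0 ∧ j ≠ 1 := by
    constructor
    · rintro rfl
      refine C.not_tendsto_pole hW hpos (fun N hN => ?_) hq
      have hN' : (fun u : ℝ => (u : ℂ)) ⁻¹' N ∈ 𝓝[>] (C.pts 0) :=
        nhdsWithin_le_nhds (Complex.continuous_ofReal.continuousAt hN)
      have : Ioo (C.pts 0) (C.pts 1) ∈ 𝓝[>] (C.pts 0) := Ioo_mem_nhdsGT hlt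
      obtain ⟨b, hb, hbs⟩ := (mem_nhdsGT_iff_exists_Ioo_subset).1 (inter_mem hN' this)
      refine ⟨Ioo (C.pts 0) b, isPreconnected_Ioo, ?_, fun u hu => (hbs hu).1, fun u hu =>
        ⟨C.ne_pts_of_mem (hbs hu).2, C.g_im_eq_zero_of_mem (hbs hu).2⟩⟩
      exact left_nhdsWithin_Ioo_neBot hb
    · rintro rfl
      refine C.not_tendsto_pole hW hpos (fun N hN => ?_) hq
      have hN' : (fun u : ℝ => (u : ℂ)) ⁻¹' N ∈ 𝓝[<] (C.pts 1) :=
        nhdsWithin_le_nhds (Complex.continuous_ofReal.continuousAt hN)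
      have : Ioo (C.pts 0) (C.pts 1) ∈ 𝓝[<] (C.pts 1) := Ioo_mem_nhdsLT hlt
      obtain ⟨b, hb, hbs⟩ := (mem_nhdsLT_iff_exists_Ioo_subset).1 (inter_mem hN' this)
      refine ⟨Ioo b (C.pts 1), isPreconnected_Ioo, ?_, fun u hu => (hbs hu).1, fun u hu =>
        ⟨C.ne_pts_of_mem (hbs hu).2, C.g_im_eq_zero_of_mem (hbs hu).2⟩⟩
      exact right_nhdsWithin_Ioo_neBot hb
  obtain ⟨n0, n1⟩ := hnot
  fin_cases j <;> simp [res] at hpos n0 n1 ⊢ <;> linarith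

/-- The upper half of the lift of `Γ₂`, from `i` to the zero `y₁`. -/
theorem exists_lift_Γ₂ : ∃ T > 0, ∃ W : ℝ → ℂ, IsLift C.g (-1) (Ioo 0 T) W ∧
    Tendsto W (𝓝[>] 0) (𝓝 Complex.I) ∧ Tendsto W (𝓝[<] T) (𝓝 (C.y₁ : ℂ)) ∧
    C.g C.y₁ = -T := by
  have hI : (-1 : ℂ) ≠ 0 := by norm_num
  obtain ⟨ε, hε, w, hw, hw0, hwd⟩ := exists_three_lifts (δ := -1) (q := Complex.I) (by simp)
    (C.analyticAt_g (by simp) (C.ne_pts_of_im_pos (by simp))) C.g_I C.analyticAt_cofI C.cofI_ne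
    C.deriv_g_near_I hI
  -- If no lift reached y₁, all three would exist for all times and converge to one of two poles.
  -- Two of them would share a pole and hence coincide, since g is injective near it.
  by_contra hcon
  have key : ∀ j, ∃ W, IsLift C.g (-1) (Ioi 0) W ∧ EqOn W (w j) (Ioo 0 ε) := by
    intro j
    rcases (hw j).exists_maximal C.locBihol_g hI hε with h | ⟨T, hT, W, hW, he, hmax⟩
    · exact h
    · exfalso
      have hT0 : 0 < T := hε.trans_le hT
      obtain ⟨r, hr⟩ := C.exists_radius
      obtain ⟨q, hqF, hq⟩ := exists_tendsto_of_finite_clusterPt (F := {(C.y₁ : ℂ)})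
        (tendsto_small_preconnected_left hT0 hW.continuousOn) (isCompact_closedBall (0 : ℂ) r)
        (by
          filter_upwards [Ioo_mem_nhdsLT hT0] with τ hτ
          refine hr _ ?_
          rw [hW.eq τ hτ]
          simpa using hτ.1.le) (finite_singleton _)
        (fun q hq => (C.eq_y₁_of_mapClusterPt hT0 hW hmax hq).1)
      obtain rfl : q = C.y₁ := hqF
      refine hcon ⟨T, hT0, W, hW, ?_, hq, (C.eq_y₁_of_mapClusterPt hT0 hW hmax hq.mapClusterPt).2⟩
      refine (hw0 j).congr' ?_
      filter_upwards [Ioo_mem_nhdsGT hε] with τ hτ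
      exact (he hτ).symm
  choose W hW he using key
  choose i hi hlim using fun j => C.mem_of_tendsto_atTop (hW j)
  have hninj : ¬ Function.Injective i := by
    intro hinj
    have h1 : Finset.univ.image i ⊆ ({3, 6} : Finset (Fin 7)) := by
      intro x hx
      obtain ⟨j, -, rfl⟩ := Finset.mem_image.1 hx
      rcases hi j with h | h <;> simp [h]
    have h2 := Finset.card_le_card h1
    rw [Finset.card_image_of_injective _ hinj] at h2
    simp at h2
  obtain ⟨j, l, hil, hjl⟩ : ∃ j l, i j = i l ∧ j ≠ l := by
    by_contra! h
    exact hninj h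
  obtain ⟨N, hN, hNinj⟩ := exists_injOn_logSum_branch (c := C.res) C.pts_strictMono.injective
    (C.res_ne (i j))
  have hmono : InjOn C.g (N ∩ {w | 0 < w.im}) := by
    rintro u ⟨hu, hu'⟩ v ⟨hv, hv'⟩ h
    exact hNinj ⟨hu, ne_ofReal_of_im_pos hu' _⟩ ⟨hv, ne_ofReal_of_im_pos hv' _⟩ h
  have heq := (hW j).eqOn_of_tendsto C.locBihol_g hI (hW l) isOpen_Ioi isPreconnected_Ioi
    (fun _ h => h) (Ioi_mem_atTop 0) hN
    hmono (hlim j) (hil ▸ hlim l)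
  have hmem : ε / 2 ∈ Ioo 0 ε := ⟨by linarith, by linarith⟩
  refine hwd j l hjl (ε / 2) hmem ?_
  rw [← he j hmem, ← he l hmem]
  exact heq hmem.1

end Config

/-! ### Reflection in the real axis and parametrization of the paths. -/

/-- The extension of a path to negative parameters by reflection in the real axis. -/
def reflect (E : ℝ → ℂ) (r : ℝ) : ℂ := if 0 ≤ r then E r else conj (E (-r))

/-- The derivative of the reflected path. -/
def reflectDeriv (d : ℂ) (D : ℝ → ℂ) (r : ℝ) : ℂ :=
  if r = 0 then d else if 0 < r then D r else -conj (D (-r))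

theorem reflect_of_nonneg {E : ℝ → ℂ} {r : ℝ} (h : 0 ≤ r) : reflect E r = E r := if_pos h

theorem reflect_neg {E : ℝ → ℂ} (h0 : (E 0).im = 0) (r : ℝ) :
    reflect E (-r) = conj (reflect E r) := by
  rcases lt_trichotomy r 0 with h | rfl | h
  · rw [reflect, reflect, if_pos (by linarith), if_neg (by linarith), Complex.conj_conj]
  · rw [neg_zero, reflect, if_pos le_rfl]
    exact (Complex.conj_eq_iff_im.2 h0).symm
  · rw [reflect, reflect, if_neg (by linarith), if_pos h.le, neg_neg]

theorem reflectDeriv_of_pos {d : ℂ} {D : ℝ → ℂ} {r : ℝ} (h : 0 < r) : reflectDeriv d D r = D r := by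
  rw [reflectDeriv, if_neg h.ne', if_pos h]

theorem reflectDeriv_neg {d : ℂ} (hd : d.re = 0) (D : ℝ → ℂ) (r : ℝ) :
    reflectDeriv d D (-r) = -conj (reflectDeriv d D r) := by
  rcases lt_trichotomy r 0 with h | rfl | h
  · rw [reflectDeriv_of_pos (by linarith), reflectDeriv, if_neg h.ne, if_neg (by linarith)]
    simp
  · rw [neg_zero, reflectDeriv, if_pos rfl]
    apply Complex.ext <;> simp [hd]
  · rw [reflectDeriv_of_pos h, reflectDeriv, if_neg (by linarith), if_neg (by linarith), neg_neg]

theorem continuousOn_reflect {E : ℝ → ℂ} (hE : ContinuousOn E (Icc 0 1)) (h0 : (E 0).im = 0) :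
    ContinuousOn (reflect E) (Icc (-1) 1) := by
  have h1 : ContinuousOn (reflect E) (Icc 0 1) :=
    hE.congr fun r hr => reflect_of_nonneg hr.1
  have h2 : ContinuousOn (reflect E) (Icc (-1) 0) := by
    have : ContinuousOn (fun r => conj (reflect E (-r))) (Icc (-1) 0) := by
      refine Complex.continuous_conj.comp_continuousOn (h1.comp continuousOn_neg ?_)
      intro r hr
      exact ⟨by linarith [hr.2], by linarith [hr.1]⟩
    refine this.congr fun r _ => ?_
    change _ = conj (reflect E (-r))
    rw [reflect_neg h0, Complex.conj_conj]
  have := h2.union_of_isClosed h1 isClosed_Icc isClosed_Icc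
  rwa [Icc_union_Icc_eq_Icc (by norm_num) (by norm_num)] at this

theorem hasDerivAt_conj_neg {F : ℝ → ℂ} {F' : ℂ} {r : ℝ} (h : HasDerivAt F F' (-r)) :
    HasDerivAt (fun r => conj (F (-r))) (-conj F') r := by
  have h1 : HasDerivAt (fun r : ℝ => F (-r)) ((-1 : ℝ) • F') r :=
    h.scomp r (hasDerivAt_neg r)
  have h2 := h1.star
  simpa using h2

theorem continuousOn_reflectDeriv {D : ℝ → ℂ} {d : ℂ} (hd : d.re = 0)
    (hDc : ContinuousOn D (Ioo 0 1)) (hlim : Tendsto D (𝓝[>] 0) (𝓝 d)) :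
    ContinuousOn (reflectDeriv d D) (Ioo (-1) 1) := by
  have hpos : ∀ r ∈ Ioo (0 : ℝ) 1, ContinuousAt (reflectDeriv d D) r := by
    intro r hr
    refine (hDc.continuousAt (Ioo_mem_nhds hr.1 hr.2)).congr ?_
    filter_upwards [lt_mem_nhds hr.1] with s hs
    exact (reflectDeriv_of_pos hs).symm
  have hlimP : Tendsto (reflectDeriv d D) (𝓝[>] 0) (𝓝 d) := by
    refine hlim.congr' ?_
    filter_upwards [self_mem_nhdsWithin] with s hs
    exact (reflectDeriv_of_pos hs).symm
  have hsymm : reflectDeriv d D = fun r => -conj (reflectDeriv d D (-r)) := by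
    funext r
    rw [reflectDeriv_neg hd]
    simp
  intro r hr
  refine ContinuousAt.continuousWithinAt ?_
  rcases lt_trichotomy r 0 with h | rfl | h
  · rw [hsymm]
    have := hpos (-r) ⟨by linarith, by linarith [hr.1]⟩
    exact (Complex.continuous_conj.continuousAt.comp
      (this.comp (f := fun r : ℝ => -r) continuous_neg.continuousAt)).neg
  · rw [continuousAt_iff_punctured_nhds, ← nhdsLT_sup_nhdsGT, tendsto_sup]
    have hd0 : reflectDeriv d D 0 = d := if_pos rfl
    rw [hd0]
    refine ⟨?_, hlimP⟩
    rw [hsymm]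
    have hneg : Tendsto (fun r : ℝ => -r) (𝓝[<] 0) (𝓝[>] 0) := by
      have := tendsto_neg_nhdsLT (a := (0 : ℝ))
      rwa [neg_zero] at this
    have h3 := (Complex.continuous_conj.tendsto d).comp (hlimP.comp hneg)
    have hd' : -conj d = d := by apply Complex.ext <;> simp [hd]
    have h4 := h3.neg
    rw [hd'] at h4
    exact h4
  · exact hpos r ⟨h, hr.2⟩

/-- At parameter 0 the one-sided derivatives are limits of nearby derivatives. They agree because d
is purely imaginary, so that −d̄ = d. -/
theorem hasDerivAt_reflect {E D : ℝ → ℂ} {d : ℂ} (hE : ContinuousOn E (Icc 0 1))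
    (h0 : (E 0).im = 0) (hD : ∀ r ∈ Ioo (0 : ℝ) 1, HasDerivAt E (D r) r)
    (hlim : Tendsto D (𝓝[>] 0) (𝓝 d)) (hd : d.re = 0) (hDc : ContinuousOn D (Ioo 0 1)) :
    ∀ r ∈ Ioo (-1 : ℝ) 1, HasDerivAt (reflect E) (reflectDeriv d D r) r := by
  have hpos : ∀ r ∈ Ioo (0 : ℝ) 1, HasDerivAt (reflect E) (reflectDeriv d D r) r := by
    intro r hr
    rw [reflectDeriv_of_pos hr.1]
    refine (hD r hr).congr_of_eventuallyEq ?_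
    filter_upwards [lt_mem_nhds hr.1] with s hs using reflect_of_nonneg hs.le
  have hneg : ∀ r ∈ Ioo (-1 : ℝ) 0, HasDerivAt (reflect E) (reflectDeriv d D r) r := by
    intro r hr
    have h1 := hasDerivAt_conj_neg (hpos (-r) ⟨by linarith [hr.2], by linarith [hr.1]⟩)
    have h2 : (fun r => conj (reflect E (-r))) = reflect E := by
      funext s
      rw [reflect_neg h0, Complex.conj_conj]
    rw [h2, reflectDeriv_neg hd] at h1
    simpa using h1
  intro r hr
  rcases lt_trichotomy r 0 with h | rfl | h
  · exact hneg r ⟨hr.1, h⟩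
  · have hc : ContinuousAt (reflect E) 0 :=
      (continuousOn_reflect hE h0).continuousAt (Icc_mem_nhds (by norm_num) (by norm_num))
    have hDc0 := (continuousOn_reflectDeriv hd hDc hlim).continuousAt
      (Ioo_mem_nhds hr.1 hr.2)
    have hr1 : HasDerivWithinAt (reflect E) (reflectDeriv d D 0) (Ici 0) 0 := by
      refine hasDerivWithinAt_Ici_of_tendsto_deriv (s := Ioo 0 1) (fun s hs =>
        (hpos s hs).differentiableAt.differentiableWithinAt) hc.continuousWithinAt
        (Ioo_mem_nhdsGT one_pos) ((hDc0.tendsto.mono_left nhdsWithin_le_nhds).congr' ?_)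
      filter_upwards [Ioo_mem_nhdsGT (one_pos : (0:ℝ) < 1)] with s hs using (hpos s hs).deriv.symm
    have hr2 : HasDerivWithinAt (reflect E) (reflectDeriv d D 0) (Iic 0) 0 := by
      refine hasDerivWithinAt_Iic_of_tendsto_deriv (s := Ioo (-1) 0) (fun s hs =>
        (hneg s hs).differentiableAt.differentiableWithinAt) hc.continuousWithinAt
        (Ioo_mem_nhdsLT (by norm_num)) ((hDc0.tendsto.mono_left nhdsWithin_le_nhds).congr' ?_)
      filter_upwards [Ioo_mem_nhdsLT (by norm_num : (-1:ℝ) < 0)] with s hs using (hneg s hs).deriv.symm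
    have := hr2.union hr1
    rwa [Iic_union_Ici, hasDerivWithinAt_univ] at this
  · exact hpos r ⟨h, hr.2⟩

/-- A path in the uniformizing plane from `-i` to `i`, symmetric under complex conjugation, whose
second half lies in the upper half-plane. -/
structure SymPath (F D : ℝ → ℂ) : Prop where
  continuousOn : ContinuousOn F (Icc (-1) 1)
  symm : ∀ r, F (-r) = conj (F r)
  deriv_symm : ∀ r, D (-r) = -conj (D r)
  one : F 1 = Complex.I
  zero_ne : F 0 ≠ 0
  im_pos : ∀ r ∈ Ioc (0 : ℝ) 1, 0 < (F r).im
  hasDeriv : ∀ r ∈ Ioo (-1 : ℝ) 1, HasDerivAt F (D r) r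
  contD : ContinuousOn D (Ioo (-1) 1)
  D_ne : ∀ r ∈ Ioo (-1 : ℝ) 1, D r ≠ 0
  bdd : ∃ B, ∀ r ∈ Ioo (-1 : ℝ) 1, ‖D r‖ ≤ B

theorem IsLift.hasDerivAt {g : ℂ → ℂ} {δ g' : ℂ} {J : Set ℝ} {W : ℝ → ℂ} (h : IsLift g δ J W)
    (hJ : IsOpen J) {τ : ℝ} (hτ : τ ∈ J) (hg : HasStrictDerivAt g g' (W τ)) (h0 : g' ≠ 0) :
    HasDerivAt W (δ / g') τ := by
  obtain ⟨u, -, hu, hud, -⟩ := exists_local_inverse hg h0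
  have hc : ContinuousAt W τ := h.continuousOn.continuousAt (hJ.mem_nhds hτ)
  have h1 : HasDerivAt (fun v : ℂ => u (δ * v)) (g'⁻¹ * δ) (τ : ℂ) := by
    have h2 : HasDerivAt (fun v : ℂ => δ * v) δ (τ : ℂ) := by
      simpa using (hasDerivAt_id (τ : ℂ)).const_mul δ
    have h3 := hud.hasDerivAt
    rw [h.eq τ hτ] at h3
    exact h3.comp (τ : ℂ) h2
  have h4 := h1.comp_ofReal
  rw [mul_comm, ← div_eq_mul_inv] at h4
  refine h4.congr_of_eventuallyEq ?_
  filter_upwards [hc.eventually hu, hJ.mem_nhds hτ] with σ hσ hσJ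
  rw [← h.eq σ hσJ, hσ]

theorem exists_bound_of_ends {D : ℝ → ℂ} (hD : ContinuousOn D (Ioo 0 1)) {B₀ B₁ : ℝ}
    (h0 : ∀ᶠ r in 𝓝[>] (0 : ℝ), ‖D r‖ ≤ B₀) (h1 : ∀ᶠ r in 𝓝[<] (1 : ℝ), ‖D r‖ ≤ B₁) :
    ∃ B, ∀ r ∈ Ioo (0 : ℝ) 1, ‖D r‖ ≤ B := by
  obtain ⟨u, hu, hu'⟩ := mem_nhdsGT_iff_exists_Ioo_subset.1 h0
  obtain ⟨v, hv, hv'⟩ := mem_nhdsLT_iff_exists_Ioo_subset.1 h1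
  have hu0 : (0 : ℝ) < u := hu
  have hv1 : v < (1 : ℝ) := hv
  have hmin : 0 < min u 1 / 2 := by positivity
  have hmax : max v 0 < 1 := max_lt hv1 one_pos
  obtain ⟨B, hB⟩ := isCompact_Icc.exists_bound_of_continuousOn
    (hD.mono (s := Ioo 0 1) (t := Icc (min u 1 / 2) ((max v 0 + 1) / 2)) (fun r hr =>
      ⟨hmin.trans_le hr.1, by linarith [hr.2]⟩))
  refine ⟨max B (max B₀ B₁), fun r hr => ?_⟩
  by_cases h2 : r < min u 1 / 2
  · refine (hu' ⟨hr.1, ?_⟩ : ‖D r‖ ≤ B₀).trans ((le_max_left _ _).trans (le_max_right _ _))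
    linarith [min_le_left u 1]
  by_cases h3 : (max v 0 + 1) / 2 < r
  · refine (hv' ⟨?_, hr.2⟩ : ‖D r‖ ≤ B₁).trans ((le_max_right _ _).trans (le_max_right _ _))
    linarith [le_max_left v 0]
  · exact (hB r ⟨not_lt.1 h2, not_lt.1 h3⟩).trans (le_max_left _ _)

namespace Config

variable {t γ a : ℝ} (C : Config t γ a)

/-- Near `i`, `g` vanishes to third order and its derivative exactly to second order. -/
theorem exists_bounds_near_I : ∃ c > 0, ∃ M > 0, ∀ᶠ w in 𝓝 Complex.I,
    ‖C.g w‖ ≤ M * ‖w - Complex.I‖ ^ 3 ∧ c * ‖w - Complex.I‖ ^ 2 ≤ ‖C.f w‖ := by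
  have hn := C.ne_pts_of_im_pos (w := Complex.I) (by simp)
  obtain ⟨k, hk, hkI, hgk⟩ := exists_factor_of_deriv (C.analyticAt_g (by simp) hn) C.analyticAt_cofI
    C.cofI_ne C.deriv_g_near_I
  have h1 : ∀ᶠ w in 𝓝 Complex.I, ‖k w‖ < ‖k Complex.I‖ + 1 :=
    hk.continuousAt.norm.eventually (gt_mem_nhds (by simp))
  have hc : 0 < ‖C.cofI Complex.I‖ / 2 := by
    have := norm_pos_iff.2 C.cofI_ne
    positivity
  have h2 : ∀ᶠ w in 𝓝 Complex.I, ‖C.cofI Complex.I‖ / 2 < ‖C.cofI w‖ :=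
    C.analyticAt_cofI.continuousAt.norm.eventually (lt_mem_nhds (by linarith))
  refine ⟨_, hc, ‖k Complex.I‖ + 1, by positivity, ?_⟩
  filter_upwards [h1, h2, hgk, C.deriv_g_near_I, C.eventually_deriv_g (by simp) hn]
    with w h1 h2 h3 h4 h5
  constructor
  · rw [h3, C.g_I, zero_add, norm_mul, norm_pow, mul_comm]
    gcongr
  · rw [← h5.deriv, h4, norm_mul, norm_pow, mul_comm]
    gcongr

theorem f_ne_zero_of_im_pos {w : ℂ} (h : 0 < w.im) (hI : w ≠ Complex.I) : C.f w ≠ 0 :=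
  C.f_ne_zero h.le (C.ne_pts_of_im_pos h) hI (ne_ofReal_of_im_pos h _) (ne_ofReal_of_im_pos h _)

/-- A lift between `i` and a real point, traversed with speed vanishing to third order at `i`,
extends to a symmetric path. -/
theorem exists_symPath {δ d q : ℂ} {T : ℝ} {W : ℝ → ℂ} {b b' : ℝ → ℝ} (hT : 0 < T)
    (hδ : ‖δ‖ = 1)
    (hW : IsLift C.g δ (Ioo 0 T) W) (hW0 : Tendsto W (𝓝[>] 0) (𝓝 Complex.I))
    (hWT : Tendsto W (𝓝[<] T) (𝓝 q)) (hq : q.im = 0) (hq0 : q ≠ 0)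
    (hb : ∀ r, HasDerivAt b (b' r) r) (hb' : Continuous b') (hb'neg : ∀ r ∈ Ioo (0 : ℝ) 1, b' r < 0)
    (hb0 : b 0 = 1) (hb1 : b 1 = 0) (hbI : ∀ r ∈ Ioo (0 : ℝ) 1, b r ∈ Ioo (0 : ℝ) 1)
    (hlim : Tendsto (fun r => δ * ((T * (3 * b r ^ 2 * b' r) : ℝ) : ℂ) / C.f (W (T * b r ^ 3)))
      (𝓝[>] 0) (𝓝 d)) (hd : d.re = 0) (hd0 : d ≠ 0) :
    ∃ F D : ℝ → ℂ, SymPath F D ∧ F 0 = q ∧ D 0 = d ∧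
      (∀ r ∈ Ioc (0 : ℝ) 1, C.g (F r) = δ * ((T * b r ^ 3 : ℝ) : ℂ)) ∧
      ∀ r ∈ Ioo (0 : ℝ) 1, C.f (F r) * D r = δ * ((T * (3 * b r ^ 2 * b' r) : ℝ) : ℂ) := by
  have hδ0 : δ ≠ 0 := by
    rw [← norm_pos_iff, hδ]
    exact one_pos
  set τ : ℝ → ℝ := fun r => T * b r ^ 3 with hτdef
  set E₀ : ℝ → ℂ := fun r => W (τ r) with hE₀
  set D : ℝ → ℂ := fun r => δ * ((T * (3 * b r ^ 2 * b' r) : ℝ) : ℂ) / C.f (E₀ r) with hDdef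
  have hbc : Continuous b := continuous_iff_continuousAt.2 fun r => (hb r).continuousAt
  have hτc : Continuous τ := continuous_const.mul (hbc.pow 3)
  have hτI : ∀ r ∈ Ioo (0 : ℝ) 1, τ r ∈ Ioo 0 T := by
    intro r hr
    obtain ⟨h1, h2⟩ := hbI r hr
    refine ⟨by positivity, ?_⟩
    have : b r ^ 3 < 1 := pow_lt_one₀ h1.le h2 (by norm_num)
    calc T * b r ^ 3 < T * 1 := by gcongr
      _ = T := mul_one T
  have him : ∀ r ∈ Ioo (0 : ℝ) 1, 0 < (E₀ r).im := fun r hr => hW.im_pos _ (hτI r hr)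
  have hgE : ∀ r ∈ Ioo (0 : ℝ) 1, C.g (E₀ r) = δ * (τ r : ℂ) := fun r hr => hW.eq _ (hτI r hr)
  have hneI : ∀ r ∈ Ioo (0 : ℝ) 1, E₀ r ≠ Complex.I := by
    intro r hr h
    have := hgE r hr
    rw [h, C.g_I] at this
    have h2 : (τ r : ℂ) ≠ 0 := by exact_mod_cast (hτI r hr).1.ne'
    exact mul_ne_zero hδ0 h2 this.symm
  have hf : ∀ r ∈ Ioo (0 : ℝ) 1, C.f (E₀ r) ≠ 0 := fun r hr =>
    C.f_ne_zero_of_im_pos (him r hr) (hneI r hr)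
  have hτd : ∀ r, HasDerivAt τ (T * (3 * b r ^ 2 * b' r)) r := by
    intro r
    have := ((hb r).pow 3).const_mul T
    simpa using this
  have hE₀d : ∀ r ∈ Ioo (0 : ℝ) 1, HasDerivAt E₀ (D r) r := by
    intro r hr
    have h1 := hW.hasDerivAt isOpen_Ioo (hτI r hr)
      (C.hasStrictDerivAt_g (him r hr).le (C.ne_pts_of_im_pos (him r hr))) (hf r hr)
    have h2 := h1.scomp r (hτd r)
    refine h2.congr_deriv ?_
    simp only [hDdef, Complex.real_smul]
    ring
  have hE₀c : ContinuousOn E₀ (Ioo 0 1) := fun r hr =>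
    (hE₀d r hr).continuousAt.continuousWithinAt
  have hlim0 : Tendsto E₀ (𝓝[>] 0) (𝓝 q) := by
    refine hWT.comp (tendsto_nhdsWithin_iff.2 ⟨?_, ?_⟩)
    · have : τ 0 = T := by simp [hτdef, hb0]
      rw [← this]
      exact hτc.continuousAt.tendsto.mono_left nhdsWithin_le_nhds
    · filter_upwards [Ioo_mem_nhdsGT (one_pos : (0:ℝ) < 1)] with r hr using (hτI r hr).2
  have hlim1 : Tendsto E₀ (𝓝[<] 1) (𝓝 Complex.I) := by
    refine hW0.comp (tendsto_nhdsWithin_iff.2 ⟨?_, ?_⟩)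
    · have : τ 1 = 0 := by simp [hτdef, hb1]
      rw [← this]
      exact hτc.continuousAt.tendsto.mono_left nhdsWithin_le_nhds
    · filter_upwards [Ioo_mem_nhdsLT (one_pos : (0:ℝ) < 1)] with r hr using (hτI r hr).1
  -- The lift lives on an open interval only; its limits i and q are filled in as end values.
  set E := extendFrom (Ioo 0 1) E₀ with hEdef
  have hE : ContinuousOn E (Icc 0 1) := continuousOn_Icc_extendFrom_Ioo hE₀c hlim0 hlim1
  have hE0 : E 0 = q := eq_lim_at_left_extendFrom_Ioo one_pos hlim0
  have hE1 : E 1 = Complex.I := eq_lim_at_right_extendFrom_Ioo one_pos hlim1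
  have hEE : ∀ r ∈ Ioo (0 : ℝ) 1, E r = E₀ r := extendFrom_extends hE₀c
  have h0 : (E 0).im = 0 := by rw [hE0, hq]
  have hEd : ∀ r ∈ Ioo (0 : ℝ) 1, HasDerivAt E (D r) r := by
    intro r hr
    refine (hE₀d r hr).congr_of_eventuallyEq ?_
    filter_upwards [Ioo_mem_nhds hr.1 hr.2] with s hs using hEE s hs
  have hDc : ContinuousOn D (Ioo 0 1) := by
    intro r hr
    refine ContinuousWithinAt.div ?_ ?_ (hf r hr)
    · exact (by fun_prop : Continuous fun r => δ * ((T * (3 * b r ^ 2 * b' r) : ℝ) : ℂ)).continuousWithinAt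
    · exact ((C.continuousAt_f (C.ne_pts_of_im_pos (him r hr))).comp
        (hE₀d r hr).continuousAt).continuousWithinAt
  have hDne : ∀ r ∈ Ioo (0 : ℝ) 1, D r ≠ 0 := by
    intro r hr
    refine div_ne_zero (mul_ne_zero hδ0 ?_) (hf r hr)
    have h1 := (hbI r hr).1
    have h2 := hb'neg r hr
    have : T * (3 * b r ^ 2 * b' r) ≠ 0 :=
      mul_ne_zero hT.ne' (mul_ne_zero (by positivity) h2.ne)
    exact_mod_cast this
  -- This is why time is T·b³. From |g| = T·b³ ≤ M|w − i|³ one gets b = O(|w − i|), so b²b'/f stays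
  -- bounded against the double zero of f at i.
  have hbound1 : ∃ B, ∀ᶠ r in 𝓝[<] (1 : ℝ), ‖D r‖ ≤ B := by
    obtain ⟨c, hc, M, hM, hev⟩ := C.exists_bounds_near_I
    obtain ⟨B', hB'⟩ := isCompact_Icc.exists_bound_of_continuousOn
      (hb'.continuousOn (s := Icc (0 : ℝ) 1))
    set m := max 1 (M / T) with hm
    have hm1 : 1 ≤ m := le_max_left _ _
    refine ⟨T * (3 * (m ^ 2 * B')) / c, ?_⟩
    filter_upwards [hlim1.eventually hev, Ioo_mem_nhdsLT (one_pos : (0:ℝ) < 1)] with r ⟨h1, h2⟩ hr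
    have hbr := (hbI r hr).1
    have hx : 0 < ‖E₀ r - Complex.I‖ := norm_pos_iff.2 (sub_ne_zero.2 (hneI r hr))
    set x := ‖E₀ r - Complex.I‖ with hxdef
    have h3 : b r ≤ m * x := by
      rw [hgE r hr, norm_mul, hδ, one_mul, Complex.norm_real, Real.norm_of_nonneg (hτI r hr).1.le] at h1
      have h4 : b r ^ 3 ≤ (m * x) ^ 3 := by
        have h5 : b r ^ 3 ≤ M / T * x ^ 3 := by
          rw [div_mul_eq_mul_div, le_div_iff₀ hT, mul_comm]
          exact h1
        refine h5.trans ?_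
        rw [mul_pow]
        gcongr
        exact (le_max_right _ _).trans (le_self_pow₀ hm1 (by norm_num))
      exact le_of_pow_le_pow_left₀ (by norm_num) (by positivity) h4
    have h6 : ‖D r‖ = T * (3 * (b r ^ 2 * |b' r|)) / ‖C.f (E₀ r)‖ := by
      simp only [hDdef]
      rw [norm_div, norm_mul, hδ, one_mul, Complex.norm_real, Real.norm_eq_abs, abs_mul, abs_mul,
        abs_mul, abs_of_pos hT, abs_of_pos (by positivity : (0:ℝ) < 3), abs_of_pos (by positivity : 0 < b r ^ 2)]
      ring_nf
    have h7 : |b' r| ≤ B' := hB' r ⟨hr.1.le, hr.2.le⟩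
    have hB'0 : 0 ≤ B' := (abs_nonneg _).trans h7
    rw [h6, div_le_div_iff₀ (norm_pos_iff.2 (hf r hr)) hc]
    calc T * (3 * (b r ^ 2 * |b' r|)) * c ≤ T * (3 * ((m * x) ^ 2 * B')) * c := by gcongr
      _ = T * (3 * (m ^ 2 * B')) * (c * x ^ 2) := by ring
      _ ≤ _ := by gcongr
  obtain ⟨B₁, hB₁⟩ := hbound1
  have hbound0 : ∀ᶠ r in 𝓝[>] (0 : ℝ), ‖D r‖ ≤ ‖d‖ + 1 :=
    (hlim.norm.eventually (gt_mem_nhds (by linarith : ‖d‖ < ‖d‖ + 1))).mono fun r hr => hr.le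
  obtain ⟨B, hB⟩ := exists_bound_of_ends hDc hbound0 hB₁
  refine ⟨reflect E, reflectDeriv d D, ⟨continuousOn_reflect hE h0, reflect_neg h0,
    reflectDeriv_neg hd D, ?_, ?_, ?_, hasDerivAt_reflect hE h0 hEd hlim hd hDc,
    continuousOn_reflectDeriv hd hDc hlim, ?_, max B ‖d‖, ?_⟩, ?_, if_pos rfl, ?_, ?_⟩
  · rw [reflect_of_nonneg zero_le_one, hE1]
  · rwa [reflect_of_nonneg le_rfl, hE0]
  · intro r hr
    rw [reflect_of_nonneg hr.1.le]
    rcases hr.2.lt_or_eq with h | rfl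
    · rw [hEE r ⟨hr.1, h⟩]
      exact him r ⟨hr.1, h⟩
    · rw [hE1]; simp
  · intro r hr
    rcases lt_trichotomy r 0 with h | rfl | h
    · have h1 := reflectDeriv_neg hd D r
      rw [reflectDeriv_of_pos (by linarith)] at h1
      intro h2
      rw [h2] at h1
      exact hDne (-r) ⟨by linarith, by linarith [hr.1]⟩ (by simpa using h1)
    · rwa [reflectDeriv, if_pos rfl]
    · rw [reflectDeriv_of_pos h]
      exact hDne r ⟨h, hr.2⟩
  · intro r hr
    rcases lt_trichotomy r 0 with h | rfl | h
    · have h1 := reflectDeriv_neg hd D (-r)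
      rw [neg_neg, reflectDeriv_of_pos (r := -r) (by linarith)] at h1
      rw [h1, norm_neg, RCLike.norm_conj]
      exact (hB (-r) ⟨by linarith, by linarith [hr.1]⟩).trans (le_max_left _ _)
    · rw [reflectDeriv, if_pos rfl]
      exact le_max_right _ _
    · rw [reflectDeriv_of_pos h]
      exact (hB r ⟨h, hr.2⟩).trans (le_max_left _ _)
  · rw [reflect_of_nonneg le_rfl, hE0]
  · intro r hr
    rw [reflect_of_nonneg hr.1.le]
    rcases hr.2.lt_or_eq with h | rfl
    · rw [hEE r ⟨hr.1, h⟩, hgE r ⟨hr.1, h⟩]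
    · rw [hE1, C.g_I, hb1]; simp
  · intro r hr
    rw [reflect_of_nonneg hr.1.le, reflectDeriv_of_pos hr.1, hEE r hr]
    exact mul_div_cancel₀ _ (hf r hr)

end Config

theorem poleSum_conj {ι : Type*} [Fintype ι] (x c : ι → ℝ) (w : ℂ) :
    poleSum x c (conj w) = conj (poleSum x c w) := by
  simp [poleSum, map_sum, map_div₀]

namespace Config

variable {t γ a : ℝ} (C : Config t γ a)

theorem f_conj (w : ℂ) : C.f (conj w) = conj (C.f w) := poleSum_conj _ _ w

/-- The values of `f(F) dF` on a symmetric path at negative parameters. -/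
theorem f_mul_neg {F D : ℝ → ℂ} (h : SymPath F D) (r : ℝ) :
    C.f (F (-r)) * D (-r) = -conj (C.f (F r) * D r) := by
  rw [h.symm, h.deriv_symm, C.f_conj, map_mul]
  ring

/-- The symmetric path over `Γ₁`. -/
theorem exists_path₁ : ∃ T > 0, ∃ F D : ℝ → ℂ, SymPath F D ∧
    (∃ q : ℝ, F 0 = q ∧ q ∈ Ioo (C.lo 0 C.s₀) 0) ∧
    (∀ r ∈ Ioc (0 : ℝ) 1, C.g (F r) = Complex.I * ((T * (1 - r) ^ 3 : ℝ) : ℂ)) ∧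
    ∀ r ∈ Ioo (-1 : ℝ) 1, C.f (F r) * D r = -((3 * T * (1 - |r|) ^ 2 : ℝ) : ℂ) * Complex.I := by
  obtain ⟨T, hT, W, q, hW, hW0, hWT, hq, hgq⟩ := C.exists_lift_Γ₁
  obtain ⟨o1, o2, o3, o4, o5, o6, o7, o8⟩ := C.order
  have hne : ∀ j, q ≠ C.pts j := by
    rw [C.forall_pts (P := fun x => q ≠ x)]
    obtain ⟨h1, h2⟩ := hq
    refine ⟨?_, ?_, ?_, ?_, ?_, ?_, ?_⟩ <;> intro h <;> linarith
  have hne' : ∀ j, (q : ℂ) ≠ C.pts j := fun j h => hne j (by exact_mod_cast h)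
  have hf : C.f q ≠ 0 := by
    refine C.f_ne_zero (by simp) hne' (fun h => ?_) (fun h => ?_) (fun h => ?_)
    · have := congrArg Complex.im h
      simp at this
    · have : q = C.y₁ := by exact_mod_cast h
      linarith [hq.1]
    · have : q = C.y₂ := by exact_mod_cast h
      linarith [hq.2]
  have him : (C.f q).im = 0 := poleSum_ofReal_im C.pts C.res q
  obtain ⟨ρ, hρ⟩ : ∃ ρ : ℝ, C.f q = ρ := ⟨(C.f q).re, Complex.ext (by simp) (by simpa using him)⟩
  set d : ℂ := Complex.I * ((-3 * T : ℝ) : ℂ) / C.f q with hd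
  have hd' : d = ((-3 * T / ρ : ℝ) : ℂ) * Complex.I := by
    rw [hd, hρ]
    push_cast
    ring
  have hb : ∀ r : ℝ, HasDerivAt (fun r : ℝ => 1 - r) (-1) r := fun r => by
    simpa using (hasDerivAt_id r).const_sub 1
  -- The end point q is not critical, so the linear choice b = 1 − r already gives a nonzero speed
  -- at r = 0.
  obtain ⟨F, D, hF, hF0, hD0, hg, hfD⟩ := C.exists_symPath (d := d) (b := fun r => 1 - r)
    (b' := fun _ => -1) hT (by simp) hW hW0 hWT (by simp)
    (by exact_mod_cast hq.2.ne) hb continuous_const (fun r _ => by norm_num) (by norm_num) (by norm_num)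
    (fun r hr => ⟨by linarith [hr.2], by linarith [hr.1]⟩)
    (by
      refine Tendsto.div ?_ ?_ hf
      · have : Continuous fun r : ℝ => Complex.I * ((T * (3 * (1 - r) ^ 2 * (-1)) : ℝ) : ℂ) := by
          fun_prop
        have h := this.tendsto 0
        have e : T * (3 * (1 - (0:ℝ)) ^ 2 * (-1)) = -3 * T := by ring
        rw [e] at h
        exact h.mono_left nhdsWithin_le_nhds
      · refine (C.continuousAt_f hne').tendsto.comp (hWT.comp (tendsto_nhdsWithin_iff.2 ⟨?_, ?_⟩))
        · have : Continuous fun r : ℝ => T * (1 - r) ^ 3 := by fun_prop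
          have h := this.tendsto 0
          simp only [sub_zero, one_pow, mul_one] at h
          exact h.mono_left nhdsWithin_le_nhds
        · filter_upwards [Ioo_mem_nhdsGT (one_pos : (0:ℝ) < 1)] with r hr
          have h1 : (1 - r) ^ 3 < 1 := pow_lt_one₀ (by linarith [hr.2]) (by linarith [hr.1]) (by norm_num)
          have : T * (1 - r) ^ 3 < T * 1 := by gcongr
          simpa using this)
    (by rw [hd', Complex.re_ofReal_mul, Complex.I_re, mul_zero]) (by
      rw [hd]
      refine div_ne_zero (mul_ne_zero Complex.I_ne_zero ?_) hf
      have : -3 * T ≠ 0 := by nlinarith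
      exact_mod_cast this)
  have hpos : ∀ r ∈ Ioo (0 : ℝ) 1,
      C.f (F r) * D r = -((3 * T * (1 - |r|) ^ 2 : ℝ) : ℂ) * Complex.I := by
    intro r hr
    rw [hfD r hr, abs_of_pos hr.1]
    push_cast
    ring
  refine ⟨T, hT, F, D, hF, ⟨q, hF0, hq⟩, hg, fun r hr => ?_⟩
  rcases lt_trichotomy r 0 with h | rfl | h
  · have h1 := C.f_mul_neg hF (-r)
    rw [neg_neg, hpos (-r) ⟨by linarith, by linarith [hr.1]⟩, abs_neg] at h1
    rw [h1, map_mul, map_neg, Complex.conj_ofReal, Complex.conj_I]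
    ring
  · rw [hF0, hD0, hd, mul_div_cancel₀ _ hf]
    push_cast
    simp
    ring
  · exact hpos r ⟨h, hr.2⟩

/-- The symmetric path over `Γ₂`. -/
theorem exists_path₂ : ∃ T > 0, ∃ F D : ℝ → ℂ, SymPath F D ∧ F 0 = C.y₁ ∧
    (∀ r ∈ Ioc (0 : ℝ) 1, C.g (F r) = -((T * (1 - r ^ 2) ^ 3 : ℝ) : ℂ)) ∧
    ∀ r ∈ Ioo (-1 : ℝ) 1, C.f (F r) * D r = ((6 * T * r * (1 - r ^ 2) ^ 2 : ℝ) : ℂ) := by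
  obtain ⟨T, hT, W, hW, hW0, hWT, hgy⟩ := C.exists_lift_Γ₂
  obtain ⟨φ, φ', hφd, hφc, hφre, hφim, hφ0, hgφ, -, hφpos⟩ := C.exists_sqrt_y₁
  have hy : C.y₁ < 0 := by
    obtain ⟨o1, o2, o3, o4, -⟩ := C.order
    linarith
  have hφr : φ' C.y₁ = ((φ' C.y₁).re : ℂ) := Complex.ext (by simp) (by simpa using hφim)
  have hφne : φ' C.y₁ ≠ 0 := fun h => by rw [h] at hφre; simp at hφre
  have h3T : 0 < √(3 * T) := Real.sqrt_pos.2 (by positivity)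
  -- Since T − T(1 − r²)³ = r²·m(r)², the square root coordinate on the path is i·r·m(r). The choice
  -- b = 1 − r² compensates for the simple critical point at y₁.
  set m : ℝ → ℝ := fun r => √(T * (3 - 3 * r ^ 2 + r ^ 4)) with hm
  have hmc : Continuous m := by fun_prop
  have hm0 : m 0 = √(3 * T) := by simp [hm, mul_comm]
  set d : ℂ := ((3 * T / √(3 * T) / (φ' C.y₁).re : ℝ) : ℂ) * Complex.I with hd
  have hτ : Tendsto (fun r : ℝ => T * (1 - r ^ 2) ^ 3) (𝓝[>] 0) (𝓝[<] T) := by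
    refine tendsto_nhdsWithin_iff.2 ⟨?_, ?_⟩
    · have : Continuous fun r : ℝ => T * (1 - r ^ 2) ^ 3 := by fun_prop
      have h := this.tendsto 0
      simp only [ne_eq, OfNat.ofNat_ne_zero, not_false_eq_true, zero_pow, sub_zero, one_pow,
        mul_one] at h
      exact h.mono_left nhdsWithin_le_nhds
    · filter_upwards [Ioo_mem_nhdsGT (one_pos : (0:ℝ) < 1)] with r hr
      have h0 : 0 < r ^ 2 := pow_pos hr.1 2
      have h2 : r ^ 2 < 1 := pow_lt_one₀ hr.1.le hr.2 (by norm_num)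
      have h1 : (1 - r ^ 2) ^ 3 < 1 := pow_lt_one₀ (by linarith) (by linarith) (by norm_num)
      have : T * (1 - r ^ 2) ^ 3 < T * 1 := by gcongr
      simpa using this
  have hE := hWT.comp hτ
  have hfφ : ∀ᶠ w in 𝓝 (C.y₁ : ℂ), C.f w = -2 * φ w * φ' w := by
    have hn : ∀ j, (C.y₁ : ℂ) ≠ C.pts j := fun j h => C.y₁_ne j (by exact_mod_cast h)
    filter_upwards [hgφ.eventually_nhds, hφd, C.eventually_deriv_g (by simp) hn] with w h1 h2 h3
    have h4 : HasDerivAt (fun w => C.g C.y₁ - φ w ^ 2) (-(2 * φ w * φ' w)) w := by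
      have := (h2.hasDerivAt.pow 2).const_sub (C.g C.y₁)
      simpa using this
    rw [h3.unique (h4.congr_of_eventuallyEq h1)]
    ring
  have hlim : Tendsto (fun r => (-1 : ℂ) * ((T * (3 * (1 - r ^ 2) ^ 2 * (-2 * r)) : ℝ) : ℂ) /
      C.f (W (T * (1 - r ^ 2) ^ 3))) (𝓝[>] 0) (𝓝 d) := by
    have h1 : Tendsto (fun r : ℝ => ((3 * T * (1 - r ^ 2) ^ 2 : ℝ) : ℂ) * Complex.I /
        ((m r : ℂ) * φ' (W (T * (1 - r ^ 2) ^ 3)))) (𝓝[>] 0) (𝓝 d) := by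
      have e : d = ((3 * T * (1 - (0:ℝ) ^ 2) ^ 2 : ℝ) : ℂ) * Complex.I / ((m 0 : ℂ) * φ' C.y₁) := by
        rw [hd, hm0, hφr]
        push_cast
        ring_nf
        simp
        ring
      rw [e]
      refine Tendsto.div ?_ ?_ ?_
      · have : Continuous fun r : ℝ => ((3 * T * (1 - r ^ 2) ^ 2 : ℝ) : ℂ) * Complex.I := by fun_prop
        exact (this.tendsto 0).mono_left nhdsWithin_le_nhds
      · refine Tendsto.mul ?_ (hφc.tendsto.comp hE)
        exact ((Complex.continuous_ofReal.comp hmc).tendsto 0).mono_left nhdsWithin_le_nhds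
      · refine mul_ne_zero ?_ hφne
        rw [hm0]
        exact_mod_cast h3T.ne'
    refine h1.congr' ?_
    filter_upwards [hE.eventually hfφ, hE.eventually hgφ, hE.eventually hφpos,
      hE.eventually (hφc.eventually_ne hφne), Ioo_mem_nhdsGT (one_pos : (0:ℝ) < 1)] with r e1 e2 e3 e4 hr
    simp only [Function.comp] at e1 e2 e3 e4
    set w := W (T * (1 - r ^ 2) ^ 3) with hw
    have h2 : r ^ 2 < 1 := pow_lt_one₀ hr.1.le hr.2 (by norm_num)
    have hτI : T * (1 - r ^ 2) ^ 3 ∈ Ioo 0 T := by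
      have h0 : 0 < r ^ 2 := pow_pos hr.1 2
      have h3 : 0 < 1 - r ^ 2 := by linarith
      have h1 : (1 - r ^ 2) ^ 3 < 1 := pow_lt_one₀ h3.le (by linarith) (by norm_num)
      refine ⟨by positivity, ?_⟩
      have : T * (1 - r ^ 2) ^ 3 < T * 1 := by gcongr
      simpa using this
    rw [hW.eq _ hτI, hgy] at e2
    have hm2 : 0 < T * (3 - 3 * r ^ 2 + r ^ 4) :=
      mul_pos hT (by nlinarith [sq_nonneg (r ^ 2)])
    have hms : (m r : ℂ) ^ 2 = T * (3 - 3 * r ^ 2 + r ^ 4) := by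
      have : m r ^ 2 = T * (3 - 3 * r ^ 2 + r ^ 4) := Real.sq_sqrt hm2.le
      exact_mod_cast this
    have hmp : 0 < m r := Real.sqrt_pos.2 hm2
    -- Of the two square roots of −r²m², the half-plane selects the one with positive imaginary
    -- part.
    have hφw : φ w = Complex.I * (r * m r : ℝ) := by
      have h5 : (φ w - Complex.I * (r * m r : ℝ)) * (φ w + Complex.I * (r * m r : ℝ)) = 0 := by
        push_cast at e2 ⊢
        linear_combination e2 + r ^ 2 * hms - (r * m r) ^ 2 * Complex.I_sq
      rcases mul_eq_zero.1 h5 with h | h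
      · exact sub_eq_zero.1 h
      · exfalso
        have h6 := congrArg Complex.im h
        have h7 := e3 (hW.im_pos _ hτI)
        have h8 : 0 < r * m r := mul_pos hr.1 hmp
        simp at h6
        linarith
    rw [e1, hφw]
    have hr0 : (r : ℂ) ≠ 0 := by exact_mod_cast hr.1.ne'
    have hmr0 : (m r : ℂ) ≠ 0 := by exact_mod_cast hmp.ne'
    push_cast
    rw [div_eq_div_iff (mul_ne_zero hmr0 e4) (mul_ne_zero (mul_ne_zero (by norm_num)
      (mul_ne_zero Complex.I_ne_zero (mul_ne_zero hr0 hmr0))) e4)]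
    linear_combination (-6 * T * (1 - (r : ℂ) ^ 2) ^ 2 * r * m r * φ' w) * Complex.I_sq
  have hb : ∀ r : ℝ, HasDerivAt (fun r : ℝ => 1 - r ^ 2) (-2 * r) r := fun r => by
    have := (hasDerivAt_pow 2 r).const_sub 1
    simpa using this
  have hd0 : 3 * T / √(3 * T) / (φ' C.y₁).re ≠ 0 := by positivity
  obtain ⟨F, D, hF, hF0, hD0, hg, hfD⟩ := C.exists_symPath (d := d) (b := fun r => 1 - r ^ 2)
    (b' := fun r => -2 * r) hT (by simp) hW hW0 hWT (by simp)
    (by exact_mod_cast hy.ne) hb (by fun_prop) (fun r hr => by linarith [hr.1]) (by norm_num)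
    (by norm_num)
    (fun r hr => by
      have h0 : 0 < r ^ 2 := pow_pos hr.1 2
      have h2 : r ^ 2 < 1 := pow_lt_one₀ hr.1.le hr.2 (by norm_num)
      exact ⟨by linarith, by linarith⟩)
    hlim (by rw [hd, Complex.re_ofReal_mul, Complex.I_re, mul_zero]) (mul_ne_zero (by exact_mod_cast hd0) Complex.I_ne_zero)
  have hpos : ∀ r ∈ Ioo (0 : ℝ) 1, C.f (F r) * D r = ((6 * T * r * (1 - r ^ 2) ^ 2 : ℝ) : ℂ) := by
    intro r hr
    rw [hfD r hr]
    push_cast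
    ring
  refine ⟨T, hT, F, D, hF, hF0, fun r hr => by rw [hg r hr]; ring, fun r hr => ?_⟩
  rcases lt_trichotomy r 0 with h | rfl | h
  · have h1 := C.f_mul_neg hF (-r)
    rw [neg_neg, hpos (-r) ⟨by linarith, by linarith [hr.1]⟩, Complex.conj_ofReal] at h1
    rw [h1]
    push_cast
    ring
  · have hn : ∀ j, (C.y₁ : ℂ) ≠ C.pts j := fun j h => C.y₁_ne j (by exact_mod_cast h)
    rw [hF0, C.f_eq hn]
    simp
  · exact hpos r ⟨h, hr.2⟩

end Config
-- Projection to the z-plane: the simple arcs.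
namespace Config

variable {t γ a : ℝ} (C : Config t γ a)

/-- The square root `R` in the uniformizing variable. -/
def X (w : ℂ) : ℂ := C.α * (w + w⁻¹)

/-- The branch point. -/
def ξ : ℂ := C.β + 2 * C.α * Complex.I

theorem X_sq {w : ℂ} (hw : w ≠ 0) : C.X w ^ 2 = (C.Z w - C.ξ) * (C.Z w - conj C.ξ) := by
  rw [X, ← C.Z_sq w hw, ξ]
  simp only [map_add, map_mul, Complex.conj_ofReal, Complex.conj_I, map_ofNat]
  linear_combination (4 * (C.α : ℂ) ^ 2) * Complex.I_sq

theorem ξ_im_pos : 0 < C.ξ.im := by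
  have := C.α_pos
  simp [ξ]
  exact this

theorem Z_im (w : ℂ) : (C.Z w).im = C.α * (1 + (Complex.normSq w)⁻¹) * w.im := by
  simp [Z, Complex.inv_im]
  ring

theorem Z_im_pos_iff {w : ℂ} : 0 < (C.Z w).im ↔ 0 < w.im := by
  rw [Z_im]
  have h1 := C.α_pos
  have h2 : 0 ≤ (Complex.normSq w)⁻¹ := inv_nonneg.2 (Complex.normSq_nonneg w)
  exact mul_pos_iff_of_pos_left (by positivity)

theorem Z_conj (w : ℂ) : C.Z (conj w) = conj (C.Z w) := by
  simp [Z]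

theorem Z_im_neg_iff {w : ℂ} : (C.Z w).im < 0 ↔ w.im < 0 := by
  have := C.Z_im_pos_iff (w := conj w)
  rw [Z_conj] at this
  simpa using this

theorem α_ne : (C.α : ℂ) ≠ 0 := by exact_mod_cast C.α_pos.ne'

theorem Z_I : C.Z Complex.I = C.ξ := by
  simp [Z, ξ]
  ring

/-- The fibres of the projection are the orbits of the sheet exchange. -/
theorem Z_eq_Z_iff {w w' : ℂ} (hw : w ≠ 0) (hw' : w' ≠ 0) :
    C.Z w = C.Z w' ↔ w' = w ∨ w' = -w⁻¹ := by
  have h : C.Z w - C.Z w' = C.α * ((w - w') * (1 + w * w')) / (w * w') := by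
    rw [Z, Z]
    field_simp
    ring
  rw [← sub_eq_zero, h, div_eq_zero_iff, or_iff_left (mul_ne_zero hw hw'), mul_eq_zero,
    or_iff_right C.α_ne, mul_eq_zero]
  refine or_congr ?_ ?_
  · rw [sub_eq_zero, eq_comm]
  · constructor
    · intro h
      field_simp
      linear_combination h
    · rintro rfl
      field_simp
      ring

theorem hasDerivAt_Z {w : ℂ} (hw : w ≠ 0) : HasDerivAt C.Z (C.X w / w) w := by
  have h := (((hasDerivAt_id w).sub (hasDerivAt_inv hw)).const_mul (C.α : ℂ)).add_const (C.β : ℂ)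
  refine h.congr_deriv ?_
  rw [X]
  field_simp
  ring

theorem X_ne {w : ℂ} (hw : w ≠ 0) (h : w ^ 2 + 1 ≠ 0) : C.X w ≠ 0 := by
  refine mul_ne_zero C.α_ne ?_
  have : w + w⁻¹ = (w ^ 2 + 1) / w := by field_simp
  rw [this]
  exact div_ne_zero h hw

/-- A symmetric path whose upper half is mapped by `g` injectively into the ray through `δ`. -/
structure CritPath (δ : ℂ) (b : ℝ → ℝ) (F D : ℝ → ℂ) : Prop extends SymPath F D where
  δ_ne : δ ≠ 0
  g_eq : ∀ r ∈ Ioc (0 : ℝ) 1, C.g (F r) = δ * (b r : ℂ)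
  b_pos : ∀ r ∈ Ioo (0 : ℝ) 1, 0 < b r
  b_one : b 1 = 0
  b_inj : InjOn b (Ioc 0 1)

/-- The curve in the `z`-plane below the path `F`, or its reversal if `ε = -1`. -/
def arc (F : ℝ → ℂ) (ε s : ℝ) : ℂ := C.Z (F (ε * (2 * s - 1)))

/-- The derivative of `arc`. -/
def arcDeriv (F D : ℝ → ℂ) (ε s : ℝ) : ℂ :=
  C.X (F (ε * (2 * s - 1))) / F (ε * (2 * s - 1)) * (2 * ε * D (ε * (2 * s - 1)))

end Config

theorem param_mem_Icc {ε s : ℝ} (hε : |ε| = 1) (hs : s ∈ Icc (0 : ℝ) 1) :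
    ε * (2 * s - 1) ∈ Icc (-1 : ℝ) 1 := by
  rw [mem_Icc, ← abs_le, abs_mul, hε, one_mul, abs_le]
  constructor <;> linarith [hs.1, hs.2]

theorem param_mem_Ioo {ε s : ℝ} (hε : |ε| = 1) (hs : s ∈ Ioo (0 : ℝ) 1) :
    ε * (2 * s - 1) ∈ Ioo (-1 : ℝ) 1 := by
  rw [mem_Ioo, ← abs_lt, abs_mul, hε, one_mul, abs_lt]
  constructor <;> linarith [hs.1, hs.2]

namespace SymPath

variable {F D : ℝ → ℂ} (h : SymPath F D)

theorem im_zero (h : SymPath F D) : (F 0).im = 0 := by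
  have := h.symm 0
  rw [neg_zero] at this
  exact Complex.conj_eq_iff_im.1 this.symm

theorem im_neg (h : SymPath F D) {r : ℝ} (hr : r ∈ Ico (-1 : ℝ) 0) : (F r).im < 0 := by
  have := h.im_pos (-r) ⟨by linarith [hr.2], by linarith [hr.1]⟩
  rw [h.symm] at this
  simpa using this

theorem im_pos_iff (h : SymPath F D) {r : ℝ} (hr : r ∈ Icc (-1 : ℝ) 1) : 0 < (F r).im ↔ 0 < r := by
  rcases lt_trichotomy r 0 with h1 | rfl | h1
  · have := h.im_neg ⟨hr.1, h1⟩
    constructor <;> intro <;> linarith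
  · simp [h.im_zero]
  · have := h.im_pos r ⟨h1, hr.2⟩
    constructor <;> intro <;> assumption

theorem im_neg_iff (h : SymPath F D) {r : ℝ} (hr : r ∈ Icc (-1 : ℝ) 1) : (F r).im < 0 ↔ r < 0 := by
  have := h.im_pos_iff (r := -r) ⟨by linarith [hr.2], by linarith [hr.1]⟩
  rw [h.symm] at this
  simpa using this

theorem ne_zero (h : SymPath F D) {r : ℝ} (hr : r ∈ Icc (-1 : ℝ) 1) : F r ≠ 0 := by
  intro h0
  have h1 := h.im_pos_iff hr
  have h2 := h.im_neg_iff hr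
  rw [h0] at h1 h2
  simp only [Complex.zero_im, lt_self_iff_false, false_iff, not_lt] at h1 h2
  have : r = 0 := le_antisymm h1 h2
  exact h.zero_ne (this ▸ h0)

end SymPath

namespace Config

variable {t γ a : ℝ} {C : Config t γ a}

namespace CritPath

variable {δ : ℂ} {b : ℝ → ℝ} {F D : ℝ → ℂ}

theorem b_nonneg (h : C.CritPath δ b F D) {r : ℝ} (hr : r ∈ Ioc (0 : ℝ) 1) : 0 ≤ b r := by
  rcases hr.2.lt_or_eq with h1 | rfl
  · exact (h.b_pos r ⟨hr.1, h1⟩).le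
  · exact h.b_one.ge

theorem sq_ne (h : C.CritPath δ b F D) {r : ℝ} (hr : r ∈ Ioo (-1 : ℝ) 1) : F r ^ 2 + 1 ≠ 0 := by
  have hpos : ∀ r ∈ Ioo (0 : ℝ) 1, F r ^ 2 + 1 ≠ 0 := by
    intro r hr
    have h1 := h.g_eq r ⟨hr.1, hr.2.le⟩
    refine sq_add_one_ne (h.im_pos r ⟨hr.1, hr.2.le⟩).le fun hI => ?_
    rw [hI, C.g_I] at h1
    have : (b r : ℂ) ≠ 0 := by exact_mod_cast (h.b_pos r hr).ne'
    exact mul_ne_zero h.δ_ne this h1.symm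
  rcases lt_trichotomy r 0 with h1 | rfl | h1
  · have h2 := hpos (-r) ⟨by linarith, by linarith [hr.1]⟩
    rw [h.symm] at h2
    intro h3
    apply h2
    rw [← map_pow, ← map_one conj, ← map_add, h3, map_zero]
  · refine sq_add_one_ne h.im_zero.ge fun hI => ?_
    have := h.im_zero
    rw [hI] at this
    simp at this
  · exact hpos r ⟨h1, hr.2⟩

theorem X_ne (h : C.CritPath δ b F D) {r : ℝ} (hr : r ∈ Ioo (-1 : ℝ) 1) : C.X (F r) ≠ 0 :=
  C.X_ne (h.ne_zero ⟨hr.1.le, hr.2.le⟩) (h.sq_ne hr)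

/-- Two points over the same z are equal or exchanged by w ↦ −1/w. The exchange reverses the sign of
g, while both values lie on one ray, so both vanish and b decides. -/
theorem eq_of_pos (h : C.CritPath δ b F D) {r r' : ℝ} (hr : r ∈ Ioc (0 : ℝ) 1)
    (hr' : r' ∈ Ioc (0 : ℝ) 1) (he : C.Z (F r) = C.Z (F r')) : r = r' := by
  have h0 := h.im_pos r hr
  rcases (C.Z_eq_Z_iff (h.ne_zero ⟨by linarith [hr.1], hr.2⟩)
    (h.ne_zero ⟨by linarith [hr'.1], hr'.2⟩)).1 he with h1 | h1
  · have h2 := h.g_eq r' hr'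
    rw [h1, h.g_eq r hr] at h2
    exact h.b_inj hr hr' (by exact_mod_cast mul_left_cancel₀ h.δ_ne h2)
  · have h2 := h.g_eq r' hr'
    rw [h1, C.g_neg_inv h0, h.g_eq r hr, ← mul_neg] at h2
    have h3 : -b r = b r' := by exact_mod_cast mul_left_cancel₀ h.δ_ne h2
    have h4 := h.b_nonneg hr
    have h5 := h.b_nonneg hr'
    exact h.b_inj hr hr' (by linarith)

/-- The sign of the imaginary part is preserved by Z, so the two halves and the midpoint are kept
apart. -/
theorem injOn (h : C.CritPath δ b F D) : InjOn (fun r => C.Z (F r)) (Icc (-1) 1) := by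
  intro r hr r' hr' he
  have he' : C.Z (F r) = C.Z (F r') := he
  have h1 : 0 < r ↔ 0 < r' := by
    rw [← h.im_pos_iff hr, ← h.im_pos_iff hr', ← C.Z_im_pos_iff (w := F r), he', C.Z_im_pos_iff]
  have h2 : r < 0 ↔ r' < 0 := by
    rw [← h.im_neg_iff hr, ← h.im_neg_iff hr', ← C.Z_im_neg_iff (w := F r), he', C.Z_im_neg_iff]
  rcases lt_trichotomy r 0 with h3 | rfl | h3
  · have h4 := h2.1 h3
    have := h.eq_of_pos (r := -r) (r' := -r') ⟨by linarith, by linarith [hr.1]⟩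
      ⟨by linarith, by linarith [hr'.1]⟩ (by
        rw [h.symm, h.symm, C.Z_conj, C.Z_conj, he'])
    linarith
  · have h3 : ¬ 0 < r' := fun h => lt_irrefl _ (h1.2 h)
    have h4 : ¬ r' < 0 := fun h => lt_irrefl _ (h2.2 h)
    linarith
  · exact h.eq_of_pos ⟨h3, hr.2⟩ ⟨h1.1 h3, hr'.2⟩ he'

variable {ε s : ℝ}

theorem hasDerivAt_arc (h : C.CritPath δ b F D) (hε : |ε| = 1) (hs : s ∈ Ioo (0 : ℝ) 1) :
    HasDerivAt (C.arc F ε) (C.arcDeriv F D ε s) s := by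
  have hr := param_mem_Ioo hε hs
  have h1 : HasDerivAt (fun s : ℝ => ε * (2 * s - 1)) (2 * ε) s := by
    have := (((hasDerivAt_id s).const_mul 2).sub_const 1).const_mul ε
    simpa [mul_comm] using this
  have h2 := (h.hasDeriv _ hr).scomp s h1
  have h3 := (C.hasDerivAt_Z (h.ne_zero ⟨hr.1.le, hr.2.le⟩)).comp s h2
  refine h3.congr_deriv ?_
  rw [arcDeriv, Complex.real_smul]
  push_cast
  ring

theorem continuousAt_X {w : ℂ} (hw : w ≠ 0) : ContinuousAt C.X w :=
  (continuousAt_id.add (continuousAt_inv₀ hw)).const_smul (C.α : ℂ)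

theorem continuousAt_param {s : ℝ} : ContinuousAt (fun s : ℝ => ε * (2 * s - 1)) s := by fun_prop

theorem continuousAt_F (h : C.CritPath δ b F D) (hε : |ε| = 1) (hs : s ∈ Ioo (0 : ℝ) 1) :
    ContinuousAt (fun s => F (ε * (2 * s - 1))) s :=
  ContinuousAt.comp (f := fun s : ℝ => ε * (2 * s - 1))
    (h.hasDeriv _ (param_mem_Ioo hε hs)).continuousAt continuousAt_param

theorem continuousOn_arcDeriv (h : C.CritPath δ b F D) (hε : |ε| = 1) :
    ContinuousOn (C.arcDeriv F D ε) (Ioo 0 1) := by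
  intro s hs
  have hr := param_mem_Ioo hε hs
  have h0 := h.ne_zero ⟨hr.1.le, hr.2.le⟩
  have h1 := h.continuousAt_F hε hs
  have h2 : ContinuousAt (fun s => D (ε * (2 * s - 1))) s :=
    ContinuousAt.comp (f := fun s : ℝ => ε * (2 * s - 1))
      (h.contD.continuousAt (Ioo_mem_nhds hr.1 hr.2)) continuousAt_param
  have h3 : ContinuousAt (fun s => C.X (F (ε * (2 * s - 1)))) s :=
    ContinuousAt.comp (f := fun s => F (ε * (2 * s - 1))) (continuousAt_X h0) h1
  exact ((h3.div h1 h0).mul (continuousAt_const.mul h2)).continuousWithinAt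

theorem arcDeriv_ne (h : C.CritPath δ b F D) (hε : |ε| = 1) (hs : s ∈ Ioo (0 : ℝ) 1) :
    C.arcDeriv F D ε s ≠ 0 := by
  have hr := param_mem_Ioo hε hs
  have hε0 : (ε : ℂ) ≠ 0 := by
    intro h
    have : ε = 0 := by exact_mod_cast h
    rw [this] at hε
    simp at hε
  exact mul_ne_zero (div_ne_zero (h.X_ne hr) (h.ne_zero ⟨hr.1.le, hr.2.le⟩))
    (mul_ne_zero (mul_ne_zero two_ne_zero hε0) (h.D_ne _ hr))

theorem continuousOn_F_param (h : C.CritPath δ b F D) (hε : |ε| = 1) :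
    ContinuousOn (fun s => F (ε * (2 * s - 1))) (Icc 0 1) :=
  h.continuousOn.comp (f := fun s : ℝ => ε * (2 * s - 1)) (by fun_prop)
    fun _ hs => param_mem_Icc hε hs

theorem continuousOn_arc (h : C.CritPath δ b F D) (hε : |ε| = 1) :
    ContinuousOn (C.arc F ε) (Icc 0 1) := by
  intro s hs
  exact (C.hasDerivAt_Z (h.ne_zero (param_mem_Icc hε hs))).continuousAt.comp_continuousWithinAt
    (f := fun s => F (ε * (2 * s - 1)))
    (h.continuousOn_F_param hε s hs)

theorem intervalIntegrable_of_bound {u : ℝ → ℂ} (hu : Measurable u) {B : ℝ}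
    (hB : ∀ s ∈ Ioo (0 : ℝ) 1, ‖u s‖ ≤ B) : IntervalIntegrable u volume 0 1 := by
  rw [intervalIntegrable_iff_integrableOn_Ioo_of_le zero_le_one]
  refine Measure.integrableOn_of_bounded (M := B) (by simp) hu.aestronglyMeasurable ?_
  exact (ae_restrict_iff' measurableSet_Ioo).2 (Eventually.of_forall hB)

theorem exists_bound_arcDeriv (h : C.CritPath δ b F D) (hε : |ε| = 1) :
    ∃ B, ∀ s ∈ Ioo (0 : ℝ) 1, ‖C.arcDeriv F D ε s‖ ≤ B := by
  obtain ⟨B, hB⟩ := h.bdd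
  have hc : ContinuousOn (fun r => C.X (F r) / F r) (Icc (-1) 1) := by
    intro r hr
    have h0 := h.ne_zero hr
    exact ((continuousAt_X h0).comp_continuousWithinAt (h.continuousOn r hr)).div
      (h.continuousOn r hr) h0
  obtain ⟨M, hM⟩ := isCompact_Icc.exists_bound_of_continuousOn hc
  refine ⟨M * (2 * B), fun s hs => ?_⟩
  have hr := param_mem_Ioo hε hs
  have h1 := hM _ ⟨hr.1.le, hr.2.le⟩
  have h2 := hB _ hr
  rw [arcDeriv, norm_mul, norm_mul, norm_mul, Complex.norm_real, Real.norm_eq_abs, hε, mul_one]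
  have h3 : ‖(2 : ℂ)‖ = 2 := by simp
  rw [h3]
  have := (norm_nonneg _).trans h1
  gcongr

theorem isSimpleArc (h : C.CritPath δ b F D) (hε : |ε| = 1) :
    IsSimpleArc (C.arc F ε) (C.Z (F (-ε))) (C.Z (F ε)) where
  continuousOn := h.continuousOn_arc hε
  injOn := by
    intro s hs s' hs' he
    have := h.injOn (param_mem_Icc hε hs) (param_mem_Icc hε hs') he
    have hε0 : ε ≠ 0 := by
      rintro rfl
      simp at hε
    have := mul_left_cancel₀ hε0 this
    linarith
  contDiffOn := by
    rw [show (1 : WithTop ℕ∞) = 0 + 1 from rfl, contDiffOn_succ_iff_deriv_of_isOpen isOpen_Ioo]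
    refine ⟨fun s hs => (h.hasDerivAt_arc hε hs).differentiableAt.differentiableWithinAt,
      by simp, contDiffOn_zero.2 ((h.continuousOn_arcDeriv hε).congr
        fun s hs => (h.hasDerivAt_arc hε hs).deriv)⟩
  deriv_ne_zero := fun s hs => by
    rw [(h.hasDerivAt_arc hε hs).deriv]
    exact h.arcDeriv_ne hε hs
  rectifiable := by
    obtain ⟨B, hB⟩ := h.exists_bound_arcDeriv hε
    exact intervalIntegrable_of_bound (measurable_deriv _) fun s hs => by
      rw [(h.hasDerivAt_arc hε hs).deriv]
      exact hB s hs
  source := by rw [arc]; norm_num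
  target := by rw [arc]; norm_num

theorem arc_im_pos_iff (h : C.CritPath δ b F D) (hε : |ε| = 1) (hs : s ∈ Icc (0 : ℝ) 1) :
    0 < (C.arc F ε s).im ↔ 0 < ε * (2 * s - 1) := by
  rw [arc, C.Z_im_pos_iff, h.im_pos_iff (param_mem_Icc hε hs)]

theorem arc_im_neg_iff (h : C.CritPath δ b F D) (hε : |ε| = 1) (hs : s ∈ Icc (0 : ℝ) 1) :
    (C.arc F ε s).im < 0 ↔ ε * (2 * s - 1) < 0 := by
  rw [arc, C.Z_im_neg_iff, h.im_neg_iff (param_mem_Icc hε hs)]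

theorem eq_half_of_im_eq_zero (h : C.CritPath δ b F D) (hε : |ε| = 1) (hs : s ∈ Icc (0 : ℝ) 1)
    (h0 : (C.arc F ε s).im = 0) : s = 1 / 2 := by
  have h1 := mt (h.arc_im_pos_iff hε hs).2 (by rw [h0]; exact lt_irrefl _)
  have h2 := mt (h.arc_im_neg_iff hε hs).2 (by rw [h0]; exact lt_irrefl _)
  have h3 : ε * (2 * s - 1) = 0 := le_antisymm (not_lt.1 h1) (not_lt.1 h2)
  rcases mul_eq_zero.1 h3 with h4 | h4
  · rw [h4] at hε
    simp at hε
  · linarith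

theorem arc_half : C.arc F ε (1 / 2) = C.Z (F 0) := by
  rw [arc]
  norm_num

theorem arc_one_sub (h : C.CritPath δ b F D) (s : ℝ) : C.arc F ε (1 - s) = conj (C.arc F ε s) := by
  rw [arc, arc, ← C.Z_conj, ← h.symm]
  congr 2
  ring

theorem openArc_inter_real (h : C.CritPath δ b F D) (hε : |ε| = 1) :
    openArc (C.arc F ε) ∩ {z | z.im = 0} = {C.Z (F 0)} := by
  ext z
  constructor
  · rintro ⟨⟨s, hs, rfl⟩, h0⟩
    rw [h.eq_half_of_im_eq_zero hε ⟨hs.1.le, hs.2.le⟩ h0, arc_half]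
    rfl
  · rintro rfl
    refine ⟨⟨1 / 2, by norm_num, arc_half⟩, ?_⟩
    change (C.Z (F 0)).im = 0
    rw [C.Z_im, h.im_zero, mul_zero]

theorem conjSymm_arc (h : C.CritPath δ b F D) : ConjSymm (openArc (C.arc F ε)) := by
  have key : ∀ z ∈ openArc (C.arc F ε), conj z ∈ openArc (C.arc F ε) := by
    rintro _ ⟨s, hs, rfl⟩
    exact ⟨1 - s, ⟨by linarith [hs.2], by linarith [hs.1]⟩, h.arc_one_sub s⟩
  refine Subset.antisymm ?_ fun z hz => ⟨conj z, key z hz, Complex.conj_conj z⟩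
  rintro _ ⟨z, hz, rfl⟩
  exact key z hz

end CritPath
end Config

/-! ### Cauchy type integrals along an arc. -/

section CauchyIntegral

variable {c u : ℝ → ℂ}

theorem isCompact_closedArc (hc : ContinuousOn c (Icc 0 1)) : IsCompact (closedArc c) :=
  isCompact_Icc.image_of_continuousOn hc

theorem isOpen_compl_closedArc (hc : ContinuousOn c (Icc 0 1)) : IsOpen (closedArc c)ᶜ :=
  (isCompact_closedArc hc).isClosed.isOpen_compl

/-- Integrability of a product with a function continuous on the closed interval. -/
theorem intervalIntegrable_mul (hu : IntervalIntegrable u volume 0 1)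
    (hc : ContinuousOn c (Icc 0 1)) : IntervalIntegrable (fun s => c s * u s) volume 0 1 :=
  hu.continuousOn_mul (by rwa [uIcc_of_le zero_le_one])

theorem aestronglyMeasurable_uIoc_of_intervalIntegrable (hu : IntervalIntegrable u volume 0 1) :
    AEStronglyMeasurable u (volume.restrict (uIoc 0 1)) := by
  rw [uIoc_of_le zero_le_one]
  exact hu.1.aestronglyMeasurable

theorem continuousOn_inv_sub (hc : ContinuousOn c (Icc 0 1)) {z : ℂ} (hz : z ∉ closedArc c) :
    ContinuousOn (fun s => (c s - z)⁻¹) (Icc 0 1) :=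
  (hc.sub continuousOn_const).inv₀ fun s hs h => hz ⟨s, hs, sub_eq_zero.1 h⟩

theorem intervalIntegrable_div_sub (hu : IntervalIntegrable u volume 0 1)
    (hc : ContinuousOn c (Icc 0 1)) {z : ℂ} (hz : z ∉ closedArc c) :
    IntervalIntegrable (fun s => u s / (c s - z)) volume 0 1 := by
  refine (intervalIntegrable_mul hu (continuousOn_inv_sub hc hz)).congr fun s _ => ?_
  exact inv_mul_eq_div _ _

/-- A Cauchy type integral is holomorphic off the contour. -/
theorem differentiableAt_cauchy (hu : IntervalIntegrable u volume 0 1)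
    (hc : ContinuousOn c (Icc 0 1)) {z : ℂ} (hz : z ∉ closedArc c) :
    DifferentiableAt ℂ (fun z => ∫ s in (0 : ℝ)..1, u s / (c s - z)) z := by
  obtain ⟨d, hd, hball⟩ := Metric.isOpen_iff.1 (isOpen_compl_closedArc hc) z hz
  have hsub : ∀ x ∈ Metric.ball z (d / 2), ∀ s ∈ Icc (0 : ℝ) 1, d / 2 ≤ ‖c s - x‖ := by
    intro x hx s hs
    by_contra hlt
    push Not at hlt
    refine hball (a := c s) ?_ ⟨s, hs, rfl⟩
    rw [Metric.mem_ball, dist_eq_norm] at hx ⊢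
    calc ‖c s - z‖ = ‖(c s - x) + (x - z)‖ := by ring_nf
      _ ≤ ‖c s - x‖ + ‖x - z‖ := norm_add_le _ _
      _ < d := by linarith
  have hm : ∀ x ∈ Metric.ball z (d / 2), x ∉ closedArc c := by
    rintro x hx ⟨s, hs, rfl⟩
    have := hsub _ hx s hs
    simp at this
    linarith
  have hub : IntervalIntegrable (fun s => ‖u s‖ * ((d / 2) ^ 2)⁻¹) volume 0 1 :=
    hu.norm.mul_const _
  have hIoc : ∀ s ∈ uIoc (0 : ℝ) 1, s ∈ Icc (0 : ℝ) 1 := by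
    rw [uIoc_of_le zero_le_one]
    exact fun s hs => Ioc_subset_Icc_self hs
  refine (intervalIntegral.hasDerivAt_integral_of_dominated_loc_of_deriv_le
    (F := fun z s => u s / (c s - z)) (F' := fun z s => u s / (c s - z) ^ 2)
    (s := Metric.ball z (d / 2)) (Metric.ball_mem_nhds z (by linarith)) ?_
    (intervalIntegrable_div_sub hu hc hz) ?_ (Eventually.of_forall fun s hs x hx => ?_) hub
    (Eventually.of_forall fun s hs x hx => ?_)).2.differentiableAt
  · filter_upwards [Metric.ball_mem_nhds z (by linarith : 0 < d / 2)] with x hx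
    exact aestronglyMeasurable_uIoc_of_intervalIntegrable (intervalIntegrable_div_sub hu hc (hm x hx))
  · have h := intervalIntegrable_div_sub (intervalIntegrable_div_sub hu hc hz) hc hz
    refine (aestronglyMeasurable_uIoc_of_intervalIntegrable h).congr (Eventually.of_forall fun s => ?_)
    change u s / (c s - z) / (c s - z) = u s / (c s - z) ^ 2
    rw [div_div, sq]
  · have h1 := hsub x hx s (hIoc s hs)
    rw [norm_div, norm_pow, div_eq_mul_inv]
    gcongr
  · have h1 : c s - x ≠ 0 := fun h => hm x hx ⟨s, hIoc s hs, sub_eq_zero.1 h⟩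
    have h2 : HasDerivAt (fun x => c s - x) (-1) x := by
      simpa using (hasDerivAt_id x).const_sub (c s)
    have h3 := (h2.inv h1).const_mul (u s)
    simp only [neg_neg] at h3
    refine (h3.congr_deriv ?_).congr_of_eventuallyEq (Eventually.of_forall fun y => ?_)
    · ring
    · simp [div_eq_mul_inv]

/-- The leading term of a Cauchy type integral at infinity. -/
theorem tendsto_mul_cauchy (hu : IntervalIntegrable u volume 0 1) (hc : ContinuousOn c (Icc 0 1)) :
    Tendsto (fun z => z * ∫ s in (0 : ℝ)..1, u s / (c s - z)) (Bornology.cobounded ℂ)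
      (𝓝 (-∫ s in (0 : ℝ)..1, u s)) := by
  obtain ⟨M, hM⟩ := isCompact_Icc.exists_bound_of_continuousOn hc
  set K := max M 1 with hK
  have hK1 : 0 < K := lt_of_lt_of_le one_pos (le_max_right _ _)
  have hMK : ∀ s ∈ Icc (0 : ℝ) 1, ‖c s‖ ≤ K := fun s hs => (hM s hs).trans (le_max_left _ _)
  have hlarge : ∀ᶠ z : ℂ in Bornology.cobounded ℂ, 2 * K < ‖z‖ :=
    tendsto_norm_cobounded_atTop.eventually_gt_atTop _
  have hne : ∀ z : ℂ, 2 * K < ‖z‖ → ∀ s ∈ Icc (0 : ℝ) 1, ‖z‖ / 2 ≤ ‖c s - z‖ := by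
    intro z hz s hs
    have h1 := hMK s hs
    have h2 := norm_sub_norm_le z (c s)
    rw [norm_sub_rev]
    linarith
  have hnm : ∀ z : ℂ, 2 * K < ‖z‖ → z ∉ closedArc c := by
    rintro z hz ⟨s, hs, rfl⟩
    have := hne _ hz s hs
    simp only [sub_self, norm_zero] at this
    linarith
  have hIoc : ∀ s ∈ uIoc (0 : ℝ) 1, s ∈ Icc (0 : ℝ) 1 := by
    rw [uIoc_of_le zero_le_one]
    exact fun s hs => Ioc_subset_Icc_self hs
  rw [← intervalIntegral.integral_neg]
  have key : ∀ᶠ z in Bornology.cobounded ℂ, ‖(z * ∫ s in (0 : ℝ)..1, u s / (c s - z)) -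
      ∫ s in (0 : ℝ)..1, -u s‖ ≤ 2 * K * (∫ s in (0 : ℝ)..1, ‖u s‖) * ‖z‖⁻¹ := by
    filter_upwards [hlarge] with z hz
    have hz0 : 0 < ‖z‖ := by linarith
    rw [← intervalIntegral.integral_const_mul, ← intervalIntegral.integral_sub
      ((intervalIntegrable_div_sub hu hc (hnm z hz)).const_mul z) (g := fun s => -u s) hu.neg]
    have h1 : ∀ s ∈ Ioc (0 : ℝ) 1, ‖z * (u s / (c s - z)) - -u s‖ ≤ 2 * K * ‖z‖⁻¹ * ‖u s‖ := by
      intro s hs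
      have hs' : s ∈ Icc (0 : ℝ) 1 := Ioc_subset_Icc_self hs
      have h2 := hne z hz s hs'
      have h3 : c s - z ≠ 0 := by
        rw [← norm_pos_iff]
        linarith
      have e : z * (u s / (c s - z)) - -u s = c s * u s / (c s - z) := by
        field_simp
        ring
      rw [e, norm_div, norm_mul, div_le_iff₀ (norm_pos_iff.2 h3)]
      have h4 : 2 * K * ‖z‖⁻¹ * ‖u s‖ * (‖z‖ / 2) ≤ 2 * K * ‖z‖⁻¹ * ‖u s‖ * ‖c s - z‖ := by gcongr
      refine le_trans ?_ h4
      have : 2 * K * ‖z‖⁻¹ * ‖u s‖ * (‖z‖ / 2) = K * ‖u s‖ := by field_simp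
      rw [this]
      gcongr
      exact hMK s hs'
    refine (intervalIntegral.norm_integral_le_of_norm_le zero_le_one
      (Eventually.of_forall h1) (hu.norm.const_mul _)).trans (le_of_eq ?_)
    rw [intervalIntegral.integral_const_mul]
    ring
  rw [tendsto_iff_norm_sub_tendsto_zero]
  refine squeeze_zero' (Eventually.of_forall fun _ => norm_nonneg _) key ?_
  have := (tendsto_inv_atTop_zero.comp (tendsto_norm_cobounded_atTop (E := ℂ))).const_mul
    (2 * K * (∫ s in (0 : ℝ)..1, ‖u s‖))
  simpa using this

/-- The exponential of the integral of a logarithmic derivative. -/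
theorem exp_integral_logDeriv {v v' : ℝ → ℂ} (hv : ContinuousOn v (Icc 0 1))
    (hv0 : ∀ s ∈ Icc (0 : ℝ) 1, v s ≠ 0) (hd : ∀ s ∈ Ioo (0 : ℝ) 1, HasDerivAt v (v' s) s)
    (hcont : ContinuousOn v' (Ioo 0 1))
    (hint : IntervalIntegrable (fun s => v' s / v s) volume 0 1) :
    Complex.exp (∫ s in (0 : ℝ)..1, v' s / v s) = v 1 / v 0 := by
  set A : ℝ → ℂ := fun x => ∫ s in (0 : ℝ)..x, v' s / v s with hA
  have hAc : ContinuousOn A (Icc 0 1) := by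
    have h1 : IntegrableOn (fun s => v' s / v s) (uIcc 0 1) volume := by
      rw [uIcc_of_le zero_le_one, integrableOn_Icc_iff_integrableOn_Ioc]
      exact (intervalIntegrable_iff_integrableOn_Ioc_of_le zero_le_one).1 hint
    have h2 := intervalIntegral.continuousOn_primitive_interval h1
    rwa [uIcc_of_le zero_le_one] at h2
  have hq : ContinuousOn (fun s => v' s / v s) (Ioo 0 1) :=
    hcont.div (hv.mono Ioo_subset_Icc_self) fun s hs => hv0 s (Ioo_subset_Icc_self hs)
  have hAd : ∀ s ∈ Ioo (0 : ℝ) 1, HasDerivAt A (v' s / v s) s := by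
    intro s hs
    refine intervalIntegral.integral_hasDerivAt_right (hint.mono_set ?_)
      (hq.stronglyMeasurableAtFilter isOpen_Ioo s hs) (hq.continuousAt (Ioo_mem_nhds hs.1 hs.2))
    rw [uIcc_of_le zero_le_one, uIcc_of_le hs.1.le]
    exact Icc_subset_Icc_right hs.2.le
  -- The product v·exp(−A), with A the primitive, has zero derivative; this avoids choosing a branch
  -- of log v.
  have hconst := intervalIntegral.integral_eq_sub_of_hasDerivAt_of_le
    (f := fun s => v s * Complex.exp (-A s)) (f' := fun _ => 0) (zero_le_one (α := ℝ))
    (hv.mul (Complex.continuous_exp.comp_continuousOn hAc.neg)) (fun s hs => by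
      have h1 := (hd s hs).mul ((hAd s hs).neg.cexp)
      refine h1.congr_deriv ?_
      have := hv0 s (Ioo_subset_Icc_self hs)
      field_simp
      ring) (by simp)
  have hA0 : A 0 = 0 := intervalIntegral.integral_same
  simp only [intervalIntegral.integral_zero, hA0, neg_zero, Complex.exp_zero, mul_one] at hconst
  have h0 := hv0 0 (by simp)
  rw [eq_div_iff h0]
  have h2 := sub_eq_zero.1 hconst.symm
  rw [← h2]
  change Complex.exp (A 1) * (v 1 * Complex.exp (-A 1)) = v 1
  rw [Complex.exp_neg]
  have := Complex.exp_ne_zero (A 1)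
  field_simp

end CauchyIntegral

/-! ### Normals to an arc and one-sided limits. -/

section Tube

variable {c : ℝ → ℂ} {p q : ℂ}

theorem IsSimpleArc.hasDerivAt (hc : IsSimpleArc c p q) {s : ℝ} (hs : s ∈ Ioo (0 : ℝ) 1) :
    HasDerivAt c (deriv c s) s :=
  ((hc.contDiffOn.differentiableOn one_ne_zero).differentiableAt (Ioo_mem_nhds hs.1 hs.2)).hasDerivAt

theorem IsSimpleArc.continuousOn_deriv (hc : IsSimpleArc c p q) :
    ContinuousOn (deriv c) (Ioo 0 1) :=
  hc.contDiffOn.continuousOn_deriv_of_isOpen isOpen_Ioo le_rfl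

/-- The point at signed distance proportional to `p.2` on the normal at `c p.1`. -/
def normalPt (c : ℝ → ℂ) (p : ℝ × ℝ) : ℂ := c p.1 + Complex.I * p.2 * deriv c p.1

theorem IsSimpleArc.continuousAt_normalPt (hc : IsSimpleArc c p q) {x : ℝ × ℝ}
    (hx : x.1 ∈ Ioo (0 : ℝ) 1) : ContinuousAt (normalPt c) x := by
  have h1 : ContinuousAt (fun p : ℝ × ℝ => c p.1) x :=
    ContinuousAt.comp (f := Prod.fst) (hc.hasDerivAt hx).continuousAt continuousAt_fst
  have h2 : ContinuousAt (fun p : ℝ × ℝ => deriv c p.1) x :=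
    ContinuousAt.comp (f := Prod.fst) (g := deriv c)
      (hc.continuousOn_deriv.continuousAt (Ioo_mem_nhds hx.1 hx.2)) continuousAt_fst
  have h3 : ContinuousAt (fun p : ℝ × ℝ => Complex.I * (p.2 : ℂ)) x := by fun_prop
  exact h1.add (h3.mul h2)

theorem normalPt_zero (c : ℝ → ℂ) (s : ℝ) : normalPt c (s, 0) = c s := by
  simp [normalPt]

/-- Points on short normals are off the arc. -/
theorem IsSimpleArc.eventually_normalPt_notMem (hc : IsSimpleArc c p q) {s₀ : ℝ}
    (hs₀ : s₀ ∈ Ioo (0 : ℝ) 1) :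
    ∀ᶠ x in 𝓝 ((s₀, 0) : ℝ × ℝ), x.2 ≠ 0 → normalPt c x ∉ closedArc c := by
  have hd := hc.deriv_ne_zero s₀ hs₀
  set d := deriv c s₀ with hd_def
  have hdpos : 0 < ‖d‖ := norm_pos_iff.2 hd
  have hcd : ContinuousAt (deriv c) s₀ :=
    hc.continuousOn_deriv.continuousAt (Ioo_mem_nhds hs₀.1 hs₀.2)
  have hstrict : HasStrictDerivAt c d s₀ :=
    hasStrictDerivAt_of_hasDerivAt_of_continuousAt
      (by filter_upwards [Ioo_mem_nhds hs₀.1 hs₀.2] with y hy using hc.hasDerivAt hy) hcd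
  have h1 := hstrict.hasStrictFDerivAt.isLittleO.def (by positivity : 0 < ‖d‖ / 4)
  rw [nhds_prod_eq] at h1
  obtain ⟨P, hP, P', hP', hPP⟩ := eventually_prod_iff.1 h1
  have h2 : ∀ᶠ y in 𝓝 s₀, ‖deriv c y - d‖ ≤ ‖d‖ / 4 := by
    filter_upwards [Metric.continuousAt_iff'.1 hcd (‖d‖ / 4) (by positivity)] with y hy
    rw [dist_eq_norm] at hy
    exact hy.le
  obtain ⟨U, hUP, hUo, hsU⟩ := mem_nhds_iff.1 hP
  -- A point of the arc near c(s₀) has parameter near s₀, by compactness and injectivity. Distant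
  -- parts of the arc therefore do not interfere.
  have h3 : ∀ᶠ z in 𝓝 (c s₀), ∀ x ∈ Icc (0 : ℝ) 1, c x = z → x ∈ U := by
    have hK : IsCompact (Icc (0 : ℝ) 1 \ U) := isCompact_Icc.diff hUo
    have hcl := (hK.image_of_continuousOn (hc.continuousOn.mono sdiff_subset)).isClosed
    have hnot : c s₀ ∉ c '' (Icc (0 : ℝ) 1 \ U) := by
      rintro ⟨x, ⟨hx, hxU⟩, hxe⟩
      have := hc.injOn hx (Ioo_subset_Icc_self hs₀) hxe
      exact hxU (this ▸ hsU)
    filter_upwards [hcl.isOpen_compl.mem_nhds hnot] with z hz x hx hxz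
    by_contra hxU
    exact hz ⟨x, ⟨hx, hxU⟩, hxz⟩
  have h4 : Tendsto (normalPt c) (𝓝 ((s₀, 0) : ℝ × ℝ)) (𝓝 (c s₀)) := by
    have := (hc.continuousAt_normalPt (x := (s₀, 0)) hs₀).tendsto
    rwa [normalPt_zero] at this
  have hfst : Tendsto (fun x : ℝ × ℝ => x.1) (𝓝 ((s₀, 0) : ℝ × ℝ)) (𝓝 s₀) :=
    continuous_fst.tendsto (s₀, (0 : ℝ))
  filter_upwards [h4.eventually h3, hfst.eventually h2, hfst.eventually hP'] with y e1 e2 e3 hy0 hmem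
  obtain ⟨x, hx, hxe⟩ := hmem
  have h5 := hPP (hUP (e1 x hx hxe)) e3
  simp only [ContinuousLinearMap.toSpanSingleton_apply] at h5
  rw [hxe, normalPt] at h5
  -- If a point of the normal were on the arc, then (Δs − i·y)·d would be smaller than half its own
  -- possible size: Δs is real and i·y imaginary, so they cannot cancel.
  have e4 : c y.1 + Complex.I * y.2 * deriv c y.1 - c y.1 - (x - y.1) • d =
      -(((x - y.1 : ℝ) : ℂ) - (y.2 : ℝ) * Complex.I) * d + Complex.I * y.2 * (deriv c y.1 - d) := by
    rw [Complex.real_smul]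
    ring
  rw [e4] at h5
  set ζ : ℂ := ((x - y.1 : ℝ) : ℂ) - (y.2 : ℝ) * Complex.I with hζ
  have hζre : |x - y.1| ≤ ‖ζ‖ := by
    have := Complex.abs_re_le_norm ζ
    simpa [hζ] using this
  have hζim : |y.2| ≤ ‖ζ‖ := by
    have := Complex.abs_im_le_norm ζ
    simpa [hζ] using this
  have h6 : ‖ζ‖ * ‖d‖ ≤ ‖d‖ / 4 * |x - y.1| + |y.2| * (‖d‖ / 4) := by
    have h7 : ‖ζ * d‖ ≤ ‖-ζ * d + Complex.I * y.2 * (deriv c y.1 - d)‖ +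
        ‖Complex.I * y.2 * (deriv c y.1 - d)‖ := by
      have : ζ * d = -(-ζ * d + Complex.I * y.2 * (deriv c y.1 - d)) +
        Complex.I * y.2 * (deriv c y.1 - d) := by ring
      calc ‖ζ * d‖ = _ := congrArg norm this
        _ ≤ _ := norm_add_le _ _
        _ = _ := by rw [norm_neg]
    have h8 : ‖Complex.I * y.2 * (deriv c y.1 - d)‖ ≤ |y.2| * (‖d‖ / 4) := by
      rw [norm_mul, norm_mul, Complex.norm_I, one_mul, Complex.norm_real, Real.norm_eq_abs]
      gcongr
    rw [norm_mul] at h7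
    rw [Real.norm_eq_abs] at h5
    linarith
  have h9 : 0 < |y.2| := abs_pos.2 hy0
  nlinarith [mul_le_mul_of_nonneg_right hζre hdpos.le, mul_le_mul_of_nonneg_right hζim hdpos.le,
    mul_pos h9 hdpos]

/-- One-sided limits on an arc of a function whose square continues across the arc. -/
theorem IsSimpleArc.exists_side_limit (hc : IsSimpleArc c p q) {R ρ : ℂ → ℂ} {s₀ σ : ℝ}
    (hs₀ : s₀ ∈ Ioo (0 : ℝ) 1) (hσ : σ ≠ 0) (hR : ContinuousOn R (closedArc c)ᶜ)
    (hρ : ∀ᶠ z in 𝓝 (c s₀), ContinuousAt ρ z) (hρ0 : ρ (c s₀) ≠ 0)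
    (hsq : ∀ᶠ z in 𝓝 (c s₀), z ∉ closedArc c → R z ^ 2 = ρ z ^ 2) :
    ∃ e : ℂ, e ^ 2 = 1 ∧ Tendsto (fun x : ℝ × ℝ => R (normalPt c (x.1, σ * x.2)))
      (𝓝 s₀ ×ˢ 𝓝[>] (0 : ℝ)) (𝓝 (e * ρ (c s₀))) := by
  have hcont : ContinuousAt (fun x : ℝ × ℝ => normalPt c (x.1, σ * x.2)) (s₀, 0) := by
    exact ContinuousAt.comp (f := fun x : ℝ × ℝ => (x.1, σ * x.2)) (x := (s₀, 0))
      (hc.continuousAt_normalPt (x := (s₀, σ * 0)) hs₀) (by fun_prop)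
  have hval : normalPt c (((s₀, 0) : ℝ × ℝ).1, σ * ((s₀, 0) : ℝ × ℝ).2) = c s₀ := by
    simp [normalPt]
  have hlim : Tendsto (fun x : ℝ × ℝ => normalPt c (x.1, σ * x.2)) (𝓝 (s₀, 0)) (𝓝 (c s₀)) := by
    have := hcont.tendsto
    rwa [hval] at this
  have hoff : ∀ᶠ x in 𝓝 ((s₀, 0) : ℝ × ℝ), x.2 ≠ 0 → normalPt c (x.1, σ * x.2) ∉ closedArc c := by
    have h1 : Tendsto (fun x : ℝ × ℝ => (x.1, σ * x.2)) (𝓝 (s₀, 0)) (𝓝 (s₀, 0)) := by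
      have : Continuous fun x : ℝ × ℝ => (x.1, σ * x.2) := by fun_prop
      simpa using this.tendsto (s₀, 0)
    filter_upwards [h1.eventually (hc.eventually_normalPt_notMem hs₀)] with x hx h0
    exact hx (mul_ne_zero hσ h0)
  have hρne := hρ.self_of_nhds.eventually_ne hρ0
  have hIoo : ∀ᶠ x in 𝓝 ((s₀, 0) : ℝ × ℝ), x.1 ∈ Ioo (0 : ℝ) 1 :=
    continuous_fst.continuousAt.eventually (Ioo_mem_nhds hs₀.1 hs₀.2)
  have hall := hoff.and (hIoo.and (hlim.eventually (hρ.and (hρne.and hsq))))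
  obtain ⟨ε, hε, hball⟩ := Metric.eventually_nhds_iff.1 hall
  -- A one-sided box of normals is connected and off the arc, so on it R equals ρ or −ρ throughout.
  set S : Set (ℝ × ℝ) := Ioo (s₀ - ε) (s₀ + ε) ×ˢ Ioo 0 ε with hS
  have hSb : ∀ x ∈ S, x.2 ≠ 0 ∧ dist x (s₀, 0) < ε := by
    rintro ⟨x, y⟩ ⟨hx, hy⟩
    refine ⟨hy.1.ne', ?_⟩
    rw [Prod.dist_eq, max_lt_iff, Real.dist_eq, Real.dist_eq, abs_lt, abs_lt]
    simp only [mem_Ioo] at hx hy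
    constructor <;> constructor <;> simp <;> linarith
  have hSpre : IsPreconnected S := isPreconnected_Ioo.prod isPreconnected_Ioo
  have hθ : ∀ x ∈ S, ContinuousAt (fun x : ℝ × ℝ => normalPt c (x.1, σ * x.2)) x := by
    intro x hx
    have h1 := (hball (hSb x hx).2).2.1
    exact ContinuousAt.comp (f := fun x : ℝ × ℝ => (x.1, σ * x.2))
      (hc.continuousAt_normalPt (x := (x.1, σ * x.2)) h1) (by fun_prop)
  have hRc : ContinuousOn (fun x : ℝ × ℝ => R (normalPt c (x.1, σ * x.2))) S := by
    intro x hx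
    have h1 := (hball (hSb x hx).2).1 (hSb x hx).1
    exact (ContinuousAt.comp (f := fun x : ℝ × ℝ => normalPt c (x.1, σ * x.2))
      (hR.continuousAt ((isOpen_compl_closedArc hc.continuousOn).mem_nhds h1))
      (hθ x hx)).continuousWithinAt
  have hρc : ContinuousOn (fun x : ℝ × ℝ => ρ (normalPt c (x.1, σ * x.2))) S := by
    intro x hx
    exact (ContinuousAt.comp (f := fun x : ℝ × ℝ => normalPt c (x.1, σ * x.2))
      (hball (hSb x hx).2).2.2.1 (hθ x hx)).continuousWithinAt
  have hmem : S ∈ 𝓝 s₀ ×ˢ 𝓝[>] (0 : ℝ) :=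
    prod_mem_prod (Ioo_mem_nhds (by linarith) (by linarith)) (Ioo_mem_nhdsGT hε)
  have hρlim : Tendsto (fun x : ℝ × ℝ => ρ (normalPt c (x.1, σ * x.2)))
      (𝓝 s₀ ×ˢ 𝓝[>] (0 : ℝ)) (𝓝 (ρ (c s₀))) := by
    refine (hρ.self_of_nhds.tendsto.comp hlim).mono_left ?_
    rw [nhds_prod_eq]
    exact Filter.prod_mono le_rfl nhdsWithin_le_nhds
  have hor := hSpre.eq_or_eq_neg_of_sq_eq hRc hρc (fun x hx => by
      have h1 := hball (hSb x hx).2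
      exact h1.2.2.2.2 (h1.1 (hSb x hx).1))
    (fun {x} hx => (hball (hSb x hx).2).2.2.2.1)
  rcases hor with h | h
  · refine ⟨1, by norm_num, ?_⟩
    rw [one_mul]
    refine hρlim.congr' ?_
    filter_upwards [hmem] with x hx using (h hx).symm
  · refine ⟨-1, by norm_num, ?_⟩
    rw [neg_one_mul]
    refine hρlim.neg.congr' ?_
    filter_upwards [hmem] with x hx using (h hx).symm

/-- One-sided boundary values are continuous along the arc. -/
theorem continuousOn_of_side_limit {G : ℝ × ℝ → ℂ} {ℓ : ℝ → ℂ} {J : Set ℝ} (hJ : IsOpen J)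
    (h : ∀ s ∈ J, Tendsto G (𝓝 s ×ˢ 𝓝[>] (0 : ℝ)) (𝓝 (ℓ s))) : ContinuousOn ℓ J := by
  intro s hs
  refine ContinuousAt.continuousWithinAt ?_
  refine (closed_nhds_basis (ℓ s)).tendsto_right_iff.2 fun U ⟨hU, hUc⟩ => ?_
  have h1 : ∀ᶠ x in 𝓝 s ×ˢ 𝓝[>] (0 : ℝ), G x ∈ U := h s hs hU
  obtain ⟨P, hP, P', hP', hPP⟩ := eventually_prod_iff.1 h1
  filter_upwards [eventually_eventually_nhds.2 hP, hJ.mem_nhds hs] with s' hs' hs'J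
  refine hUc.mem_of_tendsto (h s' hs'J) ?_
  exact eventually_prod_iff.2 ⟨P, hs', P', hP', fun hx _ hy => hPP hx hy⟩

end Tube
-- The Cauchy integral of dz/R₊ in the uniformizing variable.
namespace Config

variable {t γ a : ℝ} (C : Config t γ a)

/-- Every square root of `(z - ξ)(z - conj ξ)` is the value of `X` at a point over `z`. -/
theorem exists_Z_eq {z ρ : ℂ} (hρ : ρ ^ 2 = (z - C.ξ) * (z - conj C.ξ)) :
    ∃ w : ℂ, w ≠ 0 ∧ C.Z w = z ∧ C.X w = ρ := by
  have hα := C.α_ne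
  have hp : ρ ^ 2 = (z - C.β) ^ 2 + 4 * C.α ^ 2 := by
    rw [hρ, ξ]
    simp only [map_add, map_mul, Complex.conj_ofReal, Complex.conj_I, map_ofNat]
    linear_combination (-4 * (C.α : ℂ) ^ 2) * Complex.I_sq
  set w : ℂ := (z - C.β + ρ) / (2 * C.α) with hw
  have h1 : w * ((ρ - (z - C.β)) / (2 * C.α)) = 1 := by
    rw [hw]
    field_simp
    linear_combination hp
  have hw0 : w ≠ 0 := left_ne_zero_of_mul_eq_one h1
  have hinv : w⁻¹ = (ρ - (z - C.β)) / (2 * C.α) := inv_eq_of_mul_eq_one_right h1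
  refine ⟨w, hw0, ?_, ?_⟩
  · rw [Z, hinv, hw]
    field_simp
    ring
  · rw [X, hinv, hw]
    field_simp
    ring

theorem exists_sqrt (z : ℂ) : ∃ ρ : ℂ, ρ ^ 2 = (z - C.ξ) * (z - conj C.ξ) :=
  IsAlgClosed.exists_pow_nat_eq _ (by norm_num)

/-- The path `F` parametrized by the unit interval. -/
def lift (F : ℝ → ℂ) (s : ℝ) : ℂ := F (1 * (2 * s - 1))

/-- The derivative of `lift`. -/
def liftDeriv (D : ℝ → ℂ) (s : ℝ) : ℂ := 2 * D (1 * (2 * s - 1))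

/-- The Cauchy integral of `dz / R₊`. -/
def cauchy (F D : ℝ → ℂ) (z : ℂ) : ℂ :=
  ∫ s in (0 : ℝ)..1, liftDeriv D s / lift F s / (C.arc F 1 s - z)

theorem arc_eq (F : ℝ → ℂ) (s : ℝ) : C.arc F 1 s = C.Z (lift F s) := rfl

theorem arcDeriv_eq (F D : ℝ → ℂ) (s : ℝ) :
    C.arcDeriv F D 1 s = C.X (lift F s) / lift F s * liftDeriv D s := by
  rw [arcDeriv, lift, liftDeriv]
  simp

variable {C}

theorem Z_sub_Z {w w' : ℂ} (hw : w ≠ 0) (hw' : w' ≠ 0) :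
    C.Z w - C.Z w' = C.α * ((w - w') * (w + w'⁻¹)) / w := by
  rw [Z, Z]
  field_simp
  ring

namespace CritPath

variable {δ : ℂ} {b : ℝ → ℝ} {F D : ℝ → ℂ}

theorem lift_ne (h : C.CritPath δ b F D) {s : ℝ} (hs : s ∈ Icc (0 : ℝ) 1) : lift F s ≠ 0 :=
  h.ne_zero (param_mem_Icc abs_one hs)

theorem hasDerivAt_lift (h : C.CritPath δ b F D) {s : ℝ} (hs : s ∈ Ioo (0 : ℝ) 1) :
    HasDerivAt (lift F) (liftDeriv D s) s := by
  have h1 : HasDerivAt (fun s : ℝ => 1 * (2 * s - 1)) 2 s := by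
    have := (((hasDerivAt_id s).const_mul 2).sub_const 1).const_mul (1 : ℝ)
    simpa using this
  have h2 := (h.hasDeriv _ (param_mem_Ioo abs_one hs)).scomp s h1
  refine h2.congr_deriv ?_
  rw [liftDeriv, Complex.real_smul]
  norm_num

theorem continuousOn_lift (h : C.CritPath δ b F D) : ContinuousOn (lift F) (Icc 0 1) :=
  h.continuousOn_F_param abs_one

theorem continuousOn_liftDeriv (h : C.CritPath δ b F D) : ContinuousOn (liftDeriv D) (Ioo 0 1) := by
  intro s hs
  have hr := param_mem_Ioo abs_one hs
  exact (continuousAt_const.mul (ContinuousAt.comp (f := fun s : ℝ => (1 : ℝ) * (2 * s - 1))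
    (h.contD.continuousAt (Ioo_mem_nhds hr.1 hr.2)) (by fun_prop))).continuousWithinAt

theorem lift_zero (h : C.CritPath δ b F D) : lift F 0 = -Complex.I := by
  rw [lift]
  norm_num
  rw [h.symm, h.one, Complex.conj_I]

theorem lift_one (h : C.CritPath δ b F D) : lift F 1 = Complex.I := by
  rw [lift]
  norm_num
  exact h.one

theorem intervalIntegrable_logDeriv (h : C.CritPath δ b F D) :
    IntervalIntegrable (fun s => liftDeriv D s / lift F s) volume 0 1 := by
  have h1 : IntervalIntegrable (liftDeriv D) volume 0 1 := by
    obtain ⟨B, hB⟩ := h.bdd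
    rw [intervalIntegrable_iff_integrableOn_Ioo_of_le zero_le_one]
    refine Integrable.of_bound (h.continuousOn_liftDeriv.aestronglyMeasurable measurableSet_Ioo)
      (2 * B) ?_
    refine (ae_restrict_iff' measurableSet_Ioo).2 (Eventually.of_forall fun s hs => ?_)
    rw [liftDeriv, norm_mul]
    have := hB _ (param_mem_Ioo abs_one hs)
    have h2 : ‖(2 : ℂ)‖ = 2 := by simp
    rw [h2]
    gcongr
  refine (intervalIntegrable_mul h1 (h.continuousOn_lift.inv₀ fun s hs => h.lift_ne hs)).congr
    fun s _ => ?_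
  exact inv_mul_eq_div _ _

/-- The path runs from −i to i and meets the real axis only at a negative point, so −w avoids the
cut of the principal logarithm; the result is log(−i) − log(i). -/
theorem integral_logDeriv (h : C.CritPath δ b F D) (hneg : (F 0).re < 0) :
    ∫ s in (0 : ℝ)..1, liftDeriv D s / lift F s = -(Real.pi * Complex.I) := by
  have hslit : ∀ s ∈ Icc (0 : ℝ) 1, -lift F s ∈ Complex.slitPlane := by
    intro s hs
    by_cases him : (lift F s).im = 0
    · left
      have h1 := h.eq_half_of_im_eq_zero abs_one hs (by rw [arc_eq, C.Z_im, him, mul_zero])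
      have : lift F s = F 0 := by rw [lift, h1]; norm_num
      rw [this, Complex.neg_re]
      linarith
    · right
      simpa using him
  rw [intervalIntegral.integral_eq_sub_of_hasDerivAt_of_le (f := fun s => Complex.log (-lift F s))
    zero_le_one]
  · simp only [h.lift_one, h.lift_zero, neg_neg, Complex.log_neg_I, Complex.log_I]
    ring
  · intro s hs
    exact (h.continuousOn_lift s hs).neg.clog (hslit s hs)
  · intro s hs
    have h1 := (h.hasDerivAt_lift hs).fun_neg.clog_real (hslit s (Ioo_subset_Icc_self hs))
    refine h1.congr_deriv ?_
    rw [neg_div_neg_eq]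
  · exact h.intervalIntegrable_logDeriv

/-- If v lies over z with X(v) = ρ, then ρ times the integrand is the logarithmic derivative of (w −
v)/(w + 1/v) along the path. The end values at −i and i have quotient −1, whatever v is. -/
theorem exp_mul_cauchy (h : C.CritPath δ b F D) {z ρ : ℂ} (hz : z ∉ closedArc (C.arc F 1))
    (hρ : ρ ^ 2 = (z - C.ξ) * (z - conj C.ξ)) : Complex.exp (ρ * C.cauchy F D z) = -1 := by
  obtain ⟨v, hv0, hZv, hXv⟩ := C.exists_Z_eq hρ
  have hξ : C.ξ ∈ closedArc (C.arc F 1) := ⟨1, by simp, by rw [arc_eq, h.lift_one, C.Z_I]⟩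
  have hξ' : conj C.ξ ∈ closedArc (C.arc F 1) :=
    ⟨0, by simp, by rw [arc_eq, h.lift_zero, ← Complex.conj_I, C.Z_conj, C.Z_I]⟩
  have hρ0 : ρ ≠ 0 := by
    rintro rfl
    have h1 : (z - C.ξ) * (z - conj C.ξ) = 0 := by rw [← hρ]; ring
    rcases mul_eq_zero.1 h1 with h2 | h2
    · exact hz (sub_eq_zero.1 h2 ▸ hξ)
    · exact hz (sub_eq_zero.1 h2 ▸ hξ')
  have hprod : ∀ s ∈ Icc (0 : ℝ) 1, (lift F s - v) * (lift F s + v⁻¹) ≠ 0 := by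
    intro s hs h0
    apply hz
    refine ⟨s, hs, ?_⟩
    rw [← sub_eq_zero, ← hZv, arc_eq, Z_sub_Z (h.lift_ne hs) hv0, h0]
    simp
  have hne1 : ∀ s ∈ Icc (0 : ℝ) 1, lift F s - v ≠ 0 := fun s hs => left_ne_zero_of_mul (hprod s hs)
  have hne2 : ∀ s ∈ Icc (0 : ℝ) 1, lift F s + v⁻¹ ≠ 0 := fun s hs =>
    right_ne_zero_of_mul (hprod s hs)
  set V : ℝ → ℂ := fun s => (lift F s - v) / (lift F s + v⁻¹) with hV
  set V' : ℝ → ℂ := fun s => liftDeriv D s * (v + v⁻¹) / (lift F s + v⁻¹) ^ 2 with hV'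
  have hlog : ∀ s ∈ Icc (0 : ℝ) 1,
      V' s / V s = ρ * (liftDeriv D s / lift F s / (C.arc F 1 s - z)) := by
    intro s hs
    have e0 := h.lift_ne hs
    have e1 := hne1 s hs
    have e2 := hne2 s hs
    have hα := C.α_ne
    rw [arc_eq, ← hZv, Z_sub_Z e0 hv0, ← hXv, X]
    simp only [hV, hV']
    generalize lift F s = x at e0 e1 e2 ⊢
    generalize v⁻¹ = y at e2 ⊢
    field_simp
  have hexp := exp_integral_logDeriv (v := V) (v' := V')
    ((h.continuousOn_lift.sub continuousOn_const).div (h.continuousOn_lift.add continuousOn_const) hne2)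
    (fun s hs => div_ne_zero (hne1 s hs) (hne2 s hs))
    (fun s hs => by
      have hs' := Ioo_subset_Icc_self hs
      have h1 := ((h.hasDerivAt_lift hs).sub_const v).div ((h.hasDerivAt_lift hs).add_const v⁻¹)
        (hne2 s hs')
      refine h1.congr_deriv ?_
      simp only [hV']
      ring)
    ((h.continuousOn_liftDeriv.mul continuousOn_const).div
      (((h.continuousOn_lift.mono Ioo_subset_Icc_self).add continuousOn_const).pow 2)
      fun s hs => pow_ne_zero _ (hne2 s (Ioo_subset_Icc_self hs)))
    (((intervalIntegrable_div_sub h.intervalIntegrable_logDeriv (h.continuousOn_arc abs_one)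
      hz).const_mul ρ).congr fun s hs => (hlog s (by
        rw [uIoc_of_le zero_le_one] at hs
        exact Ioc_subset_Icc_self hs)).symm)
  have hint : ∫ s in (0 : ℝ)..1, V' s / V s = ρ * C.cauchy F D z := by
    rw [cauchy, ← intervalIntegral.integral_const_mul]
    refine intervalIntegral.integral_congr fun s hs => hlog s ?_
    rwa [uIcc_of_le zero_le_one] at hs
  rw [← hint, hexp]
  have a1 := hne1 1 (by simp)
  have a2 := hne2 1 (by simp)
  have a3 := hne1 0 (by simp)
  have a4 := hne2 0 (by simp)
  rw [h.lift_one] at a1 a2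
  rw [h.lift_zero] at a3 a4
  simp only [hV, h.lift_one, h.lift_zero]
  have hvv : v * v⁻¹ = 1 := mul_inv_cancel₀ hv0
  rw [div_div_div_eq, div_eq_iff (mul_ne_zero a2 a3)]
  linear_combination -2 * hvv - 2 * Complex.I_sq

/-- Squaring removes the choice of ρ and leaves a function of z that is analytic off the arc with
discrete values. -/
theorem exists_odd (h : C.CritPath δ b F D) {z : ℂ} (hz : z ∉ closedArc (C.arc F 1)) :
    ∃ m : ℤ, (z - C.ξ) * (z - conj C.ξ) * C.cauchy F D z ^ 2 =
      -((Real.pi ^ 2 * (2 * m + 1) ^ 2 : ℝ) : ℂ) := by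
  obtain ⟨ρ, hρ⟩ := C.exists_sqrt z
  have h1 := h.exp_mul_cauchy hz hρ
  have h2 : Complex.exp (ρ * C.cauchy F D z - Real.pi * Complex.I) = 1 := by
    rw [Complex.exp_sub, h1, Complex.exp_pi_mul_I]
    norm_num
  obtain ⟨m, hm⟩ := Complex.exp_eq_one_iff.1 h2
  refine ⟨m, ?_⟩
  have h3 : ρ * C.cauchy F D z = Real.pi * (2 * m + 1) * Complex.I := by linear_combination hm
  rw [← hρ, ← mul_pow, h3, mul_pow, Complex.I_sq]
  push_cast
  ring

theorem differentiableAt_cauchy (h : C.CritPath δ b F D) {z : ℂ}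
    (hz : z ∉ closedArc (C.arc F 1)) : DifferentiableAt ℂ (C.cauchy F D) z :=
  HFunction.differentiableAt_cauchy h.intervalIntegrable_logDeriv (h.continuousOn_arc abs_one) hz

theorem tendsto_mul_cauchy (h : C.CritPath δ b F D) (hneg : (F 0).re < 0) :
    Tendsto (fun z => z * C.cauchy F D z) (Bornology.cobounded ℂ) (𝓝 (Real.pi * Complex.I)) := by
  have := HFunction.tendsto_mul_cauchy h.intervalIntegrable_logDeriv (h.continuousOn_arc abs_one)
  rw [h.integral_logDeriv hneg, neg_neg] at this
  exact this

theorem tendsto_mul_cauchy_sq (h : C.CritPath δ b F D) (hneg : (F 0).re < 0) :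
    Tendsto (fun z => (z - C.ξ) * (z - conj C.ξ) * C.cauchy F D z ^ 2) (Bornology.cobounded ℂ)
      (𝓝 (-(Real.pi ^ 2 : ℝ))) := by
  have h1 := h.tendsto_mul_cauchy hneg
  have h2 : ∀ x : ℂ, Tendsto (fun z : ℂ => 1 - x * z⁻¹) (Bornology.cobounded ℂ) (𝓝 1) := by
    intro x
    have := ((tendsto_inv₀_cobounded (α := ℂ)).const_mul x).const_sub 1
    simpa using this
  have h3 := ((h2 C.ξ).mul (h2 (conj C.ξ))).mul (h1.pow 2)
  have e : (1 : ℂ) * 1 * (Real.pi * Complex.I) ^ 2 = -((Real.pi ^ 2 : ℝ) : ℂ) := by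
    rw [mul_pow, Complex.I_sq]
    push_cast
    ring
  rw [e] at h3
  refine h3.congr' ?_
  filter_upwards [Bornology.eventually_ne_cobounded (0 : ℂ)] with z hz
  field_simp

end CritPath
end Config
-- The arc does not separate the plane.
namespace Config

variable {t γ a : ℝ} {C : Config t γ a}

theorem norm_le_of_Z_norm_le {w : ℂ} {B : ℝ} (hB : ‖C.Z w‖ ≤ B) :
    ‖w‖ ≤ (B + |C.β|) / C.α + 1 ∧ ‖w⁻¹‖ ≤ (B + |C.β|) / C.α + 1 := by
  have hα := C.α_pos
  have h1 : ‖w - w⁻¹‖ ≤ (B + |C.β|) / C.α := by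
    rw [le_div_iff₀ hα]
    calc ‖w - w⁻¹‖ * C.α = ‖C.Z w - C.β‖ := by
          rw [Z, add_sub_cancel_right, norm_mul, Complex.norm_real, Real.norm_of_nonneg hα.le, mul_comm]
      _ ≤ ‖C.Z w‖ + ‖(C.β : ℂ)‖ := norm_sub_le _ _
      _ ≤ _ := by
        rw [Complex.norm_real, Real.norm_eq_abs]
        gcongr
  have h2 : ‖w‖ ≤ ‖w - w⁻¹‖ + ‖w⁻¹‖ := by
    calc ‖w‖ = ‖(w - w⁻¹) + w⁻¹‖ := by ring_nf
      _ ≤ _ := norm_add_le _ _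
  have h3 : ‖w⁻¹‖ ≤ ‖w - w⁻¹‖ + ‖w‖ := by
    calc ‖w⁻¹‖ = ‖w - (w - w⁻¹)‖ := by ring_nf
      _ ≤ ‖w‖ + ‖w - w⁻¹‖ := norm_sub_le _ _
      _ = _ := add_comm _ _
  rcases le_total ‖w‖ 1 with h4 | h4
  · constructor <;> linarith [norm_nonneg (w - w⁻¹)]
  · have h5 : ‖w⁻¹‖ ≤ 1 := by
      rw [norm_inv]
      exact inv_le_one_of_one_le₀ h4
    constructor <;> linarith [norm_nonneg (w - w⁻¹)]

/-- Where f does not vanish g is open, so it cannot map a neighbourhood into the imaginary axis. -/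
theorem not_eventually_re_eq_zero {w : ℂ} (h0 : 0 < w.im) (hI : w ≠ Complex.I) :
    ¬ ∀ᶠ v in 𝓝 w, (C.g v).re = 0 := by
  intro h
  have hs := C.hasStrictDerivAt_g h0.le (C.ne_pts_of_im_pos h0)
  have h1 : ∀ᶠ ζ in 𝓝 (C.g w), ζ.re = 0 := by
    rw [← hs.map_nhds_eq (C.f_ne_zero_of_im_pos h0 hI)]
    exact h
  have h2 : Tendsto (fun x : ℝ => C.g w + (x : ℂ)) (𝓝[>] 0) (𝓝 (C.g w)) := by
    have : Continuous fun x : ℝ => C.g w + (x : ℂ) := by fun_prop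
    have h3 := this.tendsto 0
    simp only [Complex.ofReal_zero, add_zero] at h3
    exact h3.mono_left nhdsWithin_le_nhds
  obtain ⟨x, hx, hx0⟩ := ((h2.eventually h1).and self_mem_nhdsWithin).exists
  have h3 := h.self_of_nhds
  rw [Complex.add_re, h3, zero_add, Complex.ofReal_re] at hx
  exact (ne_of_gt hx0) hx

namespace CritPath

variable {δ : ℂ} {b : ℝ → ℝ} {F D : ℝ → ℂ}

theorem g_re_eq_zero (h : C.CritPath δ b F D) (hδ : δ.re = 0) (hpole : ∀ j, F 0 ≠ C.pts j)
    (hpole' : ∀ j, -(F 0)⁻¹ ≠ C.pts j) :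
    (C.g (F 0)).re = 0 ∧ (C.g (-(F 0)⁻¹)).re = 0 := by
  have hF : ContinuousAt F 0 := (h.hasDeriv 0 (by norm_num)).continuousAt
  have hmem : ∀ᶠ r : ℝ in 𝓝[>] 0, r ∈ Ioo (0 : ℝ) 1 := Ioo_mem_nhdsGT one_pos
  have hF0 := h.zero_ne
  have hFl : Tendsto F (𝓝[>] 0) (𝓝 (F 0)) := hF.tendsto.mono_left nhdsWithin_le_nhds
  have hFl' : Tendsto (fun r => -(F r)⁻¹) (𝓝[>] 0) (𝓝 (-(F 0)⁻¹)) := (hFl.inv₀ hF0).neg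
  have key : ∀ (V : ℝ → ℂ) (q : ℂ), q.im = 0 → (∀ j, q ≠ C.pts j) →
      Tendsto V (𝓝[>] 0) (𝓝 q) → (∀ r ∈ Ioo (0 : ℝ) 1, (C.g (V r)).re = 0) →
      (C.g q).re = 0 := by
    intro V q hq hqp hV hre
    have h1 := (Complex.continuous_re.tendsto _).comp
      ((C.analyticAt_g hq.ge hqp).continuousAt.tendsto.comp hV)
    refine tendsto_nhds_unique_of_eventuallyEq h1 tendsto_const_nhds ?_
    filter_upwards [hmem] with r hr using hre r hr
  have hg : ∀ r ∈ Ioo (0 : ℝ) 1, (C.g (F r)).re = 0 := by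
    intro r hr
    rw [h.g_eq r ⟨hr.1, hr.2.le⟩, Complex.re_mul_ofReal, hδ, zero_mul]
  refine ⟨key F _ h.im_zero hpole hFl hg, key _ _ ?_ hpole' hFl' fun r hr => ?_⟩
  · rw [Complex.neg_im, Complex.inv_im, h.im_zero]
    simp
  · rw [C.g_neg_inv (h.im_pos r ⟨hr.1, hr.2.le⟩), Complex.neg_re, hg r hr, neg_zero]

/-- No bounded open set in the upper half-plane is bordered by the arc alone. -/
theorem not_bounded (h : C.CritPath δ b F D) (hδ : δ.re = 0) (hpole : ∀ j, F 0 ≠ C.pts j)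
    (hpole' : ∀ j, -(F 0)⁻¹ ≠ C.pts j) {V : Set ℂ} (hVo : IsOpen V) (hVne : V.Nonempty)
    (hVb : Bornology.IsBounded V) (hVim : ∀ z ∈ V, 0 < z.im)
    (hVarc : Disjoint V (closedArc (C.arc F 1))) (hfr : frontier V ⊆ closedArc (C.arc F 1)) :
    False := by
  obtain ⟨hg0, hg0'⟩ := h.g_re_eq_zero hδ hpole hpole'
  obtain ⟨B, hB⟩ := isBounded_iff_forall_norm_le.1 hVb
  -- The preimage of V in the half-plane is bounded, and bounded away from 0 as well. Its boundary
  -- lies over the arc, where Re g = 0 on both sheets.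
  set U : Set ℂ := {w | 0 < w.im ∧ C.Z w ∈ V} with hU
  set M := (B + |C.β|) / C.α + 1 with hM
  have hUM : ∀ w ∈ U, ‖w‖ ≤ M ∧ ‖w⁻¹‖ ≤ M := fun w hw => norm_le_of_Z_norm_le (hB _ hw.2)
  have hZc : ∀ w : ℂ, w ≠ 0 → ContinuousAt C.Z w := fun w hw => (C.hasDerivAt_Z hw).continuousAt
  have hne : ∀ w : ℂ, 0 < w.im → w ≠ 0 := by
    rintro w hw rfl
    simp at hw
  have hUo : IsOpen U := by
    rw [isOpen_iff_mem_nhds]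
    intro w hw
    filter_upwards [(isOpen_lt continuous_const Complex.continuous_im).mem_nhds hw.1,
      (hZc w (hne w hw.1)).preimage_mem_nhds (hVo.mem_nhds hw.2)] with v h1 h2 using ⟨h1, h2⟩
  have hUb : Bornology.IsBounded U := isBounded_iff_forall_norm_le.2 ⟨M, fun w hw => (hUM w hw).1⟩
  have hcl : ∀ w ∈ closure U, 0 ≤ w.im ∧ w ≠ 0 ∧ C.Z w ∈ closure V := by
    intro w hw
    have h1 : 0 ≤ w.im := closure_minimal (t := {w : ℂ | 0 ≤ w.im}) (fun v hv => le_of_lt hv.1)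
      (isClosed_le continuous_const Complex.continuous_im) hw
    have h2 : 1 ≤ M * ‖w‖ := by
      refine closure_minimal (t := {w : ℂ | 1 ≤ M * ‖w‖}) (fun v hv => ?_)
        (isClosed_le continuous_const (by fun_prop)) hw
      have h3 := (hUM v hv).2
      have h4 : 0 < ‖v‖ := norm_pos_iff.2 (hne v hv.1)
      rw [norm_inv] at h3
      change 1 ≤ M * ‖v‖
      calc 1 = ‖v‖⁻¹ * ‖v‖ := (inv_mul_cancel₀ h4.ne').symm
        _ ≤ M * ‖v‖ := by gcongr
    have h3 : w ≠ 0 := by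
      rintro rfl
      simp at h2
      linarith
    refine ⟨h1, h3, ?_⟩
    exact closure_mono (image_subset_iff.2 fun v hv => hv.2)
      (mem_closure_image (hZc w h3) hw)
  have hfrV : ∀ z ∈ closure V, z ∉ V → z ∈ closedArc (C.arc F 1) := by
    intro z hz hzV
    exact hfr ⟨hz, by rwa [hVo.interior_eq]⟩
  -- A real boundary point projects to the crossing point of the arc with the real axis. Its two
  -- preimages are not poles, so g is analytic on the closure of U.
  have hreal : ∀ w ∈ closure U, w.im = 0 → w = F 0 ∨ w = -(F 0)⁻¹ := by
    intro w hw him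
    obtain ⟨-, hw0, hZw⟩ := hcl w hw
    have h1 : (C.Z w).im = 0 := by rw [C.Z_im, him, mul_zero]
    obtain ⟨s, hs, hse⟩ := hfrV _ hZw fun h2 => by
      have := hVim _ h2
      linarith
    have h2 := h.eq_half_of_im_eq_zero abs_one hs (by rw [hse, h1])
    rw [h2, arc_half] at hse
    exact (C.Z_eq_Z_iff h.zero_ne hw0).1 hse
  have hnp : ∀ w ∈ closure U, ∀ j, w ≠ C.pts j := by
    intro w hw
    rcases (hcl w hw).1.lt_or_eq with h1 | h1
    · exact C.ne_pts_of_im_pos h1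
    · rcases hreal w hw h1.symm with rfl | rfl
      · exact hpole
      · exact hpole'
  have hgfr : ∀ w ∈ frontier U, (C.g w).re = 0 := by
    intro w hw
    have hwc := frontier_subset_closure hw
    have hwU : w ∉ U := by
      rw [← hUo.interior_eq]
      exact hw.2
    obtain ⟨h1, hw0, hZw⟩ := hcl w hwc
    rcases h1.lt_or_eq with h1 | h1
    · obtain ⟨s, hs, hse⟩ := hfrV _ hZw fun h2 => hwU ⟨h1, h2⟩
      have h2 : 0 < (C.arc F 1 s).im := by rw [hse, C.Z_im_pos_iff]; exact h1
      have h3 := (h.arc_im_pos_iff abs_one hs).1 h2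
      have hr := param_mem_Icc abs_one hs
      have hr' : (1 : ℝ) * (2 * s - 1) ∈ Ioc (0 : ℝ) 1 := ⟨h3, hr.2⟩
      have h4 := h.g_eq _ hr'
      rcases (C.Z_eq_Z_iff (h.ne_zero hr) hw0).1 hse with h5 | h5
      · rw [h5, h4, Complex.re_mul_ofReal, hδ, zero_mul]
      · rw [h5, C.g_neg_inv (h.im_pos _ hr'), h4, Complex.neg_re, Complex.re_mul_ofReal, hδ, zero_mul,
          neg_zero]
    · rcases hreal w hwc h1.symm with rfl | rfl
      · exact hg0
      · exact hg0'
  have hgd : ∀ w ∈ closure U, DifferentiableAt ℂ C.g w := fun w hw =>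
    (C.analyticAt_g (hcl w hw).1 (hnp w hw)).differentiableAt
  -- Maximum principle for exp(σg), used with σ = 1 and σ = −1; together they give Re g = 0 on U.
  have hbound : ∀ σ : ℂ, σ.im = 0 → ∀ w ∈ U, (σ * C.g w).re ≤ 0 := by
    intro σ hσ w hw
    have hd : DiffContOnCl ℂ (fun w => Complex.exp (σ * C.g w)) U :=
      ⟨fun v hv => ((hgd v (subset_closure hv)).const_mul σ).cexp.differentiableWithinAt,
        fun v hv => ((hgd v hv).const_mul σ).cexp.continuousAt.continuousWithinAt⟩
    have h1 := Complex.norm_le_of_forall_mem_frontier_norm_le hUb hd (C := 1) (fun v hv => by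
      rw [Complex.norm_exp, Complex.mul_re, hσ, hgfr v hv]
      simp) (subset_closure hw)
    rw [Complex.norm_exp, Real.exp_le_one_iff] at h1
    exact h1
  have hre : ∀ w ∈ U, (C.g w).re = 0 := by
    intro w hw
    have h1 := hbound 1 (by simp) w hw
    have h2 := hbound (-1) (by simp) w hw
    simp at h1 h2
    linarith
  obtain ⟨z, hz⟩ := hVne
  obtain ⟨ρ, hρ⟩ := C.exists_sqrt z
  obtain ⟨w, -, hZw, -⟩ := C.exists_Z_eq hρ
  have hw0 : 0 < w.im := by
    rw [← C.Z_im_pos_iff, hZw]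
    exact hVim z hz
  have hwU : w ∈ U := ⟨hw0, by rwa [hZw]⟩
  refine not_eventually_re_eq_zero (C := C) hw0 (fun hI => ?_) ?_
  · refine Set.disjoint_left.1 hVarc hz ⟨1, by simp, ?_⟩
    rw [arc_eq, h.lift_one, ← hZw, hI]
  · filter_upwards [hUo.mem_nhds hwU] with v hv using hre v hv

theorem conj_mem_closedArc (h : C.CritPath δ b F D) {z : ℂ} :
    conj z ∈ closedArc (C.arc F 1) ↔ z ∈ closedArc (C.arc F 1) := by
  have key : ∀ z, z ∈ closedArc (C.arc F 1) → conj z ∈ closedArc (C.arc F 1) := by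
    rintro _ ⟨s, hs, rfl⟩
    exact ⟨1 - s, ⟨by linarith [hs.2], by linarith [hs.1]⟩, h.arc_one_sub s⟩
  refine ⟨fun h1 => ?_, key z⟩
  have := key _ h1
  rwa [Complex.conj_conj] at this

theorem ofReal_notMem (h : C.CritPath δ b F D) {x : ℝ} (hx : (x : ℂ) ≠ C.Z (F 0)) :
    (x : ℂ) ∉ closedArc (C.arc F 1) := by
  rintro ⟨s, hs, hse⟩
  have h1 := h.eq_half_of_im_eq_zero abs_one hs (by rw [hse, Complex.ofReal_im])
  rw [h1, arc_half] at hse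
  exact hx hse.symm

/-- All components of the complement of the arc are unbounded. -/
theorem not_isBounded_component (h : C.CritPath δ b F D) (hδ : δ.re = 0)
    (hpole : ∀ j, F 0 ≠ C.pts j) (hpole' : ∀ j, -(F 0)⁻¹ ≠ C.pts j) {z : ℂ}
    (hz : z ∉ closedArc (C.arc F 1)) :
    ¬ Bornology.IsBounded (connectedComponentIn (closedArc (C.arc F 1))ᶜ z) := by
  intro hb
  set K := closedArc (C.arc F 1) with hK
  have hKo : IsOpen Kᶜ := isOpen_compl_closedArc (h.continuousOn_arc abs_one)
  set V := connectedComponentIn Kᶜ z with hV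
  have hVo : IsOpen V := hKo.connectedComponentIn
  have hVK : V ⊆ Kᶜ := connectedComponentIn_subset _ _
  have hzV : z ∈ V := mem_connectedComponentIn hz
  have hVc : IsPreconnected V := isPreconnected_connectedComponentIn
  have hVdisj : Disjoint V K := Set.disjoint_left.2 hVK
  have hfr : frontier V ⊆ K := by
    intro y hy
    by_contra hyK
    have hYo : IsOpen (connectedComponentIn Kᶜ y) := hKo.connectedComponentIn
    obtain ⟨v, hvY, hvV⟩ := mem_closure_iff.1 hy.1 _ hYo (mem_connectedComponentIn hyK)
    have e1 := connectedComponentIn_eq hvY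
    have e2 := connectedComponentIn_eq hvV
    have hyV : y ∈ V := by
      rw [hV, e2, ← e1]
      exact mem_connectedComponentIn hyK
    apply hy.2
    rwa [hVo.interior_eq]
  have him0 : (C.Z (F 0)).im = 0 := by rw [C.Z_im, h.im_zero, mul_zero]
  set x₀ := (C.Z (F 0)).re with hx₀
  have hxe : C.Z (F 0) = x₀ := Complex.ext (by simp [hx₀]) (by simpa using him0)
  -- Removing the crossing point leaves two unbounded rays of the real axis that avoid the arc; a
  -- bounded component therefore misses them and lies in one open half-plane.
  have hnoreal : ∀ x : ℝ, (x : ℂ) ∉ V := by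
    have key : ∀ (J : Set ℝ), IsPreconnected J → x₀ ∉ J → ¬ Bornology.IsBounded J →
        ∀ x ∈ J, (x : ℂ) ∉ V := by
      intro J hJ hJ0 hJb x hx hxV
      apply hJb
      have h1 : (fun x : ℝ => (x : ℂ)) '' J ⊆ V := by
        rw [hV, connectedComponentIn_eq hxV]
        refine (hJ.image _ Complex.continuous_ofReal.continuousOn).subset_connectedComponentIn
          ⟨x, hx, rfl⟩ ?_
        rintro _ ⟨y, hy, rfl⟩
        refine h.ofReal_notMem fun hye => hJ0 ?_
        rw [hxe] at hye
        rwa [← Complex.ofReal_injective hye]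
      obtain ⟨B, hB⟩ := isBounded_iff_forall_norm_le.1 hb
      refine isBounded_iff_forall_norm_le.2 ⟨B, fun y hy => ?_⟩
      have := hB _ (h1 ⟨y, hy, rfl⟩)
      rwa [Complex.norm_real] at this
    intro x hxV
    rcases lt_trichotomy x x₀ with hx | hx | hx
    · refine key (Iio x₀) isPreconnected_Iio (by simp) (fun hb => ?_) x hx hxV
      exact not_bddBelow_Iio _ hb.bddBelow
    · exact hVK hxV ⟨1 / 2, by norm_num, by rw [arc_half, hxe, hx]⟩
    · refine key (Ioi x₀) isPreconnected_Ioi (by simp) (fun hb => ?_) x hx hxV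
      exact not_bddAbove_Ioi _ hb.bddAbove
  have hnoim : ∀ v ∈ V, v.im ≠ 0 := by
    intro v hv h0
    apply hnoreal v.re
    rwa [show ((v.re : ℝ) : ℂ) = v from Complex.ext (by simp) (by simp [h0])]
  have hsign : (∀ v ∈ V, 0 < v.im) ∨ ∀ v ∈ V, v.im < 0 := by
    by_contra! hcon
    obtain ⟨⟨u, hu, hu0⟩, v, hv, hv0⟩ := hcon
    obtain ⟨y, hy, hy0⟩ := hVc.intermediate_value hu hv Complex.continuous_im.continuousOn
      (show (0 : ℝ) ∈ Icc u.im v.im from ⟨hu0, hv0⟩)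
    exact hnoim y hy hy0
  rcases hsign with hs | hs
  · exact h.not_bounded hδ hpole hpole' hVo ⟨z, hzV⟩ hb hs hVdisj hfr
  · have hfr' : frontier ((fun z : ℂ => conj z) ⁻¹' V) = (fun z : ℂ => conj z) ⁻¹' frontier V :=
      (Complex.conjCLE.toHomeomorph.preimage_frontier V).symm
    refine h.not_bounded hδ hpole hpole' (V := (fun z : ℂ => conj z) ⁻¹' V)
      (hVo.preimage Complex.continuous_conj) ⟨conj z, by simpa using hzV⟩ ?_ ?_ ?_ ?_
    · obtain ⟨B, hB⟩ := isBounded_iff_forall_norm_le.1 hb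
      refine isBounded_iff_forall_norm_le.2 ⟨B, fun y hy => ?_⟩
      have := hB _ hy
      rwa [RCLike.norm_conj] at this
    · intro y hy
      have := hs _ hy
      simpa using this
    · refine Set.disjoint_left.2 fun y hy hyK => hVK hy ?_
      exact h.conj_mem_closedArc.2 hyK
    · rw [hfr']
      intro y hy
      exact h.conj_mem_closedArc.1 (hfr hy)

/-- The Cauchy integral is `π i` times the reciprocal of a square root. -/
theorem mul_cauchy_sq (h : C.CritPath δ b F D) (hδ : δ.re = 0) (hneg : (F 0).re < 0)
    (hpole : ∀ j, F 0 ≠ C.pts j) (hpole' : ∀ j, -(F 0)⁻¹ ≠ C.pts j) {z : ℂ}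
    (hz : z ∉ closedArc (C.arc F 1)) :
    (z - C.ξ) * (z - conj C.ξ) * C.cauchy F D z ^ 2 = -(Real.pi ^ 2 : ℝ) := by
  set N : ℂ → ℝ := fun z => (-((z - C.ξ) * (z - conj C.ξ) * C.cauchy F D z ^ 2)).re / Real.pi ^ 2
    with hN
  have hπ : 0 < Real.pi ^ 2 := by positivity
  have hodd : ∀ y ∉ closedArc (C.arc F 1), ∃ m : ℤ, N y = (2 * m + 1) ^ 2 ∧
      (z - C.ξ) * (z - conj C.ξ) * C.cauchy F D z ^ 2 = -((Real.pi ^ 2 * N z : ℝ) : ℂ) := by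
    intro y hy
    obtain ⟨m, hm⟩ := h.exists_odd hy
    obtain ⟨m', hm'⟩ := h.exists_odd hz
    refine ⟨m, ?_, ?_⟩
    · simp only [hN]
      rw [hm, neg_neg, Complex.ofReal_re]
      field_simp
    · simp only [hN]
      rw [hm', neg_neg, Complex.ofReal_re]
      congr 2
      field_simp
  -- All values of N are squares of odd integers. The value 4 separates 1 from the others, so by
  -- continuity a component that reaches the region near infinity has N = 1.
  have hN4 : ∀ y ∉ closedArc (C.arc F 1), N y ≠ 4 := by
    intro y hy h4
    obtain ⟨m, hm, -⟩ := hodd y hy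
    rw [h4] at hm
    have h5 : (4 : ℤ) = (2 * m + 1) ^ 2 := by exact_mod_cast hm
    have h6 : (2 * m + 1) ^ 2 = 2 * (2 * m ^ 2 + 2 * m) + 1 := by ring
    omega
  have hlim : Tendsto N (Bornology.cobounded ℂ) (𝓝 1) := by
    have h1 := (Complex.continuous_re.tendsto _).comp (h.tendsto_mul_cauchy_sq hneg).neg
    have h2 := h1.div_const (Real.pi ^ 2)
    rw [neg_neg, Complex.ofReal_re, div_self hπ.ne'] at h2
    exact h2
  set V := connectedComponentIn (closedArc (C.arc F 1))ᶜ z with hV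
  have hVK : V ⊆ (closedArc (C.arc F 1))ᶜ := connectedComponentIn_subset _ _
  have hcont : ContinuousOn N V := by
    intro y hy
    have h1 := (h.differentiableAt_cauchy (hVK hy)).continuousAt
    have h2 : ContinuousAt (fun z => -((z - C.ξ) * (z - conj C.ξ) * C.cauchy F D z ^ 2)) y :=
      (((continuousAt_id.sub continuousAt_const).mul
        (continuousAt_id.sub continuousAt_const)).mul (h1.pow 2)).neg
    exact ((Complex.continuous_re.continuousAt.comp h2).div_const _).continuousWithinAt
  obtain ⟨r, -, hr⟩ := (Metric.hasBasis_cobounded_compl_closedBall (0 : ℂ)).eventually_iff.1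
    (hlim.eventually (gt_mem_nhds (by norm_num : (1 : ℝ) < 4)))
  obtain ⟨y, hyV, hyr⟩ : ∃ y ∈ V, y ∈ (Metric.closedBall (0 : ℂ) r)ᶜ := by
    by_contra! hcon
    refine h.not_isBounded_component hδ hpole hpole' hz ?_
    exact (Metric.isBounded_closedBall (x := (0 : ℂ)) (r := r)).subset fun y hy => by
      simpa using hcon y hy
  have hNz : N z < 4 := by
    by_contra hge
    obtain ⟨x, hx, hx4⟩ := isPreconnected_connectedComponentIn.intermediate_value hyV
      (mem_connectedComponentIn hz) hcont (show (4 : ℝ) ∈ Icc (N y) (N z) from ⟨(hr hyr).le, not_lt.1 hge⟩)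
    exact hN4 x (hVK hx) hx4
  obtain ⟨m, hm, he⟩ := hodd z hz
  have hNz1 : N z = 1 := by
    have h5 : (2 * m + 1) ^ 2 < (4 : ℤ) := by
      rw [hm] at hNz
      exact_mod_cast hNz
    have h6 : (2 * m + 1) ^ 2 = (1 : ℤ) := by
      have h7 : -1 ≤ m := by nlinarith
      have h8 : m ≤ 0 := by nlinarith
      interval_cases m <;> norm_num
    rw [hm]
    exact_mod_cast h6
  rw [he, hNz1, mul_one]

end CritPath
end Config

/-! ### The branch R and its boundary values. -/

theorem tendsto_mono_prod {f : ℝ × ℝ → ℂ} {l : Filter ℝ} {s : ℝ} {L : ℂ}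
    (h : Tendsto f (𝓝 s ×ˢ l) (𝓝 L)) : Tendsto (fun y => f (s, y)) l (𝓝 L) :=
  h.comp ((tendsto_const_nhds (x := s)).prodMk tendsto_id)

theorem hasLeftLimit_iff {f : ℂ → ℂ} {c : ℝ → ℂ} {s : ℝ} {l : ℂ} :
    HasLeftLimit f c s l ↔ Tendsto (fun x : ℝ × ℝ => f (normalPt c (x.1, 1 * x.2)))
      (𝓝 s ×ˢ 𝓝[>] (0 : ℝ)) (𝓝 l) := by
  rw [HasLeftLimit]
  simp only [normalPt, one_mul]

theorem hasRightLimit_iff {f : ℂ → ℂ} {c : ℝ → ℂ} {s : ℝ} {l : ℂ} :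
    HasRightLimit f c s l ↔ Tendsto (fun x : ℝ × ℝ => f (normalPt c (x.1, -1 * x.2)))
      (𝓝 s ×ˢ 𝓝[>] (0 : ℝ)) (𝓝 l) := by
  have : ∀ x : ℝ × ℝ, c x.1 - Complex.I * x.2 * deriv c x.1 = normalPt c (x.1, -1 * x.2) := by
    intro x
    rw [normalPt]
    push_cast
    ring
  rw [HasRightLimit]
  simp only [this]

namespace SymPath

variable {F D : ℝ → ℂ}

theorem deriv_zero_re (h : SymPath F D) : (D 0).re = 0 := by
  have h1 := congrArg Complex.re (h.deriv_symm 0)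
  simp at h1
  linarith

/-- The path enters the upper half-plane at parameter 0. The direction of crossing is what later
distinguishes the left side of Γ₁ from the right. -/
theorem deriv_zero_im_pos (h : SymPath F D) : 0 < (D 0).im := by
  have h1 := h.hasDeriv 0 (by norm_num)
  have h2 : HasDerivAt (fun r => (F r).im) (D 0).im 0 :=
    Complex.imCLM.hasFDerivAt.comp_hasDerivAt (0 : ℝ) h1
  have h3 : 0 ≤ (D 0).im := by
    have h4 := (hasDerivAt_iff_tendsto_slope.1 h2).mono_left
      (nhdsWithin_mono (0 : ℝ) (fun x (hx : x ∈ Ioi (0 : ℝ)) => (ne_of_gt hx : x ≠ 0)))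
    refine ge_of_tendsto h4 ?_
    filter_upwards [Ioo_mem_nhdsGT (one_pos : (0 : ℝ) < 1)] with r hr
    rw [slope_def_field, h.im_zero, sub_zero, sub_zero]
    exact (div_pos (h.im_pos r ⟨hr.1, hr.2.le⟩) hr.1).le
  refine lt_of_le_of_ne h3 fun h4 => h.D_ne 0 (by norm_num) ?_
  exact Complex.ext h.deriv_zero_re h4.symm

end SymPath

namespace Config

variable {t γ a : ℝ} (C : Config t γ a)

/-- The branch of the square root cut along the arc below `F`. -/
def R (F D : ℝ → ℂ) (z : ℂ) : ℂ := Real.pi * Complex.I / C.cauchy F D z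

theorem X_re_neg {w : ℂ} (him : w.im = 0) (hre : w.re < 0) : (C.X w).re < 0 ∧ (C.X w).im = 0 := by
  obtain ⟨q, rfl⟩ : ∃ q : ℝ, w = q := ⟨w.re, Complex.ext (by simp) (by simpa using him)⟩
  rw [Complex.ofReal_re] at hre
  have : C.X q = ((C.α * (q + q⁻¹) : ℝ) : ℂ) := by
    rw [X]
    push_cast
    ring
  rw [this, Complex.ofReal_re, Complex.ofReal_im]
  exact ⟨mul_neg_of_pos_of_neg C.α_pos (add_neg hre (inv_lt_zero.2 hre)), rfl⟩

theorem p_ofReal (x : ℝ) :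
    ((x : ℂ) - C.ξ) * (x - conj C.ξ) = (((x - C.β) ^ 2 + 4 * C.α ^ 2 : ℝ) : ℂ) := by
  rw [ξ]
  simp only [map_add, map_mul, Complex.conj_ofReal, Complex.conj_I, map_ofNat]
  push_cast
  linear_combination (-4 * (C.α : ℂ) ^ 2) * Complex.I_sq

theorem p_pos (x : ℝ) : 0 < (x - C.β) ^ 2 + 4 * C.α ^ 2 := by
  have := C.α_pos
  positivity

/-- A symmetric path over the trajectory `Γ₁`. -/
structure TrajPath (b : ℝ → ℝ) (F D : ℝ → ℂ) : Prop extends C.CritPath Complex.I b F D where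
  neg : (F 0).re < 0
  pole : ∀ j, F 0 ≠ C.pts j
  pole' : ∀ j, -(F 0)⁻¹ ≠ C.pts j
  Z_pos : 0 < (C.Z (F 0)).re

variable {C}

namespace TrajPath

variable {b : ℝ → ℝ} {F D : ℝ → ℂ}

theorem R_sq (h : C.TrajPath b F D) {z : ℂ} (hz : z ∉ closedArc (C.arc F 1)) :
    C.R F D z ^ 2 = (z - C.ξ) * (z - conj C.ξ) := by
  have h1 := h.mul_cauchy_sq (by simp) h.neg h.pole h.pole' hz
  have hπ : (Real.pi : ℂ) ≠ 0 := by exact_mod_cast Real.pi_ne_zero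
  have h2 : C.cauchy F D z ≠ 0 := by
    intro h0
    rw [h0] at h1
    simp [hπ] at h1
  rw [R, div_pow, mul_pow, Complex.I_sq, div_eq_iff (pow_ne_zero 2 h2), h1]
  push_cast
  ring

theorem cauchy_ne (h : C.TrajPath b F D) {z : ℂ} (hz : z ∉ closedArc (C.arc F 1)) :
    C.cauchy F D z ≠ 0 := by
  intro h0
  have h1 := h.mul_cauchy_sq (by simp) h.neg h.pole h.pole' hz
  rw [h0] at h1
  simp at h1

theorem R_ne (h : C.TrajPath b F D) {z : ℂ} (hz : z ∉ closedArc (C.arc F 1)) : C.R F D z ≠ 0 := by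
  have hπ : (Real.pi : ℂ) ≠ 0 := by exact_mod_cast Real.pi_ne_zero
  exact div_ne_zero (mul_ne_zero hπ Complex.I_ne_zero) (h.cauchy_ne hz)

theorem isOpen_compl (h : C.TrajPath b F D) : IsOpen (closedArc (C.arc F 1))ᶜ :=
  isOpen_compl_closedArc (h.continuousOn_arc abs_one)

theorem differentiableOn_R (h : C.TrajPath b F D) :
    DifferentiableOn ℂ (C.R F D) (closedArc (C.arc F 1))ᶜ := fun _ hz =>
  ((differentiableAt_const _).div (h.differentiableAt_cauchy hz) (h.cauchy_ne hz)).differentiableWithinAt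

theorem tendsto_R_div (h : C.TrajPath b F D) :
    Tendsto (fun z => C.R F D z / z) (Bornology.cobounded ℂ) (𝓝 1) := by
  have hπ : (Real.pi * Complex.I : ℂ) ≠ 0 :=
    mul_ne_zero (by exact_mod_cast Real.pi_ne_zero) Complex.I_ne_zero
  have h1 := (tendsto_const_nhds (x := (Real.pi * Complex.I : ℂ))).div (h.tendsto_mul_cauchy h.neg) hπ
  rw [div_self hπ] at h1
  refine h1.congr fun z => ?_
  simp only [Pi.div_apply, R]
  rw [div_div, mul_comm z]

theorem isSqrtBranch (h : C.TrajPath b F D) : IsSqrtBranch (C.arc F 1) C.ξ (C.R F D) where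
  analytic := h.differentiableOn_R.analyticOnNhd h.isOpen_compl
  sq := fun _ hz => h.R_sq hz
  atInfinity := h.tendsto_R_div

theorem Z_zero_eq (h : C.TrajPath b F D) : C.Z (F 0) = ((C.Z (F 0)).re : ℂ) := by
  refine Complex.ext (by simp) ?_
  rw [C.Z_im, h.im_zero, mul_zero, Complex.ofReal_im]

theorem notMem_of_ne (h : C.TrajPath b F D) {x : ℝ} (hx : x ≠ (C.Z (F 0)).re) :
    (x : ℂ) ∉ closedArc (C.arc F 1) :=
  h.ofReal_notMem fun he => hx (by rw [← he, Complex.ofReal_re])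

theorem R_ofReal (h : C.TrajPath b F D) {x : ℝ} (hx : x ≠ (C.Z (F 0)).re) :
    (C.R F D x).im = 0 ∧ (C.R F D x).re ≠ 0 := by
  have h1 := h.R_sq (h.notMem_of_ne hx)
  rw [C.p_ofReal] at h1
  have h2 := C.p_pos x
  have e1 := congrArg Complex.re h1
  have e2 := congrArg Complex.im h1
  rw [sq, Complex.mul_re, Complex.ofReal_re] at e1
  rw [sq, Complex.mul_im, Complex.ofReal_im] at e2
  have e3 : (C.R F D x).re * (C.R F D x).im = 0 := by linarith
  have hre : (C.R F D x).re ≠ 0 := by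
    intro h0
    rw [h0] at e1
    nlinarith [mul_self_nonneg (C.R F D x).im]
  exact ⟨(mul_eq_zero.1 e3).resolve_left hre, hre⟩

theorem continuousOn_R_re (h : C.TrajPath b F D) {J : Set ℝ} (hJ : (C.Z (F 0)).re ∉ J) :
    ContinuousOn (fun x : ℝ => (C.R F D x).re) J := by
  intro x hx
  have h1 : (x : ℂ) ∉ closedArc (C.arc F 1) := h.notMem_of_ne fun he => hJ (he ▸ hx)
  have h2 := (h.differentiableOn_R.differentiableAt (h.isOpen_compl.mem_nhds h1)).continuousAt
  exact (Complex.continuous_re.continuousAt.comp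
    (h2.comp Complex.continuous_ofReal.continuousAt)).continuousWithinAt

theorem R_sign_of_large (h : C.TrajPath b F D) :
    ∃ M : ℝ, ∀ x : ℝ, M < |x| → 0 < (C.R F D x).re * x := by
  have h1 := (Complex.continuous_re.tendsto _).comp h.tendsto_R_div
  obtain ⟨r, -, hr⟩ := (Metric.hasBasis_cobounded_compl_closedBall (0 : ℂ)).eventually_iff.1
    (h1.eventually (lt_mem_nhds (by simp : (0 : ℝ) < (1 : ℂ).re)))
  refine ⟨max r 0, fun x hx => ?_⟩
  have h2 := hr (x := (x : ℂ)) (by simpa using (le_max_left _ _).trans_lt hx)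
  have hx0 : x ≠ 0 := by
    rintro rfl
    simp at hx
  simp only [Function.comp, Complex.div_ofReal_re] at h2
  have h3 : (C.R F D x).re * x = (C.R F D x).re / x * x ^ 2 := by field_simp
  rw [h3]
  positivity

/-- On the real axis off the arc R is real and nonzero, so its sign on the ray is the one dictated
by R(z) ~ z. -/
theorem R_neg (h : C.TrajPath b F D) {x : ℝ} (hx : x < (C.Z (F 0)).re) : (C.R F D x).re < 0 := by
  obtain ⟨M, hM⟩ := h.R_sign_of_large
  by_contra hge
  set y := min x (-(|M| + 1)) with hy
  have hy0 : y < 0 := lt_of_le_of_lt (min_le_right _ _) (by linarith [abs_nonneg M])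
  have hyM : M < |y| := by
    have h1 : y ≤ -(|M| + 1) := min_le_right _ _
    rw [abs_of_neg hy0]
    linarith [le_abs_self M]
  have hyneg : (C.R F D y).re < 0 := by
    have := hM y hyM
    nlinarith
  obtain ⟨v, hv, hv0⟩ := (isPreconnected_Iio (a := (C.Z (F 0)).re)).intermediate_value
    (show y ∈ Iio (C.Z (F 0)).re from (min_le_left _ _).trans_lt hx) (show x ∈ Iio (C.Z (F 0)).re from hx)
    (h.continuousOn_R_re (by simp)) (show (0 : ℝ) ∈ Icc _ _ from ⟨hyneg.le, not_lt.1 hge⟩)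
  exact (h.R_ofReal (ne_of_lt hv)).2 hv0

theorem R_pos (h : C.TrajPath b F D) {x : ℝ} (hx : (C.Z (F 0)).re < x) : 0 < (C.R F D x).re := by
  obtain ⟨M, hM⟩ := h.R_sign_of_large
  by_contra hge
  set y := max x (|M| + 1) with hy
  have hy0 : 0 < y := lt_of_lt_of_le (by positivity) (le_max_right _ _)
  have hyM : M < |y| := by
    have h1 : |M| + 1 ≤ y := le_max_right _ _
    rw [abs_of_pos hy0]
    linarith [le_abs_self M]
  have hypos : 0 < (C.R F D y).re := pos_of_mul_pos_left (hM y hyM) hy0.le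
  obtain ⟨v, hv, hv0⟩ := (isPreconnected_Ioi (a := (C.Z (F 0)).re)).intermediate_value
    (show x ∈ Ioi (C.Z (F 0)).re from hx)
    (show y ∈ Ioi (C.Z (F 0)).re from hx.trans_le (le_max_left _ _))
    (h.continuousOn_R_re (by simp)) (show (0 : ℝ) ∈ Icc _ _ from ⟨not_lt.1 hge, hypos.le⟩)
  exact (h.R_ofReal (ne_of_gt hv)).2 hv0

/-- The values of the branch to the left of the arc on the real axis. -/
theorem R_eq_neg (h : C.TrajPath b F D) {x s : ℝ} (hx : x < (C.Z (F 0)).re) (hs : 0 < s)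
    (hsq : s ^ 2 = (x - C.β) ^ 2 + 4 * C.α ^ 2) : C.R F D x = -(s : ℂ) := by
  have h1 := h.R_sq (h.notMem_of_ne hx.ne)
  rw [C.p_ofReal, ← hsq] at h1
  push_cast at h1
  rcases sq_eq_sq_iff_eq_or_eq_neg.1 h1 with h2 | h2
  · have := h.R_neg hx
    rw [h2, Complex.ofReal_re] at this
    linarith
  · exact h2

/-- A local inverse u of Z yields the square root X∘u, which is continuous across the arc and with
which R can be compared. -/
theorem exists_side_limit (h : C.TrajPath b F D) {σ s : ℝ} (hσ : σ ≠ 0) (hs : s ∈ Ioo (0 : ℝ) 1) :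
    ∃ e : ℂ, e ^ 2 = 1 ∧ Tendsto (fun x : ℝ × ℝ => C.R F D (normalPt (C.arc F 1) (x.1, σ * x.2)))
      (𝓝 s ×ˢ 𝓝[>] (0 : ℝ)) (𝓝 (e * C.X (lift F s))) := by
  have hr := param_mem_Ioo abs_one hs
  have hw0 : lift F s ≠ 0 := h.lift_ne (Ioo_subset_Icc_self hs)
  have hstrict : HasStrictDerivAt C.Z (C.X (lift F s) / lift F s) (lift F s) := by
    have hne : ∀ᶠ w in 𝓝 (lift F s), w ≠ 0 := isOpen_ne.mem_nhds hw0
    refine hasStrictDerivAt_of_hasDerivAt_of_continuousAt (f' := fun w => C.X w / w) ?_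
      ((CritPath.continuousAt_X hw0).div continuousAt_id hw0)
    filter_upwards [hne] with w hw using C.hasDerivAt_Z hw
  obtain ⟨u, hu0, -, hud, hu⟩ := exists_local_inverse hstrict (div_ne_zero (h.X_ne hr) hw0)
  have hune : ∀ᶠ v in 𝓝 (C.Z (lift F s)), u v ≠ 0 := by
    refine hud.hasDerivAt.continuousAt.eventually_ne ?_
    rwa [hu0]
  have hX : C.X (u (C.Z (lift F s))) = C.X (lift F s) := by rw [hu0]
  have := (h.isSimpleArc abs_one).exists_side_limit (R := C.R F D) (ρ := fun v => C.X (u v)) hs hσ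
    h.differentiableOn_R.continuousOn (by
      rw [arc_eq]
      filter_upwards [hu, hune] with v h1 h2
      exact ContinuousAt.comp (g := C.X) (f := u) (CritPath.continuousAt_X h2) h1.1)
    (by rw [arc_eq, hX]; exact h.X_ne hr) (by
      rw [arc_eq]
      filter_upwards [hu, hune] with v h1 h2 hv
      rw [h.R_sq hv, C.X_sq h2, h1.2])
  rwa [arc_eq, hX] at this

/-- The normal to the arc at its real point is the real axis. -/
theorem normalPt_half (h : C.TrajPath b F D) : ∃ κ : ℝ, 0 < κ ∧ ∀ y : ℝ,
    normalPt (C.arc F 1) (1 / 2, y) = (((C.Z (F 0)).re - κ * y : ℝ) : ℂ) := by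
  obtain ⟨q, hq⟩ : ∃ q : ℝ, F 0 = q := ⟨(F 0).re, Complex.ext (by simp) (by simpa using h.im_zero)⟩
  have hq0 : q ≠ 0 := by
    rintro rfl
    exact h.zero_ne (by simpa using hq)
  have hα := C.α_pos
  have hD : D 0 = (D 0).im * Complex.I := Complex.ext (by simp [h.deriv_zero_re]) (by simp)
  have hd : deriv (C.arc F 1) (1 / 2) = ((2 * (C.α * (1 + (q ^ 2)⁻¹)) * (D 0).im : ℝ) : ℂ) * Complex.I := by
    rw [(h.hasDerivAt_arc abs_one (by norm_num)).deriv, arcDeriv_eq, lift, liftDeriv]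
    norm_num
    rw [hq, X, hD]
    have : (q : ℂ) ≠ 0 := by exact_mod_cast hq0
    field_simp
    simp
  refine ⟨2 * (C.α * (1 + (q ^ 2)⁻¹)) * (D 0).im, ?_, fun y => ?_⟩
  · have := h.deriv_zero_im_pos
    positivity
  · rw [normalPt, hd, CritPath.arc_half, h.Z_zero_eq]
    push_cast
    rw [Complex.ofReal_re]
    linear_combination (2 * (C.α * (1 + ((q : ℂ) ^ 2)⁻¹)) * ((D 0).im : ℂ) * y) * Complex.I_sq

theorem X_lift_half (h : C.TrajPath b F D) : (C.X (lift F (1 / 2))).re < 0 := by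
  have : lift F (1 / 2) = F 0 := by rw [lift]; norm_num
  rw [this]
  exact (C.X_re_neg h.im_zero h.neg).1

theorem continuousOn_X_lift (h : C.TrajPath b F D) :
    ContinuousOn (fun s => C.X (lift F s)) (Icc 0 1) := fun s hs =>
  (CritPath.continuousAt_X (h.lift_ne hs)).comp_continuousWithinAt (h.continuousOn_lift s hs)

theorem X_lift_ne (h : C.TrajPath b F D) {s : ℝ} (hs : s ∈ Ioo (0 : ℝ) 1) : C.X (lift F s) ≠ 0 :=
  h.X_ne (param_mem_Ioo abs_one hs)

/-- On each side of the arc the boundary values of the branch are `X` or `-X` throughout. -/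
theorem side_limit_eq (h : C.TrajPath b F D) {σ : ℝ} (hσ : σ ≠ 0) :
    ∃ e : ℂ, e ^ 2 = 1 ∧ ∀ s ∈ Ioo (0 : ℝ) 1,
      Tendsto (fun x : ℝ × ℝ => C.R F D (normalPt (C.arc F 1) (x.1, σ * x.2)))
        (𝓝 s ×ˢ 𝓝[>] (0 : ℝ)) (𝓝 (e * C.X (lift F s))) := by
  choose! e he hlim using fun (s : ℝ) (hs : s ∈ Ioo (0 : ℝ) 1) => h.exists_side_limit hσ hs
  have hc := continuousOn_of_side_limit isOpen_Ioo hlim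
  have hor := isPreconnected_Ioo.eq_or_eq_neg_of_sq_eq hc
    (h.continuousOn_X_lift.mono Ioo_subset_Icc_self) (fun s hs => by
      change (e s * C.X (lift F s)) ^ 2 = (C.X (lift F s)) ^ 2
      rw [mul_pow, he s hs, one_mul])
    (fun {s} hs => h.X_lift_ne hs)
  rcases hor with h1 | h1
  · refine ⟨1, by norm_num, fun s hs => ?_⟩
    have h2 : e s * C.X (lift F s) = C.X (lift F s) := h1 hs
    rw [one_mul, ← h2]
    exact hlim s hs
  · refine ⟨-1, by norm_num, fun s hs => ?_⟩
    have h2 : e s * C.X (lift F s) = -C.X (lift F s) := h1 hs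
    rw [neg_one_mul, ← h2]
    exact hlim s hs

/-- The sign is constant along the arc and can be tested at its real point. There the left normal
points towards smaller x, where R < 0, and X is negative as well because F(0) < 0. -/
theorem hasLeftLimit_R (h : C.TrajPath b F D) {s : ℝ} (hs : s ∈ Ioo (0 : ℝ) 1) :
    HasLeftLimit (C.R F D) (C.arc F 1) s (C.X (lift F s)) := by
  rw [hasLeftLimit_iff]
  obtain ⟨e, he, hlim⟩ := h.side_limit_eq one_ne_zero
  obtain ⟨κ, hκ, hN⟩ := h.normalPt_half
  have h1 := tendsto_mono_prod (hlim (1 / 2) (by norm_num))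
  have h2 : (e * C.X (lift F (1 / 2))).re ≤ 0 := by
    refine le_of_tendsto ((Complex.continuous_re.tendsto _).comp h1) ?_
    filter_upwards [self_mem_nhdsWithin] with y hy
    have hy0 : 0 < κ * y := mul_pos hκ hy
    simp only [Function.comp]
    rw [hN, one_mul]
    exact (h.R_neg (by linarith)).le
  have h3 := h.X_lift_half
  rcases mul_self_eq_one_iff.1 ((sq e).symm.trans he) with rfl | rfl
  · simpa using hlim s hs
  · rw [neg_one_mul, Complex.neg_re] at h2
    linarith

theorem hasRightLimit_R (h : C.TrajPath b F D) {s : ℝ} (hs : s ∈ Ioo (0 : ℝ) 1) :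
    HasRightLimit (C.R F D) (C.arc F 1) s (-C.X (lift F s)) := by
  rw [hasRightLimit_iff]
  obtain ⟨e, he, hlim⟩ := h.side_limit_eq (by norm_num : (-1 : ℝ) ≠ 0)
  obtain ⟨κ, hκ, hN⟩ := h.normalPt_half
  have h1 := tendsto_mono_prod (hlim (1 / 2) (by norm_num))
  have h2 : 0 ≤ (e * C.X (lift F (1 / 2))).re := by
    refine ge_of_tendsto ((Complex.continuous_re.tendsto _).comp h1) ?_
    filter_upwards [self_mem_nhdsWithin] with y hy
    have hy0 : 0 < κ * y := mul_pos hκ hy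
    simp only [Function.comp]
    rw [hN]
    exact (h.R_pos (by linarith)).le
  have h3 := h.X_lift_half
  rcases mul_self_eq_one_iff.1 ((sq e).symm.trans he) with rfl | rfl
  · rw [one_mul] at h2
    linarith
  · simpa using hlim s hs

/-- The branch vanishes at its branch points. -/
theorem tendsto_R_zero (h : C.TrajPath b F D) {ζ : ℂ} (hζ : (ζ - C.ξ) * (ζ - conj C.ξ) = 0) :
    Tendsto (C.R F D) (𝓝[(closedArc (C.arc F 1))ᶜ] ζ) (𝓝 0) := by
  rw [tendsto_zero_iff_norm_tendsto_zero]
  have h1 : Tendsto (fun z => √‖(z - C.ξ) * (z - conj C.ξ)‖) (𝓝[(closedArc (C.arc F 1))ᶜ] ζ) (𝓝 0) := by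
    have : Continuous fun z => √‖(z - C.ξ) * (z - conj C.ξ)‖ := by fun_prop
    have h2 := this.tendsto ζ
    rw [hζ, norm_zero, Real.sqrt_zero] at h2
    exact h2.mono_left nhdsWithin_le_nhds
  refine h1.congr' ?_
  filter_upwards [self_mem_nhdsWithin] with z hz
  rw [← h.R_sq hz, norm_pow, Real.sqrt_sq (norm_nonneg _)]

/-- One has R − z = (R² − z²)/(R + z), with numerator of degree one and R + z ~ 2z. -/
theorem R_sub_isBigO (h : C.TrajPath b F D) :
    (fun z => C.R F D z - z) =O[Bornology.cobounded ℂ] (fun _ => (1 : ℂ)) := by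
  have hK : ∀ᶠ z in Bornology.cobounded ℂ, z ∉ closedArc (C.arc F 1) :=
    (isCompact_closedArc (h.continuousOn_arc abs_one)).isBounded
  have h1 : Tendsto (fun z => C.R F D z / z + 1) (Bornology.cobounded ℂ) (𝓝 (1 + 1)) :=
    h.tendsto_R_div.add_const 1
  have h2 : Tendsto (fun z : ℂ => -(C.ξ + conj C.ξ) + C.ξ * conj C.ξ * z⁻¹) (Bornology.cobounded ℂ)
      (𝓝 (-(C.ξ + conj C.ξ) + C.ξ * conj C.ξ * 0)) :=
    ((tendsto_inv₀_cobounded (α := ℂ)).const_mul _).const_add _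
  have h3 := h2.div h1 (by norm_num)
  refine (h3.isBigO_one ℂ).congr' ?_ (Eventually.of_forall fun _ => rfl)
  filter_upwards [hK, Bornology.eventually_ne_cobounded (0 : ℂ),
    h1.eventually_ne (by norm_num : (1 : ℂ) + 1 ≠ 0)] with z hz hz0 hne
  have h4 := h.R_sq hz
  simp only [Pi.div_apply]
  rw [div_eq_iff hne]
  field_simp
  linear_combination -h4

/-- The branch on a second arc that crosses the real axis to the left of the cut. -/
theorem R_arc (h : C.TrajPath b F D) {δ : ℂ} {b₂ : ℝ → ℝ} {F₂ D₂ : ℝ → ℂ} {ε : ℝ} (hε : |ε| = 1)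
    (h₂ : C.CritPath δ b₂ F₂ D₂) (hneg : (F₂ 0).re < 0) (hlt : (C.Z (F₂ 0)).re < (C.Z (F 0)).re)
    (hdisj : Disjoint (openArc (C.arc F₂ ε)) (closedArc (C.arc F 1))) {s : ℝ}
    (hs : s ∈ Ioo (0 : ℝ) 1) : C.R F D (C.arc F₂ ε s) = C.X (F₂ (ε * (2 * s - 1))) := by
  have hoff : ∀ s ∈ Ioo (0 : ℝ) 1, C.arc F₂ ε s ∉ closedArc (C.arc F 1) := fun s hs =>
    Set.disjoint_left.1 hdisj ⟨s, hs, rfl⟩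
  have hne : ∀ s ∈ Ioo (0 : ℝ) 1, F₂ (ε * (2 * s - 1)) ≠ 0 := fun s hs =>
    h₂.ne_zero (param_mem_Icc hε (Ioo_subset_Icc_self hs))
  have hor := isPreconnected_Ioo.eq_or_eq_neg_of_sq_eq
    (f := fun s => C.R F D (C.arc F₂ ε s)) (g := fun s => C.X (F₂ (ε * (2 * s - 1))))
    (S := Ioo (0 : ℝ) 1) (h.differentiableOn_R.continuousOn.comp
      ((h₂.continuousOn_arc hε).mono Ioo_subset_Icc_self) hoff)
    (fun s hs => (CritPath.continuousAt_X (hne s hs)).comp_continuousWithinAt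
      (f := fun s => F₂ (ε * (2 * s - 1)))
      ((h₂.continuousOn_F_param hε).mono Ioo_subset_Icc_self s hs))
    (fun s hs => by
      change (C.R F D (C.arc F₂ ε s)) ^ 2 = (C.X (F₂ (ε * (2 * s - 1)))) ^ 2
      rw [h.R_sq (hoff s hs), C.X_sq (hne s hs)]
      rfl)
    (fun {s} hs => h₂.X_ne (param_mem_Ioo hε hs))
  rcases hor with h1 | h1
  · exact h1 hs
  -- The sign is tested where the second arc crosses the real axis, to the left of the cut: there
  -- both R and X are negative.
  · exfalso
    have h2 : C.R F D (C.arc F₂ ε (1 / 2)) = -C.X (F₂ (ε * (2 * (1 / 2) - 1))) := h1 (by norm_num)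
    have h3 : ε * (2 * (1 / 2) - 1) = 0 := by ring
    rw [CritPath.arc_half, h3] at h2
    have h4 : C.Z (F₂ 0) = ((C.Z (F₂ 0)).re : ℂ) :=
      Complex.ext (by simp) (by rw [C.Z_im, h₂.im_zero, mul_zero, Complex.ofReal_im])
    have h5 := h.R_neg hlt
    rw [← h4, h2, Complex.neg_re] at h5
    linarith [(C.X_re_neg h₂.im_zero hneg).1]

end TrajPath
end Config

/-! ### The function h: explicit form, boundary values, behaviour at infinity. -/

theorem hasArcIntegral_of_eqOn {c F u : ℝ → ℂ} {J : ℂ} (hu : IntervalIntegrable u volume 0 1)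
    (he : ∀ s ∈ Ioo (0 : ℝ) 1, F s * deriv c s = u s) (hJ : ∫ s in (0 : ℝ)..1, u s = J) :
    HasArcIntegral c F J := by
  constructor
  · rw [intervalIntegrable_iff_integrableOn_Ioo_of_le zero_le_one] at hu ⊢
    exact hu.congr_fun (fun s hs => (he s hs).symm) measurableSet_Ioo
  · rw [← hJ, intervalIntegral.integral_of_le zero_le_one, intervalIntegral.integral_of_le zero_le_one,
      integral_Ioc_eq_integral_Ioo, integral_Ioc_eq_integral_Ioo]
    exact setIntegral_congr_fun measurableSet_Ioo he

namespace Config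

variable {t γ a : ℝ} (C : Config t γ a)

theorem t_ne (C : Config t γ a) : (t : ℂ) ≠ 0 := by exact_mod_cast C.t_pos.ne'

theorem one_sub_ne (C : Config t γ a) : (1 - (t : ℂ) ^ 2) ≠ 0 := by
  have h1 := C.t_pos
  have h2 := C.t_lt
  have : 1 - t ^ 2 ≠ 0 := by nlinarith
  exact_mod_cast this

/-- The residues divided by the values of the square root. -/
theorem res_div : ((a : ℂ) + 1) / C.s₀ = (1 + γ * a) * C.z₀ ∧
    (a : ℂ) / C.s₁ = (1 + γ * a) * (C.z₀ - t) / (1 - t ^ 2) ∧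
    ((γ : ℂ) * a) / C.s₂ = (1 + γ * a) * t * (1 - t * C.z₀) / (1 - t ^ 2) := by
  have h0 : (C.s₀ : ℂ) ≠ 0 := by exact_mod_cast C.s₀_pos.ne'
  have h1 : (C.s₁ : ℂ) ≠ 0 := by exact_mod_cast C.s₁_pos.ne'
  have h2 : (C.s₂ : ℂ) ≠ 0 := by exact_mod_cast C.s₂_pos.ne'
  have e0 : (1 + (γ : ℂ) * a) * C.s₀ * C.z₀ = a + 1 := by exact_mod_cast C.res₀
  have e1 : (1 + (γ : ℂ) * a) * C.s₁ * (C.z₀ - t) = a * (1 - t ^ 2) := by exact_mod_cast C.res₁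
  have e2 : (1 + (γ : ℂ) * a) * C.s₂ * t * (1 - t * C.z₀) = γ * a * (1 - t ^ 2) := by
    exact_mod_cast C.res₂
  have h3 := C.one_sub_ne
  refine ⟨?_, ?_, ?_⟩
  · rw [div_eq_iff h0]
    linear_combination -e0
  · rw [div_eq_div_iff h1 h3]
    linear_combination -e1
  · rw [div_eq_div_iff h2 h3]
    linear_combination -e2

/-- The rational factor of `Φ`. -/
def ratio (z : ℂ) : ℂ := (1 + γ * a) * ((z + C.z₀) / (z * (z + t) * (z + (t : ℂ)⁻¹)))

theorem ratio_eq {z : ℂ} (h0 : z ≠ 0) (h1 : z + t ≠ 0) (h2 : z + (t : ℂ)⁻¹ ≠ 0) :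
    ((a : ℂ) + 1) / C.s₀ / z - (a : ℂ) / C.s₁ / (z + t) - ((γ : ℂ) * a) / C.s₂ / (z + (t : ℂ)⁻¹) =
      C.ratio z := by
  obtain ⟨e0, e1, e2⟩ := C.res_div
  have ht := C.t_ne
  have h3 := C.one_sub_ne
  have h2' : t * z + 1 ≠ 0 := by
    intro h
    apply h2
    field_simp
    linear_combination h
  have h2'' : 1 + t * z ≠ 0 := by rwa [add_comm]
  have e : z + (t : ℂ)⁻¹ = (1 + t * z) / t := by field_simp; ring
  rw [e0, e1, e2, ratio, e]
  obtain ⟨x, hx⟩ : ∃ x, x = 1 + t * z := ⟨_, rfl⟩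
  rw [← hx] at h2'' ⊢
  field_simp
  rw [hx]
  ring

theorem Φ_eq (R : ℂ → ℂ) (z : ℂ) : Φ t γ a C.z₀ R z = R z * C.ratio z := by
  rw [Φ, ratio]
  ring

theorem Q_eq {w : ℂ} (hw : w ≠ 0) : Q t γ a C.z₀ C.ξ (C.Z w) = -(C.X w * C.ratio (C.Z w)) ^ 2 := by
  rw [Q, ← C.X_sq hw, ratio]
  generalize C.Z w + t = x
  generalize C.Z w + (t : ℂ)⁻¹ = y
  ring

variable {C}

/-- The identity Φ dz = f dw along the path. All sign conditions on Γ₁ and Γ₂ thus reduce to the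
known values of f(F)·D. -/
theorem CritPath.mul_arcDeriv {δ : ℂ} {b : ℝ → ℝ} {F D : ℝ → ℂ} (h : C.CritPath δ b F D) {ε s : ℝ}
    (hε : |ε| = 1) (hs : s ∈ Ioo (0 : ℝ) 1) (hpole : ∀ j, F 0 ≠ C.pts j) :
    C.X (F (ε * (2 * s - 1))) * C.ratio (C.arc F ε s) * C.arcDeriv F D ε s =
      2 * ε * (C.f (F (ε * (2 * s - 1))) * D (ε * (2 * s - 1))) := by
  have hr := param_mem_Ioo hε hs
  have hr' : ε * (2 * s - 1) ∈ Icc (-1 : ℝ) 1 := ⟨hr.1.le, hr.2.le⟩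
  rw [arc, arcDeriv]
  generalize ε * (2 * s - 1) = r at hr hr'
  have hw := h.ne_zero hr'
  have hpts : ∀ j, F r ≠ C.pts j := by
    intro j hj
    have him : (F r).im = 0 := by rw [hj, Complex.ofReal_im]
    have h1 := mt (h.im_pos_iff hr').2 (by rw [him]; exact lt_irrefl _)
    have h2 := mt (h.im_neg_iff hr').2 (by rw [him]; exact lt_irrefl _)
    have h3 : r = 0 := le_antisymm (not_lt.1 h1) (not_lt.1 h2)
    exact hpole j (h3 ▸ hj)
  have e1 := C.mul_f_eq hpts
  rw [C.Z_sq _ hw] at e1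
  have e2 : C.f (F r) = C.X (F r) ^ 2 * C.ratio (C.Z (F r)) / F r := by
    rw [eq_div_iff hw, mul_comm, e1, ratio, X]
    ring
  rw [e2]
  ring

namespace TrajPath

variable {b : ℝ → ℝ} {F D : ℝ → ℂ}

theorem notMem_of_le (h : C.TrajPath b F D) {x : ℝ} (hx : x ≤ 0) :
    (x : ℂ) ∉ closedArc (C.arc F 1) :=
  h.notMem_of_ne (by linarith [h.Z_pos])

theorem zero_notMem (h : C.TrajPath b F D) : (0 : ℂ) ∉ closedArc (C.arc F 1) := by
  simpa using h.notMem_of_le le_rfl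

theorem neg_t_notMem (h : C.TrajPath b F D) : (-t : ℂ) ∉ closedArc (C.arc F 1) := by
  have := h.notMem_of_le (x := -t) (by linarith [C.t_pos])
  push_cast at this
  exact this

theorem neg_inv_notMem (h : C.TrajPath b F D) : -(t : ℂ)⁻¹ ∉ closedArc (C.arc F 1) := by
  have h1 := C.t_pos
  have := h.notMem_of_le (x := -t⁻¹) (by simp; exact h1.le)
  push_cast at this
  exact this

theorem R_zero (h : C.TrajPath b F D) : C.R F D 0 = -(C.s₀ : ℂ) := by
  have := h.R_eq_neg h.Z_pos C.s₀_pos (by rw [C.s₀_sq]; ring)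
  simpa using this

theorem R_neg_t (h : C.TrajPath b F D) : C.R F D (-t) = -(C.s₁ : ℂ) := by
  have := h.R_eq_neg (x := -t) (by linarith [h.Z_pos, C.t_pos]) C.s₁_pos (by rw [C.s₁_sq]; ring)
  push_cast at this
  exact this

theorem R_neg_inv (h : C.TrajPath b F D) : C.R F D (-(t : ℂ)⁻¹) = -(C.s₂ : ℂ) := by
  have h1 : 0 < t⁻¹ := inv_pos.2 C.t_pos
  have := h.R_eq_neg (x := -t⁻¹) (by linarith [h.Z_pos]) C.s₂_pos (by rw [C.s₂_sq]; ring)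
  push_cast at this
  exact this

end TrajPath

variable (C) in
/-- The function `h`. -/
def H (F D : ℝ → ℂ) (z : ℂ) : ℂ :=
  -(1 / 2) * ((a + 1) / C.R F D 0 * dslope (C.R F D) 0 z - a / C.R F D (-t) * dslope (C.R F D) (-t) z -
    γ * a / C.R F D (-(t : ℂ)⁻¹) * dslope (C.R F D) (-(t : ℂ)⁻¹) z)

namespace TrajPath

variable {b : ℝ → ℝ} {F D : ℝ → ℂ}

/-- Divided differences of R are analytic at their base points, so the poles of W' never become
singularities of h. -/
theorem differentiableOn_H (h : C.TrajPath b F D) :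
    DifferentiableOn ℂ (C.H F D) (closedArc (C.arc F 1))ᶜ := by
  have key : ∀ x ∉ closedArc (C.arc F 1),
      DifferentiableOn ℂ (dslope (C.R F D) x) (closedArc (C.arc F 1))ᶜ := fun x hx =>
    (Complex.differentiableOn_dslope (h.isOpen_compl.mem_nhds hx)).2 h.differentiableOn_R
  exact ((((key _ h.zero_notMem).const_mul _).sub ((key _ h.neg_t_notMem).const_mul _)).sub
    ((key _ h.neg_inv_notMem).const_mul _)).const_mul _

/-- Expanding each divided difference, the constant terms R(x) cancel the denominators and assemble
to W'/2; the terms with R(z) form the bracket. -/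
theorem H_eq_W (h : C.TrajPath b F D) {z : ℂ} (h0 : z ≠ 0) (h1 : z ≠ -t) (h2 : z ≠ -(t : ℂ)⁻¹) :
    C.H F D z = W' t γ a z / 2 + C.R F D z / 2 *
      (γ * a / ((z + (t : ℂ)⁻¹) * C.R F D (-(t : ℂ)⁻¹)) + a / ((z + t) * C.R F D (-t))
        - (a + 1) / (z * C.R F D 0)) := by
  have e0 := h.R_ne h.zero_notMem
  have e1 := h.R_ne h.neg_t_notMem
  have e2 := h.R_ne h.neg_inv_notMem
  have h1' : z + t ≠ 0 := fun h => h1 (eq_neg_of_add_eq_zero_left h)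
  have h2' : z + (t : ℂ)⁻¹ ≠ 0 := fun h => h2 (eq_neg_of_add_eq_zero_left h)
  rw [H, dslope_of_ne _ h0, dslope_of_ne _ h1, dslope_of_ne _ h2, slope_def_field, slope_def_field,
    slope_def_field, sub_neg_eq_add, sub_neg_eq_add, sub_zero, W']
  generalize C.R F D 0 = r0 at e0 ⊢
  generalize C.R F D (-t) = r1 at e1 ⊢
  generalize C.R F D (-(t : ℂ)⁻¹) = r2 at e2 ⊢
  generalize C.R F D z = r
  generalize (z + (t : ℂ)⁻¹) = y at h2' ⊢
  generalize z + (t : ℂ) = x at h1' ⊢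
  field_simp
  ring

theorem H_eq (h : C.TrajPath b F D) {z : ℂ} (h0 : z ≠ 0) (h1 : z ≠ -t) (h2 : z ≠ -(t : ℂ)⁻¹) :
    C.H F D z = W' t γ a z / 2 + C.R F D z * C.ratio z / 2 := by
  have h1' : z + t ≠ 0 := fun h => h1 (eq_neg_of_add_eq_zero_left h)
  have h2' : z + (t : ℂ)⁻¹ ≠ 0 := fun h => h2 (eq_neg_of_add_eq_zero_left h)
  have hs0 : (C.s₀ : ℂ) ≠ 0 := by exact_mod_cast C.s₀_pos.ne'
  have hs1 : (C.s₁ : ℂ) ≠ 0 := by exact_mod_cast C.s₁_pos.ne'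
  have hs2 : (C.s₂ : ℂ) ≠ 0 := by exact_mod_cast C.s₂_pos.ne'
  rw [h.H_eq_W h0 h1 h2, ← C.ratio_eq h0 h1' h2', h.R_zero, h.R_neg_t, h.R_neg_inv]
  generalize (z + (t : ℂ)⁻¹) = y at h2' ⊢
  generalize z + (t : ℂ) = x at h1' ⊢
  field_simp
  ring

theorem arc_ne_pole (h : C.TrajPath b F D) {s : ℝ} (hs : s ∈ Icc (0 : ℝ) 1) :
    C.arc F 1 s ≠ 0 ∧ C.arc F 1 s ≠ -t ∧ C.arc F 1 s ≠ -(t : ℂ)⁻¹ :=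
  ⟨fun he => h.zero_notMem ⟨s, hs, he⟩, fun he => h.neg_t_notMem ⟨s, hs, he⟩,
    fun he => h.neg_inv_notMem ⟨s, hs, he⟩⟩

theorem continuousAt_W' {z : ℂ} (h0 : z ≠ 0) (h1 : z ≠ -t) (h2 : z ≠ -(t : ℂ)⁻¹) :
    ContinuousAt (W' t γ a) z := by
  have h1' : z + t ≠ 0 := fun h => h1 (eq_neg_of_add_eq_zero_left h)
  have h2' : z + (t : ℂ)⁻¹ ≠ 0 := fun h => h2 (eq_neg_of_add_eq_zero_left h)
  unfold W'
  fun_prop (disch := assumption)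

theorem continuousAt_ratio {z : ℂ} (h0 : z ≠ 0) (h1 : z ≠ -t) (h2 : z ≠ -(t : ℂ)⁻¹) :
    ContinuousAt C.ratio z := by
  have h1' : z + t ≠ 0 := fun h => h1 (eq_neg_of_add_eq_zero_left h)
  have h2' : z + (t : ℂ)⁻¹ ≠ 0 := fun h => h2 (eq_neg_of_add_eq_zero_left h)
  have h3 : z * (z + t) * (z + (t : ℂ)⁻¹) ≠ 0 := mul_ne_zero (mul_ne_zero h0 h1') h2'
  unfold ratio
  fun_prop (disch := assumption)

theorem tendsto_H (h : C.TrajPath b F D) {ι : Type*} {l : Filter ι} {θ : ι → ℂ} {z L : ℂ}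
    (h0 : z ≠ 0) (h1 : z ≠ -t) (h2 : z ≠ -(t : ℂ)⁻¹) (hθ : Tendsto θ l (𝓝 z))
    (hR : Tendsto (fun i => C.R F D (θ i)) l (𝓝 L)) :
    Tendsto (fun i => C.H F D (θ i)) l (𝓝 (W' t γ a z / 2 + L * C.ratio z / 2)) := by
  have e1 := ((continuousAt_W' (γ := γ) (a := a) h0 h1 h2).tendsto.comp hθ).div_const 2
  have e2 := (hR.mul ((continuousAt_ratio (C := C) h0 h1 h2).tendsto.comp hθ)).div_const 2
  refine (e1.add e2).congr' ?_
  filter_upwards [hθ.eventually_ne h0, hθ.eventually_ne h1, hθ.eventually_ne h2] with i i0 i1 i2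
  rw [h.H_eq i0 i1 i2]
  rfl

theorem tendsto_normalPt {c : ℝ → ℂ} {p q : ℂ} (hc : IsSimpleArc c p q) {s σ : ℝ}
    (hs : s ∈ Ioo (0 : ℝ) 1) :
    Tendsto (fun x : ℝ × ℝ => normalPt c (x.1, σ * x.2)) (𝓝 s ×ˢ 𝓝[>] (0 : ℝ)) (𝓝 (c s)) := by
  have h1 : Tendsto (fun x : ℝ × ℝ => (x.1, σ * x.2)) (𝓝 (s, 0)) (𝓝 (s, 0)) := by
    have : Continuous fun x : ℝ × ℝ => (x.1, σ * x.2) := by fun_prop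
    simpa using this.tendsto (s, 0)
  have h2 := (hc.continuousAt_normalPt (x := (s, 0)) hs).tendsto
  rw [normalPt_zero] at h2
  refine (h2.comp h1).mono_left ?_
  rw [nhds_prod_eq]
  exact Filter.prod_mono le_rfl nhdsWithin_le_nhds

theorem hasLeftLimit_H (h : C.TrajPath b F D) {s : ℝ} (hs : s ∈ Ioo (0 : ℝ) 1) :
    HasLeftLimit (C.H F D) (C.arc F 1) s
      (W' t γ a (C.arc F 1 s) / 2 + C.X (lift F s) * C.ratio (C.arc F 1 s) / 2) := by
  obtain ⟨h0, h1, h2⟩ := h.arc_ne_pole (Ioo_subset_Icc_self hs)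
  rw [hasLeftLimit_iff]
  exact h.tendsto_H h0 h1 h2 (tendsto_normalPt (h.isSimpleArc abs_one) hs)
    (hasLeftLimit_iff.1 (h.hasLeftLimit_R hs))

theorem hasRightLimit_H (h : C.TrajPath b F D) {s : ℝ} (hs : s ∈ Ioo (0 : ℝ) 1) :
    HasRightLimit (C.H F D) (C.arc F 1) s
      (W' t γ a (C.arc F 1 s) / 2 - C.X (lift F s) * C.ratio (C.arc F 1 s) / 2) := by
  obtain ⟨h0, h1, h2⟩ := h.arc_ne_pole (Ioo_subset_Icc_self hs)
  rw [hasRightLimit_iff]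
  have := h.tendsto_H h0 h1 h2 (tendsto_normalPt (h.isSimpleArc abs_one) hs)
    (hasRightLimit_iff.1 (h.hasRightLimit_R hs))
  rwa [neg_mul, neg_div, ← sub_eq_add_neg] at this

theorem hasLeftLimit_Φ (h : C.TrajPath b F D) {s : ℝ} (hs : s ∈ Ioo (0 : ℝ) 1) :
    HasLeftLimit (Φ t γ a C.z₀ (C.R F D)) (C.arc F 1) s
      (C.X (lift F s) * C.ratio (C.arc F 1 s)) := by
  obtain ⟨h0, h1, h2⟩ := h.arc_ne_pole (Ioo_subset_Icc_self hs)
  rw [hasLeftLimit_iff]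
  simp only [C.Φ_eq]
  exact (hasLeftLimit_iff.1 (h.hasLeftLimit_R hs)).mul
    ((continuousAt_ratio h0 h1 h2).tendsto.comp (tendsto_normalPt (h.isSimpleArc abs_one) hs))

theorem exists_tendsto_H (h : C.TrajPath b F D) {ζ : ℂ} (hζ : (ζ - C.ξ) * (ζ - conj C.ξ) = 0)
    (him : ζ.im ≠ 0) : ∃ l, Tendsto (C.H F D) (𝓝[(closedArc (C.arc F 1))ᶜ] ζ) (𝓝 l) := by
  refine ⟨_, h.tendsto_H (z := ζ) ?_ ?_ ?_ (tendsto_id.mono_left nhdsWithin_le_nhds)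
    (h.tendsto_R_zero hζ)⟩
  · rintro rfl
    simp at him
  · rintro rfl
    simp at him
  · rintro rfl
    rw [← Complex.ofReal_inv, ← Complex.ofReal_neg, Complex.ofReal_im] at him
    exact him rfl

/-- The behaviour of `h` at infinity. -/
theorem H_sub_isBigO (h : C.TrajPath b F D) :
    (fun z => C.H F D z - 1 / z) =O[Bornology.cobounded ℂ] (fun z => (z ^ 2)⁻¹) := by
  have hy : Tendsto (fun z : ℂ => z⁻¹) (Bornology.cobounded ℂ) (𝓝 0) := tendsto_inv₀_cobounded
  have key : ∀ f : ℂ → ℂ, ContinuousAt f 0 →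
      (fun z : ℂ => f z⁻¹) =O[Bornology.cobounded ℂ] (fun _ => (1 : ℂ)) := fun f hf =>
    (hf.tendsto.comp hy).isBigO_one ℂ
  -- With y = 1/z, the difference h − 1/z is z⁻² times A(y)(R − z) + B(y), with A and B regular at y
  -- = 0. The leading terms of W'/2 and Φ/2, namely (1 − γa)/(2z) and (1 + γa)/(2z), add up to 1/z.
  have hA := key (fun y => (1 + γ * a) / 2 * ((1 + C.z₀ * y) / ((1 + t * y) * (1 + (t : ℂ)⁻¹ * y))))
    (by
      have : (1 + (t : ℂ) * 0) * (1 + (t : ℂ)⁻¹ * 0) ≠ 0 := by simp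
      fun_prop (disch := assumption))
  have hB := key (fun y => (γ * a * (t : ℂ)⁻¹ / (1 + (t : ℂ)⁻¹ * y) + a * t / (1 + t * y)) / 2 +
    (1 + γ * a) / 2 * ((C.z₀ - t - (t : ℂ)⁻¹ - y) / ((1 + t * y) * (1 + (t : ℂ)⁻¹ * y)))) (by
      have h1 : (1 + (t : ℂ) * 0) * (1 + (t : ℂ)⁻¹ * 0) ≠ 0 := by simp
      have h2 : (1 + (t : ℂ) * 0) ≠ 0 := by simp
      have h3 : (1 + (t : ℂ)⁻¹ * 0) ≠ 0 := by simp
      fun_prop (disch := assumption))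
  have h3 := ((hA.mul h.R_sub_isBigO).add (by simpa using hB)).mul
    (Asymptotics.isBigO_refl (fun z : ℂ => (z ^ 2)⁻¹) (Bornology.cobounded ℂ))
  refine h3.congr' ?_ (Eventually.of_forall fun z => by simp)
  filter_upwards [Bornology.eventually_ne_cobounded (0 : ℂ), Bornology.eventually_ne_cobounded (-t : ℂ),
    Bornology.eventually_ne_cobounded (-(t : ℂ)⁻¹)] with z h0 h1 h2
  have ht := C.t_ne
  have h1' : z + t ≠ 0 := fun h => h1 (eq_neg_of_add_eq_zero_left h)
  have h2' : z + (t : ℂ)⁻¹ ≠ 0 := fun h => h2 (eq_neg_of_add_eq_zero_left h)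
  have e1 : 1 + t * z⁻¹ = (z + t) / z := by field_simp
  have e2 : 1 + (t : ℂ)⁻¹ * z⁻¹ = (z + (t : ℂ)⁻¹) / z := by field_simp
  rw [h.H_eq h0 h1 h2, e1, e2, W', ratio]
  generalize C.R F D z = r
  have e3 : (t : ℂ) * (t : ℂ)⁻¹ = 1 := mul_inv_cancel₀ ht
  generalize (t : ℂ)⁻¹ = y at h2' e3 ⊢
  field_simp
  linear_combination (γ * a + 1 : ℂ) * e3

end TrajPath
end Config
-- Integral formulas over Γ₁.
namespace Config

variable {t γ a : ℝ} {C : Config t γ a}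

namespace TrajPath

variable {b : ℝ → ℝ} {F D : ℝ → ℂ}

/-- This is dz/R₊ = dw/w. The factor X vanishing at the branch points cancels, so the integrals
converge absolutely. -/
theorem integrand_eq (h : C.TrajPath b F D) (g : ℂ) {s : ℝ} (hs : s ∈ Ioo (0 : ℝ) 1) :
    g / C.X (lift F s) * deriv (C.arc F 1) s = g * (liftDeriv D s / lift F s) := by
  rw [(h.hasDerivAt_arc abs_one hs).deriv, arcDeriv_eq]
  have h1 := h.X_lift_ne hs
  have h2 := h.lift_ne (Ioo_subset_Icc_self hs)
  field_simp

theorem continuousOn_W'_arc (h : C.TrajPath b F D) :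
    ContinuousOn (fun s => W' t γ a (C.arc F 1 s)) (Icc 0 1) := by
  intro s hs
  obtain ⟨h0, h1, h2⟩ := h.arc_ne_pole hs
  exact (continuousAt_W' h0 h1 h2).comp_continuousWithinAt (f := C.arc F 1)
    (h.continuousOn_arc abs_one s hs)

theorem intervalIntegrable_W' (h : C.TrajPath b F D) :
    IntervalIntegrable (fun s => W' t γ a (C.arc F 1 s) * (liftDeriv D s / lift F s)) volume 0 1 :=
  intervalIntegrable_mul h.intervalIntegrable_logDeriv h.continuousOn_W'_arc

theorem cauchy_eq (C : Config t γ a) (F D : ℝ → ℂ) (z : ℂ) :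
    C.cauchy F D z = Real.pi * Complex.I / C.R F D z := by
  have : (Real.pi * Complex.I : ℂ) ≠ 0 :=
    mul_ne_zero (by exact_mod_cast Real.pi_ne_zero) Complex.I_ne_zero
  rw [R, div_div_cancel₀ this]

theorem intervalIntegrable_cauchy (h : C.TrajPath b F D) {z : ℂ} (hz : z ∉ closedArc (C.arc F 1)) :
    IntervalIntegrable (fun s => liftDeriv D s / lift F s / (C.arc F 1 s - z)) volume 0 1 :=
  intervalIntegrable_div_sub h.intervalIntegrable_logDeriv (h.continuousOn_arc abs_one) hz

theorem W'_eq (z : ℂ) : W' t γ a z =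
    -(γ * a) / (z - -(t : ℂ)⁻¹) - a / (z - -t) + (a + 1) / (z - 0) := by
  rw [W', sub_neg_eq_add, sub_neg_eq_add, sub_zero]

/-- Partial fractions in s split the integrand over the pairs formed by z and a pole of W'; each
piece is a Cauchy integral of dz/R₊. -/
theorem integral_W'_mul_div (h : C.TrajPath b F D) {z : ℂ} (hz : z ∉ closedArc (C.arc F 1))
    (h0 : z ≠ 0) (h1 : z ≠ -t) (h2 : z ≠ -(t : ℂ)⁻¹) :
    ∫ s in (0 : ℝ)..1, W' t γ a (C.arc F 1 s) * (liftDeriv D s / lift F s) / (C.arc F 1 s - z) =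
      -(γ * a) / (z - -(t : ℂ)⁻¹) * (C.cauchy F D z - C.cauchy F D (-(t : ℂ)⁻¹)) -
      a / (z - -t) * (C.cauchy F D z - C.cauchy F D (-t)) +
      (a + 1) / (z - 0) * (C.cauchy F D z - C.cauchy F D 0) := by
  have iz := h.intervalIntegrable_cauchy hz
  have i0 := h.intervalIntegrable_cauchy h.zero_notMem
  have i1 := h.intervalIntegrable_cauchy h.neg_t_notMem
  have i2 := h.intervalIntegrable_cauchy h.neg_inv_notMem
  simp only [cauchy]
  rw [← intervalIntegral.integral_sub iz i2, ← intervalIntegral.integral_sub iz i1,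
    ← intervalIntegral.integral_sub iz i0, ← intervalIntegral.integral_const_mul,
    ← intervalIntegral.integral_const_mul, ← intervalIntegral.integral_const_mul,
    ← intervalIntegral.integral_sub ((iz.sub i2).const_mul _) ((iz.sub i1).const_mul _),
    ← intervalIntegral.integral_add (((iz.sub i2).const_mul _).sub ((iz.sub i1).const_mul _))
      ((iz.sub i0).const_mul _)]
  refine intervalIntegral.integral_congr fun s hs => ?_
  rw [uIcc_of_le zero_le_one] at hs
  obtain ⟨c0, c1, c2⟩ := h.arc_ne_pole hs
  have cz : C.arc F 1 s - z ≠ 0 := fun h' => hz ⟨s, hs, sub_eq_zero.1 h'⟩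
  simp only [W'_eq]
  generalize liftDeriv D s / lift F s = u
  have pf : ∀ x : ℂ, C.arc F 1 s ≠ x → z ≠ x → ∀ ω : ℂ,
      ω / (C.arc F 1 s - x) * u / (C.arc F 1 s - z) =
        ω / (z - x) * (u / (C.arc F 1 s - z) - u / (C.arc F 1 s - x)) := by
    intro x hc hzx ω
    have e1 := sub_ne_zero.2 hc
    have e2 := sub_ne_zero.2 hzx
    field_simp
    ring
  rw [← pf _ c2 h2, ← pf _ c1 h1, ← pf _ c0 h0]
  ring

/-- The Cauchy integral formula for `h`. -/
theorem H_eq_integral (h : C.TrajPath b F D) {z : ℂ} (hz : z ∉ closedArc (C.arc F 1)) :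
    C.H F D z = C.R F D z / (2 * Real.pi * Complex.I) *
      ∫ s in (0 : ℝ)..1, W' t γ a (C.arc F 1 s) * (liftDeriv D s / lift F s) / (C.arc F 1 s - z) := by
  have hU := h.isOpen_compl.mem_nhds hz
  have hπ : (Real.pi : ℂ) ≠ 0 := by exact_mod_cast Real.pi_ne_zero
  have hc1 : ContinuousAt (C.H F D) z := (h.differentiableOn_H.differentiableAt hU).continuousAt
  have hc2 : ContinuousAt (fun z => C.R F D z / (2 * Real.pi * Complex.I) *
      ∫ s in (0 : ℝ)..1, W' t γ a (C.arc F 1 s) * (liftDeriv D s / lift F s) / (C.arc F 1 s - z)) z :=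
    ((h.differentiableOn_R.differentiableAt hU).continuousAt.div_const _).mul
      (HFunction.differentiableAt_cauchy h.intervalIntegrable_W' (h.continuousOn_arc abs_one)
        hz).continuousAt
  have hne : ∀ x : ℂ, ∀ᶠ w in 𝓝[≠] z, w ≠ x := by
    intro x
    by_cases hx : z = x
    · rw [← hx]
      exact self_mem_nhdsWithin
    · exact eventually_ne_nhdsWithin hx
  -- Both sides are continuous off the arc, so it suffices to compare them near z with the three
  -- poles of W' removed; this covers z = 0, −t, −1/t.
  refine tendsto_nhds_unique (hc1.tendsto.mono_left nhdsWithin_le_nhds)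
    ((hc2.tendsto.mono_left (nhdsWithin_le_nhds (s := {z}ᶜ))).congr' ?_)
  filter_upwards [nhdsWithin_le_nhds hU, hne 0, hne (-t), hne (-(t : ℂ)⁻¹)] with w hw h0 h1 h2
  have r := h.R_ne hw
  have r0 := h.R_ne h.zero_notMem
  have r1 := h.R_ne h.neg_t_notMem
  have r2 := h.R_ne h.neg_inv_notMem
  have h1' : w + t ≠ 0 := fun h => h1 (eq_neg_of_add_eq_zero_left h)
  have h2' : w + (t : ℂ)⁻¹ ≠ 0 := fun h => h2 (eq_neg_of_add_eq_zero_left h)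
  rw [h.integral_W'_mul_div hw h0 h1 h2, h.H_eq_W h0 h1 h2, W']
  simp only [cauchy_eq, sub_neg_eq_add, sub_zero]
  have hI := Complex.I_ne_zero
  generalize (w + (t : ℂ)⁻¹) = y at h2' ⊢
  generalize w + (t : ℂ) = x at h1' ⊢
  field_simp
  ring

theorem hasArcIntegral_cauchy (h : C.TrajPath b F D) {z : ℂ} (hz : z ∉ closedArc (C.arc F 1)) :
    ∃ J : ℂ, HasArcIntegral (C.arc F 1)
      (fun s => W' t γ a (C.arc F 1 s) / (C.X (lift F s) * (C.arc F 1 s - z))) J ∧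
      C.H F D z = C.R F D z / (2 * Real.pi * Complex.I) * J := by
  refine ⟨_, hasArcIntegral_of_eqOn (intervalIntegrable_div_sub h.intervalIntegrable_W'
    (h.continuousOn_arc abs_one) hz) (fun s hs => ?_) rfl, h.H_eq_integral hz⟩
  rw [mul_comm (C.X _), ← div_div, h.integrand_eq _ hs]
  ring

/-- The Cauchy integrals at the poles are −πi/sᵢ, and the residue equations make their weighted sum
vanish. -/
theorem integral_W' (h : C.TrajPath b F D) :
    ∫ s in (0 : ℝ)..1, W' t γ a (C.arc F 1 s) * (liftDeriv D s / lift F s) = 0 := by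
  have i0 := h.intervalIntegrable_cauchy h.zero_notMem
  have i1 := h.intervalIntegrable_cauchy h.neg_t_notMem
  have i2 := h.intervalIntegrable_cauchy h.neg_inv_notMem
  have e : ∫ s in (0 : ℝ)..1, W' t γ a (C.arc F 1 s) * (liftDeriv D s / lift F s) =
      -(γ * a) * C.cauchy F D (-(t : ℂ)⁻¹) - a * C.cauchy F D (-t) + (a + 1) * C.cauchy F D 0 := by
    simp only [cauchy]
    rw [← intervalIntegral.integral_const_mul,
      ← intervalIntegral.integral_const_mul, ← intervalIntegral.integral_const_mul,
      ← intervalIntegral.integral_sub (i2.const_mul _) (i1.const_mul _),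
      ← intervalIntegral.integral_add ((i2.const_mul _).sub (i1.const_mul _)) (i0.const_mul _)]
    refine intervalIntegral.integral_congr fun s hs => ?_
    simp only [W'_eq]
    ring
  obtain ⟨e0, e1, e2⟩ := C.res_div
  have h3 := C.one_sub_ne
  have e' : (γ : ℂ) * a / C.s₂ + a / C.s₁ - (a + 1) / C.s₀ = 0 := by
    rw [e0, e1, e2]
    field_simp
    ring
  rw [e]
  simp only [cauchy_eq, h.R_zero, h.R_neg_t, h.R_neg_inv]
  linear_combination (Real.pi * Complex.I) * e'

/-- Multiplying W' by z leaves the constant 1 − γa plus two simple fractions. The constant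
contributes −πi(1 − γa) and, by the residue equations, the fractions −πi(1 + γa). -/
theorem integral_mul_W' (h : C.TrajPath b F D) :
    ∫ s in (0 : ℝ)..1, C.arc F 1 s * W' t γ a (C.arc F 1 s) * (liftDeriv D s / lift F s) =
      -(2 * Real.pi * Complex.I) := by
  have i := h.intervalIntegrable_logDeriv
  have i1 := h.intervalIntegrable_cauchy h.neg_t_notMem
  have i2 := h.intervalIntegrable_cauchy h.neg_inv_notMem
  have e : ∫ s in (0 : ℝ)..1, C.arc F 1 s * W' t γ a (C.arc F 1 s) * (liftDeriv D s / lift F s) =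
      γ * a * (t : ℂ)⁻¹ * C.cauchy F D (-(t : ℂ)⁻¹) + a * t * C.cauchy F D (-t) +
        (1 - γ * a) * ∫ s in (0 : ℝ)..1, liftDeriv D s / lift F s := by
    simp only [cauchy]
    rw [← intervalIntegral.integral_const_mul,
      ← intervalIntegral.integral_const_mul, ← intervalIntegral.integral_const_mul,
      ← intervalIntegral.integral_add (i2.const_mul _) (i1.const_mul _),
      ← intervalIntegral.integral_add ((i2.const_mul _).add (i1.const_mul _)) (i.const_mul _)]
    refine intervalIntegral.integral_congr fun s hs => ?_
    rw [uIcc_of_le zero_le_one] at hs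
    obtain ⟨c0, c1, c2⟩ := h.arc_ne_pole hs
    have d0 := sub_ne_zero.2 c0
    have d1 := sub_ne_zero.2 c1
    have d2 := sub_ne_zero.2 c2
    simp only [W'_eq]
    generalize liftDeriv D s / lift F s = u
    rw [sub_zero] at d0 ⊢
    rw [sub_neg_eq_add] at d1 d2 ⊢
    rw [sub_neg_eq_add]
    have ht := C.t_ne
    generalize (t : ℂ)⁻¹ = y at d2 ⊢
    field_simp
    ring
  obtain ⟨e0, e1, e2⟩ := C.res_div
  have h3 := C.one_sub_ne
  have ht := C.t_ne
  have e' : (t : ℂ)⁻¹ * (γ * a / C.s₂) + t * (a / C.s₁) = 1 + γ * a := by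
    rw [e1, e2]
    field_simp
    ring
  rw [e, h.integral_logDeriv h.neg]
  simp only [cauchy_eq, h.R_neg_t, h.R_neg_inv]
  linear_combination (-Real.pi * Complex.I) * e'

theorem hasArcIntegral_W' (h : C.TrajPath b F D) :
    HasArcIntegral (C.arc F 1) (fun s => W' t γ a (C.arc F 1 s) / C.X (lift F s)) 0 :=
  hasArcIntegral_of_eqOn h.intervalIntegrable_W' (fun _ hs => h.integrand_eq _ hs) h.integral_W'

theorem hasArcIntegral_mul_W' (h : C.TrajPath b F D) :
    HasArcIntegral (C.arc F 1) (fun s => C.arc F 1 s * W' t γ a (C.arc F 1 s) / C.X (lift F s))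
      (-(2 * Real.pi * Complex.I)) :=
  hasArcIntegral_of_eqOn (intervalIntegrable_mul h.intervalIntegrable_logDeriv
    ((h.continuousOn_arc abs_one).mul h.continuousOn_W'_arc)) (fun _ hs => h.integrand_eq _ hs)
    h.integral_mul_W'

end TrajPath
end Config
-- The two curves together and the final statement.
namespace Config

variable {t γ a : ℝ} (C : Config t γ a)

theorem exists_trajPath : ∃ T > 0, ∃ F D : ℝ → ℂ, C.TrajPath (fun r => T * (1 - r) ^ 3) F D ∧
    ∀ r ∈ Ioo (-1 : ℝ) 1, C.f (F r) * D r = -((3 * T * (1 - |r|) ^ 2 : ℝ) : ℂ) * Complex.I := by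
  obtain ⟨T, hT, F, D, hF, ⟨q, hq, hq1, hq2⟩, hg, hf⟩ := C.exists_path₁
  obtain ⟨o1, o2, o3, o4, o5, o6, o7, o8⟩ := C.order
  have hhi := C.isRoot₀.hi_pos
  have hlh := C.isRoot₀.lo_mul_hi
  -- The exchange w ↦ −1/w is increasing on the negative axis and maps the lower preimage of 0 to
  -- the upper one, so the partner of q lies to the right of every pole.
  have hinv : C.hi 0 C.s₀ < -q⁻¹ := by
    have h1 : q * -q⁻¹ = -1 := by rw [mul_neg, mul_inv_cancel₀ hq2.ne]
    nlinarith
  refine ⟨T, hT, F, D, ?_, hf⟩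
  refine { hF with
    δ_ne := Complex.I_ne_zero
    g_eq := hg
    b_pos := fun r hr => mul_pos hT (pow_pos (by linarith [hr.2]) 3)
    b_one := by simp
    b_inj := fun r hr r' hr' he => ?_
    neg := by rw [hq]; exact hq2
    pole := ?_
    pole' := ?_
    Z_pos := ?_ }
  · have h1 := mul_left_cancel₀ hT.ne' he
    have h2 := (Odd.strictMono_pow (R := ℝ) (n := 3) (by decide)).injective h1
    linarith
  · rw [hq]
    refine (C.forall_pts (P := fun x => (q : ℂ) ≠ x)).2 ⟨?_, ?_, ?_, ?_, ?_, ?_, ?_⟩ <;>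
    · rw [Ne, Complex.ofReal_inj]
      intro h
      linarith
  · rw [hq, ← Complex.ofReal_inv, ← Complex.ofReal_neg]
    refine (C.forall_pts (P := fun x => ((-q⁻¹ : ℝ) : ℂ) ≠ x)).2 ⟨?_, ?_, ?_, ?_, ?_, ?_, ?_⟩ <;>
    · rw [Ne, Complex.ofReal_inj]
      intro h
      linarith
  · have h1 := C.isRoot₀.Z_sub (w := q) (by exact_mod_cast hq2.ne)
    have h2 : C.Z q = ((C.α * ((q - C.lo 0 C.s₀) * (q - C.hi 0 C.s₀)) / q : ℝ) : ℂ) := by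
      push_cast
      rw [← h1]
      simp
    rw [hq, h2, Complex.ofReal_re]
    exact div_pos_of_neg_of_neg (mul_neg_of_pos_of_neg C.α_pos
      (mul_neg_of_pos_of_neg (by linarith) (by linarith))) hq2

theorem exists_critPath : ∃ T > 0, ∃ F D : ℝ → ℂ,
    C.CritPath (-1) (fun r => T * (1 - r ^ 2) ^ 3) F D ∧ F 0 = C.y₁ ∧
    ∀ r ∈ Ioo (-1 : ℝ) 1, C.f (F r) * D r = ((6 * T * r * (1 - r ^ 2) ^ 2 : ℝ) : ℂ) := by
  obtain ⟨T, hT, F, D, hF, h0, hg, hf⟩ := C.exists_path₂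
  refine ⟨T, hT, F, D, ?_, h0, hf⟩
  refine { hF with
    δ_ne := by norm_num
    g_eq := fun r hr => by rw [hg r hr]; ring
    b_pos := fun r hr => mul_pos hT (pow_pos (by nlinarith [hr.1, hr.2]) 3)
    b_one := by simp
    b_inj := fun r hr r' hr' he => ?_ }
  have h1 := mul_left_cancel₀ hT.ne' he
  have h2 := (Odd.strictMono_pow (R := ℝ) (n := 3) (by decide)).injective h1
  have h3 : r ^ 2 = r' ^ 2 := by linarith
  exact (pow_left_inj₀ hr.1.le hr'.1.le two_ne_zero).1 h3

variable {C}

theorem Z_y₁ (C : Config t γ a) : C.Z C.y₁ = -(C.z₀ : ℂ) := by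
  rw [y₁, C.isRoot₃.Z_lo]
  push_cast
  rfl

/-- The curve on which `g` is imaginary does not meet the curve on which it is negative. -/
theorem disjoint_arcs {b₁ b₂ : ℝ → ℝ} {F₁ D₁ F₂ D₂ : ℝ → ℂ} {ε₁ ε₂ : ℝ} (hε₁ : |ε₁| = 1)
    (hε₂ : |ε₂| = 1) (h₁ : C.CritPath Complex.I b₁ F₁ D₁) (h₂ : C.CritPath (-1) b₂ F₂ D₂)
    (h0 : C.Z (F₂ 0) ≠ C.Z (F₁ 0)) :
    Disjoint (openArc (C.arc F₂ ε₂)) (closedArc (C.arc F₁ ε₁)) := by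
  have hpos : ∀ r ∈ Ioo (0 : ℝ) 1, ∀ r' ∈ Ioc (0 : ℝ) 1, C.Z (F₂ r) ≠ C.Z (F₁ r') := by
    intro r hr r' hr' he
    have hr1 : r ∈ Ioc (0 : ℝ) 1 := ⟨hr.1, hr.2.le⟩
    -- At a common point g would be both negative and, up to the sign from the sheet exchange,
    -- purely imaginary; b₂ > 0 excludes this.
    have hb : (-1 : ℂ) * b₂ r = Complex.I * b₁ r' ∨ (-1 : ℂ) * b₂ r = -(Complex.I * b₁ r') := by
      rcases (C.Z_eq_Z_iff (h₁.ne_zero ⟨by linarith [hr'.1], hr'.2⟩)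
        (h₂.ne_zero ⟨by linarith [hr.1], hr.2.le⟩)).1 he.symm with h3 | h3
      · left
        rw [← h₂.g_eq r hr1, h3, h₁.g_eq r' hr']
      · right
        rw [← h₂.g_eq r hr1, h3, C.g_neg_inv (h₁.im_pos r' hr'), h₁.g_eq r' hr']
    have h4 := h₂.b_pos r hr
    rcases hb with h5 | h5 <;>
    · have := congrArg Complex.re h5
      simp at this
      linarith
  refine Set.disjoint_left.2 ?_
  rintro _ ⟨s, hs, rfl⟩ ⟨s', hs', he⟩
  rw [arc, arc] at he
  have hr := param_mem_Ioo hε₂ hs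
  have hr' := param_mem_Icc hε₁ hs'
  generalize ε₂ * (2 * s - 1) = r at hr he
  generalize ε₁ * (2 * s' - 1) = r' at hr' he
  have hrI : r ∈ Icc (-1 : ℝ) 1 := Ioo_subset_Icc_self hr
  have e1 : 0 < r ↔ 0 < r' := by
    rw [← h₂.im_pos_iff hrI, ← h₁.im_pos_iff hr', ← C.Z_im_pos_iff (w := F₂ r), ← he, C.Z_im_pos_iff]
  have e2 : r < 0 ↔ r' < 0 := by
    rw [← h₂.im_neg_iff hrI, ← h₁.im_neg_iff hr', ← C.Z_im_neg_iff (w := F₂ r), ← he, C.Z_im_neg_iff]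
  rcases lt_trichotomy r 0 with h3 | rfl | h3
  · have h4 := e2.1 h3
    refine hpos (-r) ⟨by linarith, by linarith [hr.1]⟩ (-r') ⟨by linarith, by linarith [hr'.1]⟩ ?_
    rw [h₂.symm, h₁.symm, C.Z_conj, C.Z_conj, he]
  · have h3 : ¬ 0 < r' := fun h => lt_irrefl _ (e1.2 h)
    have h4 : ¬ r' < 0 := fun h => lt_irrefl _ (e2.2 h)
    have h5 : r' = 0 := by linarith
    exact h0 (by rw [← he, h5])
  · exact hpos r ⟨h3, hr.2⟩ r' ⟨e1.1 h3, hr'.2⟩ he.symm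

/-- A symmetric arc avoids a set of reals that misses its real point. -/
theorem CritPath.disjoint_ofReal {δ : ℂ} {b : ℝ → ℝ} {F D : ℝ → ℂ} (h : C.CritPath δ b F D) {ε : ℝ}
    (hε : |ε| = 1) {S : Set ℝ} (hS : (C.Z (F 0)).re ∉ S) :
    Disjoint (openArc (C.arc F ε)) ((fun x : ℝ => (x : ℂ)) '' S) := by
  refine Set.disjoint_left.2 ?_
  rintro _ hz ⟨x, hx, rfl⟩
  have h1 : (x : ℂ) ∈ openArc (C.arc F ε) ∩ {z | z.im = 0} := ⟨hz, Complex.ofReal_im x⟩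
  rw [h.openArc_inter_real hε, mem_singleton_iff] at h1
  rw [← h1, Complex.ofReal_re] at hS
  exact hS hx

end Config

end HFunction

end

theorem proposition3p1 (t γ a : ℝ) (ht0 : 0 < t) (ht1 : t < 1) (hγ : 1 ≤ γ)
    (ha : a0 t γ < a) :
    ∃ (ξ : ℂ) (c₁ c₂ : ℝ → ℂ) (h R : ℂ → ℂ) (Rp hp hm : ℝ → ℂ) (z₀ : ℝ),
      -- the endpoint and the contours `Γ₁ = openArc c₁`, `Γ₂ = openArc c₂`
      0 < ξ.im ∧
      IsSimpleArc c₁ (conj ξ) ξ ∧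
      Disjoint (openArc c₁) ((fun x : ℝ => (x : ℂ)) '' Iic 0) ∧
      ConjSymm (openArc c₁) ∧
      IsSimpleArc c₂ ξ (conj ξ) ∧
      Disjoint (openArc c₂) ((fun x : ℝ => (x : ℂ)) '' (Iic (-t⁻¹) ∪ Ici (-t))) ∧
      ConjSymm (openArc c₂) ∧
      Disjoint (openArc c₂) (closedArc c₁) ∧
      -- `h` is analytic off the closure of `Γ₁` and continuous up to the boundary,
      -- with boundary values `hp`, `hm` on the two sides of `Γ₁`
      AnalyticOnNhd ℂ h (closedArc c₁)ᶜ ∧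
      (∀ s ∈ Ioo (0 : ℝ) 1, HasLeftLimit h c₁ s (hp s)) ∧
      (∀ s ∈ Ioo (0 : ℝ) 1, HasRightLimit h c₁ s (hm s)) ∧
      (∃ l : ℂ, Tendsto h (𝓝[(closedArc c₁)ᶜ] ξ) (𝓝 l)) ∧
      (∃ l : ℂ, Tendsto h (𝓝[(closedArc c₁)ᶜ] (conj ξ)) (𝓝 l)) ∧
      -- (a)
      (∀ s ∈ Ioo (0 : ℝ) 1, hp s + hm s = W' t γ a (c₁ s)) ∧
      -- (b)
      (fun z => h z - 1 / z) =O[Bornology.cobounded ℂ] (fun z => (z ^ 2)⁻¹) ∧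
      -- (c)
      (∀ s ∈ Ioo (0 : ℝ) 1, PosReal (Complex.I * (hp s - hm s) * deriv c₁ s)) ∧
      -- (d)
      (∀ s ∈ Ioo (0 : ℝ) 1, 0 < (c₂ s).im →
        NegReal ((2 * h (c₂ s) - W' t γ a (c₂ s)) * deriv c₂ s)) ∧
      (∀ s ∈ Ioo (0 : ℝ) 1, (c₂ s).im < 0 →
        PosReal ((2 * h (c₂ s) - W' t γ a (c₂ s)) * deriv c₂ s)) ∧
      -- the branch `R` of the square root, and its values `Rp` on the left side of `Γ₁`
      IsSqrtBranch c₁ ξ R ∧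
      (∀ s ∈ Ioo (0 : ℝ) 1, HasLeftLimit R c₁ s (Rp s)) ∧
      -- (i), both formulas for `h`
      (∀ z ∉ closedArc c₁, ∃ J : ℂ,
        HasArcIntegral c₁ (fun s => W' t γ a (c₁ s) / (Rp s * (c₁ s - z))) J ∧
        h z = R z / (2 * Real.pi * Complex.I) * J) ∧
      (∀ z ∉ closedArc c₁, z ≠ 0 → z ≠ -t → z ≠ -(t : ℂ)⁻¹ →
        h z = W' t γ a z / 2 + R z / 2 *
          (γ * a / ((z + (t : ℂ)⁻¹) * R (-(t : ℂ)⁻¹)) + a / ((z + t) * R (-t))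
            - (a + 1) / (z * R 0))) ∧
      -- (ii)
      HasArcIntegral c₁ (fun s => W' t γ a (c₁ s) / Rp s) 0 ∧
      (∃ J : ℂ, HasArcIntegral c₁ (fun s => c₁ s * W' t γ a (c₁ s) / Rp s) J ∧
        1 / (2 * Real.pi * Complex.I) * J = -1) ∧
      -- (iii)
      (z₀ : ℂ) = (a + 1) / (-R 0 * (1 + γ * a)) ∧
      (∀ z ∉ closedArc c₁, z ≠ 0 → z ≠ -t → z ≠ -(t : ℂ)⁻¹ →
        2 * h z - W' t γ a z = Φ t γ a z₀ R z) ∧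
      (∀ s ∈ Ioo (0 : ℝ) 1, HasLeftLimit (Φ t γ a z₀ R) c₁ s (hp s - hm s)) ∧
      (∀ z ∈ openArc c₂, 2 * h z - W' t γ a z = Φ t γ a z₀ R z) ∧
      -- (iv)
      openArc c₂ ∩ {z | z.im = 0} = {-(z₀ : ℂ)} ∧
      -- `Γ₁` is a trajectory of `Q(z) (dz)²`; `Γ₂` is made of orthogonal trajectories,
      -- which meet at the zero `-z₀` of `Q`
      (∀ s ∈ Ioo (0 : ℝ) 1, PosReal (Q t γ a z₀ ξ (c₁ s) * deriv c₁ s ^ 2)) ∧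
      (∀ s ∈ Ioo (0 : ℝ) 1, c₂ s ≠ -(z₀ : ℂ) →
        NegReal (Q t γ a z₀ ξ (c₂ s) * deriv c₂ s ^ 2)) := by
  obtain ⟨C⟩ := exists_config ht0 ht1 hγ ha
  obtain ⟨T₁, hT₁, F₁, D₁, h₁, hf₁⟩ := C.exists_trajPath
  obtain ⟨T₂, hT₂, F₂, D₂, h₂, hF₂, hf₂⟩ := C.exists_critPath
  -- The second path goes from −i to i; the parameter −1 reverses it, so that Γ₂ runs from ξ to ξ̄.
  have hε : |(-1 : ℝ)| = 1 := by norm_num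
  have hpole₂ : ∀ j, F₂ 0 ≠ C.pts j := fun j => by
    rw [hF₂, Ne, Complex.ofReal_inj]
    exact C.y₁_ne j
  have hneg₂ : (F₂ 0).re < 0 := by
    rw [hF₂, Complex.ofReal_re]
    exact C.isRoot₃.lo_neg
  have hZ₂ : C.Z (F₂ 0) = -(C.z₀ : ℂ) := by rw [hF₂, C.Z_y₁]
  have hZ₂re : (C.Z (F₂ 0)).re = -C.z₀ := by rw [hZ₂, Complex.neg_re, Complex.ofReal_re]
  have hz₀ : 0 < C.z₀ := C.t_pos.trans C.lt_z₀
  have hlt : (C.Z (F₂ 0)).re < (C.Z (F₁ 0)).re := by linarith [h₁.Z_pos]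
  have hdisj : Disjoint (openArc (C.arc F₂ (-1))) (closedArc (C.arc F₁ 1)) :=
    Config.disjoint_arcs abs_one hε h₁.toCritPath h₂ fun h => by
      rw [h] at hlt
      exact lt_irrefl _ hlt
  have hreal : Disjoint (openArc (C.arc F₂ (-1)))
      ((fun x : ℝ => (x : ℂ)) '' (Iic (-t⁻¹) ∪ Ici (-t))) := by
    refine h₂.disjoint_ofReal hε ?_
    have := C.z₀_lt_inv
    have := C.lt_z₀
    rw [hZ₂re]
    rintro (h | h)
    · rw [mem_Iic] at h
      linarith
    · rw [mem_Ici] at h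
      linarith
  have hne₂ : ∀ z ∈ openArc (C.arc F₂ (-1)), z ≠ 0 ∧ z ≠ -t ∧ z ≠ -(t : ℂ)⁻¹ := by
    intro z hz
    have key : ∀ x ∈ Iic (-t⁻¹) ∪ Ici (-t), z ≠ (x : ℂ) := fun x hx h =>
      Set.disjoint_left.1 hreal hz ⟨x, hx, h.symm⟩
    refine ⟨?_, ?_, ?_⟩
    · simpa using key 0 (Or.inr (by rw [mem_Ici]; linarith))
    · simpa using key (-t) (Or.inr self_mem_Ici)
    · simpa using key (-t⁻¹) (Or.inl self_mem_Iic)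
  have hoff₂ : ∀ z ∈ openArc (C.arc F₂ (-1)), z ∉ closedArc (C.arc F₁ 1) := fun z hz =>
    Set.disjoint_left.1 hdisj hz
  have hΦ : ∀ z : ℂ, z ≠ 0 → z ≠ -t → z ≠ -(t : ℂ)⁻¹ →
      2 * C.H F₁ D₁ z - W' t γ a z = Φ t γ a C.z₀ (C.R F₁ D₁) z := by
    intro z h0 h1 h2
    rw [h₁.H_eq h0 h1 h2, C.Φ_eq]
    ring
  have hd₁ : ∀ s ∈ Ioo (0 : ℝ) 1,
      C.X (Config.lift F₁ s) * C.ratio (C.arc F₁ 1 s) * deriv (C.arc F₁ 1) s =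
        -((6 * T₁ * (1 - |2 * s - 1|) ^ 2 : ℝ) : ℂ) * Complex.I := by
    intro s hs
    have := h₁.mul_arcDeriv abs_one hs h₁.pole
    rw [hf₁ _ (param_mem_Ioo abs_one hs), ← (h₁.hasDerivAt_arc abs_one hs).deriv] at this
    rw [Config.lift, this, one_mul]
    push_cast
    ring
  have hpos₁ : ∀ s ∈ Ioo (0 : ℝ) 1, 0 < 6 * T₁ * (1 - |2 * s - 1|) ^ 2 := by
    intro s hs
    have h : |2 * s - 1| < 1 := abs_lt.2 ⟨by linarith [hs.1], by linarith [hs.2]⟩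
    have : 0 < 1 - |2 * s - 1| := by linarith
    positivity
  have hd₂ : ∀ s ∈ Ioo (0 : ℝ) 1,
      C.X (F₂ (-1 * (2 * s - 1))) * C.ratio (C.arc F₂ (-1) s) * deriv (C.arc F₂ (-1)) s =
        ((12 * T₂ * (1 - (2 * s - 1) ^ 2) ^ 2 * (2 * s - 1) : ℝ) : ℂ) := by
    intro s hs
    have := h₂.mul_arcDeriv hε hs hpole₂
    rw [hf₂ _ (param_mem_Ioo hε hs), ← (h₂.hasDerivAt_arc hε hs).deriv] at this
    rw [this]
    push_cast
    ring
  have hpos₂ : ∀ s ∈ Ioo (0 : ℝ) 1, 0 < 12 * T₂ * (1 - (2 * s - 1) ^ 2) ^ 2 := by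
    intro s hs
    have : 0 < 1 - (2 * s - 1) ^ 2 := by nlinarith [hs.1, hs.2]
    positivity
  -- The sign of this real number is that of 2s − 1. Because of the reversal, the upper half of Γ₂
  -- corresponds to s < 1/2, which gives (d).
  have hD₂ : ∀ s ∈ Ioo (0 : ℝ) 1,
      (2 * C.H F₁ D₁ (C.arc F₂ (-1) s) - W' t γ a (C.arc F₂ (-1) s)) * deriv (C.arc F₂ (-1)) s =
        ((12 * T₂ * (1 - (2 * s - 1) ^ 2) ^ 2 * (2 * s - 1) : ℝ) : ℂ) := by
    intro s hs
    obtain ⟨h0, h1, h2⟩ := hne₂ _ ⟨s, hs, rfl⟩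
    rw [hΦ _ h0 h1 h2, C.Φ_eq, h₁.R_arc hε h₂ hneg₂ hlt hdisj hs, hd₂ s hs]
  refine ⟨C.ξ, C.arc F₁ 1, C.arc F₂ (-1), C.H F₁ D₁, C.R F₁ D₁, fun s => C.X (Config.lift F₁ s),
    fun s => W' t γ a (C.arc F₁ 1 s) / 2 + C.X (Config.lift F₁ s) * C.ratio (C.arc F₁ 1 s) / 2,
    fun s => W' t γ a (C.arc F₁ 1 s) / 2 - C.X (Config.lift F₁ s) * C.ratio (C.arc F₁ 1 s) / 2,
    C.z₀, C.ξ_im_pos, ?_, h₁.disjoint_ofReal abs_one (by rw [mem_Iic, not_le]; exact h₁.Z_pos),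
    h₁.conjSymm_arc, ?_, hreal, h₂.conjSymm_arc, hdisj,
    h₁.differentiableOn_H.analyticOnNhd h₁.isOpen_compl,
    fun s hs => h₁.hasLeftLimit_H hs, fun s hs => h₁.hasRightLimit_H hs,
    h₁.exists_tendsto_H (by simp) C.ξ_im_pos.ne',
    h₁.exists_tendsto_H (by simp) (by simpa using C.ξ_im_pos.ne'),
    fun s _ => by ring, h₁.H_sub_isBigO, fun s hs => ?_, fun s hs him => ?_, fun s hs him => ?_,
    h₁.isSqrtBranch, fun s hs => h₁.hasLeftLimit_R hs, fun z hz => h₁.hasArcIntegral_cauchy hz,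
    fun z _ h0 h1 h2 => h₁.H_eq_W h0 h1 h2, h₁.hasArcIntegral_W', ⟨_, h₁.hasArcIntegral_mul_W', ?_⟩,
    ?_, fun z _ h0 h1 h2 => hΦ z h0 h1 h2, fun s hs => ?_, fun z hz => ?_, ?_, fun s hs => ?_,
    fun s hs hne => ?_⟩
  · have := h₁.isSimpleArc abs_one
    rwa [h₁.symm, h₁.one, C.Z_conj, C.Z_I] at this
  · have := h₂.isSimpleArc hε
    rwa [neg_neg, h₂.symm, h₂.one, C.Z_conj, C.Z_I] at this
  · have : Complex.I * (W' t γ a (C.arc F₁ 1 s) / 2 + C.X (Config.lift F₁ s) * C.ratio (C.arc F₁ 1 s) / 2 -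
        (W' t γ a (C.arc F₁ 1 s) / 2 - C.X (Config.lift F₁ s) * C.ratio (C.arc F₁ 1 s) / 2)) *
        deriv (C.arc F₁ 1) s = ((6 * T₁ * (1 - |2 * s - 1|) ^ 2 : ℝ) : ℂ) := by
      linear_combination Complex.I * hd₁ s hs -
        ((6 * T₁ * (1 - |2 * s - 1|) ^ 2 : ℝ) : ℂ) * Complex.I_sq
    rw [this]
    exact ⟨hpos₁ s hs, Complex.ofReal_im _⟩
  · rw [hD₂ s hs]
    have h := (h₂.arc_im_pos_iff hε (Ioo_subset_Icc_self hs)).1 him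
    exact ⟨mul_neg_of_pos_of_neg (hpos₂ s hs) (by linarith), Complex.ofReal_im _⟩
  · rw [hD₂ s hs]
    have h := (h₂.arc_im_neg_iff hε (Ioo_subset_Icc_self hs)).1 him
    exact ⟨mul_pos (hpos₂ s hs) (by linarith), Complex.ofReal_im _⟩
  · have hπ : (Real.pi : ℂ) ≠ 0 := by exact_mod_cast Real.pi_ne_zero
    have hI := Complex.I_ne_zero
    field_simp
  · have e0 : (1 + (γ : ℂ) * a) * C.s₀ * C.z₀ = a + 1 := by exact_mod_cast C.res₀
    have hk : (1 + (γ : ℂ) * a) ≠ 0 := by exact_mod_cast C.k_pos.ne'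
    have hs₀ : (C.s₀ : ℂ) ≠ 0 := by exact_mod_cast C.s₀_pos.ne'
    rw [h₁.R_zero, neg_neg, eq_div_iff (mul_ne_zero hs₀ hk)]
    linear_combination e0
  · have := h₁.hasLeftLimit_Φ hs
    convert this using 1
    ring
  · obtain ⟨h0, h1, h2⟩ := hne₂ z hz
    exact hΦ z h0 h1 h2
  · rw [h₂.openArc_inter_real hε, hZ₂]
  · have : Q t γ a C.z₀ C.ξ (C.arc F₁ 1 s) * deriv (C.arc F₁ 1) s ^ 2 =
        (((6 * T₁ * (1 - |2 * s - 1|) ^ 2) ^ 2 : ℝ) : ℂ) := by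
      rw [C.arc_eq, C.Q_eq (h₁.lift_ne (Ioo_subset_Icc_self hs)), ← C.arc_eq, neg_mul, ← mul_pow,
        hd₁ s hs, mul_pow, Complex.I_sq]
      push_cast
      ring
    rw [this]
    exact ⟨pow_pos (hpos₁ s hs) 2, Complex.ofReal_im _⟩
  · have : Q t γ a C.z₀ C.ξ (C.arc F₂ (-1) s) * deriv (C.arc F₂ (-1)) s ^ 2 =
        ((-(12 * T₂ * (1 - (2 * s - 1) ^ 2) ^ 2 * (2 * s - 1)) ^ 2 : ℝ) : ℂ) := by
      have h := hd₂ s hs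
      rw [Config.arc] at h ⊢
      rw [C.Q_eq (h₂.ne_zero (param_mem_Icc hε (Ioo_subset_Icc_self hs))), neg_mul, ← mul_pow, h]
      push_cast
      ring
    rw [this]
    -- The midpoint s = 1/2 is mapped to −z₀, the only point of Γ₂ at which the differential
    -- vanishes.
    have hr : 2 * s - 1 ≠ 0 := by
      intro h0
      apply hne
      rw [Config.arc, h0, mul_zero, hZ₂]
    exact ⟨neg_lt_zero.2 (by have := mul_ne_zero (hpos₂ s hs).ne' hr; positivity),
      Complex.ofReal_im _⟩
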